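/- **Setting.** Let $C$ be a smooth projective geometrically irreducible curve over a finite field $\mathbb F_q$ with function field $Q$, let $\infty\in C(\mathbb F_q)$ be a rational point, and let $A=\Gamma(C\setminus\{\infty\},\mathcal O_C)$. Let $L=\mathbb F_s$ be a finite field containing $\mathbb F_q$, $s=q^e$, put $C_L=C\times_{\mathbb F_q}\operatorname{Spec}L$, $A_L=A\otimes_{\mathbb F_q}L$, and let $\sigma$ be the endomorphism of $C_L$ (and $\sigma^*$ that of $A_L$) which is the identity on $C$ and the $q$-Frobenius on $L$. *Abelian $\tau$-sheaves.* An abelian $\tau$-sheaf over $L$ of rank $r\ge 0$, dimension $d\ge 0$ and characteristic $c:\operatorname{Spec}L\to C$ is a family $\underline{\mathcal F}=(\mathcal F_i,\Pi_i,\tau_i)_{i\in\mathbb Z}$ of locally free sheaves $\mathcal F_i$ of rank $r$ on $C_L$ with injective $\mathcal O_{C_L}$-linear maps $\Pi_i:\mathcal F_i\to\mathcal F_{i+1}$ and $\tau_i:\sigma^*\mathcal F_i\to\mathcal F_{i+1}$ such that (i) $\Pi_{i+1}\circ\tau_i=\tau_{i+1}\circ\sigma^*\Pi_i$; (ii) there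 are integers $k,l>0$ with $ld=kr$ such that, for all $i$, $\Pi_{i+l-1}\circ\cdots\circ\Pi_i$ identifies $\mathcal F_i$ with the subsheaf $\mathcal F_{i+l}(-k\cdot\infty)$ of $\mathcal F_{i+l}$; (iii) $\operatorname{coker}\Pi_i$ is torsion with $\dim_L\Gamma(C_L,\operatorname{coker}\Pi_i)=d$; (iv) $\operatorname{coker}\tau_i$ is annihilated by $\mathcal J^d$, where $\mathcal J$ is the ideal sheaf of the graph of $c$, and $\dim_L\Gamma(C_L,\operatorname{coker}\tau_i)=d$. The characteristic is said to be different from $\infty$ if the image of $c$ is not $\infty$. Morphisms are families $f_i:\mathcal F_i\to\mathcal F_i'$ compatible with all $\Pi_i$ and $\tau_i$. For a finite extension $L'/L$, $\underline{\mathcal F}\otimes_LL'$ is the pullback $(\mathcal F_i\otimes_{\mathcal O_{C_L}}\mathcal O_{C_{L'}},\Pi_i\otimes1,\tau_i\otimes1)$ to $C_{L'}$, with characteristic the composite $\operatorname{Spec}L'\to\operatorname{Spec}L\to C$. An isogeny is a morphism all of whose $f_i$ are injective with cokernels supported in $D\times\operatorname{Spec}L$ for a common finite set $D$ of closed points of $C$.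 Abelian $\tau$-sheaves $\underline{\mathcal F},\underline{\mathcal F}'$ of the same characteristic are quasi-isogenous if there is an isogeny $\underline{\mathcal F}\to\underline{\mathcal F}'(D)$ for some effective divisor $D$ on $C$. A quasi-endomorphism of $\underline{\mathcal F}$ is a morphism $\underline{\mathcal F}\to\underline{\mathcal F}(D)$ for some effective divisor $D$ on $C$, up to agreement on generic fibres; these form a $Q$-algebra. $\underline{\mathcal F}$ is simple if it is non-zero and every abelian quotient $\tau$-sheaf of $\underline{\mathcal F}$ is $0$ or $\underline{\mathcal F}$, and semisimple if it is quasi-isogenous to a finite (possibly empty) direct sum, itself an abelian $\tau$-sheaf, of simple abelian $\tau$-sheaves. The Frobenius endomorphism of $\underline{\mathcal F}$ over $L=\mathbb F_{q^e}$ is the quasi-endomorphism $\pi$ with $\Pi_{i+e-1}\circ\cdots\circ\Pi_i\circ\pi_i=\tau_{i+e-1}\circ\cdots\circ(\sigma^*)^{e-1}\tau_i$ for all $i$ (using $(\sigma^*)^e\mathcal F_i=\mathcal F_i$). It is absolutely semisimple if $Q[\pi]\otimes_QK$ is a semisimple ring for every field extension $K/Q$. *Pure Anderson motives.* Let $c^*:A\to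 L$ be a homomorphism of $\mathbb F_q$-algebras. A pure Anderson motive over $L$ of rank $r$, dimension $d$ and characteristic $c^*$ is a locally free $A_L$-module $M$ of rank $r$ with an injective $A_L$-linear map $\tau:\sigma^*M\to M$ such that $\dim_L\operatorname{coker}\tau=d$ and $\operatorname{coker}\tau$ is annihilated by $J^d$, where $J=(a\otimes1-1\otimes c^*(a):a\in A)\subseteq A_L$, and such that $M$ extends to a locally free sheaf $\mathcal M$ on $C_L$ for which, for some integers $k,l>0$, the map $\tau\circ\sigma^*\tau\circ\cdots\circ(\sigma^*)^{l-1}\tau$ induces an isomorphism $(\sigma^*)^l\mathcal M_\infty\to\mathcal M(k\cdot\infty)_\infty$ of stalks at $\infty$. Morphisms are $A_L$-linear maps compatible with $\tau$. $M$ and $M'$ are quasi-isogenous if some element of $\operatorname{Hom}(M,M')\otimes_AQ$ is invertible, with inverse in $\operatorname{Hom}(M',M)\otimes_AQ$. $M$ is simple if it is non-zero and every quotient of $M$ that is a pure Anderson motive is $0$ or $M$, and semisimple if it is quasi-isogenous to a finite direct sum, itself a pure Anderson motive, of simple pure Anderson motives. **Theorem.** Let $\mathbb F_s\supseteq\mathbb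 F_q$ be a finite field. 1. For every abelian $\tau$-sheaf $\underline{\mathcal F}$ over $\mathbb F_s$ there is a finite field extension $\mathbb F_{s'}/\mathbb F_s$ whose degree is a power of $\operatorname{char}\mathbb F_s$ such that the abelian $\tau$-sheaf $\underline{\mathcal F}\otimes_{\mathbb F_s}\mathbb F_{s'}$ over $\mathbb F_{s'}$ has an absolutely semisimple Frobenius endomorphism; and if moreover the characteristic of $\underline{\mathcal F}$ is different from $\infty$, then $\underline{\mathcal F}\otimes_{\mathbb F_s}\mathbb F_{s'}$ (for this same $\mathbb F_{s'}$) is semisimple. 2. If $\underline{\mathcal F}$ is a semisimple abelian $\tau$-sheaf over $\mathbb F_s$ of characteristic different from $\infty$, then $\underline{\mathcal F}\otimes_{\mathbb F_s}\mathbb F_{s'}$ is semisimple for every finite field extension $\mathbb F_{s'}/\mathbb F_s$. 3. If $M$ is a semisimple pure Anderson motive over $\mathbb F_s$, then $M\otimes_{\mathbb F_s}\mathbb F_{s'}$ is semisimple for every finite field extension $\mathbb F_{s'}/\mathbb F_s$. -/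

import Mathlib

open scoped TensorProduct DirectSum

universe u

namespace TauSheaves

noncomputable section

/-! ### The curve

A smooth projective geometrically irreducible curve `C` over the finite field `Fq` is given by its
function field `Q`: the closed points of `C` are the places of `Q`, that is the valuation rings of
`Q` containing `Fq` and different from `Q`, and the local ring of `C` at a closed point is the
corresponding valuation ring. -/

section Curve

variable (Fq Q : Type u) [Field Fq] [Field Q] [Algebra Fq Q]

/-- `Q` is the function field of a smooth projective geometrically irreducible curve over the
finite (hence perfect) field `Fq`: it is finitely generated of transcendence degree one over `Fq`,
and `Fq` is algebraically closed in `Q`. -/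
structure IsCurveFunctionField : Prop where
  fg : (⊤ : IntermediateField Fq Q).FG
  trdeg : Algebra.trdeg Fq Q = 1
  const : algebraicClosure Fq Q = ⊥

/-- The closed points of the curve. -/
structure Place where
  /-- the local ring at the point -/
  ring : ValuationSubring Q
  const_mem : ∀ a : Fq, algebraMap Fq Q a ∈ ring
  ne_top : ring ≠ ⊤

variable {Fq Q}

/-- The point is `Fq`-rational: its residue field is `Fq`. -/
def Place.IsRational (v : Place Fq Q) : Prop :=
  ∀ a ∈ v.ring, ∃ b : Fq, a - algebraMap Fq Q b ∈ v.ring.nonunits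

/-- `z` generates the maximal ideal of the local ring at `v`. -/
def Place.IsUniformizer (v : Place Fq Q) (z : Q) : Prop :=
  z ≠ 0 ∧ z ∈ v.ring.nonunits ∧ ∀ y ∈ v.ring.nonunits, y * z⁻¹ ∈ v.ring

/-- The ring `A` of functions on the curve which are regular outside the point `inf`. -/
def affineRing (inf : Place Fq Q) : Subalgebra Fq Q where
  carrier := {a | ∀ v : Place Fq Q, v ≠ inf → a ∈ v.ring}
  mul_mem' ha hb v hv := v.ring.mul_mem _ _ (ha v hv) (hb v hv)
  add_mem' ha hb v hv := v.ring.add_mem _ _ (ha v hv) (hb v hv)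
  algebraMap_mem' a v _ := v.const_mem a

end Curve

/-! ### Coefficient rings

For an `Fq`-algebra `B` (below `B = Q` or `B = A`) and a finite field `L` containing `Fq`, put
`B_L = B ⊗ L`, with the endomorphism `σ^* : b ⊗ x ↦ b ⊗ x ^ q`. -/

section Coeff

variable (Fq B L : Type u) [Field Fq] [CommRing B] [Algebra Fq B] [Field L] [Algebra Fq L]

/-- The endomorphism `b ⊗ x ↦ b ⊗ x ^ q` of `B_L`, where `q = #Fq`. -/
def sigma [Fintype Fq] : B ⊗[Fq] L →+* B ⊗[Fq] L :=
  (Algebra.TensorProduct.map (AlgHom.id Fq B) (FiniteField.frobeniusAlgHom Fq L)).toRingHom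

/-- The map `B_L → B_{L'}` for a field extension `L' / L`. -/
def extHom (L' : Type u) [Field L'] [Algebra Fq L'] [Algebra L L'] [IsScalarTower Fq L L'] :
    B ⊗[Fq] L →+* B ⊗[Fq] L' :=
  (Algebra.TensorProduct.map (AlgHom.id Fq B) (IsScalarTower.toAlgHom Fq L L')).toRingHom

theorem extHom_comp_sigma [Fintype Fq] (L' : Type u) [Field L'] [Algebra Fq L'] [Algebra L L']
    [IsScalarTower Fq L L'] :
    (extHom Fq B L L').comp (sigma Fq B L) = (sigma Fq B L').comp (extHom Fq B L L') := by
  refine RingHom.ext fun x => ?_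
  induction x using TensorProduct.induction_on with
  | zero => simp
  | add x y hx hy => rw [map_add, map_add, hx, hy]
  | tmul b x => simp [extHom, sigma]

/-- A `B_L`-module. -/
structure CoeffModule where
  /-- the underlying type -/
  carrier : Type u
  [addCommGroup : AddCommGroup carrier]
  [module : Module (B ⊗[Fq] L) carrier]

attribute [instance] CoeffModule.addCommGroup CoeffModule.module

instance : CoeSort (CoeffModule Fq B L) (Type u) := ⟨CoeffModule.carrier⟩

variable {Fq B L} (V : CoeffModule Fq B L)

/-- The action of `B` through `b ↦ b ⊗ 1`. -/
instance CoeffModule.moduleLeft : Module B V :=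
  Module.compHom V (Algebra.TensorProduct.includeLeft : B →ₐ[Fq] B ⊗[Fq] L).toRingHom

/-- The action of `L` through `x ↦ 1 ⊗ x`. -/
instance CoeffModule.moduleRight : Module L V :=
  Module.compHom V (Algebra.TensorProduct.includeRight : L →ₐ[Fq] B ⊗[Fq] L).toRingHom

theorem CoeffModule.left_smul_def (b : B) (x : V) :
    b • x = (b ⊗ₜ[Fq] (1 : L) : B ⊗[Fq] L) • x := rfl

theorem CoeffModule.right_smul_def (a : L) (x : V) :
    a • x = ((1 : B) ⊗ₜ[Fq] a : B ⊗[Fq] L) • x := rfl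

instance CoeffModule.towerLeft : IsScalarTower B (B ⊗[Fq] L) V where
  smul_assoc b r x := by
    rw [CoeffModule.left_smul_def, ← mul_smul]
    congr 1
    rw [Algebra.smul_def]; rfl

instance CoeffModule.commLeft : SMulCommClass B (B ⊗[Fq] L) V where
  smul_comm b r x := by
    rw [CoeffModule.left_smul_def, CoeffModule.left_smul_def, ← mul_smul, ← mul_smul, mul_comm]

instance CoeffModule.commLeft' : SMulCommClass (B ⊗[Fq] L) B V where
  smul_comm r b x := (smul_comm b r x).symm

instance CoeffModule.commRight : SMulCommClass B L V where
  smul_comm b a x := by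
    rw [CoeffModule.right_smul_def, CoeffModule.right_smul_def, smul_comm]

end Coeff

/-! ### Extension of scalars along a ring homomorphism -/

section ScalarExt

variable {R R' : Type u} [CommRing R] [CommRing R'] (φ : R →+* R')
  (V W : Type u) [AddCommGroup V] [Module R V] [AddCommGroup W] [Module R W]

/-- The `R'`-module `R' ⊗_R V`, where `R'` is an `R`-algebra through `φ`. -/
def ScalarExt : Type u :=
  letI := φ.toAlgebra
  R' ⊗[R] V

instance ScalarExt.addCommGroup : AddCommGroup (ScalarExt φ V) := by
  letI := φ.toAlgebra
  exact (inferInstance : AddCommGroup (R' ⊗[R] V))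

instance ScalarExt.module : Module R' (ScalarExt φ V) := by
  letI := φ.toAlgebra
  exact (inferInstance : Module R' (R' ⊗[R] V))

variable {V W}

/-- The canonical map `x ↦ 1 ⊗ x`. -/
def ScalarExt.of (x : V) : ScalarExt φ V :=
  letI := φ.toAlgebra
  (1 : R') ⊗ₜ[R] x

/-- The linear map `1 ⊗ f`. -/
def ScalarExt.map (f : V →ₗ[R] W) : ScalarExt φ V →ₗ[R'] ScalarExt φ W :=
  letI := φ.toAlgebra
  f.baseChange R'

/-- The semilinear map `σ' ⊗ f`, for a `σ`-semilinear map `f`. -/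
def ScalarExt.mapSemi {σ : R →+* R} {σ' : R' →+* R'} (h : φ.comp σ = σ'.comp φ)
    (f : V →ₛₗ[σ] W) : ScalarExt φ V →ₛₗ[σ'] ScalarExt φ W :=
  letI := φ.toAlgebra
  let s : R' →ₛₗ[σ] R' :=
    { toFun := σ'
      map_add' := map_add σ'
      map_smul' := fun a x => by
        have := congrArg (fun g : R →+* R' => g a) h
        simp only [RingHom.comp_apply] at this
        simp only [Algebra.smul_def, map_mul]
        exact congrArg (· * σ' x) this.symm }
  let g : R' ⊗[R] V →ₛₗ[σ] R' ⊗[R] W := TensorProduct.map s f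
  have hg : ∀ (a : R') (x : R' ⊗[R] V), g (a • x) = σ' a • g x := fun a x => by
    induction x using TensorProduct.induction_on with
    | zero => simp
    | add x y hx hy => rw [smul_add, map_add, map_add, smul_add, hx, hy]
    | tmul b x =>
      have h1 : g (a • b ⊗ₜ[R] x) = s (a * b) ⊗ₜ[R] f x := rfl
      have h2 : g (b ⊗ₜ[R] x) = s b ⊗ₜ[R] f x := rfl
      have h3 : s (a * b) = σ' a • s b := map_mul σ' a b
      rw [h1, h2, h3, TensorProduct.smul_tmul']
  { toFun := g
    map_add' := map_add g
    map_smul' := hg }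

/-- The base change `B_{L'} ⊗_{B_L} V`. -/
def CoeffModule.baseChange {Fq B L : Type u} [Field Fq] [CommRing B] [Algebra Fq B] [Field L]
    [Algebra Fq L] (V : CoeffModule Fq B L) (L' : Type u) [Field L'] [Algebra Fq L']
    [Algebra L L'] [IsScalarTower Fq L L'] : CoeffModule Fq B L' :=
  ⟨ScalarExt (extHom Fq B L L') V⟩

/-- The direct sum of finitely many modules. -/
def CoeffModule.pi {Fq B L : Type u} [Field Fq] [CommRing B] [Algebra Fq B] [Field L]
    [Algebra Fq L] {n : ℕ} (V : Fin n → CoeffModule Fq B L) : CoeffModule Fq B L :=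
  ⟨∀ j, V j⟩

end ScalarExt

/-! ### Locally free sheaves on `C_L`

The projection `p : C_L → C` is finite. A torsion free coherent sheaf `E` on `C_L` is given by its
generic fibre, a `Q_L`-module, together with, for every closed point `v` of `C`, the stalk
`(p_* E)_v`, an `O_v ⊗ L`-submodule of the generic fibre. (The points of `C_L` above `v` are the
maximal ideals of the semilocal ring `O_v ⊗ L`.) -/

section Sheaf

variable (Fq Q L : Type u) [Field Fq] [Field Q] [Algebra Fq Q] [Field L] [Algebra Fq L]

/-- A family of subspaces of a `Q_L`-module, the candidates for the stalks of a sheaf on `C_L`. -/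
structure LatticeSheaf where
  /-- the fibre at the generic point -/
  fibre : CoeffModule Fq Q L
  /-- the stalks at (the fibres of `p` over) the closed points of the curve -/
  stalk : Place Fq Q → Submodule L fibre

variable {Fq Q L}

/-- The sheaf is a locally free `O_{C_L}`-module of rank `r`: every closed point `v` of the curve
has an open (that is, cofinite) neighbourhood over which the sheaf is free with some basis `b`. -/
def LatticeSheaf.IsLocallyFree (E : LatticeSheaf Fq Q L) (r : ℕ) : Prop :=
  ∀ v : Place Fq Q, ∃ (b : Module.Basis (Fin r) (Q ⊗[Fq] L) E.fibre) (S : Set (Place Fq Q)),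
    S.Finite ∧ v ∉ S ∧ ∀ w ∉ S,
      E.stalk w = Submodule.span L {x | ∃ a ∈ w.ring, ∃ j, x = a • b j}

/-- The twist `E(D)` by a divisor `D` on `C`. -/
def LatticeSheaf.twist (E : LatticeSheaf Fq Q L) (D : Place Fq Q →₀ ℤ) : LatticeSheaf Fq Q L where
  fibre := E.fibre
  stalk v :=
    { carrier := {x | ∀ z : Q, v.IsUniformizer z → z ^ D v • x ∈ E.stalk v}
      add_mem' := fun hx hy z hz => by
        rw [smul_add]; exact (E.stalk v).add_mem (hx z hz) (hy z hz)
      zero_mem' := fun z _ => by rw [smul_zero]; exact (E.stalk v).zero_mem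
      smul_mem' := fun a x hx z hz => by
        rw [smul_comm]; exact (E.stalk v).smul_mem a (hx z hz) }

/-- For a submodule `P` of the generic fibre of `E` for every closed point `v` of the curve,
the direct sum over all `v` of `E_v / (P_v ∩ E_v)`. If the `P_v ⊆ E_v` are the stalks of a subsheaf
of full rank, this is the `L`-vector space of global sections of the torsion sheaf `E / P`. -/
abbrev LatticeSheaf.Coker (E : LatticeSheaf Fq Q L) (P : Place Fq Q → Submodule L E.fibre) :
    Type u :=
  ⨁ v : Place Fq Q, (E.stalk v ⧸ (P v).submoduleOf (E.stalk v))

/-- A point `c : Spec L → C`, where `L` is a finite field. Its image is then a closed point, and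
`c` amounts to a local homomorphism of `Fq`-algebras from the local ring at this point to `L`. -/
structure Characteristic (Fq Q L : Type u) [Field Fq] [Field Q] [Algebra Fq Q] [Field L]
    [Algebra Fq L] where
  /-- the characteristic point -/
  place : Place Fq Q
  /-- the map from its local ring to `L` -/
  hom : place.ring →+* L
  hom_const : ∀ a : Fq, hom ⟨algebraMap Fq Q a, place.const_mem a⟩ = algebraMap Fq L a
  hom_local : ∀ a : place.ring, (a : Q) ∈ place.ring.nonunits → hom a = 0

/-- The composite `Spec L' → Spec L → C`. -/
def Characteristic.baseChange (c : Characteristic Fq Q L) (L' : Type u) [Field L'] [Algebra Fq L']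
    [Algebra L L'] [IsScalarTower Fq L L'] : Characteristic Fq Q L' where
  place := c.place
  hom := (algebraMap L L').comp c.hom
  hom_const a := by
    rw [RingHom.comp_apply, c.hom_const, ← IsScalarTower.algebraMap_apply]
  hom_local a ha := by rw [RingHom.comp_apply, c.hom_local a ha, map_zero]

/-- The base change of a sheaf along `C_{L'} → C_L`. -/
def LatticeSheaf.baseChange (E : LatticeSheaf Fq Q L) (L' : Type u) [Field L'] [Algebra Fq L']
    [Algebra L L'] [IsScalarTower Fq L L'] : LatticeSheaf Fq Q L' where
  fibre := E.fibre.baseChange L'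
  stalk v := Submodule.span L' (ScalarExt.of (extHom Fq Q L L') '' (E.stalk v : Set E.fibre))

end Sheaf

/-! ### Abelian `τ`-sheaves -/

/-- The composite `f_{i+n-1} ∘ ⋯ ∘ f_i : G i → G j` for `j = i + n`. -/
def iter {G : ℤ → Type u} (f : ∀ i, G i → G (i + 1)) : (n : ℕ) → (i j : ℤ) → i + n = j → G i → G j
  | 0, i, j, h => fun x => (show i = j by simpa using h) ▸ x
  | n + 1, i, j, h => fun x => iter f n (i + 1) j (by push_cast at h; omega) (f i x)

section TauSheaf

variable (Fq Q L : Type u) [Field Fq] [Fintype Fq] [Field Q] [Algebra Fq Q] [Field L]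
  [Algebra Fq L]

/-- The data `(F_i, Π_i, τ_i)` underlying an abelian `τ`-sheaf. The linear map
`τ_i : σ^* F_i → F_{i+1}` is given by the corresponding `σ^*`-semilinear map. -/
structure PreTauSheaf where
  /-- the sheaves `F_i` on `C_L` -/
  sheaf : ℤ → LatticeSheaf Fq Q L
  /-- the maps `Π_i : F_i → F_{i+1}` -/
  Pi : ∀ i, (sheaf i).fibre →ₗ[Q ⊗[Fq] L] (sheaf (i + 1)).fibre
  /-- the maps `τ_i : σ^* F_i → F_{i+1}` -/
  tau : ∀ i, (sheaf i).fibre →ₛₗ[sigma Fq Q L] (sheaf (i + 1)).fibre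

variable {Fq Q L}

namespace PreTauSheaf

variable (F : PreTauSheaf Fq Q L)

/-- `Π_{i+n-1} ∘ ⋯ ∘ Π_i` -/
def piIter (n : ℕ) (i j : ℤ) (h : i + n = j) : (F.sheaf i).fibre → (F.sheaf j).fibre :=
  iter (G := fun i => (F.sheaf i).fibre) (fun i => F.Pi i) n i j h

/-- `τ_{i+n-1} ∘ σ^* τ_{i+n-2} ∘ ⋯ ∘ (σ^*)^{n-1} τ_i` -/
def tauIter (n : ℕ) (i j : ℤ) (h : i + n = j) : (F.sheaf i).fibre → (F.sheaf j).fibre :=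
  iter (G := fun i => (F.sheaf i).fibre) (fun i => F.tau i) n i j h

/-- The stalk at `v` of the image of `Π_i`. -/
def piImage (i : ℤ) (v : Place Fq Q) : Submodule L (F.sheaf (i + 1)).fibre :=
  Submodule.span L (F.Pi i '' ((F.sheaf i).stalk v : Set (F.sheaf i).fibre))

/-- The stalk at `v` of the image of `τ_i : σ^* F_i → F_{i+1}`. -/
def tauImage (i : ℤ) (v : Place Fq Q) : Submodule L (F.sheaf (i + 1)).fibre :=
  Submodule.span L (F.tau i '' ((F.sheaf i).stalk v : Set (F.sheaf i).fibre))

/-- `F` is an abelian `τ`-sheaf of rank `r`, dimension `d` and characteristic `c` over `L`. -/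
structure IsAbelianOf (inf : Place Fq Q) (c : Characteristic Fq Q L) (r d : ℕ) : Prop where
  locallyFree : ∀ i, (F.sheaf i).IsLocallyFree r
  pi_mem : ∀ i v, ∀ x ∈ (F.sheaf i).stalk v, F.Pi i x ∈ (F.sheaf (i + 1)).stalk v
  tau_mem : ∀ i v, ∀ x ∈ (F.sheaf i).stalk v, F.tau i x ∈ (F.sheaf (i + 1)).stalk v
  pi_injective : ∀ i, Function.Injective (F.Pi i)
  tau_injective : ∀ i, Function.Injective (F.tau i)
  comm : ∀ i x, F.Pi (i + 1) (F.tau i x) = F.tau (i + 1) (F.Pi i x)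
  /-- `Π_{i+l-1} ∘ ⋯ ∘ Π_i` identifies `F_i` with the subsheaf `F_{i+l}(-k∞)` of `F_{i+l}` -/
  periodic : ∃ k l : ℕ, 0 < k ∧ 0 < l ∧ l * d = k * r ∧ ∀ (i : ℤ) (v : Place Fq Q),
    F.piIter l i (i + l) rfl '' ((F.sheaf i).stalk v : Set (F.sheaf i).fibre) =
      {x | x ∈ ((F.sheaf (i + l)).twist (Finsupp.single inf (-(k : ℤ)))).stalk v}
  dim_coker_pi : ∀ i, Module.rank L ((F.sheaf (i + 1)).Coker (F.piImage i)) = d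
  dim_coker_tau : ∀ i, Module.rank L ((F.sheaf (i + 1)).Coker (F.tauImage i)) = d
  /-- `coker τ_i` is annihilated by the `d`-th power of the ideal sheaf of the graph of `c`,
  at the points away from the characteristic point, where the ideal sheaf is trivial -/
  coker_tau_away : ∀ i, ∀ v : Place Fq Q, v ≠ c.place →
    (F.sheaf (i + 1)).stalk v ≤ F.tauImage i v
  /-- and at the characteristic point `v`, where the ideal sheaf is the kernel of
  `O_v ⊗ L → L`, generated by the elements `a ⊗ 1 - 1 ⊗ c(a)` -/
  coker_tau_graph : ∀ i, ∀ a : Fin d → c.place.ring, ∀ x ∈ (F.sheaf (i + 1)).stalk c.place,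
    (∏ j, ((a j : Q) ⊗ₜ[Fq] (1 : L) - (1 : Q) ⊗ₜ[Fq] c.hom (a j))) • x ∈ F.tauImage i c.place

/-- `F` is an abelian `τ`-sheaf of characteristic `c` over `L`. -/
def IsAbelian (inf : Place Fq Q) (c : Characteristic Fq Q L) : Prop :=
  ∃ r d : ℕ, F.IsAbelianOf inf c r d

/-- The twist `F(D)` by a divisor `D` on `C`. -/
def twist (D : Place Fq Q →₀ ℤ) : PreTauSheaf Fq Q L where
  sheaf i := (F.sheaf i).twist D
  Pi i := F.Pi i
  tau i := F.tau i

/-- The base change `F ⊗_L L'`. -/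
def baseChange (L' : Type u) [Field L'] [Algebra Fq L'] [Algebra L L'] [IsScalarTower Fq L L'] :
    PreTauSheaf Fq Q L' where
  sheaf i := (F.sheaf i).baseChange L'
  Pi i := ScalarExt.map (extHom Fq Q L L') (F.Pi i)
  tau i := ScalarExt.mapSemi (extHom Fq Q L L') (extHom_comp_sigma Fq Q L L') (F.tau i)

/-- The finite direct sum `F_1 ⊕ ⋯ ⊕ F_n`. -/
def directSum {n : ℕ} (G : Fin n → PreTauSheaf Fq Q L) : PreTauSheaf Fq Q L where
  sheaf i :=
    { fibre := CoeffModule.pi fun j => ((G j).sheaf i).fibre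
      stalk := fun v =>
        { carrier := {x | ∀ j, x j ∈ ((G j).sheaf i).stalk v}
          add_mem' := fun hx hy j => (((G j).sheaf i).stalk v).add_mem (hx j) (hy j)
          zero_mem' := fun j => (((G j).sheaf i).stalk v).zero_mem
          smul_mem' := fun a _ hx j => (((G j).sheaf i).stalk v).smul_mem a (hx j) } }
  Pi i :=
    { toFun := fun x j => (G j).Pi i (x j)
      map_add' := fun x y => funext fun j => map_add ((G j).Pi i) (x j) (y j)
      map_smul' := fun a x => funext fun j => map_smul ((G j).Pi i) a (x j) }
  tau i :=
    { toFun := fun x j => (G j).tau i (x j)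
      map_add' := fun x y => funext fun j => map_add ((G j).tau i) (x j) (y j)
      map_smul' := fun a x => funext fun j => map_smulₛₗ ((G j).tau i) a (x j) }

/-- `F` is the zero sheaf. -/
def IsZero : Prop := ∀ i, Subsingleton (F.sheaf i).fibre

/-- Morphisms of abelian `τ`-sheaves. -/
structure Hom (F F' : PreTauSheaf Fq Q L) where
  /-- the morphisms `f_i : F_i → F'_i` -/
  map : ∀ i, (F.sheaf i).fibre →ₗ[Q ⊗[Fq] L] (F'.sheaf i).fibre
  map_mem : ∀ i v, ∀ x ∈ (F.sheaf i).stalk v, map i x ∈ (F'.sheaf i).stalk v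
  map_pi : ∀ i x, map (i + 1) (F.Pi i x) = F'.Pi i (map i x)
  map_tau : ∀ i x, map (i + 1) (F.tau i x) = F'.tau i (map i x)

variable {F} {F' : PreTauSheaf Fq Q L}

/-- All `f_i` are injective maps of sheaves. -/
def Hom.IsInjective (f : Hom F F') : Prop := ∀ i, Function.Injective (f.map i)

/-- All `f_i` are surjective maps of sheaves (on all stalks, at the closed points and at the
generic point). -/
def Hom.IsSurjective (f : Hom F F') : Prop :=
  ∀ i, Function.Surjective (f.map i) ∧
    ∀ v, ∀ y ∈ (F'.sheaf i).stalk v, ∃ x ∈ (F.sheaf i).stalk v, f.map i x = y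

/-- `f` is injective, and the supports of all `coker f_i` are contained in `D × Spec L` for a fixed
finite set `D` of closed points of `C`. -/
def Hom.IsIsogeny (f : Hom F F') : Prop :=
  f.IsInjective ∧ ∃ D : Set (Place Fq Q), D.Finite ∧ ∀ i, Function.Surjective (f.map i) ∧
    ∀ v ∉ D, ∀ y ∈ (F'.sheaf i).stalk v, ∃ x ∈ (F.sheaf i).stalk v, f.map i x = y

variable (F F')

/-- `F` and `F'` are quasi-isogenous abelian `τ`-sheaves: there is an isogeny from `F` to `F'(D)`
for an effective divisor `D` on `C`. -/
def QuasiIsogenous (inf : Place Fq Q) (c : Characteristic Fq Q L) : Prop :=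
  F.IsAbelian inf c ∧ F'.IsAbelian inf c ∧
    ∃ D : Place Fq Q →₀ ℤ, 0 ≤ D ∧ ∃ f : Hom F (F'.twist D), f.IsIsogeny

/-- `F` is a simple abelian `τ`-sheaf: it is non-zero, and every abelian quotient `τ`-sheaf of `F`
is zero or equal to `F`. -/
def IsSimple (inf : Place Fq Q) (c : Characteristic Fq Q L) : Prop :=
  F.IsAbelian inf c ∧ ¬ F.IsZero ∧
    ∀ (G : PreTauSheaf Fq Q L) (f : Hom F G), G.IsAbelian inf c → f.IsSurjective →
      G.IsZero ∨ f.IsInjective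

/-- `F` is a semisimple abelian `τ`-sheaf: it is quasi-isogenous to a direct sum of finitely many
simple abelian `τ`-sheaves. -/
def IsSemisimple (inf : Place Fq Q) (c : Characteristic Fq Q L) : Prop :=
  ∃ (n : ℕ) (G : Fin n → PreTauSheaf Fq Q L),
    (∀ j, (G j).IsSimple inf c) ∧ F.QuasiIsogenous (directSum G) inf c

/-- A family of endomorphisms of the generic fibres is a quasi-endomorphism of `F` if it is a
morphism from `F` to `F(D)` for an effective divisor `D` on `C`. (Two quasi-morphisms are
equivalent if and only if they agree on the generic fibres.) -/
def IsQuasiEnd (π : ∀ i, Module.End (Q ⊗[Fq] L) (F.sheaf i).fibre) : Prop :=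
  ∃ D : Place Fq Q →₀ ℤ, 0 ≤ D ∧ ∃ f : Hom F (F.twist D), ∀ i, f.map i = π i

/-- For `#L = s = q ^ e`, the `s`-Frobenius of `F`: the quasi-endomorphism `π` for which
`Π_{i+e-1} ∘ ⋯ ∘ Π_i ∘ π_i` is the composite
`τ_{i+e-1} ∘ ⋯ ∘ (σ^*)^{e-1} τ_i : F_i = (σ^*)^e F_i → F_{i+e}`. -/
def IsFrobenius (π : ∀ i, Module.End (Q ⊗[Fq] L) (F.sheaf i).fibre) : Prop :=
  F.IsQuasiEnd π ∧ ∀ i x,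
    F.piIter (Module.finrank Fq L) i (i + Module.finrank Fq L) rfl (π i x) =
      F.tauIter (Module.finrank Fq L) i (i + Module.finrank Fq L) rfl x

/-- The quasi-endomorphism `π` is absolutely semisimple: the commutative `Q`-algebra `Q[π]` stays
semisimple after every extension of the field `Q`. -/
def IsAbsolutelySemisimple (π : ∀ i, Module.End (Q ⊗[Fq] L) (F.sheaf i).fibre) : Prop :=
  ∀ (K : Type u) [Field K] [Algebra Q K],
    IsSemisimpleRing (K ⊗[Q] (Algebra.adjoin Q {π}))

end PreTauSheaf

end TauSheaf

/-! ### Pure Anderson motives -/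

section Motive

variable {Fq Q : Type u} [Field Fq] [Fintype Fq] [Field Q] [Algebra Fq Q] (inf : Place Fq Q)
  (L : Type u) [Field L] [Algebra Fq L]

/-- The data `(M, τ)` underlying a pure Anderson motive: an `A_L`-module and a linear map
`τ : σ^* M → M`, given by the corresponding `σ^*`-semilinear map. -/
structure PreMotive where
  /-- the module `M` -/
  mod : CoeffModule Fq (affineRing inf) L
  /-- the map `τ` -/
  tau : mod →ₛₗ[sigma Fq (affineRing inf) L] mod

/-- The inclusion of `A_L` into `Q_L`. -/
def affineHom : affineRing inf ⊗[Fq] L →+* Q ⊗[Fq] L :=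
  (Algebra.TensorProduct.map (affineRing inf).val (AlgHom.id Fq L)).toRingHom

variable {inf L}

/-- The ideal `J` of `A_L` generated by the elements `a ⊗ 1 - 1 ⊗ c(a)`. -/
def charIdeal (c : affineRing inf →ₐ[Fq] L) : Ideal (affineRing inf ⊗[Fq] L) :=
  Ideal.span (Set.range fun a => a ⊗ₜ[Fq] (1 : L) - (1 : affineRing inf) ⊗ₜ[Fq] c a)

namespace PreMotive

variable (M : PreMotive inf L)

/-- The image of `τ : σ^* M → M`. -/
def tauImage : Submodule (affineRing inf ⊗[Fq] L) M.mod :=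
  Submodule.span _ (Set.range M.tau)

/-- The cokernel of `τ : σ^* M → M`. -/
def coker : CoeffModule Fq (affineRing inf) L :=
  ⟨M.mod ⧸ M.tauImage⟩

/-- The purity condition: `M` extends to a locally free sheaf `E` of rank `r` on `C_L` such that,
for some positive integers `k` and `l`, the map `τ ^ l` induces an isomorphism of
`(σ^*)^l E_∞` with `E(k∞)_∞`. Here `ι` is the identification of `M` with the sections of `E` outside
`inf`, and `T` is the extension of `τ` to the generic fibre. -/
def IsPure (r : ℕ) : Prop :=
  ∃ (E : LatticeSheaf Fq Q L) (ι : M.mod →ₛₗ[affineHom inf L] E.fibre)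
    (T : E.fibre →ₛₗ[sigma Fq Q L] E.fibre) (k l : ℕ),
    E.IsLocallyFree r ∧ Function.Injective ι ∧
    Set.range ι = {x | ∀ v : Place Fq Q, v ≠ inf → x ∈ E.stalk v} ∧
    (∀ x, T (ι x) = ι (M.tau x)) ∧ 0 < k ∧ 0 < l ∧
    Submodule.span L (T^[l] '' (E.stalk inf : Set E.fibre)) =
      (E.twist (Finsupp.single inf (k : ℤ))).stalk inf

/-- `M` is a pure Anderson motive of rank `r`, dimension `d` and characteristic `c` over `L`. -/
structure IsPureAndersonOf (c : affineRing inf →ₐ[Fq] L) (r d : ℕ) : Prop where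
  finite : Module.Finite (affineRing inf ⊗[Fq] L) M.mod
  projective : Module.Projective (affineRing inf ⊗[Fq] L) M.mod
  rank : ∀ p : PrimeSpectrum (affineRing inf ⊗[Fq] L), Module.rankAtStalk M.mod p = r
  tau_injective : Function.Injective M.tau
  dim_coker : Module.rank L M.coker = d
  coker_annihilated : charIdeal c ^ d • (⊤ : Submodule (affineRing inf ⊗[Fq] L) M.mod) ≤ M.tauImage
  pure : M.IsPure r

/-- `M` is a pure Anderson motive of characteristic `c` over `L`. -/
def IsPureAnderson (c : affineRing inf →ₐ[Fq] L) : Prop :=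
  ∃ r d : ℕ, M.IsPureAndersonOf c r d

/-- The base change `M ⊗_L L'`. -/
def baseChange (L' : Type u) [Field L'] [Algebra Fq L'] [Algebra L L'] [IsScalarTower Fq L L'] :
    PreMotive inf L' where
  mod := M.mod.baseChange L'
  tau := ScalarExt.mapSemi (extHom Fq (affineRing inf) L L')
    (extHom_comp_sigma Fq (affineRing inf) L L') M.tau

/-- The finite direct sum `M_1 ⊕ ⋯ ⊕ M_n`. -/
def directSum {n : ℕ} (N : Fin n → PreMotive inf L) : PreMotive inf L where
  mod := CoeffModule.pi fun j => (N j).mod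
  tau :=
    { toFun := fun x j => (N j).tau (x j)
      map_add' := fun x y => funext fun j => map_add (N j).tau (x j) (y j)
      map_smul' := fun a x => funext fun j => map_smulₛₗ (N j).tau a (x j) }

/-- Morphisms of Anderson motives. -/
structure Hom (M M' : PreMotive inf L) where
  /-- the underlying linear map -/
  map : M.mod →ₗ[affineRing inf ⊗[Fq] L] M'.mod
  map_tau : ∀ x, map (M.tau x) = M'.tau (map x)

/-- `M` and `M'` are quasi-isogenous pure Anderson motives: some element of `Hom(M, M') ⊗_A Q` has
an inverse in `Hom(M', M) ⊗_A Q`. After clearing denominators this means that there are morphisms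
in both directions whose composites are multiplication by a non-zero element of `A`. -/
def QuasiIsogenous (M' : PreMotive inf L) (c : affineRing inf →ₐ[Fq] L) : Prop :=
  M.IsPureAnderson c ∧ M'.IsPureAnderson c ∧
    ∃ (f : Hom M M') (g : Hom M' M) (a : affineRing inf), a ≠ 0 ∧
      (∀ x, g.map (f.map x) = a • x) ∧ ∀ y, f.map (g.map y) = a • y

/-- `M` is a simple pure Anderson motive: it is non-zero, and every quotient motive of `M` is zero
or equal to `M`. -/
def IsSimple (c : affineRing inf →ₐ[Fq] L) : Prop :=
  M.IsPureAnderson c ∧ Nontrivial M.mod ∧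
    ∀ (N : PreMotive inf L) (f : Hom M N), N.IsPureAnderson c → Function.Surjective f.map →
      Subsingleton N.mod ∨ Function.Injective f.map

/-- `M` is a semisimple pure Anderson motive: it is quasi-isogenous to a direct sum of finitely
many simple pure Anderson motives. -/
def IsSemisimple (c : affineRing inf →ₐ[Fq] L) : Prop :=
  ∃ (n : ℕ) (N : Fin n → PreMotive inf L),
    (∀ j, (N j).IsSimple c) ∧ M.QuasiIsogenous (directSum N) c

end PreMotive

end Motive

end

end TauSheaves

/-! Let `V` be the generic fibre of a τ-sheaf or motive: a finite-dimensional vector space over the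
field `Q ⊗ L` with an injective σ-semilinear map `φ`. Its power `φ ^ e`, where `e = [L : Fq]`, is
linear; it is the Frobenius π. The theorem comes down to one criterion: an abelian τ-sheaf of
characteristic different from ∞, or a pure Anderson motive, is semisimple if and only if the
commutative ring `Q[π]` is reduced (`FrobReduced`).

Given the criterion, the rest is algebra of polynomials. An extension of degree `m` replaces π by `π
^ m`, and `Q[π ^ m]` lies in `Q[π]`, so reducedness survives every base change
(`FrobReduced.extSemi`); this gives assertions 2 and 3. For assertion 1, in characteristic `p` every
non-zero polynomial, in particular the minimal polynomial of π, divides some `h(X ^ (p ^ n))` with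
`h` separable (`exists_separable_dvd_expand`). After an extension of degree `p ^ n` the Frobenius is
therefore a root of `h`, so that its algebra is semisimple over every extension of `Q`, and in
particular reduced.

From semisimple to reduced: the generic fibre of a simple object has no proper `φ`-stable subspace,
so the stable subspace `ker p(π)` is zero or everything, and a nilpotent `p(π)` vanishes. Sums and
quasi-isogenies preserve the conclusion. From reduced to semisimple: a Maschke-type averaging gives
every stable subspace a stable complement (`FrobReduced.exists_isCompl`), hence `V` is the product
of quotients by maximal stable subspaces (`FrobReduced.exists_maximal_family`). The images of the
lattices in these quotients define simple objects, and the object is quasi-isogenous to their sum.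

Both directions need that a quotient of `V` by a stable subspace, with the image lattices, is an
object of the same kind. For motives this is almost formal (`GoodMotive.map`). For τ-sheaves
(`Good.map`) the cokernels of Π and of τ must have equal dimension. Both indices are multiplicative
along subspace and quotient, and they agree on `V`. On the subspace and on the quotient, the index
of τ at the characteristic point is at most that of Π at ∞ (`relIndex_map_le_of_exhaustion`),
because sections over the complement of ∞ generate the cokernel of τ and are exhausted by finite
groups. So equality holds in both places. This is where the characteristic must differ from ∞.

The curve enters only through the places of `Q`. Riemann–Roch is replaced by a pigeonhole argument
producing a non-constant function whose only pole is ∞ (`exists_transcendental_mem_affineRing`).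
From it follow that `A` is a Dedekind domain with fraction field `Q`, that it separates points, and
that lattices have finitely many global sections. -/

namespace TauSheaves

/-! ### Separating elements and integral models of the curve -/

section Curve

open IntermediateField

variable {Fq Q : Type u} [Field Fq] [Field Q] [Algebra Fq Q]

theorem IsCurveFunctionField.isTranscendenceBasis (hQ : IsCurveFunctionField Fq Q) {x : Q}
    (hx : Transcendental Fq x) : IsTranscendenceBasis Fq ((↑) : ({x} : Set Q) → Q) := by
  refine AlgebraicIndependent.isTranscendenceBasis_of_trdeg_le_of_finite ?_ (by simp [hQ.trdeg])
  exact (algebraicIndependent_unique_type_iff (R := Fq)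
    (x := ((↑) : ({x} : Set Q) → Q))).2 hx

/-- Finite fields are perfect, so the finitely generated extension `Q` is separably generated; in
transcendence degree one a separating basis is a single element. -/
theorem IsCurveFunctionField.exists_separating [Finite Fq] (hQ : IsCurveFunctionField Fq Q) :
    ∃ x : Q, Transcendental Fq x ∧ Algebra.IsSeparable Fq⟮x⟯ Q := by
  have := (fg_top_iff (F := Fq) (E := Q)).1 hQ.fg
  obtain ⟨s, hs, hsep⟩ := exists_isTranscendenceBasis_and_isSeparable_of_perfectField Fq Q
  have h1 := hs.cardinalMk_eq_trdeg
  rw [hQ.trdeg] at h1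
  have h2 : s.card = 1 := by
    have : (Cardinal.mk s) = s.card := by simp
    rw [this] at h1
    exact_mod_cast h1
  obtain ⟨x, rfl⟩ := Finset.card_eq_one.1 h2
  rw [Finset.coe_singleton] at hsep
  refine ⟨x, ?_, hsep⟩
  have := hs.1.transcendental ⟨x, by simp⟩
  exact this

theorem IsCurveFunctionField.isAlgebraic (hQ : IsCurveFunctionField Fq Q) {x : Q}
    (hx : Transcendental Fq x) : Algebra.IsAlgebraic Fq⟮x⟯ Q := by
  have := (hQ.isTranscendenceBasis hx).isAlgebraic_field
  rwa [Subtype.range_coe] at this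

theorem IsCurveFunctionField.finiteDimensional (hQ : IsCurveFunctionField Fq Q) {x : Q}
    (hx : Transcendental Fq x) : FiniteDimensional Fq⟮x⟯ Q := by
  have := (fg_top_iff (F := Fq) (E := Q)).1 hQ.fg
  have := hQ.isAlgebraic hx
  have : Algebra.EssFiniteType Fq⟮x⟯ Q := Algebra.EssFiniteType.of_comp Fq _ _
  exact Algebra.finite_of_essFiniteType_of_isAlgebraic

/-- The ring of functions whose poles are poles of `x`. -/
noncomputable abbrev coordRing (Fq : Type u) [Field Fq] [Algebra Fq Q] (x : Q) : Subalgebra (Algebra.adjoin Fq {x}) Q :=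
  integralClosure (Algebra.adjoin Fq {x}) Q

theorem isPrincipalIdealRing_adjoin {x : Q} (hx : Transcendental Fq x) :
    IsPrincipalIdealRing (Algebra.adjoin Fq {x}) :=
  IsPrincipalIdealRing.of_surjective
    (Polynomial.algEquivOfTranscendental Fq x hx).toRingEquiv.toRingHom
    (Polynomial.algEquivOfTranscendental Fq x hx).surjective

section

open scoped algebraAdjoinAdjoin

/-- Separability over `Fq(x)` is what makes the integral closure of the principal ideal domain
`Fq[x]` a finite module. -/
theorem coordRing_facts (hQ : IsCurveFunctionField Fq Q) {x : Q} (hx : Transcendental Fq x)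
    [Algebra.IsSeparable Fq⟮x⟯ Q] :
    IsDedekindDomain (coordRing Fq x) ∧ IsFractionRing (coordRing Fq x) Q ∧
      Module.Finite (Algebra.adjoin Fq {x}) (coordRing Fq x) := by
  have := isPrincipalIdealRing_adjoin hx
  have := hQ.finiteDimensional hx
  have : IsDedekindDomain (Algebra.adjoin Fq {x}) := inferInstance
  refine ⟨integralClosure.isDedekindDomain (Algebra.adjoin Fq {x}) Fq⟮x⟯ Q,
    integralClosure.isFractionRing_of_finite_extension Fq⟮x⟯ Q, ?_⟩
  exact IsIntegralClosure.finite (Algebra.adjoin Fq {x}) Fq⟮x⟯ Q (coordRing Fq x)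

end

theorem Place.isIntegrallyClosedIn (v : Place Fq Q) {y : Q} {R : Type*} [CommRing R] [Algebra R Q]
    (hR : ∀ r : R, algebraMap R Q r ∈ v.ring) (hy : IsIntegral R y) : y ∈ v.ring := by
  obtain ⟨p, hp, hpy⟩ := hy
  have : IsIntegral v.ring y := by
    refine ⟨p.map ((algebraMap R Q).codRestrict v.ring.toSubring hR), hp.map _, ?_⟩
    rw [Polynomial.eval₂_map]
    exact hpy
  obtain ⟨z, rfl⟩ := IsIntegrallyClosed.isIntegral_iff.1 this
  exact z.2

theorem Place.coordRing_le (v : Place Fq Q) {x : Q} (hx : x ∈ v.ring) {y : Q}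
    (hy : y ∈ coordRing Fq x) : y ∈ v.ring := by
  refine v.isIntegrallyClosedIn (fun r => ?_) hy
  have : Algebra.adjoin Fq {x} ≤ ({ v.ring with algebraMap_mem' := v.const_mem } :
    Subalgebra Fq Q) := Algebra.adjoin_le (by simpa using hx)
  exact this r.2

/-- A place over a Dedekind domain `B` with fraction field `Q` is a localization of `B`. -/
theorem Place.dvr_of_dedekind (v : Place Fq Q) (B : Type u) [CommRing B] [IsDedekindDomain B]
    [Algebra B Q] [IsFractionRing B Q] (hB : ∀ b : B, algebraMap B Q b ∈ v.ring) :
    IsDiscreteValuationRing v.ring ∧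
    ∀ y ∈ v.ring, ∃ a s : B, algebraMap B Q s ∉ v.ring.nonunits ∧
      y = algebraMap B Q a / algebraMap B Q s := by
  classical
  let : Algebra B v.ring := ((algebraMap B Q).codRestrict v.ring.toSubring hB).toAlgebra
  have : IsScalarTower B v.ring Q := IsScalarTower.of_algebraMap_eq fun _ => rfl
  have hmap : ∀ b : B, ((algebraMap B v.ring b : v.ring) : Q) = algebraMap B Q b := fun _ => rfl
  -- The centre of `v` on `B`; the aim is that the localization at `P` is the whole local ring of
  -- `v`.
  let P : Ideal B := (IsLocalRing.maximalIdeal v.ring).comap (algebraMap B v.ring)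
  have : P.IsPrime := Ideal.comap_isPrime _ _
  have hP : ∀ b : B, b ∈ P ↔ algebraMap B Q b ∈ v.ring.nonunits := fun b => by
    rw [Ideal.mem_comap, ← ValuationSubring.coe_mem_nonunits_iff]; rfl
  have hinj : Function.Injective (algebraMap B Q) := IsFractionRing.injective B Q
  have h0 : ∀ s : B, s ∉ P → algebraMap B Q s ≠ 0 := fun s hs h => hs (by
    rw [(map_eq_zero_iff _ hinj).1 h]; exact P.zero_mem)
  have hdiv : ∀ y ∈ v.ring, ∃ a s : B, s ∉ P ∧ y = algebraMap B Q a / algebraMap B Q s := by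
    intro y hy
    obtain ⟨a, b, hb, rfl⟩ := IsFractionRing.div_surjective (A := B) y
    have hb0 : algebraMap B Q b ≠ 0 := (map_ne_zero_iff _ hinj).2 (nonZeroDivisors.ne_zero hb)
    -- The localization at `P` is a field or a discrete valuation ring, so of `a` and `b` one
    -- divides the other there.
    have hval : ValuationRing (Localization.AtPrime P) := by
      by_cases hbot : P = ⊥
      · have : IsDedekindDomain (Localization.AtPrime P) :=
          IsLocalization.isDedekindDomain B P.primeCompl_le_nonZeroDivisors _
        have : IsPrincipalIdealRing (Localization.AtPrime P) := by
          have hm : IsLocalRing.maximalIdeal (Localization.AtPrime P) = ⊥ := by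
            rw [← Localization.AtPrime.map_eq_maximalIdeal]
            simp [hbot]
          have : IsField (Localization.AtPrime P) := IsLocalRing.isField_iff_maximalIdeal_eq.2 hm
          let := this.toField
          infer_instance
        infer_instance
      · have := IsLocalization.AtPrime.isDiscreteValuationRing_of_dedekind_domain B hbot
          (Localization.AtPrime P)
        infer_instance
    have key : ∀ a b : B, algebraMap B (Localization.AtPrime P) a ∣
        algebraMap B (Localization.AtPrime P) b → ∃ c s : B, s ∉ P ∧ b * s = a * c := by
      rintro a b ⟨w, hw⟩
      obtain ⟨⟨c, s⟩, hcs⟩ := IsLocalization.surj P.primeCompl w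
      refine ⟨c, s, s.2, ?_⟩
      apply IsLocalization.injective (Localization.AtPrime P) P.primeCompl_le_nonZeroDivisors
      simp only [map_mul] at hcs ⊢
      rw [hw, mul_assoc, hcs]
    rcases ValuationRing.dvd_total (algebraMap B (Localization.AtPrime P) b)
      (algebraMap B (Localization.AtPrime P) a) with h | h
    · obtain ⟨c, s, hs, hcs⟩ := key _ _ h
      refine ⟨c, s, hs, ?_⟩
      rw [div_eq_div_iff hb0 (h0 s hs), ← map_mul, ← map_mul, hcs, mul_comm b c]
    · obtain ⟨c, s, hs, hcs⟩ := key _ _ h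
      -- Here `a / b = s / c`. A denominator `c` in `P` would put `s = (a / b) c` into the maximal
      -- ideal, contrary to `s ∉ P`.
      by_cases hc : c ∈ P
      · exfalso
        by_cases ha : a = 0
        · subst ha
          rw [zero_mul] at hcs
          rcases mul_eq_zero.1 hcs with h | h
          · exact hb0 (by simp [h])
          · exact hs (h ▸ P.zero_mem)
        have ha0 : algebraMap B Q a ≠ 0 := (map_ne_zero_iff _ hinj).2 ha
        have h1 : algebraMap B Q a / algebraMap B Q b * algebraMap B Q c = algebraMap B Q s := by
          rw [div_mul_eq_mul_div, div_eq_iff hb0, ← map_mul, ← map_mul, ← hcs, mul_comm]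
        apply hs
        have h2 : (⟨_, hy⟩ : v.ring) * algebraMap B v.ring c = algebraMap B v.ring s :=
          Subtype.ext h1
        change algebraMap B v.ring s ∈ IsLocalRing.maximalIdeal v.ring
        rw [← h2]
        exact Ideal.mul_mem_left _ _ hc
      · refine ⟨s, c, hc, ?_⟩
        rw [div_eq_div_iff hb0 (h0 c hc), ← map_mul, ← map_mul, ← hcs, mul_comm]
  refine ⟨?_, fun y hy => ?_⟩
  -- With zero centre every non-zero element of `B` would be a unit at `v`, and the local ring would
  -- be all of `Q`.
  · have hbot : P ≠ ⊥ := by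
      intro hbot
      apply v.ne_top
      rw [eq_top_iff]
      intro y _
      obtain ⟨a, b, hb, rfl⟩ := IsFractionRing.div_surjective (A := B) y
      have hb0 : b ∉ P := by rw [hbot]; exact nonZeroDivisors.ne_zero hb
      rw [hP, ValuationSubring.mem_nonunits_iff_or] at hb0
      push Not at hb0
      rw [div_eq_mul_inv]
      exact v.ring.mul_mem _ _ (hB a) hb0.2
    have : IsLocalization.AtPrime v.ring P := by
      refine ⟨fun s => ?_, fun y => ?_, fun {a b} h => ⟨1, ?_⟩⟩
      · by_contra h
        exact s.2 ((IsLocalRing.mem_maximalIdeal _).2 h)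
      · obtain ⟨a, s, hs, h⟩ := hdiv y y.2
        refine ⟨(a, ⟨s, hs⟩), Subtype.ext ?_⟩
        change (y : Q) * algebraMap B Q s = algebraMap B Q a
        rw [h, div_mul_cancel₀ _ (h0 s hs)]
      · rw [hinj (congrArg Subtype.val h)]
    exact IsLocalization.AtPrime.isDiscreteValuationRing_of_dedekind_domain B hbot v.ring
  · obtain ⟨a, s, hs, h⟩ := hdiv y hy
    exact ⟨a, s, fun h' => hs ((hP s).2 h'), h⟩

end Curve


/-! ### Places, uniformizers and the finiteness of poles -/

section Curve

open IntermediateField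

variable {Fq Q : Type u} [Field Fq] [Field Q] [Algebra Fq Q]

theorem adjoin_inv_eq (x : Q) : Fq⟮x⁻¹⟯ = Fq⟮x⟯ := by
  apply le_antisymm
  · rw [adjoin_simple_le_iff]
    exact inv_mem (mem_adjoin_simple_self Fq x)
  · rw [adjoin_simple_le_iff]
    simpa using inv_mem (mem_adjoin_simple_self Fq x⁻¹)

theorem transcendental_inv {x : Q} (hx : Transcendental Fq x) : Transcendental Fq x⁻¹ := by
  intro h
  apply hx
  simpa using h.inv

theorem IsCurveFunctionField.exists_separating_mem [Finite Fq] (hQ : IsCurveFunctionField Fq Q)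
    (v : Place Fq Q) :
    ∃ x : Q, x ∈ v.ring ∧ Transcendental Fq x ∧ Algebra.IsSeparable Fq⟮x⟯ Q := by
  obtain ⟨x, hx, hs⟩ := hQ.exists_separating
  rcases v.ring.mem_or_inv_mem x with h | h
  · exact ⟨x, h, hx, hs⟩
  · exact ⟨x⁻¹, h, transcendental_inv hx, by rw [adjoin_inv_eq]; exact hs⟩

theorem Place.isDVR [Finite Fq] (hQ : IsCurveFunctionField Fq Q) (v : Place Fq Q) :
    IsDiscreteValuationRing v.ring := by
  obtain ⟨x, hxv, hx, hs⟩ := hQ.exists_separating_mem v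
  obtain ⟨h1, h2, -⟩ := coordRing_facts hQ hx
  exact (v.dvr_of_dedekind (coordRing Fq x) fun b => v.coordRing_le hxv b.2).1

theorem Place.ext_ring {v w : Place Fq Q} (h : v.ring = w.ring) : v = w := by
  cases v; cases w; cases h; rfl

/-- A discrete valuation ring is a maximal proper subring of its fraction field. -/
theorem Place.eq_of_le [Finite Fq] (hQ : IsCurveFunctionField Fq Q) {v w : Place Fq Q}
    (h : v.ring ≤ w.ring) : v = w := by
  have := v.isDVR hQ
  rcases ValuationSubring.eq_self_or_eq_top_of_le h with h | h
  · exact Place.ext_ring h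
  · exact absurd h w.ne_top

theorem Place.notMem_nonunits {v : Place Fq Q} {y : Q} (h : y ∉ v.ring.nonunits) :
    y ≠ 0 ∧ y⁻¹ ∈ v.ring := by
  rw [ValuationSubring.mem_nonunits_iff_or] at h
  push Not at h
  exact h

theorem Place.mem_of_nonunits {v : Place Fq Q} {y : Q} (h : y ∈ v.ring.nonunits) : y ∈ v.ring :=
  v.ring.nonunits_subset h

theorem Place.mul_mem_nonunits {v : Place Fq Q} {y z : Q} (h : y ∈ v.ring.nonunits)
    (hz : z ∈ v.ring) : y * z ∈ v.ring.nonunits := by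
  rw [ValuationSubring.mem_nonunits_iff] at *
  rw [map_mul]
  exact mul_lt_one_of_lt_of_le h ((v.ring.valuation_le_one_iff _).2 hz)

theorem Place.one_notMem_nonunits {v : Place Fq Q} : (1 : Q) ∉ v.ring.nonunits := by
  rw [ValuationSubring.mem_nonunits_iff]
  simp

theorem Place.mem_or_mem_nonunits {v : Place Fq Q} {y z : Q} (hy : y ∈ v.ring) (hz : z ∈ v.ring)
    (h : y * z ∈ v.ring.nonunits) : y ∈ v.ring.nonunits ∨ z ∈ v.ring.nonunits := by
  by_contra! hc
  obtain ⟨hy0, hy'⟩ := notMem_nonunits hc.1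
  apply hc.2
  have := mul_mem_nonunits h hy'
  rwa [mul_comm y, mul_inv_cancel_right₀ hy0] at this

theorem Place.exists_uniformizer [Finite Fq] (hQ : IsCurveFunctionField Fq Q) (v : Place Fq Q) :
    ∃ z, v.IsUniformizer z := by
  have := v.isDVR hQ
  obtain ⟨ϖ, hϖ⟩ := IsDiscreteValuationRing.exists_irreducible v.ring
  have h0 : (ϖ : Q) ≠ 0 := fun h => hϖ.ne_zero (Subtype.ext h)
  refine ⟨ϖ, h0, ?_, fun y hy => ?_⟩
  · rw [ValuationSubring.coe_mem_nonunits_iff]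
    exact (IsLocalRing.mem_maximalIdeal _).2 hϖ.not_isUnit
  · obtain ⟨hy', hm⟩ := ValuationSubring.mem_nonunits_iff_exists_mem_maximalIdeal.1 hy
    rw [hϖ.maximalIdeal_eq, Ideal.mem_span_singleton] at hm
    obtain ⟨w, hw⟩ := hm
    have : y = ϖ * w := congrArg Subtype.val hw
    rw [this, mul_comm, ← mul_assoc, inv_mul_cancel₀ h0, one_mul]
    exact w.2

theorem Place.IsUniformizer.exists_eq_mul_zpow [Finite Fq] (hQ : IsCurveFunctionField Fq Q)
    {v : Place Fq Q} {z : Q} (hz : v.IsUniformizer z) {y : Q} (hy : y ≠ 0) :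
    ∃ (n : ℤ) (w : Q), w ∈ v.ring ∧ w⁻¹ ∈ v.ring ∧ y = w * z ^ n := by
  have := v.isDVR hQ
  have hzm : z ∈ v.ring := mem_of_nonunits hz.2.1
  have hirr : Irreducible (⟨z, hzm⟩ : v.ring) := by
    rw [IsDiscreteValuationRing.irreducible_iff_uniformizer]
    apply le_antisymm
    · intro a ha
      have h1 := hz.2.2 a (ValuationSubring.coe_mem_nonunits_iff.2 ha)
      rw [Ideal.mem_span_singleton]
      refine ⟨⟨_, h1⟩, Subtype.ext ?_⟩
      change (a : Q) = z * (a * z⁻¹)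
      rw [mul_comm, inv_mul_cancel_right₀ hz.1]
    · rw [Ideal.span_singleton_le_iff_mem, ← ValuationSubring.coe_mem_nonunits_iff]
      exact hz.2.1
  have key : ∀ y : Q, y ≠ 0 → y ∈ v.ring →
      ∃ (n : ℕ) (w : Q), w ∈ v.ring ∧ w⁻¹ ∈ v.ring ∧ y = w * z ^ n := by
    intro y hy hyv
    obtain ⟨n, w, hw⟩ := IsDiscreteValuationRing.eq_unit_mul_pow_irreducible
      (x := (⟨y, hyv⟩ : v.ring)) (fun h => hy (congrArg Subtype.val h)) hirr
    refine ⟨n, (w : v.ring), (w : v.ring).2, ?_, congrArg Subtype.val hw⟩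
    have : ((w : v.ring) : Q) * ((w⁻¹ : v.ringˣ) : v.ring) = 1 := by
      exact congrArg Subtype.val (w.mul_inv)
    rw [← eq_inv_of_mul_eq_one_right this]
    exact ((w⁻¹ : v.ringˣ) : v.ring).2
  rcases v.ring.mem_or_inv_mem y with h | h
  · obtain ⟨n, w, h1, h2, h3⟩ := key y hy h
    exact ⟨n, w, h1, h2, by simpa using h3⟩
  · obtain ⟨n, w, h1, h2, h3⟩ := key y⁻¹ (inv_ne_zero hy) h
    refine ⟨-n, w⁻¹, h2, by simpa using h1, ?_⟩
    rw [← inv_inv y, h3, mul_inv]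
    simp

/-- A place over `B` where `a / b` has a pole has its centre among the finitely many primes dividing
`b`, and a place over `B` is determined by its centre. -/
theorem finite_places_of_dedekind [Finite Fq] (hQ : IsCurveFunctionField Fq Q)
    (B : Type u) [CommRing B] [IsDedekindDomain B] [Algebra B Q] [IsFractionRing B Q] (y : Q) :
    {v : Place Fq Q | (∀ c : B, algebraMap B Q c ∈ v.ring) ∧ y ∉ v.ring}.Finite := by
  obtain ⟨a, b, hb, rfl⟩ := IsFractionRing.div_surjective (A := B) y
  have hb0 : b ≠ 0 := nonZeroDivisors.ne_zero hb
  let P : ∀ v : Place Fq Q, (∀ c : B, algebraMap B Q c ∈ v.ring) → Ideal B := fun v hv =>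
    (IsLocalRing.maximalIdeal v.ring).comap ((algebraMap B Q).codRestrict v.ring.toSubring hv)
  have hP : ∀ v hv c, c ∈ P v hv ↔ algebraMap B Q c ∈ v.ring.nonunits := fun v hv c => by
    change (algebraMap B Q).codRestrict v.ring.toSubring hv c ∈
      IsLocalRing.maximalIdeal v.ring ↔ _
    rw [← ValuationSubring.coe_mem_nonunits_iff]; rfl
  have hPp : ∀ v hv, (P v hv).IsPrime := fun v hv => Ideal.comap_isPrime _ _
  have hfin := Ideal.finite_factors (I := Ideal.span {b}) (by simpa using hb0)
  have key : ∀ v ∈ {v : Place Fq Q | (∀ c : B, algebraMap B Q c ∈ v.ring) ∧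
      algebraMap B Q a / algebraMap B Q b ∉ v.ring},
      ∃ p : IsDedekindDomain.HeightOneSpectrum B, p.asIdeal ∣ Ideal.span {b} ∧
        ∀ hv, p.asIdeal = P v hv := by
    rintro v ⟨hv, hvy⟩
    have hbP : b ∈ P v hv := by
      rw [hP]
      by_contra h
      apply hvy
      rw [div_eq_mul_inv]
      exact v.ring.mul_mem _ _ (hv a) (Place.notMem_nonunits h).2
    refine ⟨⟨P v hv, hPp v hv, fun h => hb0 ?_⟩, ?_, fun _ => rfl⟩
    · rw [h] at hbP; exact hbP
    · exact Ideal.dvd_iff_le.2 (by simpa using hbP)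
  choose f hf hf' using key
  -- The map from places to their centres, with the default value `⊥` outside the set in question.
  refine Set.Finite.of_finite_image (s := {v : Place Fq Q | (∀ c : B, algebraMap B Q c ∈ v.ring) ∧
      algebraMap B Q a / algebraMap B Q b ∉ v.ring}) (f := fun v => open Classical in
        if h : v ∈ {v : Place Fq Q | (∀ c : B, algebraMap B Q c ∈ v.ring) ∧
          algebraMap B Q a / algebraMap B Q b ∉ v.ring} then (f v h).asIdeal else ⊥)
    ((hfin.image fun p => p.asIdeal).subset ?_) ?_
  · rintro _ ⟨v, hv, rfl⟩
    exact ⟨f v hv, hf v hv, by simp only [dif_pos hv]⟩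
  intro v hv w hw hvw
  have hPP : P v hv.1 = P w hw.1 := by
    rw [← hf' v hv, ← hf' w hw]
    simpa only [dif_pos hv, dif_pos hw] using hvw
  apply Place.eq_of_le hQ
  intro y hy
  obtain ⟨a, s, hs, rfl⟩ := (v.dvr_of_dedekind B hv.1).2 y hy
  have : algebraMap B Q s ∉ w.ring.nonunits := fun h => hs (by
    rwa [← hP w hw.1, ← hPP, hP] at h)
  rw [div_eq_mul_inv]
  exact w.ring.mul_mem _ _ (hw.1 a) (Place.notMem_nonunits this).2

theorem finite_places_of_mem [Finite Fq] (hQ : IsCurveFunctionField Fq Q) {x : Q}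
    (hx : Transcendental Fq x) (hs : Algebra.IsSeparable Fq⟮x⟯ Q) (y : Q) :
    {v : Place Fq Q | x ∈ v.ring ∧ y ∉ v.ring}.Finite := by
  obtain ⟨h1, h2, -⟩ := coordRing_facts hQ hx
  refine (finite_places_of_dedekind hQ (coordRing Fq x) y).subset ?_
  rintro v ⟨hv, hy⟩
  exact ⟨fun c => v.coordRing_le hv c.2, hy⟩

/-- A rational function on the curve has finitely many poles. -/
theorem finite_poles [Finite Fq] (hQ : IsCurveFunctionField Fq Q) (y : Q) :
    {v : Place Fq Q | y ∉ v.ring}.Finite := by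
  obtain ⟨x, hx, hs⟩ := hQ.exists_separating
  have h1 := finite_places_of_mem hQ hx hs y
  have h2 := finite_places_of_mem hQ (transcendental_inv hx) (by rw [adjoin_inv_eq]; exact hs) y
  refine (h1.union h2).subset fun v hv => ?_
  rcases v.ring.mem_or_inv_mem x with h | h
  · exact Or.inl ⟨h, hv⟩
  · exact Or.inr ⟨h, hv⟩

/-- The valuation rings containing a subring intersect in its integral closure, so an everywhere
regular function is integral over `Fq`; as `Fq` is algebraically closed in `Q`, it is a constant. -/
theorem exists_algebraMap_eq_of_forall_mem (hQ : IsCurveFunctionField Fq Q) {y : Q}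
    (hy : ∀ v : Place Fq Q, y ∈ v.ring) : ∃ c : Fq, algebraMap Fq Q c = y := by
  have h := iInf_valuationSubring_superset (K := Q) (s := Set.range (algebraMap Fq Q))
  have hmem : y ∈ (⨅ V : {V : ValuationSubring Q // Set.range (algebraMap Fq Q) ⊆ V.toSubring},
      V.1.toSubring) := by
    rw [Subring.mem_iInf]
    rintro ⟨V, hV⟩
    by_cases hT : V = ⊤
    · subst hT; exact ValuationSubring.mem_top y
    · exact hy ⟨V, fun a => hV ⟨a, rfl⟩, hT⟩
  rw [h] at hmem
  have hint : IsIntegral (Subring.closure (Set.range (algebraMap Fq Q))) y := hmem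
  have : IsIntegral Fq y := by
    obtain ⟨p, hp, hpy⟩ := hint
    have hcl : ∀ r : Subring.closure (Set.range (algebraMap Fq Q)),
        (r : Q) ∈ (algebraMap Fq Q).range := fun r => by
      have : Subring.closure (Set.range (algebraMap Fq Q)) ≤ (algebraMap Fq Q).range :=
        Subring.closure_le.2 (by rintro _ ⟨a, rfl⟩; exact ⟨a, rfl⟩)
      exact this r.2
    have hl : p.map (algebraMap _ Q) ∈ Polynomial.lifts (algebraMap Fq Q) := by
      rw [Polynomial.lifts_iff_coeff_lifts]
      intro n
      rw [Polynomial.coeff_map]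
      exact hcl _
    obtain ⟨r, hr, -, hrm⟩ := Polynomial.lifts_and_natDegree_eq_and_monic hl (hp.map _)
    refine ⟨r, hrm, ?_⟩
    rw [← Polynomial.eval_map, hr, Polynomial.eval_map]
    exact hpy
  have h2 : y ∈ algebraicClosure Fq Q := mem_algebraicClosure_iff.2 this.isAlgebraic
  rw [hQ.const, mem_bot] at h2
  exact h2

theorem exists_pole (hQ : IsCurveFunctionField Fq Q) {y : Q} (hy : Transcendental Fq y) :
    ∃ v : Place Fq Q, y ∉ v.ring := by
  by_contra! h
  obtain ⟨c, rfl⟩ := exists_algebraMap_eq_of_forall_mem hQ h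
  exact hy (isAlgebraic_algebraMap c)

theorem transcendental_of_notMem_range (hQ : IsCurveFunctionField Fq Q) {y : Q}
    (hy : y ∉ Set.range (algebraMap Fq Q)) : Transcendental Fq y := fun h => hy (by
  have h2 : y ∈ algebraicClosure Fq Q :=
    mem_algebraicClosure_iff.2 h
  rw [hQ.const, mem_bot] at h2
  exact h2)

/-- Residue fields are algebraic over `Fq`: otherwise `Fq(y)` would embed into the local ring, which
is integrally closed and would then contain the algebraic extension `Q` of `Fq(y)`. -/
theorem Place.exists_aeval_mem_nonunits (hQ : IsCurveFunctionField Fq Q) (v : Place Fq Q) {y : Q}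
    (hy : y ∈ v.ring) :
    ∃ h : Polynomial Fq, h ≠ 0 ∧ Polynomial.aeval y h ∈ v.ring.nonunits := by
  by_contra! hc
  by_cases hy' : IsAlgebraic Fq y
  · obtain ⟨h, h0, h1⟩ := hy'
    apply hc h h0
    rw [h1, ValuationSubring.mem_nonunits_iff]
    simp
  · have hp : ∀ h : Polynomial Fq, Polynomial.aeval y h ∈ v.ring := fun h => by
      have : Algebra.adjoin Fq {y} ≤ ({ v.ring with algebraMap_mem' := v.const_mem } :
        Subalgebra Fq Q) := Algebra.adjoin_le (by simpa using hy)
      exact this (Polynomial.aeval_mem_adjoin_singleton Fq y)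
    have hK : ∀ k : Fq⟮y⟯, algebraMap Fq⟮y⟯ Q k ∈ v.ring := fun k => by
      obtain ⟨r, s, h⟩ := (mem_adjoin_simple_iff Fq _).1 k.2
      change (k : Q) ∈ v.ring
      rw [h]
      by_cases hs : s = 0
      · simp [hs, v.ring.zero_mem]
      · rw [div_eq_mul_inv]
        exact v.ring.mul_mem _ _ (hp r) (notMem_nonunits (hc s hs)).2
    have := hQ.isAlgebraic hy'
    apply v.ne_top
    rw [eq_top_iff]
    intro w _
    exact v.isIntegrallyClosedIn hK (Algebra.IsAlgebraic.isAlgebraic (R := Fq⟮y⟯) w).isIntegral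

end Curve


/-! ### Clearing poles, and indices of ideals -/

section Curve

open IntermediateField

variable {Fq Q : Type u} [Field Fq] [Field Q] [Algebra Fq Q]

/-- An element outside an integrally closed subring is missed by some valuation ring above it; here
that valuation ring contains `x` and is a place. Integrality can thus be tested on poles. -/
theorem mem_coordRing_of_forall {x y : Q} (h : ∀ v : Place Fq Q, x ∈ v.ring → y ∈ v.ring) :
    y ∈ coordRing Fq x := by
  by_contra hy
  obtain ⟨V, hV, hyV⟩ := Subring.exists_le_valuationSubring_of_isIntegrallyClosedIn
    (R := (coordRing Fq x).toSubring) (x := y) hy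
  have hR : ∀ r : Algebra.adjoin Fq {x}, (r : Q) ∈ V := fun r =>
    hV ((coordRing Fq x).algebraMap_mem r)
  refine hyV (h ⟨V, fun a => hR (algebraMap Fq _ a), ?_⟩
    (hR ⟨x, Algebra.self_mem_adjoin_singleton Fq x⟩))
  rintro rfl
  exact hyV (ValuationSubring.mem_top y)

/-- Since `t` vanishes to order at least one, the pole order of `w` bounds the exponent. The form
"for all large `k`" lets finitely many places share one exponent later. -/
theorem Place.exists_pow_mul_mem [Finite Fq] (hQ : IsCurveFunctionField Fq Q) (v : Place Fq Q)
    {t : Q} (ht : t ∈ v.ring.nonunits) (ht0 : t ≠ 0) (w : Q) :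
    ∃ k₀ : ℕ, ∀ k ≥ k₀, t ^ k * w ∈ v.ring := by
  by_cases hw : w = 0
  · exact ⟨0, fun k _ => by simp [hw, v.ring.zero_mem]⟩
  obtain ⟨z, hz⟩ := v.exists_uniformizer hQ
  have hzm : z ∈ v.ring := mem_of_nonunits hz.2.1
  obtain ⟨b, w', hw1, hw2, rfl⟩ := hz.exists_eq_mul_zpow hQ hw
  have htz : t * z⁻¹ ∈ v.ring := hz.2.2 t ht
  have ht' : t = (t * z⁻¹) * z := by rw [inv_mul_cancel_right₀ hz.1]
  refine ⟨(-b).toNat, fun k hk => ?_⟩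
  have hkb : 0 ≤ (k : ℤ) + b := by omega
  rw [ht', mul_pow, show (t * z⁻¹) ^ k * z ^ k * (w' * z ^ b) =
    (t * z⁻¹) ^ k * w' * (z ^ k * z ^ b) by ring, ← zpow_natCast z k, ← zpow_add₀ hz.1]
  obtain ⟨m, hm⟩ := Int.eq_ofNat_of_zero_le hkb
  rw [hm, zpow_natCast]
  exact v.ring.mul_mem _ _ (v.ring.mul_mem _ _ (pow_mem htz k) hw1) (pow_mem hzm m)

/-- Otherwise every denominator allowed at `v` would be a unit at `w`, and the local ring of `v`, a
localization of `B`, would lie in that of `w`. -/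
theorem Place.exists_sub_separate [Finite Fq] (hQ : IsCurveFunctionField Fq Q) {v w : Place Fq Q}
    (hvw : v ≠ w) (B : Type u) [CommRing B] [IsDedekindDomain B] [Algebra B Q]
    [IsFractionRing B Q] (hv : ∀ c : B, algebraMap B Q c ∈ v.ring)
    (hw : ∀ c : B, algebraMap B Q c ∈ w.ring) :
    ∃ s : B, algebraMap B Q s ∈ w.ring.nonunits ∧ algebraMap B Q s ∉ v.ring.nonunits := by
  by_contra! hc
  apply hvw
  apply Place.eq_of_le hQ
  intro y hy
  obtain ⟨a, s, hs, rfl⟩ := (v.dvr_of_dedekind B hv).2 y hy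
  rw [div_eq_mul_inv]
  exact w.ring.mul_mem _ _ (hw a) (Place.notMem_nonunits fun h => hs (hc s h)).2

/-- In a Dedekind domain `I ^ k` is generated by `I ^ (k + 1)` and one further element `a`, so `b ↦
b a` maps `B / I` onto `I ^ k / I ^ (k + 1)`: no layer is larger than `B / I`. -/
theorem index_pow_le {B : Type*} [CommRing B] [IsDedekindDomain B] {I : Ideal B} (hI : I ≠ ⊥)
    (hfin : I.toAddSubgroup.index ≠ 0) (N : ℕ) :
    (I ^ N).toAddSubgroup.index ≠ 0 ∧
      (I ^ N).toAddSubgroup.index ≤ I.toAddSubgroup.index ^ N := by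
  induction N with
  | zero =>
    have : ((I ^ 0 : Ideal B)).toAddSubgroup = ⊤ := by
      ext; simp
    rw [this]; simp
  | succ k ih =>
    obtain ⟨a, ha⟩ := IsDedekindDomain.exists_sup_span_eq (Ideal.pow_le_pow_right (I := I)
      (Nat.le_succ k)) (pow_ne_zero (k + 1) hI)
    have hle : (I ^ (k + 1)).toAddSubgroup ≤ (I ^ k).toAddSubgroup :=
      Ideal.pow_le_pow_right (Nat.le_succ k)
    have ha' : a ∈ I ^ k := by
      rw [← ha]; exact Ideal.mem_sup_right (Ideal.mem_span_singleton_self a)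
    let g : B →+ (I ^ k).toAddSubgroup ⧸
        ((I ^ (k + 1)).toAddSubgroup.addSubgroupOf (I ^ k).toAddSubgroup) :=
      (QuotientAddGroup.mk' _).comp
        ((AddMonoidHom.mulRight a).codRestrict (I ^ k).toAddSubgroup
          fun b => Ideal.mul_mem_left _ b ha')
    have hg : Function.Surjective g := by
      rintro ⟨⟨y, hy⟩⟩
      have hy' : y ∈ I ^ (k + 1) ⊔ Ideal.span {a} := by rw [ha]; exact hy
      obtain ⟨i, hi, j, hj, rfl⟩ := Submodule.mem_sup.1 hy'
      obtain ⟨b, rfl⟩ := Ideal.mem_span_singleton'.1 hj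
      refine ⟨b, ?_⟩
      refine QuotientAddGroup.eq.2 ?_
      change -(b * a) + (i + b * a) ∈ I ^ (k + 1)
      convert! hi using 1
      ring
    have hker : I.toAddSubgroup ≤ g.ker := by
      intro b hb
      rw [AddMonoidHom.mem_ker]
      refine (QuotientAddGroup.eq_zero_iff _).2 ?_
      change b * a ∈ I ^ (k + 1)
      rw [pow_succ, mul_comm b]
      exact Ideal.mul_mem_mul ha' hb
    have h1 : g.ker.index = ((I ^ (k + 1)).toAddSubgroup).relIndex (I ^ k).toAddSubgroup := by
      rw [AddSubgroup.index_ker, AddMonoidHom.range_eq_top.2 hg, AddSubgroup.card_top]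
      rfl
    have h2 : g.ker.index ∣ I.toAddSubgroup.index := AddSubgroup.index_dvd_of_le hker
    rw [h1] at h2
    have h3 := AddSubgroup.relIndex_mul_index hle
    rw [← h3, pow_succ, mul_comm]
    refine ⟨mul_ne_zero ih.1 (ne_zero_of_dvd_ne_zero hfin h2), ?_⟩
    exact Nat.mul_le_mul ih.2 (Nat.le_of_dvd (Nat.pos_of_ne_zero hfin) h2)

/-- Splitting off the full power of `P`. The inclusion is strict because `P` divides `(t)` but not
`I`; this strictness gains the factor two on which the counting below depends. -/
theorem exists_eq_pow_mul_of_mem_prime {B : Type*} [CommRing B] [IsDedekindDomain B] {P : Ideal B}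
    [P.IsPrime] {t : B} (ht : t ∈ P) (ht0 : t ≠ 0) :
    ∃ (e : ℕ) (I : Ideal B), Ideal.span {t} = P ^ e * I ∧ Ideal.span {t} < I := by
  have hP : P ≠ ⊥ := fun h => ht0 (by rwa [h] at ht)
  have hPd : P ∣ Ideal.span {t} := Ideal.dvd_iff_le.2 (by simpa using ht)
  have hfin : FiniteMultiplicity P (Ideal.span {t}) :=
    FiniteMultiplicity.of_not_isUnit (fun h => Ideal.IsPrime.ne_top ‹_› (Ideal.isUnit_iff.1 h))
      (by simpa using ht0)
  obtain ⟨I, hI, hn⟩ := hfin.exists_eq_pow_mul_and_not_dvd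
  refine ⟨_, I, hI, lt_of_le_of_ne ?_ ?_⟩
  · conv_lhs => rw [hI]
    exact Ideal.mul_le_right (I := P ^ _) (J := I)
  · intro h
    exact hn (h ▸ hPd)

/-- The coordinate ring is free over `Fq[t]` of rank `[Q : Fq(t)]`, so modulo `t` it is spanned over
`Fq` by the images of a basis. -/
theorem index_span_le [Finite Fq] (hQ : IsCurveFunctionField Fq Q) {t : Q}
    (ht : Transcendental Fq t) [Algebra.IsSeparable Fq⟮t⟯ Q] (b : coordRing Fq t)
    (hb : (b : Q) = t) :
    (Ideal.span {b}).toAddSubgroup.index ≠ 0 ∧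
      (Ideal.span {b}).toAddSubgroup.index ≤ Nat.card Fq ^ Module.finrank Fq⟮t⟯ Q := by
  have := isPrincipalIdealRing_adjoin ht
  have := hQ.finiteDimensional ht
  have hFin := (coordRing_facts hQ ht).2.2
  open scoped algebraAdjoinAdjoin in
  have hfree : Module.Free (Algebra.adjoin Fq {t}) (coordRing Fq t) :=
    IsIntegralClosure.module_free (Algebra.adjoin Fq {t}) Fq⟮t⟯ Q (coordRing Fq t)
  open scoped algebraAdjoinAdjoin in
  have hrank : Module.finrank (Algebra.adjoin Fq {t}) (coordRing Fq t) =
      Module.finrank Fq⟮t⟯ Q :=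
    IsIntegralClosure.rank (Algebra.adjoin Fq {t}) Fq⟮t⟯ Q (coordRing Fq t)
  let β := Module.finBasis (Algebra.adjoin Fq {t}) (coordRing Fq t)
  rw [hrank] at β
  let g : (Fin (Module.finrank Fq⟮t⟯ Q) → Fq) → coordRing Fq t ⧸ Ideal.span {b} := fun c =>
    Ideal.Quotient.mk _ (∑ j, (algebraMap Fq (Algebra.adjoin Fq {t}) (c j)) • β j)
  have hdec : ∀ r : Algebra.adjoin Fq {t}, ∃ (c : Fq) (r' : Algebra.adjoin Fq {t}),
      (r : Q) = algebraMap Fq Q c + r' * t := by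
    rintro ⟨r, hr⟩
    rw [Algebra.adjoin_singleton_eq_range_aeval] at hr
    obtain ⟨p, rfl⟩ := hr
    refine ⟨p.coeff 0, ⟨Polynomial.aeval t p.divX, ?_⟩, ?_⟩
    · exact Polynomial.aeval_mem_adjoin_singleton Fq t
    · have := congrArg (Polynomial.aeval t) (Polynomial.divX_mul_X_add p)
      simp only [map_add, map_mul, Polynomial.aeval_X, Polynomial.aeval_C] at this
      rw [add_comm]
      exact this.symm
  have hg : Function.Surjective g := by
    rintro y
    obtain ⟨y, rfl⟩ := Ideal.Quotient.mk_surjective y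
    choose c r' hcr using fun j => hdec (β.repr y j)
    refine ⟨c, ?_⟩
    rw [eq_comm, Ideal.Quotient.eq, Ideal.mem_span_singleton']
    refine ⟨∑ j, r' j • β j, ?_⟩
    have h1 : y = ∑ j, β.repr y j • β j := (β.sum_repr y).symm
    conv_rhs => rw [h1]
    apply Subtype.ext
    rw [← Finset.sum_sub_distrib, Finset.sum_mul]
    push_cast
    refine Finset.sum_congr rfl fun j _ => ?_
    rw [← sub_smul, Algebra.smul_def, Algebra.smul_def]
    push_cast
    rw [hb]
    change (r' j : Q) * (β j : Q) * t = ((β.repr y j : Q) - algebraMap Fq Q (c j)) * (β j : Q)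
    rw [hcr j]; ring
  have hfinite : Finite (coordRing Fq t ⧸ Ideal.span {b}) := Finite.of_surjective g hg
  have hcard : (Ideal.span {b}).toAddSubgroup.index = Nat.card (coordRing Fq t ⧸ Ideal.span {b}) :=
    rfl
  rw [hcard]
  refine ⟨Nat.card_pos.ne', ?_⟩
  have := Nat.card_le_card_of_surjective g hg
  rwa [Nat.card_fun, Nat.card_fin] at this

end Curve


/-! ### A non-constant function with its only pole at ∞ -/

section Curve

open IntermediateField

variable {Fq Q : Type u} [Field Fq] [Field Q] [Algebra Fq Q]

/-- The poles of `w` are finitely many zeros of `t`, where a high power of `t` removes them. -/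
theorem exists_pow_mul_mem_coordRing [Finite Fq] (hQ : IsCurveFunctionField Fq Q) {t : Q}
    (ht0 : t ≠ 0) {w : Q} (hw : w ∈ coordRing Fq t⁻¹) :
    ∃ k₀ : ℕ, ∀ k ≥ k₀, t ^ k * w ∈ coordRing Fq t := by
  have h : ∀ v : Place Fq Q, ∃ k₀ : ℕ, ∀ k ≥ k₀, t ∈ v.ring → t ^ k * w ∈ v.ring := by
    intro v
    by_cases htv : t ∈ v.ring.nonunits
    · obtain ⟨k₀, hk⟩ := v.exists_pow_mul_mem hQ htv ht0 w
      exact ⟨k₀, fun k hk' _ => hk k hk'⟩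
    · exact ⟨0, fun k _ h => v.ring.mul_mem _ _ (pow_mem h k)
        (v.coordRing_le (Place.notMem_nonunits htv).2 hw)⟩
  choose κ hκ using h
  refine ⟨(finite_poles hQ w).toFinset.sup κ, fun k hk => mem_coordRing_of_forall fun v hv => ?_⟩
  by_cases hwv : w ∈ v.ring
  · exact v.ring.mul_mem _ _ (pow_mem hv k) hwv
  · exact hκ v k (le_trans (Finset.le_sup (f := κ) (by simpa using hwv)) hk) hv

theorem exists_separating_mem_nonunits [Finite Fq] (hQ : IsCurveFunctionField Fq Q)
    (inf : Place Fq Q) (hinf : inf.IsRational) :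
    ∃ t ∈ inf.ring.nonunits, Transcendental Fq t ∧ Algebra.IsSeparable Fq⟮t⟯ Q := by
  obtain ⟨y, hy, hyt, hys⟩ := hQ.exists_separating_mem inf
  obtain ⟨c, hc⟩ := hinf y hy
  refine ⟨_, hc, fun h => hyt ?_, ?_⟩
  · simpa using h.add (isAlgebraic_algebraMap c)
  · have : Fq⟮y - algebraMap Fq Q c⟯ = Fq⟮y⟯ := by
      apply le_antisymm
      · rw [adjoin_simple_le_iff]
        exact sub_mem (mem_adjoin_simple_self Fq y) (IntermediateField.algebraMap_mem _ c)
      · rw [adjoin_simple_le_iff]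
        have := add_mem (mem_adjoin_simple_self Fq (y - algebraMap Fq Q c))
          (IntermediateField.algebraMap_mem Fq⟮y - algebraMap Fq Q c⟯ c)
        rwa [sub_add_cancel] at this
    rw [this]; exact hys

/-- Two complementary ideals: functions with `t ^ N * f ∈ I ^ N` are regular at all zeros of `t`
other than the given one. -/
theorem mem_ring_of_mul_mem_pow [Finite Fq] (hQ : IsCurveFunctionField Fq Q) {v inf : Place Fq Q}
    (hv : v ≠ inf) (B : Type u) [CommRing B] [IsDedekindDomain B] [Algebra B Q]
    [IsFractionRing B Q] (hvB : ∀ c : B, algebraMap B Q c ∈ v.ring)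
    (hinfB : ∀ c : B, algebraMap B Q c ∈ inf.ring) {P I : Ideal B}
    (hP : ∀ c : B, algebraMap B Q c ∈ inf.ring.nonunits → c ∈ P) {t : B} (ht0 : t ≠ 0) {e : ℕ}
    (hI : Ideal.span {t} = P ^ e * I) {N : ℕ} {i : B} (hi : i ∈ I ^ N) {f : Q}
    (hf : algebraMap B Q i = algebraMap B Q t ^ N * f) : f ∈ v.ring := by
  obtain ⟨s, hs1, hs2⟩ := Place.exists_sub_separate hQ hv B hvB hinfB
  have hinj : Function.Injective (algebraMap B Q) := IsFractionRing.injective B Q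
  -- The function `s` vanishes at `inf` but not at `v`; its power supplies the factor `P ^ (e N)`
  -- that `i` lacks for divisibility by `t ^ N`.
  have hmem : s ^ (e * N) * i ∈ Ideal.span {t ^ N} := by
    rw [← Ideal.span_singleton_pow, hI, mul_pow, ← pow_mul]
    exact Ideal.mul_mem_mul (Ideal.pow_mem_pow (hP s hs1) _) hi
  obtain ⟨b, hb⟩ := Ideal.mem_span_singleton'.1 hmem
  have htN : algebraMap B Q t ^ N ≠ 0 := pow_ne_zero _ ((map_ne_zero_iff _ hinj).2 ht0)
  obtain ⟨hs0, hs'⟩ := Place.notMem_nonunits hs2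
  have : algebraMap B Q b = algebraMap B Q s ^ (e * N) * f := by
    have h := congrArg (algebraMap B Q) hb
    simp only [map_mul, map_pow, hf] at h
    apply mul_right_cancel₀ htN
    rw [h]; ring
  have : f = algebraMap B Q b * ((algebraMap B Q s)⁻¹) ^ (e * N) := by
    rw [this, inv_pow, mul_comm, inv_mul_cancel_left₀ (pow_ne_zero _ hs0)]
  rw [this]
  exact v.ring.mul_mem _ _ (hvB b) (pow_mem hs' _)

/-- The numerical core of the pigeonhole: as `i` is at most half of `q ^ n`, the ratio of the two
sides gains a factor of at least two whenever `m` grows by one. -/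
theorem counting_bound {q n c₀ i : ℕ} (hq : 2 ≤ q) (hi : 2 * i ≤ q ^ n) :
    ∃ m, q * i ^ (m + c₀) < q ^ ((m + 1) * n) := by
  -- Any `m` with `q ^ (1 + n c₀) < 2 ^ m` would do; this one works because `m < 2 ^ m`.
  refine ⟨q ^ (1 + n * c₀), ?_⟩
  set m := q ^ (1 + n * c₀) with hm
  have h2 : m < 2 ^ m := Nat.lt_two_pow_self
  have hq0 : 0 < q := by omega
  by_contra! hc
  have h3 : 2 ^ (m + c₀) * q ^ ((m + 1) * n) ≤ q * (2 * i) ^ (m + c₀) := by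
    rw [mul_pow]
    calc _ ≤ 2 ^ (m + c₀) * (q * i ^ (m + c₀)) := Nat.mul_le_mul_left _ hc
      _ = _ := by ring
  have h4 : q * (2 * i) ^ (m + c₀) ≤ q ^ (1 + n * c₀) * q ^ (m * n) := by
    calc _ ≤ q * (q ^ n) ^ (m + c₀) := Nat.mul_le_mul_left _ (Nat.pow_le_pow_left hi _)
      _ = _ := by ring
  have h5 : q ^ (1 + n * c₀) * q ^ (m * n) < 2 ^ (m + c₀) * q ^ ((m + 1) * n) := by
    apply Nat.mul_lt_mul_of_lt_of_le
    · rw [← hm]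
      exact h2.trans_le (Nat.pow_le_pow_right (by norm_num) (by omega))
    · exact Nat.pow_le_pow_right hq0 (Nat.mul_le_mul_right _ (by omega))
    · positivity
  omega

theorem linearIndependent_pow_mul (K : IntermediateField Fq Q) {ι : Type*} (β : Module.Basis ι K Q)
    {x : Q} (hx : Transcendental Fq x) (hxK : x ∈ K) (m : ℕ) :
    LinearIndependent Fq (fun p : Fin m × ι => x ^ (p.1 : ℕ) * β p.2) := by
  have h1 : LinearIndependent Fq (fun a : Fin m => (⟨x, hxK⟩ : K) ^ (a : ℕ)) := by
    have hinj : Function.Injective (Polynomial.aeval (R := Fq) (⟨x, hxK⟩ : K)) := by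
      have h := transcendental_iff_injective.1 hx
      have h2 : ∀ p : Polynomial Fq, algebraMap K Q (Polynomial.aeval (⟨x, hxK⟩ : K) p) =
          Polynomial.aeval x p := fun p => (Polynomial.aeval_algebraMap_apply Q _ p).symm
      intro p p' hp
      apply h
      rw [← h2, ← h2, hp]
    have := (Polynomial.basisMonomials Fq).linearIndependent.map'
      (Polynomial.aeval (R := Fq) (⟨x, hxK⟩ : K)).toLinearMap (LinearMap.ker_eq_bot.2 hinj)
    have h3 : LinearIndependent Fq (fun a : ℕ => (⟨x, hxK⟩ : K) ^ a) := by
      convert! this using 1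
      ext a
      simp
    exact h3.comp _ Fin.val_injective
  have := _root_.linearIndependent_smul h1 β.linearIndependent
  convert! this using 1

/-- There is a non-constant function whose only pole is the given rational point. -/
theorem exists_transcendental_mem_affineRing [Finite Fq] (hQ : IsCurveFunctionField Fq Q)
    (inf : Place Fq Q) (hinf : inf.IsRational) :
    ∃ f ∈ affineRing inf, Transcendental Fq f := by
  classical
  obtain ⟨t, htm, ht, hs⟩ := exists_separating_mem_nonunits hQ inf hinf
  have ht0 : t ≠ 0 := by rintro rfl; exact ht isAlgebraic_zero
  have hx := transcendental_inv ht
  have hsx : Algebra.IsSeparable Fq⟮t⁻¹⟯ Q := by rw [adjoin_inv_eq]; exact hs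
  obtain ⟨hB1, hB2, hB3⟩ := coordRing_facts hQ ht
  have hfd := hQ.finiteDimensional hx
  -- A basis of `Q` over `Fq(t⁻¹)` that is integral over `Fq[t⁻¹]`: its members, and their products
  -- with powers of `t⁻¹`, have poles only at zeros of `t`.
  obtain ⟨s, β, hβ⟩ := by
    open scoped algebraAdjoinAdjoin in
    exact FiniteDimensional.exists_is_basis_integral (Algebra.adjoin Fq {t⁻¹}) Fq⟮t⁻¹⟯ Q
  set n := Module.finrank Fq⟮t⟯ Q with hn
  have hcard : Nat.card s = n := by
    rw [hn, ← adjoin_inv_eq, Module.finrank_eq_nat_card_basis β]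
  choose κ hκ using fun j : s => exists_pow_mul_mem_coordRing hQ ht0 (hβ j)
  set c₀ := Finset.univ.sup κ with hc₀
  have htB : t ∈ coordRing Fq t := mem_coordRing_of_forall fun v hv => hv
  have hinfB : ∀ c : coordRing Fq t, algebraMap (coordRing Fq t) Q c ∈ inf.ring :=
    fun c => inf.coordRing_le (Place.mem_of_nonunits htm) c.2
  let P : Ideal (coordRing Fq t) := (IsLocalRing.maximalIdeal inf.ring).comap
    ((algebraMap (coordRing Fq t) Q).codRestrict inf.ring.toSubring hinfB)
  have hPp : P.IsPrime := Ideal.comap_isPrime _ _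
  have hP : ∀ c, c ∈ P ↔ algebraMap (coordRing Fq t) Q c ∈ inf.ring.nonunits := fun c => by
    change (algebraMap (coordRing Fq t) Q).codRestrict inf.ring.toSubring hinfB c ∈
      IsLocalRing.maximalIdeal inf.ring ↔ _
    rw [← ValuationSubring.coe_mem_nonunits_iff]; rfl
  have htb0 : (⟨t, htB⟩ : coordRing Fq t) ≠ 0 := fun h => ht0 (congrArg Subtype.val h)
  obtain ⟨e, I, hI, hlt⟩ := exists_eq_pow_mul_of_mem_prime (P := P) ((hP ⟨t, htB⟩).2 htm) htb0
  obtain ⟨hi1, hi2⟩ := index_span_le hQ ht ⟨t, htB⟩ rfl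
  rw [← hn] at hi2
  have hle : (Ideal.span {(⟨t, htB⟩ : coordRing Fq t)}).toAddSubgroup ≤ I.toAddSubgroup := hlt.le
  have hmul := AddSubgroup.relIndex_mul_index hle
  have hIfin : I.toAddSubgroup.index ≠ 0 := fun h => hi1 (by rw [← hmul, h, mul_zero])
  -- A proper subgroup has index at least two, so the index of `I` is at most half of `q ^ n`.
  have hrel : 2 ≤ (Ideal.span {(⟨t, htB⟩ : coordRing Fq t)}).toAddSubgroup.relIndex
      I.toAddSubgroup := by
    have h0 : (Ideal.span {(⟨t, htB⟩ : coordRing Fq t)}).toAddSubgroup.relIndex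
      I.toAddSubgroup ≠ 0 := fun h => hi1 (by rw [← hmul, h, zero_mul])
    have h1 : (Ideal.span {(⟨t, htB⟩ : coordRing Fq t)}).toAddSubgroup.relIndex
      I.toAddSubgroup ≠ 1 := fun h => hlt.not_ge (AddSubgroup.relIndex_eq_one.1 h)
    omega
  have hi3 : 2 * I.toAddSubgroup.index ≤ Nat.card Fq ^ n := by
    calc _ ≤ _ := Nat.mul_le_mul_right _ hrel
      _ = _ := hmul
      _ ≤ _ := hi2
  obtain ⟨m, hm⟩ := counting_bound (c₀ := c₀) (Finite.one_lt_card (α := Fq)) hi3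
  have hIbot : I ≠ ⊥ := fun h => by rw [h] at hlt; exact not_lt_bot hlt
  obtain ⟨hN1, hN2⟩ := index_pow_le hIbot hIfin (m + c₀)
  have hli := linearIndependent_pow_mul Fq⟮t⁻¹⟯ β hx (mem_adjoin_simple_self Fq t⁻¹) (m + 1)
  -- The combinations of the `t⁻¹ ^ a * β j` with `a ≤ m`; by linear independence there are `q ^ ((m
  -- + 1) n)` different ones.
  let Φ := Fintype.linearCombination Fq (fun p : Fin (m + 1) × s => t⁻¹ ^ (p.1 : ℕ) * β p.2)
  have hΦ : Function.Injective Φ := hli.fintypeLinearCombination_injective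
  have hΦmem : ∀ c, t ^ (m + c₀) * Φ c ∈ coordRing Fq t := by
    intro c
    rw [show Φ c = ∑ p, c p • (t⁻¹ ^ (p.1 : ℕ) * β p.2) from Fintype.linearCombination_apply _ _ _,
      Finset.mul_sum]
    refine sum_mem fun p _ => ?_
    rw [mul_smul_comm]
    have h1 : t ^ (m + c₀) * (t⁻¹ ^ (p.1 : ℕ) * β p.2) =
        t ^ (m - p.1 + c₀) * β p.2 := by
      have hp : (p.1 : ℕ) ≤ m := by omega
      rw [← mul_assoc]
      congr 1
      rw [show m + c₀ = (m - p.1 + c₀) + p.1 by omega, pow_add, inv_pow,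
        mul_inv_cancel_right₀ (pow_ne_zero _ ht0)]
    rw [h1]
    have h2 := hκ p.2 (m - p.1 + c₀)
      (le_trans (Finset.le_sup (f := κ) (Finset.mem_univ _)) (Nat.le_add_left _ _))
    rw [Algebra.smul_def]
    exact mul_mem (mem_coordRing_of_forall fun v _ => v.const_mem _) h2
  -- The kernel of `Ψ` consists of the combinations that `t ^ (m + c₀)` brings into `I ^ (m + c₀)`.
  -- These are regular at all zeros of `t` except possibly `inf`, so they lie in `A`.
  let Ψ : (Fin (m + 1) × s → Fq) →+ coordRing Fq t ⧸ I ^ (m + c₀) :=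
    (Ideal.Quotient.mk (I ^ (m + c₀))).toAddMonoidHom.comp
      (AddMonoidHom.mk' (fun c => (⟨t ^ (m + c₀) * Φ c, hΦmem c⟩ : coordRing Fq t))
        fun c c' => Subtype.ext (by simp [mul_add]))
  have hΨ : ∀ c, c ∈ Ψ.ker →
      (⟨t ^ (m + c₀) * Φ c, hΦmem c⟩ : coordRing Fq t) ∈ I ^ (m + c₀) := fun c hc =>
    Ideal.Quotient.eq_zero_iff_mem.1 ((AddMonoidHom.mem_ker).1 hc)
  have hgood : ∀ c ∈ Ψ.ker, Φ c ∈ affineRing inf := by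
    intro c hc v hv
    by_cases hxv : t⁻¹ ∈ v.ring
    · rw [show Φ c = ∑ p, c p • (t⁻¹ ^ (p.1 : ℕ) * β p.2) from
        Fintype.linearCombination_apply _ _ _]
      refine sum_mem fun p _ => ?_
      rw [Algebra.smul_def]
      exact v.ring.mul_mem _ _ (v.const_mem _)
        (v.ring.mul_mem _ _ (pow_mem hxv _) (v.coordRing_le hxv (hβ p.2)))
    · have htv : t ∈ v.ring := (v.ring.mem_or_inv_mem t).resolve_right hxv
      exact mem_ring_of_mul_mem_pow hQ hv (coordRing Fq t) (fun c => v.coordRing_le htv c.2) hinfB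
        (fun c => (hP c).2) htb0 hI (hΨ c hc) rfl
  -- If `A` contained only constants, the kernel would have at most `q` elements; but its index is
  -- at most the `(m + c₀)`-th power of the index of `I`, and the total count contradicts
  -- `counting_bound`.
  by_contra! hcon
  have hconst : ∀ c : Ψ.ker, ∃ a : Fq, algebraMap Fq Q a = Φ c := by
    intro c
    by_contra h
    exact hcon _ (hgood c c.2) (transcendental_of_notMem_range hQ h)
  choose a ha using hconst
  have hainj : Function.Injective a := fun c c' h => by
    apply Subtype.ext
    apply hΦ
    rw [← ha, ← ha, h]
  have h1 : Nat.card Ψ.ker ≤ Nat.card Fq := Nat.card_le_card_of_injective a hainj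
  have hfinq : Finite (coordRing Fq t ⧸ I ^ (m + c₀)) := Nat.finite_of_card_ne_zero hN1
  have h2 : Ψ.ker.index ≤ I.toAddSubgroup.index ^ (m + c₀) := by
    rw [AddSubgroup.index_ker]
    exact (Nat.card_le_card_of_injective _ Subtype.val_injective).trans hN2
  have h3 := AddSubgroup.card_mul_index Ψ.ker
  rw [Nat.card_fun, Nat.card_prod, Nat.card_fin, hcard] at h3
  have h4 := Nat.mul_le_mul h1 h2
  omega

end Curve


/-! ### The affine ring `A` -/

section Curve

open IntermediateField

variable {Fq Q : Type u} [Field Fq] [Field Q] [Algebra Fq Q]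

theorem aeval_mem_affineRing {inf : Place Fq Q} {f : Q} (hf : f ∈ affineRing inf)
    (h : Polynomial Fq) : Polynomial.aeval f h ∈ affineRing inf := by
  have : Algebra.adjoin Fq {f} ≤ affineRing inf := Algebra.adjoin_le (by simpa using hf)
  exact this (Polynomial.aeval_mem_adjoin_singleton Fq f)

variable [Finite Fq] (hQ : IsCurveFunctionField Fq Q) {inf : Place Fq Q} (hinf : inf.IsRational)

include hQ hinf

/-- There is a function in `A` vanishing at finitely many given points. -/
theorem exists_affine_nonunits (T : Finset (Place Fq Q)) (hT : inf ∉ T) :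
    ∃ g ∈ affineRing inf, g ≠ 0 ∧ ∀ w ∈ T, g ∈ w.ring.nonunits := by
  classical
  obtain ⟨f, hf, hft⟩ := exists_transcendental_mem_affineRing hQ inf hinf
  have hw : ∀ w : Place Fq Q, w ≠ inf → ∃ h : Polynomial Fq, h ≠ 0 ∧
      Polynomial.aeval f h ∈ w.ring.nonunits :=
    fun w hw => w.exists_aeval_mem_nonunits hQ (hf w hw)
  induction T using Finset.induction_on with
  | empty => exact ⟨1, one_mem _, one_ne_zero, by simp⟩
  | insert w T hwT ih =>
    simp only [Finset.mem_insert, not_or] at hT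
    obtain ⟨g, hg, hg0, hgT⟩ := ih hT.2
    obtain ⟨h, h0, hh⟩ := hw w (Ne.symm hT.1)
    have hmem := aeval_mem_affineRing hf h
    refine ⟨Polynomial.aeval f h * g, mul_mem hmem hg, mul_ne_zero ?_ hg0, fun w' hw' => ?_⟩
    · intro h'; exact hft ⟨h, h0, h'⟩
    · rcases Finset.mem_insert.1 hw' with rfl | hw'
      · exact Place.mul_mem_nonunits hh (hg _ (Ne.symm hT.1))
      · rw [mul_comm]
        exact Place.mul_mem_nonunits (hgT _ hw') (hmem _ (fun h => hT.2 (h ▸ hw')))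

theorem exists_affine_denominator (y : Q) :
    ∃ g ∈ affineRing inf, g ≠ 0 ∧ g * y ∈ affineRing inf := by
  classical
  obtain ⟨g, hg, hg0, hgT⟩ := exists_affine_nonunits hQ hinf
    ((finite_poles hQ y).toFinset.erase inf) (by simp)
  have h : ∀ v : Place Fq Q, ∃ k₀ : ℕ, ∀ k ≥ k₀, v ≠ inf → g ^ k * y ∈ v.ring := by
    intro v
    by_cases hv : v = inf
    · exact ⟨0, fun _ _ h => absurd hv h⟩
    by_cases hy : y ∈ v.ring
    · exact ⟨0, fun k _ h => v.ring.mul_mem _ _ (pow_mem (hg v h) k) hy⟩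
    · obtain ⟨k₀, hk⟩ := v.exists_pow_mul_mem hQ (hgT v (by simp [hv, hy])) hg0 y
      exact ⟨k₀, fun k hk' _ => hk k hk'⟩
  choose κ hκ using h
  refine ⟨g ^ ((finite_poles hQ y).toFinset.sup κ), pow_mem hg _, pow_ne_zero _ hg0, fun v hv => ?_⟩
  by_cases hy : y ∈ v.ring
  · exact v.ring.mul_mem _ _ (pow_mem (hg v hv) _) hy
  · exact hκ v _ (Finset.le_sup (f := κ) (by simpa using hy)) hv

theorem isFractionRing_affineRing : IsFractionRing (affineRing inf) Q := by
  refine IsFractionRing.of_field _ _ fun y => ?_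
  obtain ⟨g, hg, hg0, hgy⟩ := exists_affine_denominator hQ hinf y
  refine ⟨⟨_, hgy⟩, ⟨g, hg⟩, ?_⟩
  change y = g * y / g
  rw [mul_comm, mul_div_assoc, div_self hg0, mul_one]

/-- Among the transcendental elements of `A` take one, `a`, of least inseparable degree. If some `n
∈ A` were not separable over `Fq(a)`, then one of `a`, `n` would be separable over the field
generated by the other, and an exchange would strictly enlarge the separable closure. So `A`, and
with it its fraction field, is separable over `Fq(a)`. -/
theorem exists_separating_mem_affineRing :
    ∃ a ∈ affineRing inf, Transcendental Fq a ∧ Algebra.IsSeparable Fq⟮a⟯ Q := by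
  classical
  obtain ⟨p, hpk⟩ := CharP.exists Fq
  have hp : Fact p.Prime := ⟨CharP.char_is_prime Fq p⟩
  have : ExpChar Fq p := .prime hp.out
  have : CharP Q p := .of_ringHom_of_ne_zero (algebraMap Fq Q) p hp.out.ne_zero
  -- The hypothesis of the exchange lemma: as scalars in `Fq` have `p`-th roots, the `p`-th powers
  -- of independent elements stay independent.
  have H : ∀ s : Finset Q, LinearIndepOn Fq _root_.id (s : Set Q) →
      LinearIndepOn Fq (· ^ p) (s : Set Q) := fun s hs => by
    refine hs.map_of_injective_injective (frobeniusEquiv Fq p).symm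
      (frobenius Q p).toAddMonoidHom (by simp) (by simp [frobenius]) fun r m => ?_
    change ((frobeniusEquiv Fq p).symm r • m) ^ p = r • m ^ p
    have h : (frobeniusEquiv Fq p).symm r ^ p = r := (frobeniusEquiv Fq p).apply_symm_apply r
    rw [Algebra.smul_def, mul_pow, ← map_pow, h, ← Algebra.smul_def]
  let S : Q → IntermediateField Fq Q := fun a =>
    (separableClosure Fq⟮a⟯ Q).restrictScalars Fq
  obtain ⟨a, ⟨ha, hat⟩, hmin⟩ : ∃ a ∈ {a : Q | a ∈ affineRing inf ∧ Transcendental Fq a},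
      ∀ b ∈ {a : Q | a ∈ affineRing inf ∧ Transcendental Fq a},
        Module.finrank (S a) Q ≤ Module.finrank (S b) Q := by
    obtain ⟨f, hf, hft⟩ := exists_transcendental_mem_affineRing hQ inf hinf
    refine ⟨Function.argminOn (fun a => Module.finrank (S a) Q)
      {a : Q | a ∈ affineRing inf ∧ Transcendental Fq a} ⟨f, hf, hft⟩,
      Function.argminOn_mem _ _ _, fun b hb =>
        Function.argminOn_le (fun a => Module.finrank (S a) Q) _ hb⟩
  refine ⟨a, ha, hat, ?_⟩
  have hle : ∀ x : Q, Fq⟮x⟯ ≤ S x := fun x => le_restrictScalars_separableClosure _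
  have haS : a ∈ S a := hle a (mem_adjoin_simple_self Fq a)
  have key : ∀ n ∈ affineRing inf, n ∈ S a := by
    intro n hn
    by_contra hna
    obtain ⟨i, hi₁, hi₂⟩ := exists_isTranscendenceBasis_and_isSeparable_of_linearIndepOn_pow'
      p hp.out (a := _root_.id) H ({a} : Set Q) n (hQ.isTranscendenceBasis hat)
      (fun h => hna (by rw [Set.mem_singleton_iff.1 h]; exact haS))
    rw [Set.image_id] at hi₂
    have hcard := hi₁.cardinalMk_eq_trdeg
    rw [hQ.trdeg, Cardinal.mk_set_eq_one_iff] at hcard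
    obtain ⟨b, hb⟩ := hcard
    have hbm : b ∈ insert n ({a} : Set Q) \ {i} := by rw [hb]; rfl
    have hbA : b ∈ affineRing inf := by
      rcases hbm.1 with rfl | h
      · exact hn
      · rw [Set.mem_singleton_iff.1 h]; exact ha
    have hbt : Transcendental Fq b := hi₁.1.transcendental ⟨b, hbm⟩
    rw [hb] at hi₂
    have hmem : ∀ x ∈ insert n ({a} : Set Q), x ∈ S b := by
      intro x hx
      by_cases hxi : x = i
      · rw [hxi]; exact hi₂
      · have : x ∈ insert n ({a} : Set Q) \ {i} := ⟨hx, hxi⟩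
        rw [hb] at this
        rw [Set.mem_singleton_iff.1 this]
        exact hle b (mem_adjoin_simple_self Fq b)
    have hlt : S a < S b := by
      refine SetLike.lt_iff_le_and_exists.mpr ⟨?_, n, hmem n (by simp), hna⟩
      rw [separableClosure_le_separableClosure_iff, adjoin_simple_le_iff]
      exact hmem a (by simp)
    have hfd := hQ.finiteDimensional hat
    have hfdS : FiniteDimensional (S a) Q :=
      inferInstanceAs (FiniteDimensional (separableClosure Fq⟮a⟯ Q) Q)
    exact hlt.ne (eq_of_le_of_finrank_le' hlt.le (hmin b ⟨hbA, hbt⟩))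
  have htop : ∀ y : Q, y ∈ S a := by
    intro y
    obtain ⟨g, hg, hg0, hgy⟩ := exists_affine_denominator hQ hinf y
    have := mul_mem (inv_mem (key g hg)) (key _ hgy)
    rwa [inv_mul_cancel_left₀ hg0] at this
  exact ⟨fun y => htop y⟩

/-- A transcendental `a ∈ A` has a pole, which can only be `inf`. So `a` is regular exactly at the
places different from `inf`, and `A` is the integral closure of `Fq[a]`. -/
theorem isDedekindDomain_affineRing : IsDedekindDomain (affineRing inf) := by
  obtain ⟨a, ha, hat, hs⟩ := exists_separating_mem_affineRing hQ hinf
  have hle : Algebra.adjoin Fq {a} ≤ affineRing inf := Algebra.adjoin_le (by simpa using ha)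
  let : Algebra (Algebra.adjoin Fq {a}) (affineRing inf) := (Subalgebra.inclusion hle).toAlgebra
  have : IsScalarTower (Algebra.adjoin Fq {a}) (affineRing inf) Q :=
    IsScalarTower.of_algebraMap_eq fun _ => rfl
  have hmem : ∀ y : Q, y ∈ affineRing inf ↔ y ∈ coordRing Fq a := by
    intro y
    refine ⟨fun hy => mem_coordRing_of_forall fun v hv => hy v ?_, fun hy v hv =>
      v.coordRing_le (ha v hv) hy⟩
    rintro rfl
    obtain ⟨w, hw⟩ := exists_pole hQ hat
    by_cases hwv : w = v
    · exact hw (hwv ▸ hv)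
    · exact hw (ha w hwv)
  have hint : IsIntegralClosure (affineRing inf) (Algebra.adjoin Fq {a}) Q :=
    { algebraMap_injective := Subtype.val_injective
      isIntegral_iff := fun {y} =>
        ⟨fun h => ⟨⟨y, (hmem y).2 h⟩, rfl⟩, fun ⟨y', h⟩ => h ▸ (hmem y').1 y'.2⟩ }
  have := isPrincipalIdealRing_adjoin hat
  have := hQ.finiteDimensional hat
  open scoped algebraAdjoinAdjoin in
  exact IsIntegralClosure.isDedekindDomain (Algebra.adjoin Fq {a}) Fq⟮a⟯ Q (affineRing inf)

omit hinf in
theorem eq_zero_of_mem_affineRing_of_nonunits {f : Q} (hf : f ∈ affineRing inf)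
    (h : f ∈ inf.ring.nonunits) : f = 0 := by
  obtain ⟨c, rfl⟩ := exists_algebraMap_eq_of_forall_mem hQ (y := f) fun v => by
    by_cases hv : v = inf
    · exact hv ▸ Place.mem_of_nonunits h
    · exact hf v hv
  by_contra h0
  have := Place.mul_mem_nonunits h (inf.const_mem c⁻¹)
  rw [map_inv₀, mul_inv_cancel₀ h0] at this
  exact Place.one_notMem_nonunits this

/-- The functions with a pole of bounded order at `inf` only form a finite-dimensional space. -/
theorem finite_bounded_poles {z : Q} (hz : inf.IsUniformizer z) (n : ℕ) :
    ∃ H : Submodule Fq Q, Module.Finite Fq H ∧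
      ∀ f, f ∈ H ↔ f ∈ affineRing inf ∧ z ^ n * f ∈ inf.ring := by
  let H : ℕ → Submodule Fq Q := fun n =>
    { carrier := {f | f ∈ affineRing inf ∧ z ^ n * f ∈ inf.ring}
      add_mem' := fun ha hb => ⟨add_mem ha.1 hb.1, by
        rw [mul_add]; exact add_mem ha.2 hb.2⟩
      zero_mem' := ⟨zero_mem _, by simp [inf.ring.zero_mem]⟩
      smul_mem' := fun c f hf => ⟨Subalgebra.smul_mem _ hf.1 c, by
        rw [mul_smul_comm, Algebra.smul_def]
        exact mul_mem (inf.const_mem c) hf.2⟩ }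
  refine ⟨H n, ?_, fun f => Iff.rfl⟩
  have hzm : z ∈ inf.ring := Place.mem_of_nonunits hz.2.1
  have step : ∀ g ∈ inf.ring, ∃ c : Fq, (g - algebraMap Fq Q c) * z⁻¹ ∈ inf.ring := fun g hg => by
    obtain ⟨c, hc⟩ := hinf g hg
    exact ⟨c, hz.2.2 _ hc⟩
  -- If any two elements of `H₂` have a non-trivial combination in `H₁`, then `H₂` exceeds `H₁` by
  -- at most a line. As `inf` is rational, this applies whenever the permitted pole order is raised
  -- by one.
  have hspan : ∀ (H₁ H₂ : Submodule Fq Q), Module.Finite Fq H₁ →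
      (∀ x ∈ H₂, ∀ y ∈ H₂, ∃ a b : Fq, (a ≠ 0 ∨ b ≠ 0) ∧ a • x + b • y ∈ H₁) →
      Module.Finite Fq H₂ := by
    intro H₁ H₂ hfin h
    by_cases hle : H₂ ≤ H₁
    · exact Submodule.finiteDimensional_of_le hle
    · obtain ⟨x, hx, hx1⟩ := SetLike.not_le_iff_exists.1 hle
      have : H₂ ≤ H₁ ⊔ Submodule.span Fq {x} := by
        intro y hy
        obtain ⟨a, b, hab, habm⟩ := h x hx y hy
        have hb : b ≠ 0 := by
          rintro rfl
          have ha : a ≠ 0 := by simpa using hab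
          rw [zero_smul, add_zero] at habm
          exact hx1 ((Submodule.smul_mem_iff _ ha).1 habm)
        have h1 := Submodule.smul_mem _ b⁻¹ habm
        rw [smul_add, smul_smul, smul_smul, inv_mul_cancel₀ hb, one_smul] at h1
        have : y = (b⁻¹ * a) • x + y + (-(b⁻¹ * a)) • x := by rw [neg_smul]; abel
        rw [this]
        exact Submodule.add_mem_sup h1
          (Submodule.smul_mem _ _ (Submodule.mem_span_singleton_self x))
      exact Submodule.finiteDimensional_of_le this
  induction n with
  | zero =>
    refine hspan ⊥ (H 0) inferInstance ?_
    rintro x ⟨hx, hx'⟩ y ⟨hy, hy'⟩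
    rw [pow_zero, one_mul] at hx' hy'
    obtain ⟨c, hc⟩ := hinf x hx'
    obtain ⟨d, hd⟩ := hinf y hy'
    have h1 := eq_zero_of_mem_affineRing_of_nonunits hQ
      (sub_mem hx ((affineRing inf).algebraMap_mem c)) hc
    have h2 := eq_zero_of_mem_affineRing_of_nonunits hQ
      (sub_mem hy ((affineRing inf).algebraMap_mem d)) hd
    rw [sub_eq_zero] at h1 h2
    subst h1 h2
    by_cases hd0 : d = 0
    · exact ⟨0, 1, Or.inr one_ne_zero, by simp [hd0]⟩
    · refine ⟨d, -c, Or.inl hd0, ?_⟩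
      rw [Submodule.mem_bot, Algebra.smul_def, Algebra.smul_def, map_neg]; ring
  | succ k ih =>
    refine hspan (H k) (H (k + 1)) ih ?_
    rintro x ⟨hx, hx'⟩ y ⟨hy, hy'⟩
    obtain ⟨c, hc⟩ := step _ hx'
    obtain ⟨d, hd⟩ := step _ hy'
    have key : ∀ (f : Q), (z ^ (k + 1) * f) * z⁻¹ = z ^ k * f := fun f => by
      rw [pow_succ]; field_simp [hz.1]
    by_cases hd0 : d = 0
    · refine ⟨0, 1, Or.inr one_ne_zero, ?_⟩
      rw [zero_smul, one_smul, zero_add]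
      refine ⟨hy, ?_⟩
      rw [← key]
      simpa [hd0] using hd
    · refine ⟨d, -c, Or.inl hd0, add_mem (Subalgebra.smul_mem _ hx _)
        (Subalgebra.smul_mem _ hy _), ?_⟩
      rw [← key, mul_add, Algebra.smul_def, Algebra.smul_def, map_neg]
      have := sub_mem (mul_mem (inf.const_mem d) hc) (mul_mem (inf.const_mem c) hd)
      convert! this using 1
      ring

/-- Functions in `A` separate points. -/
theorem exists_affine_separate {v : Place Fq Q} (hv : v ≠ inf) (T : Finset (Place Fq Q))
    (hvT : v ∉ T) (hT : inf ∉ T) :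
    ∃ s ∈ affineRing inf, s ∉ v.ring.nonunits ∧ ∀ w ∈ T, s ∈ w.ring.nonunits := by
  classical
  have := isDedekindDomain_affineRing hQ hinf
  have := isFractionRing_affineRing hQ hinf
  induction T using Finset.induction_on with
  | empty => exact ⟨1, one_mem _, Place.one_notMem_nonunits, by simp⟩
  | insert w T hwT ih =>
    simp only [Finset.mem_insert, not_or] at hT hvT
    obtain ⟨s, hs, hs1, hs2⟩ := ih hvT.2 hT.2
    obtain ⟨⟨s', hs'⟩, h1, h2⟩ := Place.exists_sub_separate hQ hvT.1 (affineRing inf)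
      (fun c => c.2 v hv) (fun c => c.2 w (Ne.symm hT.1))
    refine ⟨s' * s, mul_mem hs' hs, fun h => ?_, fun w' hw' => ?_⟩
    · rcases Place.mem_or_mem_nonunits (hs' v hv) (hs v hv) h with h | h
      · exact h2 h
      · exact hs1 h
    · rcases Finset.mem_insert.1 hw' with rfl | hw'
      · exact Place.mul_mem_nonunits h1 (hs _ (Ne.symm hT.1))
      · rw [mul_comm]
        exact Place.mul_mem_nonunits (hs2 _ hw') (hs' _ (fun h => hT.2 (h ▸ hw')))

end Curve


/-! ### The field `Q ⊗ L` and its subrings `R ⊗ L` -/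

section CoeffField

variable {Fq Q : Type u} [Field Fq] [Field Q] [Algebra Fq Q]

-- The coefficients of a monic factor over `Q` are integral over `Fq`, hence lie in `Fq`, which is
-- algebraically closed in `Q`. A factorization over `Q` is thus one over `Fq`.
open Polynomial in
theorem irreducible_map_of_isCurveFunctionField (hQ : IsCurveFunctionField Fq Q)
    {f : Fq[X]} (hf : f.Monic) (hirr : Irreducible f) :
    Irreducible (f.map (algebraMap Fq Q)) := by
  have hfm := hf.map (algebraMap Fq Q)
  have key : ∀ g : Q[X], g.Monic → g ∣ f.map (algebraMap Fq Q) →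
      ∃ g₀ : Fq[X], g₀.map (algebraMap Fq Q) = g ∧ g₀.natDegree = g.natDegree ∧ g₀.Monic := by
    intro g hg hd
    apply lifts_and_natDegree_eq_and_monic _ hg
    have h1 := integralClosure.mem_lifts_of_monic_of_dvd_map Q hf hg hd
    rw [lifts_iff_coeff_lifts] at h1 ⊢
    intro n
    obtain ⟨y, hy⟩ := h1 n
    have h2 : g.coeff n ∈ algebraicClosure Fq Q := by
      rw [mem_algebraicClosure_iff, ← hy]
      exact y.2.isAlgebraic
    rw [hQ.const, IntermediateField.mem_bot] at h2
    exact h2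
  rw [hfm.irreducible_iff_natDegree]
  refine ⟨fun h => hirr.1 ?_, fun g h hg hh he => ?_⟩
  · rw [← Polynomial.map_one (algebraMap Fq Q)] at h
    rw [Polynomial.map_injective _ (algebraMap Fq Q).injective h]
    exact isUnit_one
  · obtain ⟨g₀, hg0, hg1, hg2⟩ := key g hg ⟨h, he.symm⟩
    obtain ⟨h₀, hh0, hh1, hh2⟩ := key h hh ⟨g, by rw [← he, mul_comm]⟩
    rw [← hg1, ← hh1]
    refine (hf.irreducible_iff_natDegree.1 hirr).2 g₀ h₀ hg2 hh2 ?_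
    apply Polynomial.map_injective _ (algebraMap Fq Q).injective
    rw [Polynomial.map_mul, hg0, hh0, he]

/-- For a primitive element of `L`, the ring `Q ⊗ L` is `Q[X]` modulo its minimal polynomial, which
stays irreducible over `Q`. -/
theorem isField_tensor [Finite Fq] (hQ : IsCurveFunctionField Fq Q) (L : Type u) [Field L]
    [Algebra Fq L] [FiniteDimensional Fq L] : IsField (Q ⊗[Fq] L) := by
  obtain ⟨α, hα⟩ := Field.exists_primitive_element Fq L
  have hint : IsIntegral Fq α := Algebra.IsIntegral.isIntegral α
  have hirr := irreducible_map_of_isCurveFunctionField hQ (minpoly.monic hint)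
    (minpoly.irreducible hint)
  have : Fact (Irreducible ((minpoly Fq α).map (algebraMap Fq Q))) := ⟨hirr⟩
  let φ : AdjoinRoot ((minpoly Fq α).map (algebraMap Fq Q)) →ₐ[Q] Q ⊗[Fq] L :=
    AdjoinRoot.liftAlgHom _ (Algebra.ofId _ _) ((1 : Q) ⊗ₜ[Fq] α) (by
      have h := Polynomial.hom_eval₂ (minpoly Fq α) (algebraMap Fq L)
        (Algebra.TensorProduct.includeRight : L →ₐ[Fq] Q ⊗[Fq] L).toRingHom α
      have h2 : Polynomial.eval₂ (algebraMap Fq L) α (minpoly Fq α) = 0 := minpoly.aeval Fq α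
      rw [h2, map_zero] at h
      rw [Polynomial.eval₂_map]
      convert! h.symm using 2
      ext a
      simp [Algebra.ofId_apply, Algebra.TensorProduct.algebraMap_apply,
        Algebra.algebraMap_eq_smul_one, TensorProduct.smul_tmul])
  have hsurj : Function.Surjective φ := by
    intro y
    have h1 : ∀ x : L, (1 : Q) ⊗ₜ[Fq] x ∈ φ.range := by
      intro x
      have hx : x ∈ Algebra.adjoin Fq {α} := by
        rw [← IntermediateField.adjoin_simple_toSubalgebra_of_isAlgebraic hint.isAlgebraic, hα]
        trivial
      induction hx using Algebra.adjoin_induction with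
      | mem x hx =>
        rw [Set.mem_singleton_iff.1 hx]
        exact ⟨AdjoinRoot.root _, by simp [φ]⟩
      | algebraMap a =>
        refine ⟨algebraMap Q _ (algebraMap Fq Q a), ?_⟩
        refine (φ.commutes _).trans ?_
        simp [Algebra.TensorProduct.algebraMap_apply,
          Algebra.algebraMap_eq_smul_one, TensorProduct.smul_tmul, Algebra.TensorProduct.one_def]
      | add x y _ _ hx hy => rw [TensorProduct.tmul_add]; exact add_mem hx hy
      | mul x y _ _ hx hy =>
        rw [← one_mul (1 : Q), ← Algebra.TensorProduct.tmul_mul_tmul]; exact mul_mem hx hy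
    change y ∈ φ.range
    induction y using TensorProduct.induction_on with
    | zero => exact zero_mem _
    | add x y hx hy => exact add_mem hx hy
    | tmul b x =>
      have : b ⊗ₜ[Fq] x = b • ((1 : Q) ⊗ₜ[Fq] x) := by simp [TensorProduct.smul_tmul']
      rw [this]
      exact Subalgebra.smul_mem _ (h1 x) b
  have hbij : Function.Bijective φ := ⟨φ.toRingHom.injective, hsurj⟩
  exact (RingEquiv.ofBijective φ hbij).symm.toMulEquiv.isField (Field.toIsField _)

/-- The inclusion of `R ⊗ L` into `Q ⊗ L`. -/
noncomputable def subHom (R : Subalgebra Fq Q) (L : Type u) [Field L] [Algebra Fq L] :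
    R ⊗[Fq] L →ₐ[R] Q ⊗[Fq] L :=
  Algebra.TensorProduct.map (Algebra.ofId R Q) (AlgHom.id Fq L)

theorem subHom_tmul (R : Subalgebra Fq Q) (L : Type u) [Field L] [Algebra Fq L] (b : R) (x : L) :
    subHom R L (b ⊗ₜ x) = (b : Q) ⊗ₜ x := rfl

theorem subHom_injective (R : Subalgebra Fq Q) (L : Type u) [Field L] [Algebra Fq L] :
    Function.Injective (subHom R L) :=
  Module.Flat.rTensor_preserves_injective_linearMap R.val.toLinearMap Subtype.val_injective

theorem trace_tmul (L : Type u) [Field L] [Algebra Fq L] [FiniteDimensional Fq L]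
    (x : Q) (y : L) :
    Algebra.trace Q (Q ⊗[Fq] L) (x ⊗ₜ y) = x * algebraMap Fq Q (Algebra.trace Fq L y) := by
  have h1 : x ⊗ₜ[Fq] y = x • ((1 : Q) ⊗ₜ[Fq] y) := by simp [TensorProduct.smul_tmul']
  rw [h1, map_smul, smul_eq_mul, Algebra.trace_apply, Algebra.trace_apply,
    ← LinearMap.trace_baseChange, Algebra.baseChange_lmul]

/-- The coordinates of `y` in the trace-dual basis are the traces of `y` times the original basis.
For integral `y` these are integral over `R`, hence in `R`. Both bases come from `L` over `Fq`, so
no denominators arise. -/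
theorem isIntegralClosure_subHom [Finite Fq] (hQ : IsCurveFunctionField Fq Q)
    (R : Subalgebra Fq Q) [IsIntegrallyClosed R] [IsFractionRing R Q]
    (L : Type u) [Field L] [Algebra Fq L] [FiniteDimensional Fq L] :
    letI := (subHom R L).toRingHom.toAlgebra
    IsIntegralClosure (R ⊗[Fq] L) R (Q ⊗[Fq] L) := by
  let _ := (isField_tensor hQ L).toField
  let _ := (subHom R L).toRingHom.toAlgebra
  have hdef : ∀ x, algebraMap (R ⊗[Fq] L) (Q ⊗[Fq] L) x = subHom R L x := fun _ => rfl
  refine ⟨subHom_injective R L, fun {y} => ⟨fun hy => ?_, ?_⟩⟩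
  · let b := Module.finBasis Fq L
    let b' := (Algebra.traceForm Fq L).dualBasis (traceForm_nondegenerate Fq L) b
    let B := b'.baseChange Q
    have hrepr : ∀ i, B.repr y i = Algebra.trace Q (Q ⊗[Fq] L) (y * (1 ⊗ₜ b i)) := by
      intro i
      conv_rhs => rw [← B.sum_repr y]
      rw [Finset.sum_mul, map_sum, Finset.sum_eq_single i]
      · rw [smul_mul_assoc, map_smul, Module.Basis.baseChange_apply,
          Algebra.TensorProduct.tmul_mul_tmul, trace_tmul]
        have := LinearMap.BilinForm.apply_dualBasis_left (B := Algebra.traceForm Fq L) (traceForm_nondegenerate Fq L) b i i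
        rw [Algebra.traceForm_apply] at this
        simp only [b']
        rw [this]
        simp
      · intro j _ hj
        rw [smul_mul_assoc, map_smul, Module.Basis.baseChange_apply,
          Algebra.TensorProduct.tmul_mul_tmul, trace_tmul]
        have := LinearMap.BilinForm.apply_dualBasis_left (B := Algebra.traceForm Fq L) (traceForm_nondegenerate Fq L) b j i
        rw [Algebra.traceForm_apply] at this
        simp only [b']
        rw [this, if_neg (Ne.symm hj)]
        simp
      · simp
    have hR : ∀ i, ∃ r : R, (r : Q) = B.repr y i := by
      intro i
      have h1 : IsIntegral R ((1 : Q) ⊗ₜ[Fq] b i) := by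
        have : IsIntegral Fq (b i) := Algebra.IsIntegral.isIntegral _
        exact (this.map (Algebra.TensorProduct.includeRight : L →ₐ[Fq] Q ⊗[Fq] L)).tower_top
      have h2 : IsIntegral R (B.repr y i) := by
        rw [hrepr]
        exact Algebra.isIntegral_trace (hy.mul h1)
      exact IsIntegrallyClosed.isIntegral_iff.1 h2
    choose r hr using hR
    refine ⟨∑ i, r i ⊗ₜ b' i, ?_⟩
    rw [map_sum]
    conv_rhs => rw [← B.sum_repr y]
    refine Finset.sum_congr rfl fun i _ => ?_
    rw [hdef, subHom_tmul, hr, Module.Basis.baseChange_apply, TensorProduct.smul_tmul', smul_eq_mul,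
      mul_one]
  · rintro ⟨x, rfl⟩
    have : IsIntegral R x := Algebra.IsIntegral.isIntegral x
    exact this.map (subHom R L)

theorem coeffRing_facts [Finite Fq] (hQ : IsCurveFunctionField Fq Q)
    (R : Subalgebra Fq Q) [IsDedekindDomain R] [IsFractionRing R Q]
    (L : Type u) [Field L] [Algebra Fq L] [FiniteDimensional Fq L] :
    IsDedekindDomain (R ⊗[Fq] L) ∧
    letI := (subHom R L).toRingHom.toAlgebra
    IsFractionRing (R ⊗[Fq] L) (Q ⊗[Fq] L) := by
  let _ := (isField_tensor hQ L).toField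
  let _ := (subHom R L).toRingHom.toAlgebra
  have := isIntegralClosure_subHom hQ R L
  have : IsScalarTower R (R ⊗[Fq] L) (Q ⊗[Fq] L) := .of_algebraMap_eq fun x =>
    ((subHom R L).commutes x).symm
  have : Algebra.IsSeparable Q (Q ⊗[Fq] L) := by
    have : Algebra.FormallyUnramified Fq L := Algebra.FormallyUnramified.of_isSeparable Fq L
    rw [← Algebra.FormallyUnramified.iff_isSeparable]
    infer_instance
  have : FiniteDimensional Q (Q ⊗[Fq] L) := inferInstance
  have hinj := subHom_injective R L
  have : IsDomain (R ⊗[Fq] L) := hinj.isDomain (subHom R L).toRingHom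
  exact ⟨IsIntegralClosure.isDedekindDomain R Q (Q ⊗[Fq] L) (R ⊗[Fq] L),
    IsIntegralClosure.isFractionRing_of_finite_extension R Q (Q ⊗[Fq] L) (R ⊗[Fq] L)⟩

/-- The local ring at a place, as an `Fq`-algebra. -/
def Place.alg (v : Place Fq Q) : Subalgebra Fq Q where
  carrier := v.ring
  mul_mem' := v.ring.mul_mem _ _
  add_mem' := v.ring.add_mem _ _
  algebraMap_mem' := v.const_mem

/-- `O_v ⊗ L` is a Dedekind domain finite over a discrete valuation ring; it has finitely many
maximal ideals and is therefore principal. -/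
theorem Place.isPrincipalIdealRing_tensor [Finite Fq] (hQ : IsCurveFunctionField Fq Q)
    (v : Place Fq Q) (L : Type u) [Field L] [Algebra Fq L] [FiniteDimensional Fq L] :
    IsDomain (v.alg ⊗[Fq] L) ∧ IsPrincipalIdealRing (v.alg ⊗[Fq] L) := by
  have h1 : IsDiscreteValuationRing v.alg := v.isDVR hQ
  have : IsFractionRing v.alg Q := (inferInstance : IsFractionRing v.ring Q)
  have := (coeffRing_facts hQ v.alg L).1
  refine ⟨inferInstance, ?_⟩
  have : Finite (PrimeSpectrum v.alg) := by
    refine Finite.of_injective (β := Prop) (fun p => p.asIdeal = ⊥) fun p q h => ?_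
    have hp : ∀ p : PrimeSpectrum v.alg, p.asIdeal ≠ ⊥ →
        p.asIdeal = IsLocalRing.maximalIdeal v.alg := fun p hp =>
      IsLocalRing.eq_maximalIdeal (p.isPrime.isMaximal hp)
    refine PrimeSpectrum.ext ?_
    by_cases h0 : p.asIdeal = ⊥
    · rw [h0, h.mp h0]
    · rw [hp p h0, hp q fun h' => h0 (h.mpr h')]
  have : Finite (PrimeSpectrum (v.alg ⊗[Fq] L)) :=
    Algebra.QuasiFinite.finite_primeSpectrum v.alg (v.alg ⊗[Fq] L)
  refine IsPrincipalIdealRing.of_finite_maximals ?_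
  refine (Set.finite_range (PrimeSpectrum.asIdeal (R := v.alg ⊗[Fq] L))).subset ?_
  intro I hI
  exact ⟨⟨I, hI.isPrime⟩, rfl⟩

end CoeffField


/-! ### Semilinear maps and the algebra generated by the Frobenius -/

section Semilinear

variable {Fq B L : Type u} [Field Fq] [CommRing B] [Algebra Fq B] [Field L] [Algebra Fq L]

theorem CoeffModule.tmul_smul {V : CoeffModule Fq B L} (b : B) (a : L) (x : V) :
    (b ⊗ₜ[Fq] a : B ⊗[Fq] L) • x = b • a • x := by
  rw [CoeffModule.left_smul_def, CoeffModule.right_smul_def, ← mul_smul,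
    Algebra.TensorProduct.tmul_mul_tmul, mul_one, one_mul]

/-- An additive map which is linear over both tensor factors. -/
def CoeffModule.mkLinear {V W : CoeffModule Fq B L} (f : V →+ W)
    (h1 : ∀ (b : B) x, f (b • x) = b • f x) (h2 : ∀ (a : L) x, f (a • x) = a • f x) :
    V →ₗ[B ⊗[Fq] L] W where
  toFun := f
  map_add' := map_add f
  map_smul' k x := by
    induction k using TensorProduct.induction_on with
    | zero => simp
    | add k l hk hl =>
      simp only [RingHom.id_apply] at hk hl ⊢
      rw [add_smul, map_add, add_smul, ← hk, ← hl]
    | tmul b a => rw [CoeffModule.tmul_smul, h1, h2, RingHom.id_apply, CoeffModule.tmul_smul]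

theorem CoeffModule.map_left_smul {V W : CoeffModule Fq B L} (f : V →ₗ[B ⊗[Fq] L] W) (b : B)
    (x : V) : f (b • x) = b • f x := f.map_smul _ _

theorem CoeffModule.map_right_smul {V W : CoeffModule Fq B L} (f : V →ₗ[B ⊗[Fq] L] W) (a : L)
    (x : V) : f (a • x) = a • f x := f.map_smul _ _

/-- A submodule for both tensor factors. -/
def CoeffModule.mkSubmodule {V : CoeffModule Fq B L} (W : AddSubgroup V)
    (h1 : ∀ (b : B), ∀ x ∈ W, b • x ∈ W) (h2 : ∀ (a : L), ∀ x ∈ W, a • x ∈ W) :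
    Submodule (B ⊗[Fq] L) V where
  carrier := W
  add_mem' := W.add_mem
  zero_mem' := W.zero_mem
  smul_mem' k x hx := by
    induction k using TensorProduct.induction_on with
    | zero => rw [zero_smul]; exact W.zero_mem
    | add k l hk hl => rw [add_smul]; exact W.add_mem hk hl
    | tmul b a => rw [CoeffModule.tmul_smul]; exact h1 _ _ (h2 _ _ hx)

theorem CoeffModule.left_smul_mem {V : CoeffModule Fq B L} (W : Submodule (B ⊗[Fq] L) V) (b : B)
    {x : V} (hx : x ∈ W) : b • x ∈ W := W.smul_mem _ hx

theorem CoeffModule.right_smul_mem {V : CoeffModule Fq B L} (W : Submodule (B ⊗[Fq] L) V) (a : L)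
    {x : V} (hx : x ∈ W) : a • x ∈ W := W.smul_mem _ hx

/-- The underlying `B`-submodule. -/
def CoeffModule.toB {V : CoeffModule Fq B L} (W : Submodule (B ⊗[Fq] L) V) : Submodule B V where
  carrier := W
  add_mem' := W.add_mem
  zero_mem' := W.zero_mem
  smul_mem' a _ hx := W.smul_mem _ hx

variable [Fintype Fq]

theorem sigma_tmul (b : B) (a : L) :
    sigma Fq B L (b ⊗ₜ a) = b ⊗ₜ (a ^ Fintype.card Fq) := rfl

variable {V W : CoeffModule Fq B L} (φ : V →ₛₗ[sigma Fq B L] W)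

theorem semi_left_smul (b : B) (x : V) : φ (b • x) = b • φ x := by
  rw [CoeffModule.left_smul_def, map_smulₛₗ, sigma_tmul, one_pow, CoeffModule.left_smul_def]

theorem semi_right_smul (a : L) (x : V) : φ (a • x) = a ^ Fintype.card Fq • φ x := by
  rw [CoeffModule.right_smul_def, map_smulₛₗ, sigma_tmul, CoeffModule.right_smul_def]

/-- A semilinear map, as a `B`-linear map. -/
def semiLin : V →ₗ[B] W where
  toFun := φ
  map_add' := map_add φ
  map_smul' := semi_left_smul φ

variable (φ : V →ₛₗ[sigma Fq B L] V)

theorem semiLin_pow_apply (n : ℕ) (x : V) : (semiLin φ ^ n) x = φ^[n] x := by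
  rw [Module.End.pow_apply]; rfl

theorem iterate_left_smul (n : ℕ) (b : B) (x : V) : φ^[n] (b • x) = b • φ^[n] x := by
  rw [← semiLin_pow_apply, map_smul, semiLin_pow_apply]

theorem iterate_right_smul (n : ℕ) (a : L) (x : V) :
    φ^[n] (a • x) = a ^ Fintype.card Fq ^ n • φ^[n] x := by
  induction n generalizing a x with
  | zero => simp
  | succ n ih => rw [Function.iterate_succ_apply, semi_right_smul, ih, ← pow_mul, ← pow_succ',
      Function.iterate_succ_apply]

variable [Finite L]

theorem frobenius_finrank (a : L) : a ^ Fintype.card Fq ^ Module.finrank Fq L = a := by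
  have := Fintype.ofFinite L
  rw [← Module.card_eq_pow_finrank (K := Fq) (V := L), FiniteField.pow_card]

theorem frobenius_surjective (n : ℕ) (a : L) : ∃ b : L, b ^ Fintype.card Fq ^ n = a := by
  have := Fintype.ofFinite L
  have hinj : Function.Injective fun b : L => b ^ Fintype.card Fq ^ n := by
    intro x y h
    have h1 : Function.Injective (FiniteField.frobeniusAlgHom Fq L) := RingHom.injective _
    have h2 := h1.iterate n
    apply h2
    have h3 : ∀ (m : ℕ) (b : L), (FiniteField.frobeniusAlgHom Fq L)^[m] b = b ^ Fintype.card Fq ^ m := by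
      intro m b
      induction m generalizing b with
      | zero => simp
      | succ m ih => rw [Function.iterate_succ_apply, ih, FiniteField.coe_frobeniusAlgHom, ← pow_mul, ← pow_succ']
    rw [h3, h3]
    exact h
  exact (Finite.injective_iff_surjective.1 hinj) a

/-- The `#L`-Frobenius `φ ^ e`. -/
noncomputable def frobLin : V →ₗ[B ⊗[Fq] L] V :=
  CoeffModule.mkLinear ((semiLin φ ^ Module.finrank Fq L : Module.End B V) : V →ₗ[B] V).toAddMonoidHom
    (fun b x => map_smul (semiLin φ ^ Module.finrank Fq L) b x)
    (fun a x => by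
      change (semiLin φ ^ Module.finrank Fq L) _ = a • (semiLin φ ^ Module.finrank Fq L) x
      rw [semiLin_pow_apply, semiLin_pow_apply, iterate_right_smul, frobenius_finrank])

theorem frobLin_apply (x : V) : frobLin φ x = φ^[Module.finrank Fq L] x := semiLin_pow_apply φ _ x

/-- The `B`-linear endomorphism `p(φ ^ e)`. -/
noncomputable def frobEval (p : Polynomial B) : Module.End B V :=
  Polynomial.aeval (semiLin φ ^ Module.finrank Fq L : Module.End B V) p

theorem frobEval_mul (p p' : Polynomial B) : frobEval φ (p * p') = frobEval φ p * frobEval φ p' :=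
  map_mul _ _ _

theorem frobEval_pow (p : Polynomial B) (n : ℕ) : frobEval φ (p ^ n) = frobEval φ p ^ n :=
  map_pow _ _ _

/-- Over `B` the map `φ` is linear and `p(φ ^ e)` is a polynomial in it. This makes `ker p(φ ^ e)` a
`φ`-stable subspace. -/
theorem frobEval_comm (p : Polynomial B) (x : V) : frobEval φ p (φ x) = φ (frobEval φ p x) := by
  have h : Commute (semiLin φ) (frobEval φ p) := by
    unfold frobEval
    induction p using Polynomial.induction_on' with
    | add p q hp hq => rw [map_add]; exact hp.add_right hq
    | monomial n b =>
      rw [Polynomial.aeval_monomial]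
      exact (Algebra.commute_algebraMap_right _ _).mul_right ((Commute.refl _).pow_right _ |>.pow_right _)
  exact (congrArg (fun f : Module.End B V => f x) h.eq).symm

theorem frobEval_map {W : CoeffModule Fq B L} (ψ : W →ₛₗ[sigma Fq B L] W) (f : V →ₗ[B] W)
    (hf : ∀ x, f (φ x) = ψ (f x)) (p : Polynomial B) (x : V) :
    f (frobEval φ p x) = frobEval ψ p (f x) := by
  have h1 : ∀ (n : ℕ) x, f (φ^[n] x) = ψ^[n] (f x) := fun n => by
    induction n with
    | zero => simp
    | succ n ih => intro x; rw [Function.iterate_succ_apply, ih, hf, Function.iterate_succ_apply]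
  unfold frobEval
  induction p using Polynomial.induction_on' with
  | add p q hp hq => rw [map_add, map_add, LinearMap.add_apply, map_add, hp, hq, LinearMap.add_apply]
  | monomial n b =>
    rw [Polynomial.aeval_monomial, Polynomial.aeval_monomial, Module.End.mul_apply,
      Module.End.mul_apply, Module.algebraMap_end_apply, Module.algebraMap_end_apply, map_smul,
      ← pow_mul, ← pow_mul, semiLin_pow_apply, semiLin_pow_apply, h1]

theorem frobEval_right_smul (p : Polynomial B) (a : L) (x : V) :
    frobEval φ p (a • x) = a • frobEval φ p x := by
  unfold frobEval
  induction p using Polynomial.induction_on' with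
  | add p q hp hq => rw [map_add, LinearMap.add_apply, hp, hq, LinearMap.add_apply, smul_add]
  | monomial n b =>
    have h : ∀ (n : ℕ) (x : V), ((semiLin φ ^ Module.finrank Fq L : Module.End B V) ^ n) (a • x) =
        a • ((semiLin φ ^ Module.finrank Fq L : Module.End B V) ^ n) x := by
      intro n
      induction n with
      | zero => intro x; rfl
      | succ n ih =>
        intro x
        rw [pow_succ, Module.End.mul_apply, Module.End.mul_apply, ← ih]
        congr 1
        rw [semiLin_pow_apply, semiLin_pow_apply, iterate_right_smul, frobenius_finrank]
    rw [Polynomial.aeval_monomial, Module.End.mul_apply,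
      Module.End.mul_apply, Module.algebraMap_end_apply, Module.algebraMap_end_apply, h,
      smul_comm]

/-- The commutative ring `B[φ ^ e]` of endomorphisms is reduced. -/
def FrobReduced : Prop :=
  ∀ (p : Polynomial B) (n : ℕ), frobEval φ p ^ n = 0 → frobEval φ p = 0

/-- A subspace is stable under `φ`. -/
def IsStable (W : Submodule (B ⊗[Fq] L) V) : Prop := ∀ x ∈ W, φ x ∈ W

/-- There are no proper stable subspaces. -/
def IsStablySimple : Prop :=
  Nontrivial V ∧ ∀ W : Submodule (B ⊗[Fq] L) V, IsStable φ W → W = ⊥ ∨ W = ⊤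

/-- The kernel of `p(φ ^ e)`. -/
noncomputable def frobKer (p : Polynomial B) : Submodule (B ⊗[Fq] L) V :=
  CoeffModule.mkSubmodule (frobEval φ p).toAddMonoidHom.ker
    (fun b x hx => by
      change frobEval φ p (b • x) = 0
      rw [map_smul, show frobEval φ p x = 0 from hx, smul_zero])
    (fun a x hx => by
      change frobEval φ p (a • x) = 0
      rw [frobEval_right_smul, show frobEval φ p x = 0 from hx, smul_zero])

theorem mem_frobKer {p : Polynomial B} {x : V} : x ∈ frobKer φ p ↔ frobEval φ p x = 0 := Iff.rfl

theorem frobKer_stable (p : Polynomial B) : IsStable φ (frobKer φ p) := fun x hx => by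
  rw [mem_frobKer] at hx ⊢
  rw [frobEval_comm, hx, map_zero]

/-- The stable subspace `ker p(φ ^ e)` is zero or everything, and an injective operator on a
non-zero space is not nilpotent. -/
theorem IsStablySimple.frobReduced {φ : V →ₛₗ[sigma Fq B L] V} (h : IsStablySimple φ) :
    FrobReduced φ := by
  intro p n hp
  have := h.1
  rcases h.2 _ (frobKer_stable φ p) with h1 | h1
  · exfalso
    have hinj : Function.Injective (frobEval φ p) := by
      refine (injective_iff_map_eq_zero _).2 fun x hx => ?_
      have : x ∈ frobKer φ p := hx
      rw [h1] at this
      exact this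
    obtain ⟨x, hx⟩ := exists_ne (0 : V)
    have h2 : Function.Injective (frobEval φ p ^ n) := by
      rw [Module.End.coe_pow]
      exact hinj.iterate n
    exact hx (h2 (by rw [hp]; simp))
  · ext x
    have : x ∈ frobKer φ p := h1 ▸ Submodule.mem_top
    exact this

theorem FrobReduced.of_injective {W : CoeffModule Fq B L} {φ : V →ₛₗ[sigma Fq B L] V}
    {ψ : W →ₛₗ[sigma Fq B L] W}
    (hW : FrobReduced ψ) (f : V →ₗ[B] W) (hf : ∀ x, f (φ x) = ψ (f x))
    (hinj : Function.Injective f) (hsurj : Function.Surjective f) : FrobReduced φ := by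
  intro p n hp
  have h1 : frobEval ψ p ^ n = 0 := by
    ext y
    obtain ⟨x, rfl⟩ := hsurj y
    rw [← frobEval_pow, ← frobEval_map φ ψ f hf, frobEval_pow, hp]
    simp
  have h2 := hW p n h1
  ext x
  apply hinj
  rw [frobEval_map φ ψ f hf, h2]
  simp

theorem FrobReduced.pi {n : ℕ} {V : Fin n → CoeffModule Fq B L}
    {φ : ∀ j, V j →ₛₗ[sigma Fq B L] V j} (h : ∀ j, FrobReduced (φ j))
    (ψ : CoeffModule.pi V →ₛₗ[sigma Fq B L] CoeffModule.pi V) (hψ : ∀ x j, ψ x j = φ j (x j)) :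
    FrobReduced ψ := by
  intro p m hp
  have key : ∀ (p : Polynomial B) (x : CoeffModule.pi V) (j : Fin n),
      frobEval ψ p x j = frobEval (φ j) p (x j) := by
    intro p x j
    let f : CoeffModule.pi V →ₗ[B] V j :=
      { toFun := fun x => x j, map_add' := fun _ _ => rfl, map_smul' := fun _ _ => rfl }
    exact frobEval_map ψ (φ j) f (fun x => hψ x j) p x
  have h1 : ∀ j, frobEval (φ j) p ^ m = 0 := fun j => by
    ext y
    obtain ⟨x, hx⟩ : ∃ x : CoeffModule.pi V, x j = y := ⟨(Pi.single j y : ∀ j, V j), Pi.single_eq_same ..⟩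
    have : frobEval ψ (p ^ m) x j = 0 := by
      rw [frobEval_pow, hp]; rfl
    rw [key, hx, frobEval_pow] at this
    exact this
  refine LinearMap.ext fun x => funext fun j => ?_
  rw [key, h j p m (h1 j)]
  rfl

end Semilinear

/-! ### Stable complements -/

section Complement

variable {Fq Q L : Type u} [Field Fq] [Fintype Fq] [Field Q] [Algebra Fq Q] [Field L] [Algebra Fq L]
  [Finite L] {V : CoeffModule Fq Q L} (φ : V →ₛₗ[sigma Fq Q L] V)

theorem CoeffModule.finite_left [Module.Finite (Q ⊗[Fq] L) V] : Module.Finite Q V :=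
  Module.Finite.trans (Q ⊗[Fq] L) V

theorem semi_bijective [Module.Finite (Q ⊗[Fq] L) V] (hφ : Function.Injective φ) :
    Function.Bijective φ := by
  have := CoeffModule.finite_left (V := V)
  exact ⟨hφ, LinearMap.injective_iff_surjective (f := semiLin φ).1 hφ⟩

/-- An injective `φ` maps the finite-dimensional `Q`-space `W` onto itself, so preimages of elements
of `W` stay in `W`. -/
theorem IsStable.exists_mem [Module.Finite (Q ⊗[Fq] L) V] {φ : V →ₛₗ[sigma Fq Q L] V}
    (hφ : Function.Injective φ) {W : Submodule (Q ⊗[Fq] L) V} (hW : IsStable φ W) {x : V}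
    (hx : φ x ∈ W) : x ∈ W := by
  have := CoeffModule.finite_left (V := V)
  let f : CoeffModule.toB W →ₗ[Q] CoeffModule.toB W := (semiLin φ).restrict hW
  have h1 : Function.Injective f := fun a b h => Subtype.ext (hφ (congrArg Subtype.val h))
  obtain ⟨y, hy⟩ := LinearMap.injective_iff_surjective.1 h1 ⟨φ x, hx⟩
  have : φ y = φ x := congrArg Subtype.val hy
  rw [← hφ this]
  exact y.2

theorem FrobReduced.squarefree [Module.Finite (Q ⊗[Fq] L) V] {φ : V →ₛₗ[sigma Fq Q L] V}
    (h : FrobReduced φ) :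
    Squarefree (minpoly Q (semiLin φ ^ Module.finrank Fq L : Module.End Q V)) := by
  have := CoeffModule.finite_left (V := V)
  refine IsRadical.squarefree (minpoly.ne_zero (Algebra.IsIntegral.isIntegral _)) ?_
  intro n p hp
  rw [minpoly.dvd_iff] at hp ⊢
  refine h p n ?_
  rw [← frobEval_pow]
  exact hp

/-- Maschke's argument in three rounds. The minimal polynomial of `φ ^ e` over `Q` is squarefree, so
there is a `Q`-linear projection onto `W` commuting with `φ ^ e`. Averaging over `Lˣ` makes it
`L`-linear. Averaging its conjugates under powers of `φ`, weighted by an element of trace one, makes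
it commute with `φ`. The kernel of the result is the complement. -/
theorem FrobReduced.exists_isCompl [Module.Finite (Q ⊗[Fq] L) V] {φ : V →ₛₗ[sigma Fq Q L] V}
    (h : FrobReduced φ) (hφ : Function.Injective φ) (W : Submodule (Q ⊗[Fq] L) V)
    (hW : IsStable φ W) : ∃ W', IsStable φ W' ∧ IsCompl W W' := by
  have := CoeffModule.finite_left (V := V)
  classical
  have := Fintype.ofFinite L
  set e := Module.finrank Fq L with he
  have hit : ∀ n : ℕ, ∀ x ∈ W, φ^[n] x ∈ W := fun n x hx => by
    induction n with
    | zero => exact hx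
    | succ n ih => rw [Function.iterate_succ_apply']; exact hW _ ih
  -- a `Q`-linear projection onto `W` commuting with the Frobenius
  obtain ⟨p₀, hp1, hp2, hp3⟩ : ∃ p₀ : V →ₗ[Q] V, (∀ x, p₀ x ∈ W) ∧ (∀ x ∈ W, p₀ x = x) ∧
      ∀ x, p₀ (φ^[e] x) = φ^[e] (p₀ x) := by
    have hss := Module.End.isSemisimple_of_squarefree_aeval_eq_zero h.squarefree
      (minpoly.aeval Q (semiLin φ ^ e : Module.End Q V))
    rw [Module.End.isSemisimple_iff] at hss
    obtain ⟨U, hU, hc⟩ := hss (CoeffModule.toB W) (by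
      rw [Module.End.mem_invtSubmodule]
      intro x hx
      rw [Submodule.mem_comap, semiLin_pow_apply]
      exact hit _ _ hx)
    refine ⟨(CoeffModule.toB W).projection U hc, fun x => Submodule.projection_apply_mem hc x,
      fun x hx => Submodule.projection_apply_of_mem_left hc hx, fun x => ?_⟩
    have h1 := Submodule.sub_projection_mem hc x
    rw [Module.End.mem_invtSubmodule] at hU
    have h2 := hU h1
    rw [Submodule.mem_comap, semiLin_pow_apply] at h2
    have h3 : φ^[e] (x - (CoeffModule.toB W).projection U hc x) =
        φ^[e] x - φ^[e] ((CoeffModule.toB W).projection U hc x) := by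
      rw [← semiLin_pow_apply, map_sub, semiLin_pow_apply, semiLin_pow_apply]
    have h4 : φ^[e] x = φ^[e] ((CoeffModule.toB W).projection U hc x) +
        φ^[e] (x - (CoeffModule.toB W).projection U hc x) := by rw [h3]; abel
    conv_lhs => rw [h4]
    rw [map_add, (Submodule.projection_apply_eq_zero_iff hc).2 h2, add_zero]
    exact Submodule.projection_apply_of_mem_left hc (hit _ _ (Submodule.projection_apply_mem hc x))
  -- averaging over `Lˣ` makes it `L`-linear
  obtain ⟨p₁, hq1, hq2, hq3, hq4⟩ : ∃ p₁ : V →ₗ[Q] V, (∀ x, p₁ x ∈ W) ∧ (∀ x ∈ W, p₁ x = x) ∧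
      (∀ x, p₁ (φ^[e] x) = φ^[e] (p₁ x)) ∧ ∀ (a : L) x, p₁ (a • x) = a • p₁ x := by
    -- The sign is the normalization of the average: `Lˣ` has `#L - 1` elements, and this number is
    -- `-1` in `L`.
    let p₁ : V →ₗ[Q] V :=
      { toFun := fun x => -∑ a : Lˣ, (a : L) • p₀ ((↑a⁻¹ : L) • x)
        map_add' := fun x y => by
          simp only [smul_add, map_add, Finset.sum_add_distrib, neg_add]
        map_smul' := fun b x => by
          simp only [RingHom.id_apply, smul_neg, Finset.smul_sum]
          congr 1
          refine Finset.sum_congr rfl fun a _ => ?_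
          rw [← smul_comm b, map_smul, smul_comm b] }
    have hdef : ∀ x, p₁ x = -∑ a : Lˣ, (a : L) • p₀ ((↑a⁻¹ : L) • x) := fun x => rfl
    refine ⟨p₁, fun x => ?_, fun x hx => ?_, fun x => ?_, fun a x => ?_⟩
    · rw [hdef]
      exact W.neg_mem (sum_mem fun a _ => CoeffModule.right_smul_mem W _ (hp1 _))
    · rw [hdef]
      have : ∀ a : Lˣ, (a : L) • p₀ ((↑a⁻¹ : L) • x) = x := fun a => by
        rw [hp2 _ (CoeffModule.right_smul_mem W _ hx), smul_smul, Units.mul_inv, one_smul]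
      simp only [this, Finset.sum_const, Finset.card_univ, Fintype.card_units]
      have h1 : (Fintype.card L : L) = 0 := FiniteField.cast_card_eq_zero L
      have h2 : ((Fintype.card L - 1 : ℕ) : L) = -1 := by
        rw [Nat.cast_sub Fintype.card_pos, h1]; simp
      rw [← Nat.cast_smul_eq_nsmul L, h2, neg_smul, neg_neg, one_smul]
    · rw [hdef, hdef, ← semiLin_pow_apply φ e (-_), map_neg, map_sum]
      congr 1
      refine Finset.sum_congr rfl fun a _ => ?_
      rw [semiLin_pow_apply, iterate_right_smul, frobenius_finrank, ← hp3, iterate_right_smul,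
        frobenius_finrank]
    · by_cases ha : a = 0
      · rw [ha, zero_smul, zero_smul, map_zero]
      · rw [hdef, hdef, smul_neg, Finset.smul_sum]
        congr 1
        refine Fintype.sum_equiv (Equiv.mulLeft (Units.mk0 a ha)⁻¹) _ _ fun u => ?_
        simp only [Equiv.coe_mulLeft, smul_smul, mul_inv_rev, inv_inv, Units.val_mul,
          Units.val_inv_eq_inv_val, Units.val_mk0]
        rw [mul_inv_cancel_left₀ ha]
  -- averaging over the powers of `φ`
  have hbij := semi_bijective φ hφ
  obtain ⟨ψ, hψ1, hψ2⟩ := Function.bijective_iff_has_inverse.1 hbij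
  have hφψ : ∀ n x, φ^[n] (ψ^[n] x) = x := fun n => hψ2.iterate n
  have hψφ : ∀ n x, ψ^[n] (φ^[n] x) = x := fun n => hψ1.iterate n
  have hψW : ∀ n, ∀ x ∈ W, ψ^[n] x ∈ W := fun n x hx => by
    induction n with
    | zero => exact hx
    | succ n ih =>
      rw [Function.iterate_succ_apply']
      refine hW.exists_mem hφ ?_
      rw [hψ2]
      exact ih
  -- The element `c` replaces the factor `1 / e`, which need not exist in positive characteristic:
  -- on `W` the map `T i` is multiplication by `c ^ q ^ i`, and these sum to the trace of `c`.
  obtain ⟨c, hc⟩ := Algebra.trace_surjective Fq L 1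
  let T : ℕ → V → V := fun i x => φ^[i] (c • p₁ (ψ^[i] x))
  have hTadd : ∀ i x y, T i (x + y) = T i x + T i y := fun i x y => by
    have h1 : ψ^[i] (x + y) = ψ^[i] x + ψ^[i] y := by
      apply hφ.iterate i
      rw [hφψ, ← semiLin_pow_apply, map_add, semiLin_pow_apply, semiLin_pow_apply, hφψ, hφψ]
    simp only [T, h1, map_add, smul_add]
    rw [← semiLin_pow_apply, map_add, semiLin_pow_apply, semiLin_pow_apply]
  have hTQ : ∀ i (b : Q) x, T i (b • x) = b • T i x := fun i b x => by
    have h1 : ψ^[i] (b • x) = b • ψ^[i] x := by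
      apply hφ.iterate i
      rw [hφψ, iterate_left_smul, hφψ]
    simp only [T, h1, map_smul]
    rw [← smul_comm b, iterate_left_smul]
  have hTL : ∀ i (a : L) x, T i (a • x) = a • T i x := fun i a x => by
    obtain ⟨b, rfl⟩ := frobenius_surjective (Fq := Fq) i a
    have h1 : ψ^[i] (b ^ Fintype.card Fq ^ i • x) = b • ψ^[i] x := by
      apply hφ.iterate i
      rw [hφψ, iterate_right_smul, hφψ]
    simp only [T, h1, hq4]
    rw [smul_comm c b, iterate_right_smul]
  have hTφ : ∀ i x, φ (T i x) = T (i + 1) (φ x) := fun i x => by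
    simp only [T]
    rw [← Function.iterate_succ_apply' φ, Function.iterate_succ_apply ψ, hψ1]
  -- Conjugation by `φ` therefore permutes `T 0, …, T (e - 1)` cyclically, and their sum commutes
  -- with `φ`.
  have hTe : ∀ x, T e x = T 0 x := fun x => by
    simp only [T]
    rw [iterate_right_smul, frobenius_finrank, ← hq3, hφψ]
    rfl
  have hTW : ∀ i x, T i x ∈ W := fun i x => hit _ _ (CoeffModule.right_smul_mem W _ (hq1 _))
  let P : V →ₗ[Q ⊗[Fq] L] V := CoeffModule.mkLinear
    (AddMonoidHom.mk' (fun x => ∑ i ∈ Finset.range e, T i x) fun x y => by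
      simp only [hTadd, Finset.sum_add_distrib])
    (fun b x => by simp only [AddMonoidHom.mk'_apply, hTQ, Finset.smul_sum])
    (fun b x => by simp only [AddMonoidHom.mk'_apply, hTL, Finset.smul_sum])
  have hP : ∀ x, P x = ∑ i ∈ Finset.range e, T i x := fun x => rfl
  have hPW : ∀ x, P x ∈ W := fun x => by
    rw [hP]; exact sum_mem fun i _ => hTW i x
  have hPid : ∀ x ∈ W, P x = x := fun x hx => by
    rw [hP]
    have h1 : ∀ i, T i x = c ^ Fintype.card Fq ^ i • x := fun i => by
      simp only [T]
      rw [hq2 _ (hψW i x hx), iterate_right_smul, hφψ]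
    simp only [h1, ← Finset.sum_smul]
    have h2 := FiniteField.algebraMap_trace_eq_sum_pow Fq L c
    rw [hc, map_one, Nat.card_eq_fintype_card] at h2
    rw [← h2, one_smul]
  have hPφ : ∀ x, P (φ x) = φ (P x) := fun x => by
    rw [hP, hP, map_sum]
    simp only [hTφ]
    have h1 := Finset.sum_range_succ (fun i => T i (φ x)) e
    have h2 := Finset.sum_range_succ' (fun i => T i (φ x)) e
    rw [h1, hTe] at h2
    exact add_right_cancel h2
  refine ⟨LinearMap.ker P, fun x hx => ?_, ?_, ?_⟩
  · rw [LinearMap.mem_ker] at hx ⊢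
    rw [hPφ, hx, map_zero]
  · rw [Submodule.disjoint_def]
    intro x hx hx'
    rw [← hPid x hx]; exact hx'
  · rw [codisjoint_iff, eq_top_iff]
    intro x _
    rw [← add_sub_cancel (P x) x]
    refine Submodule.add_mem_sup (hPW x) ?_
    rw [LinearMap.mem_ker, map_sub, hPid _ (hPW x), sub_self]

end Complement


/-! ### Decomposition into simple quotients -/

section Decomposition

variable {Fq Q L : Type u} [Field Fq] [Fintype Fq] [Field Q] [Algebra Fq Q] [Field L] [Algebra Fq L]
  [Finite L] {V : CoeffModule Fq Q L} {φ : V →ₛₗ[sigma Fq Q L] V}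

theorem IsStable.sup {W W' : Submodule (Q ⊗[Fq] L) V} (h : IsStable φ W) (h' : IsStable φ W') :
    IsStable φ (W ⊔ W') := by
  intro x hx
  obtain ⟨y, hy, z, hz, rfl⟩ := Submodule.mem_sup.1 hx
  rw [map_add]
  exact Submodule.add_mem_sup (h _ hy) (h' _ hz)

/-- The last two conditions say that `V` maps injectively and surjectively to the product of the
quotients `V / K j`, which maximality makes simple. -/
theorem FrobReduced.exists_maximal_family [Module.Finite (Q ⊗[Fq] L) V] (h : FrobReduced φ)
    (hφ : Function.Injective φ) :
    ∃ (n : ℕ) (K : Fin n → Submodule (Q ⊗[Fq] L) V), (∀ j, IsStable φ (K j)) ∧ (∀ j, K j ≠ ⊤) ∧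
      (∀ j W, IsStable φ W → K j ≤ W → W = K j ∨ W = ⊤) ∧ (∀ x, (∀ j, x ∈ K j) → x = 0) ∧
      ∀ y : Fin n → V, ∃ x, ∀ j, x - y j ∈ K j := by
  have := CoeffModule.finite_left (V := V)
  have : IsNoetherian (Q ⊗[Fq] L) V := isNoetherian_of_tower Q inferInstance
  have : IsArtinian (Q ⊗[Fq] L) V := isArtinian_of_tower Q inferInstance
  -- Noetherian induction needs the relative statement, in which every `K j` contains `U` and their
  -- intersection lies in `U`.
  suffices key : ∀ U : Submodule (Q ⊗[Fq] L) V, IsStable φ U →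
      ∃ (n : ℕ) (K : Fin n → Submodule (Q ⊗[Fq] L) V), (∀ j, IsStable φ (K j)) ∧ (∀ j, K j ≠ ⊤) ∧
      (∀ j W, IsStable φ W → K j ≤ W → W = K j ∨ W = ⊤) ∧ (∀ x, (∀ j, x ∈ K j) → x ∈ U) ∧
      (∀ j, U ≤ K j) ∧ ∀ y : Fin n → V, ∃ x, ∀ j, x - y j ∈ K j by
    obtain ⟨n, K, h1, h2, h3, h4, -, h5⟩ := key ⊥ (fun x hx => by
      rw [Submodule.mem_bot] at hx ⊢; rw [hx, map_zero])
    exact ⟨n, K, h1, h2, h3, fun x hx => (Submodule.mem_bot _).1 (h4 x hx), h5⟩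
  intro U
  induction U using WellFoundedGT.induction with
  | ind U ih =>
  intro hU
  by_cases hUt : U = ⊤
  · exact ⟨0, fun _ => ⊤, fun j => j.elim0, fun j => j.elim0, fun j => j.elim0,
      fun x _ => hUt ▸ Submodule.mem_top, fun j => j.elim0, fun _ => ⟨0, fun j => j.elim0⟩⟩
  -- With `U'` minimal among the stable subspaces strictly above `U` and `C` a stable complement of
  -- `U'`, the new member of the family is `C ⊔ U`. It meets `U'` in `U`, and it is maximal because
  -- nothing stable lies strictly between `U` and `U'`.
  obtain ⟨U', ⟨hU'1, hU'2⟩, hmin⟩ := (wellFounded_lt (α := Submodule (Q ⊗[Fq] L) V)).has_min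
    {W | IsStable φ W ∧ U < W} ⟨⊤, fun _ _ => Submodule.mem_top, lt_top_iff_ne_top.2 hUt⟩
  obtain ⟨C, hC, hc⟩ := h.exists_isCompl hφ U' hU'1
  obtain ⟨n, K, h1, h2, h3, h4, h5, h6⟩ := ih U' hU'2 hU'1
  have hinf : (C ⊔ U) ⊓ U' = U := by
    rw [sup_comm, sup_inf_assoc_of_le _ hU'2.le, inf_comm, hc.inf_eq_bot, sup_bot_eq]
  have hsup : U' ⊔ (C ⊔ U) = ⊤ := by
    rw [← sup_assoc, hc.sup_eq_top, top_sup_eq]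
  refine ⟨n + 1, Fin.cons (C ⊔ U) K, ?_, ?_, ?_, ?_, ?_, ?_⟩
  · exact Fin.cases (hC.sup hU) h1
  · refine Fin.cases (fun h0 => ?_) h2
    rw [Fin.cons_zero] at h0
    rw [h0, top_inf_eq] at hinf
    exact hU'2.ne' hinf
  · refine Fin.cases (fun W hW hle => ?_) h3
    rw [Fin.cons_zero] at hle ⊢
    by_cases hWU : W ⊓ U' = U
    · left
      refine le_antisymm (fun w hw => ?_) hle
      obtain ⟨a, ha, b, hb, hab⟩ := Submodule.mem_sup.1 (hsup ▸ Submodule.mem_top : w ∈ U' ⊔ (C ⊔ U))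
      have : a ∈ W ⊓ U' := ⟨by
        rw [← add_sub_cancel_right a b, hab]; exact W.sub_mem hw (hle hb), ha⟩
      rw [hWU] at this
      rw [← hab]
      exact Submodule.add_mem _ (Submodule.mem_sup_right this) hb
    · right
      have hlt : U < W ⊓ U' := lt_of_le_of_ne
        (le_inf (le_sup_right.trans hle) hU'2.le) (Ne.symm hWU)
      have h0 : W ⊓ U' = U' := by
        by_contra hne
        exact hmin _ ⟨fun x hx => Submodule.mem_inf.2 ⟨hW x hx.1, hU'1 x hx.2⟩, hlt⟩
          (lt_of_le_of_ne inf_le_right hne)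
      rw [eq_top_iff, ← hsup]
      exact sup_le (inf_eq_right.1 h0) hle
  · intro x hx
    rw [← hinf]
    exact ⟨hx 0, h4 x fun j => hx j.succ⟩
  · exact Fin.cases le_sup_right fun j => hU'2.le.trans (h5 j)
  · intro y
    obtain ⟨x, hx⟩ := h6 (Fin.tail y)
    obtain ⟨a, ha, b, hb, hab⟩ := Submodule.mem_sup.1
      (hsup ▸ Submodule.mem_top : y 0 - x ∈ U' ⊔ (C ⊔ U))
    refine ⟨x + a, Fin.cases ?_ fun j => ?_⟩
    · rw [Fin.cons_zero]
      have : x + a - y 0 = -b := by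
        rw [eq_neg_iff_add_eq_zero]
        calc x + a - y 0 + b = (a + b) - (y 0 - x) := by abel
          _ = 0 := by rw [hab, sub_self]
      rw [this]
      exact Submodule.neg_mem _ hb
    · rw [Fin.cons_succ]
      have : x + a - y j.succ = (x - Fin.tail y j) + a := by
        simp only [Fin.tail]; abel
      rw [this]
      exact Submodule.add_mem _ (hx j) (h5 j ha)

end Decomposition

/-! ### Separable polynomials in `X ^ (p ^ n)` -/

section Separable

open Polynomial

variable {K : Type u} [Field K] (p : ℕ) [Fact p.Prime] [CharP K p]

/-- The least common multiple `h₁ * u`, where `h₂ = g * u` and `g` is the greatest common divisor.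
Separability of `h₂` makes `u` coprime to `g`, hence to `h₁`. -/
theorem Separable.exists_mul_dvd {h₁ h₂ : K[X]} (hh1 : h₁.Separable) (hh2 : h₂.Separable) :
    ∃ h : K[X], h.Separable ∧ h₁ ∣ h ∧ h₂ ∣ h := by
  classical
  have h20 := hh2.ne_zero
  obtain ⟨u, hu⟩ := EuclideanDomain.gcd_dvd_right h₁ h₂
  obtain ⟨w, hw⟩ := EuclideanDomain.gcd_dvd_left h₁ h₂
  set g := EuclideanDomain.gcd h₁ h₂
  have hgu : IsCoprime g u := (hu ▸ hh2).isCoprime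
  have hc : IsCoprime h₁ u := by
    have hwu : IsCoprime w u := by
      have h1 : IsCoprime (g * w) (g * u) ∨ True := Or.inr trivial
      have hg0 : g ≠ 0 := fun h => h20 (by rw [hu, h, zero_mul])
      obtain ⟨a, b, hab⟩ := EuclideanDomain.gcd_eq_gcd_ab h₁ h₂ |> fun h =>
        (⟨_, _, h⟩ : ∃ a b, g = h₁ * a + h₂ * b)
      refine ⟨a, b, mul_left_cancel₀ hg0 ?_⟩
      rw [mul_one]
      conv_rhs => rw [hab, hw, hu]
      ring
    rw [hw]
    exact hgu.mul_left hwu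
  refine ⟨h₁ * u, hh1.mul (hh2.of_dvd ⟨g, by rw [mul_comm, ← hu]⟩) hc, dvd_mul_right _ _, ?_⟩
  rw [hu, hw]
  exact ⟨w, by ring⟩

/-- In characteristic `p`, raising to a `p`-th power raises the variable and the coefficients
separately, and the Frobenius on coefficients preserves separability. -/
theorem exists_expand_pow_eq (h : K[X]) (N k : ℕ) :
    ∃ h' : K[X], (h.Separable → h'.Separable) ∧
      expand K (p ^ N) h ^ p ^ k = expand K (p ^ (N + k)) h' := by
  have : ExpChar K p := ExpChar.prime Fact.out
  refine ⟨h.map (iterateFrobenius K p k), fun hh => hh.map, ?_⟩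
  rw [pow_add, expand_mul, ← map_pow, ← map_iterateFrobenius_expand, map_expand]

/-- Induction over prime factors. An irreducible factor has a separable contraction. For a product,
both polynomials are brought to a common expansion and replaced by a common separable multiple; the
square that appears is absorbed by one further `p`-th power, since `2 ≤ p`. -/
theorem exists_separable_dvd_expand {f : K[X]} (hf : f ≠ 0) :
    ∃ (N : ℕ) (h : K[X]), h.Separable ∧ f ∣ expand K (p ^ N) h := by
  have hEC : ExpChar K p := ExpChar.prime Fact.out
  have hp : p.Prime := Fact.out
  induction f using UniqueFactorizationMonoid.induction_on_prime with
  | h₁ => exact absurd rfl hf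
  | h₂ x hx => exact ⟨0, 1, separable_one, hx.dvd⟩
  | h₃ a q ha hq ih =>
    obtain ⟨N₁, h₁, hs1, hd1⟩ := ih ha
    obtain ⟨N₂, h₂, hs2, hd2⟩ : ∃ (N : ℕ) (h : K[X]), h.Separable ∧ q ∣ expand K (p ^ N) h := by
      obtain ⟨g, hg, n, hn⟩ := Irreducible.hasSeparableContraction p hq.irreducible
      exact ⟨n, g, hg, hn ▸ dvd_rfl⟩
    obtain ⟨h₁', hs1', he1⟩ := exists_expand_pow_eq p h₁ N₁ N₂
    obtain ⟨h₂', hs2', he2⟩ := exists_expand_pow_eq p h₂ N₂ N₁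
    rw [add_comm N₂ N₁] at he2
    obtain ⟨h, hs, hh1, hh2⟩ := Separable.exists_mul_dvd (hs1' hs1) (hs2' hs2)
    obtain ⟨h', hs', he⟩ := exists_expand_pow_eq p h (N₁ + N₂) 1
    refine ⟨N₁ + N₂ + 1, h', hs' hs, ?_⟩
    rw [← he, pow_one]
    have h1 : a ∣ expand K (p ^ (N₁ + N₂)) h :=
      hd1.trans ((dvd_pow_self _ (pow_ne_zero _ hp.ne_zero)).trans
        (he1 ▸ _root_.map_dvd (expand K (p ^ (N₁ + N₂))) hh1))
    have h2 : q ∣ expand K (p ^ (N₁ + N₂)) h :=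
      hd2.trans ((dvd_pow_self _ (pow_ne_zero _ hp.ne_zero)).trans
        (he2 ▸ _root_.map_dvd (expand K (p ^ (N₁ + N₂))) hh2))
    calc q * a ∣ expand K (p ^ (N₁ + N₂)) h * expand K (p ^ (N₁ + N₂)) h := mul_dvd_mul h2 h1
      _ = expand K (p ^ (N₁ + N₂)) h ^ 2 := (sq _).symm
      _ ∣ _ := pow_dvd_pow _ hp.two_le

end Separable

/-! ### Base change of modules and semilinear maps -/

section Ext

variable {Fq B L : Type u} [Field Fq] [CommRing B] [Algebra Fq B] [Field L] [Algebra Fq L]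
  (L' : Type u) [Field L'] [Algebra Fq L'] [Algebra L L'] [IsScalarTower Fq L L']

theorem extHom_tmul (b : B) (a : L) : extHom Fq B L L' (b ⊗ₜ a) = b ⊗ₜ algebraMap L L' a := rfl

variable {L'} in
theorem ScalarExt.of_add {R R' V : Type u} [CommRing R] [CommRing R'] (φ : R →+* R') [AddCommGroup V]
    [Module R V] (x y : V) : ScalarExt.of φ (x + y) = ScalarExt.of φ x + ScalarExt.of φ y :=
  letI := φ.toAlgebra
  TensorProduct.tmul_add (1 : R') x y

variable {L'} in
theorem ScalarExt.of_smul {R R' V : Type u} [CommRing R] [CommRing R'] (φ : R →+* R')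
    [AddCommGroup V] [Module R V] (r : R) (x : V) :
    ScalarExt.of φ (r • x) = φ r • ScalarExt.of φ x := by
  letI := φ.toAlgebra
  have h : (1 : R') ⊗ₜ[R] (r • x) = (φ r : R') • (1 : R') ⊗ₜ[R] x := by
    rw [TensorProduct.tmul_smul, TensorProduct.smul_tmul', TensorProduct.smul_tmul',
      smul_eq_mul, mul_one, Algebra.smul_def, mul_one]
    rfl
  exact h

theorem ScalarExt.induction {R R' V : Type u} [CommRing R] [CommRing R'] (φ : R →+* R')
    [AddCommGroup V] [Module R V] {P : ScalarExt φ V → Prop} (h0 : P 0)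
    (hadd : ∀ x y, P x → P y → P (x + y)) (h : ∀ (a : R') (x : V), P (a • ScalarExt.of φ x))
    (y : ScalarExt φ V) : P y := by
  letI := φ.toAlgebra
  refine TensorProduct.induction_on (motive := P) (R := R) (M := R') (N := V) y h0 (fun a x => ?_) hadd
  have h1 : a ⊗ₜ[R] x = a • (1 : R') ⊗ₜ[R] x := by
    rw [TensorProduct.smul_tmul', smul_eq_mul, mul_one]
  have := h a x
  exact h1 ▸ this

theorem ScalarExt.map_of {R R' V W : Type u} [CommRing R] [CommRing R'] (φ : R →+* R')
    [AddCommGroup V] [Module R V] [AddCommGroup W] [Module R W] (f : V →ₗ[R] W) (x : V) :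
    ScalarExt.map φ f (ScalarExt.of φ x) = ScalarExt.of φ (f x) := rfl

theorem ScalarExt.mapSemi_of {R R' V W : Type u} [CommRing R] [CommRing R'] (φ : R →+* R')
    [AddCommGroup V] [Module R V] [AddCommGroup W] [Module R W] {σ : R →+* R} {σ' : R' →+* R'}
    (h : φ.comp σ = σ'.comp φ) (f : V →ₛₗ[σ] W) (x : V) :
    ScalarExt.mapSemi φ h f (ScalarExt.of φ x) = ScalarExt.of φ (f x) := by
  letI := φ.toAlgebra
  have h1 : ScalarExt.mapSemi φ h f (ScalarExt.of φ x) = (σ' 1) ⊗ₜ[R] f x := rfl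
  rw [h1, map_one]
  rfl

variable {L'}

/-- The canonical map to the base change. -/
def ofExt (L' : Type u) [Field L'] [Algebra Fq L'] [Algebra L L'] [IsScalarTower Fq L L']
    {V : CoeffModule Fq B L} (x : V) : V.baseChange L' :=
  ScalarExt.of (extHom Fq B L L') x

variable {V : CoeffModule Fq B L}

theorem ofExt_add (x y : V) : ofExt L' (x + y) = ofExt L' x + ofExt L' y := ScalarExt.of_add _ x y

theorem ofExt_smul (k : B ⊗[Fq] L) (x : V) :
    ofExt L' (k • x) = extHom Fq B L L' k • ofExt L' x := ScalarExt.of_smul _ k x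

theorem ofExt_left_smul (b : B) (x : V) : ofExt L' (b • x) = b • ofExt L' x := by
  rw [CoeffModule.left_smul_def, ofExt_smul, extHom_tmul, map_one, CoeffModule.left_smul_def]

theorem ofExt_right_smul (a : L) (x : V) :
    ofExt L' (a • x) = algebraMap L L' a • ofExt L' x := by
  rw [CoeffModule.right_smul_def, ofExt_smul, extHom_tmul, CoeffModule.right_smul_def]

theorem ofExt_zero : ofExt L' (0 : V) = 0 := by
  rw [← zero_smul L (0 : V), ofExt_right_smul, map_zero, zero_smul]

theorem baseChange_induction_tensor {P : V.baseChange L' → Prop} (h0 : P 0)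
    (hadd : ∀ x y, P x → P y → P (x + y)) (h : ∀ (a : B ⊗[Fq] L') (x : V), P (a • ofExt L' x))
    (y : V.baseChange L') : P y :=
  ScalarExt.induction _ h0 hadd h y

theorem baseChange_induction {P : V.baseChange L' → Prop} (h0 : P 0)
    (hadd : ∀ x y, P x → P y → P (x + y)) (h : ∀ (a : L') (x : V), P (a • ofExt L' x))
    (y : V.baseChange L') : P y := by
  refine baseChange_induction_tensor h0 hadd (fun a x => ?_) y
  induction a using TensorProduct.induction_on with
  | zero => rw [zero_smul]; exact h0
  | add a b ha hb => rw [add_smul]; exact hadd _ _ ha hb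
  | tmul b a =>
    have := h a (b • x)
    rw [ofExt_left_smul, ← smul_comm b a, ← CoeffModule.tmul_smul] at this
    exact this

variable (L') in
/-- The canonical map to the base change, as a linear map. -/
def ofExtLin (V : CoeffModule Fq B L) : V →ₗ[B] V.baseChange L' where
  toFun := ofExt L'
  map_add' := ofExt_add
  map_smul' := ofExt_left_smul

@[simp] theorem ofExtLin_apply (x : V) : ofExtLin L' V x = ofExt L' x := rfl

/-- Coordinates on a base change with respect to a basis of `L'` over `L`. -/
theorem exists_coord (V : CoeffModule Fq B L) {ι : Type*} [Fintype ι] [DecidableEq ι]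
    (e : Module.Basis ι L L') :
    ∃ coord : ι → (V.baseChange L' →+ V),
      (∀ i k y, coord i (extHom Fq B L L' k • y) = k • coord i y) ∧
      (∀ y, y = ∑ i, e i • ofExt L' (coord i y)) ∧
      ∀ i j x, coord i (e j • ofExt L' x) =
        if i = j then x else 0 := by
  letI := (extHom Fq B L L').toAlgebra
  have hsm : ∀ (k : B ⊗[Fq] L) (y : B ⊗[Fq] L'), k • y = extHom Fq B L L' k * y :=
    fun k y => Algebra.smul_def k y
  let f : ι → (B ⊗[Fq] L' →ₗ[B ⊗[Fq] L] B ⊗[Fq] L) := fun i =>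
    { toFun := ((e.coord i).restrictScalars Fq).lTensor B
      map_add' := map_add _
      map_smul' := fun k y => by
        rw [hsm, RingHom.id_apply, smul_eq_mul]
        induction y using TensorProduct.induction_on with
        | zero => simp
        | add x y hx hy => rw [mul_add, map_add, hx, hy, map_add, mul_add]
        | tmul b x =>
          induction k using TensorProduct.induction_on with
          | zero => simp
          | add k l hk hl => rw [map_add, add_mul, map_add, hk, hl, add_mul]
          | tmul c a =>
            rw [extHom_tmul, Algebra.TensorProduct.tmul_mul_tmul, LinearMap.lTensor_tmul,
              LinearMap.lTensor_tmul, Algebra.TensorProduct.tmul_mul_tmul]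
            congr 1
            rw [← Algebra.smul_def]
            exact (e.coord i).map_smul a x }
  have hf : ∀ i b x, f i (b ⊗ₜ x) = b ⊗ₜ e.coord i x := fun i b x => rfl
  have hsum : ∀ y : B ⊗[Fq] L', y = ∑ i, extHom Fq B L L' (f i y) * (1 ⊗ₜ e i) := by
    intro y
    induction y using TensorProduct.induction_on with
    | zero => simp
    | add x y hx hy =>
      conv_lhs => rw [hx, hy]
      simp only [map_add, add_mul, Finset.sum_add_distrib]
    | tmul b x =>
      simp only [hf, extHom_tmul, Algebra.TensorProduct.tmul_mul_tmul, mul_one]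
      rw [← TensorProduct.tmul_sum]
      congr 1
      conv_lhs => rw [← e.sum_repr x]
      simp only [Algebra.smul_def]
      rfl
  let g : ι → (((B ⊗[Fq] L') ⊗[B ⊗[Fq] L] V) →ₗ[B ⊗[Fq] L] V) := fun i =>
    (TensorProduct.lid _ _).toLinearMap ∘ₗ (f i).rTensor V
  have hg : ∀ i a x, g i (a ⊗ₜ x) = f i a • x := fun i a x => by simp [g]
  let G : ι → (V.baseChange L' →+ V) := fun i => (g i).toAddMonoidHom
  have hG : ∀ i (a : B ⊗[Fq] L') x, G i (a • ofExt L' x) = f i a • x := fun i a x => by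
    rw [← hg i a x]
    have : (a • ofExt L' x : V.baseChange L') = a ⊗ₜ[B ⊗[Fq] L] x := by
      change a • (1 : B ⊗[Fq] L') ⊗ₜ[B ⊗[Fq] L] x = _
      rw [TensorProduct.smul_tmul', smul_eq_mul, mul_one]
    exact congrArg (G i) this
  refine ⟨G, fun i k y => ?_, fun y => ?_, fun i j x => ?_⟩
  · have : extHom Fq B L L' k • y = (k • (show (B ⊗[Fq] L') ⊗[B ⊗[Fq] L] V from y) : _) :=
      algebraMap_smul (B ⊗[Fq] L') k (show (B ⊗[Fq] L') ⊗[B ⊗[Fq] L] V from y)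
    rw [this]
    exact (g i).map_smul k _
  · refine baseChange_induction_tensor
      (P := fun y : V.baseChange L' => y = ∑ i, e i • ofExt L' (G i y))
      ?_ (fun x y hx hy => ?_) (fun a x => ?_) y
    · refine (Finset.sum_eq_zero fun i _ => ?_).symm
      rw [map_zero, ofExt_zero, smul_zero]
    · conv_lhs => rw [hx, hy]
      rw [← Finset.sum_add_distrib]
      refine Finset.sum_congr rfl fun i _ => ?_
      rw [map_add, ofExt_add, smul_add]
    · conv_lhs => rw [hsum a, Finset.sum_smul]
      refine Finset.sum_congr rfl fun i _ => ?_
      refine Eq.trans ?_ (congrArg (fun z => e i • ofExt L' z) (hG i a x)).symm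
      rw [ofExt_smul, mul_smul, CoeffModule.right_smul_def, smul_comm]
  · have h1 : f i ((1 : B) ⊗ₜ[Fq] e j) = if i = j then 1 else 0 := by
      rw [hf, Module.Basis.coord_apply, Module.Basis.repr_self, Finsupp.single_apply]
      split_ifs with h h' h'
      · rfl
      · exact absurd h.symm h'
      · exact absurd h'.symm h
      · exact TensorProduct.tmul_zero _ _
    rw [CoeffModule.right_smul_def, hG, h1, ite_smul, one_smul, zero_smul]

theorem ofExt_injective [FiniteDimensional L L'] :
    Function.Injective (ofExt L' : V → V.baseChange L') := by
  classical
  refine (injective_iff_map_eq_zero (ofExtLin L' V)).2 fun x hx => ?_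
  obtain ⟨c, h1, h2, h3⟩ := exists_coord V (Module.finBasis L L')
  have hpos : 0 < Module.finrank L L' := Module.finrank_pos
  have := h3 ⟨0, hpos⟩ ⟨0, hpos⟩ x
  rw [if_pos rfl, ← ofExtLin_apply, hx, smul_zero, map_zero] at this
  exact this.symm

theorem aeval_map {V W : Type*} [AddCommGroup V] [Module B V] [AddCommGroup W] [Module B W]
    (S : Module.End B V) (T : Module.End B W) (f : V →ₗ[B] W) (h : ∀ x, f (S x) = T (f x))
    (p : Polynomial B) (x : V) :
    f (Polynomial.aeval S p x) = Polynomial.aeval T p (f x) := by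
  have h1 : ∀ (n : ℕ) x, f ((S ^ n) x) = (T ^ n) (f x) := fun n => by
    induction n with
    | zero => intro x; rfl
    | succ n ih => intro x; rw [pow_succ, Module.End.mul_apply, ih, h, pow_succ, Module.End.mul_apply]
  induction p using Polynomial.induction_on' with
  | add p q hp hq => rw [map_add, map_add, LinearMap.add_apply, map_add, hp, hq, LinearMap.add_apply]
  | monomial n b =>
    rw [Polynomial.aeval_monomial, Polynomial.aeval_monomial, Module.End.mul_apply,
      Module.End.mul_apply, Module.algebraMap_end_apply, Module.algebraMap_end_apply, map_smul, h1]

variable [Fintype Fq]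

/-- The extension of a semilinear map to the base change. -/
def extSemi (L' : Type u) [Field L'] [Algebra Fq L'] [Algebra L L'] [IsScalarTower Fq L L']
    {V W : CoeffModule Fq B L} (φ : V →ₛₗ[sigma Fq B L] W) :
    V.baseChange L' →ₛₗ[sigma Fq B L'] W.baseChange L' :=
  ScalarExt.mapSemi (extHom Fq B L L') (extHom_comp_sigma Fq B L L') φ

theorem extSemi_ofExt {W : CoeffModule Fq B L} (φ : V →ₛₗ[sigma Fq B L] W) (x : V) :
    extSemi L' φ (ofExt L' x) = ofExt L' (φ x) := ScalarExt.mapSemi_of _ _ _ _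

variable [Finite L] [FiniteDimensional L L'] [Finite L']

/-- The extension of `φ` sends `e i ⊗ x` to `e i ^ q ⊗ φ x`, so coordinates in its target refer to
the `q`-th powers. These are independent because elements of `L` have `q`-th roots and the Frobenius
is injective. -/
theorem exists_basis_pow_card : ∃ e e' : Module.Basis (Fin (Module.finrank L L')) L L',
    ∀ i, e' i = e i ^ Fintype.card Fq := by
  let e := Module.finBasis L L'
  have hli : LinearIndependent L fun i => e i ^ Fintype.card Fq := by
    rw [Fintype.linearIndependent_iff]
    intro g hg
    have h1 : ∀ i, ∃ b : L, b ^ Fintype.card Fq = g i := fun i => by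
      simpa using frobenius_surjective (Fq := Fq) 1 (g i)
    choose b hb using h1
    have h2 : FiniteField.frobeniusAlgHom Fq L' (∑ i, b i • e i) = 0 := by
      rw [map_sum, ← hg]
      refine Finset.sum_congr rfl fun i _ => ?_
      rw [FiniteField.coe_frobeniusAlgHom, Algebra.smul_def]
      dsimp only
      rw [mul_pow, ← map_pow, hb,
        Algebra.smul_def]
    have h3 : ∑ i, b i • e i = 0 := (map_eq_zero (FiniteField.frobeniusAlgHom Fq L')).1 h2
    intro i
    rw [← hb, Fintype.linearIndependent_iff.1 e.linearIndependent b h3 i,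
      zero_pow Fintype.card_ne_zero]
  rcases Nat.eq_zero_or_pos (Module.finrank L L') with h0 | h0
  · exact absurd h0 Module.finrank_pos.ne'
  · have : Nonempty (Fin (Module.finrank L L')) := ⟨⟨0, h0⟩⟩
    exact ⟨e, basisOfLinearIndependentOfCardEqFinrank hli (by simp), fun i => by simp⟩

theorem extSemi_injective {W : CoeffModule Fq B L}
    {φ : V →ₛₗ[sigma Fq B L] W} (hφ : Function.Injective φ) :
    Function.Injective (extSemi L' φ) := by
  classical
  obtain ⟨e, e', he⟩ := exists_basis_pow_card (Fq := Fq) (L := L) (L' := L')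
  obtain ⟨c, h1, h2, h3⟩ := exists_coord V e
  obtain ⟨c', h1', h2', h3'⟩ := exists_coord W e'
  refine (injective_iff_map_eq_zero (extSemi L' φ)).2 fun y hy => ?_
  rw [h2 y, map_sum] at hy
  have h4 : ∀ i, φ (c i y) = 0 := fun i => by
    have := congrArg (c' i) hy
    simp only [map_sum, map_zero, semi_right_smul, extSemi_ofExt, ← he, h3',
      Finset.sum_ite_eq, Finset.mem_univ, if_true] at this
    exact this
  rw [h2 y]
  refine Finset.sum_eq_zero fun i _ => ?_
  rw [hφ ((h4 i).trans (map_zero φ).symm), ofExt_zero, smul_zero]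

/-- On `V` the Frobenius over `L'` restricts to the `[L' : L]`-th power of the one over `L`;
substituting a power into a polynomial is `expand`. -/
theorem frobEval_ofExt (φ : V →ₛₗ[sigma Fq B L] V) (p : Polynomial B) (x : V) :
    frobEval (extSemi L' φ) p (ofExt L' x) =
      ofExt L' (frobEval φ (Polynomial.expand B (Module.finrank L L') p) x) := by
  have : FiniteDimensional Fq L := inferInstance
  unfold frobEval
  rw [Polynomial.expand_aeval, ← pow_mul, Module.finrank_mul_finrank]
  refine (aeval_map _ _ (ofExtLin L' V) (fun x => ?_) p x).symm
  rw [semiLin_pow_apply, semiLin_pow_apply, ofExtLin_apply, ofExtLin_apply]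
  induction Module.finrank Fq L' generalizing x with
  | zero => rfl
  | succ n ih => rw [Function.iterate_succ_apply, ih, Function.iterate_succ_apply, extSemi_ofExt]

theorem frobEval_extSemi_eq_zero {φ : V →ₛₗ[sigma Fq B L] V} {p : Polynomial B}
    (h : frobEval φ (Polynomial.expand B (Module.finrank L L') p) = 0) :
    frobEval (extSemi L' φ) p = 0 := by
  ext y
  induction y using baseChange_induction with
  | h0 => simp
  | hadd x y hx hy => rw [map_add, hx, hy]; simp
  | h a x => rw [frobEval_right_smul, frobEval_ofExt, h, LinearMap.zero_apply, ofExt_zero, smul_zero]; rfl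

/-- With `m = [L' : L]`, the ring `B[π ^ m]` is contained in the reduced ring `B[π]`. -/
theorem FrobReduced.extSemi {φ : V →ₛₗ[sigma Fq B L] V} (h : FrobReduced φ) :
    FrobReduced (extSemi L' φ) := by
  intro p n hp
  refine frobEval_extSemi_eq_zero (h _ n ?_)
  rw [← frobEval_pow, ← map_pow]
  ext x
  apply ofExt_injective (L' := L')
  rw [← frobEval_ofExt, frobEval_pow, hp]
  simp [ofExt_zero]

end Ext

/-! ### Extensions after which the Frobenius is separable -/

section SeparableFrobenius

variable {Fq Q L : Type u} [Field Fq] [Fintype Fq] [Field Q] [Algebra Fq Q] [Field L] [Algebra Fq L]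
  [Finite L] {V : CoeffModule Fq Q L}

theorem exists_separable_frobEval [Module.Finite (Q ⊗[Fq] L) V] (φ : V →ₛₗ[sigma Fq Q L] V) (p : ℕ)
    [Fact p.Prime] [CharP L p] :
    ∃ (n : ℕ) (h : Polynomial Q), h.Separable ∧ frobEval φ (Polynomial.expand Q (p ^ n) h) = 0 := by
  have := CoeffModule.finite_left (V := V)
  have : CharP Fq p := (algebraMap Fq L).charP (algebraMap Fq L).injective p
  have : CharP Q p := charP_of_injective_algebraMap (algebraMap Fq Q).injective p
  obtain ⟨n, h, hs, g, hg⟩ := exists_separable_dvd_expand p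
    (minpoly.ne_zero (Algebra.IsIntegral.isIntegral
      (R := Q) (semiLin φ ^ Module.finrank Fq L : Module.End Q V)))
  refine ⟨n, h, hs, ?_⟩
  rw [hg, frobEval_mul, frobEval, minpoly.aeval, zero_mul]

theorem FrobReduced.of_separable [Module.Finite (Q ⊗[Fq] L) V] {φ : V →ₛₗ[sigma Fq Q L] V}
    {h : Polynomial Q} (hs : h.Separable) (h0 : frobEval φ h = 0) : FrobReduced φ := by
  intro p n hp
  rw [← frobEval_pow] at hp
  have h1 := (hs.squarefree.squarefree_of_dvd
    (minpoly.dvd Q (semiLin φ ^ Module.finrank Fq L : Module.End Q V) h0)).isRadical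
  have := h1 n p (minpoly.dvd Q _ hp)
  rw [minpoly.dvd_iff] at this
  exact this

/-- A field extension of degree `p ^ n`. -/
theorem exists_extension (p : ℕ) [Fact p.Prime] (n : ℕ) :
    ∃ (L' : Type u) (_ : Field L') (_ : Algebra Fq L') (_ : Algebra L L')
        (_ : IsScalarTower Fq L L') (_ : FiniteDimensional L L'),
        Module.finrank L L' = p ^ n := by
  have hd : p ^ n ≠ 0 := pow_ne_zero _ (Fact.out : p.Prime).ne_zero
  have : Fintype L := Fintype.ofFinite L
  obtain ⟨q, hq⟩ := CharP.exists L
  have hqp : Fact q.Prime := ⟨CharP.char_is_prime L q⟩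
  have : NeZero (p ^ n) := ⟨hd⟩
  let E := FiniteField.Extension L q (p ^ n)
  let iFq : Algebra Fq (ULift.{u} E) :=
    ((algebraMap L (ULift.{u} E)).comp (algebraMap Fq L)).toAlgebra
  have hT : IsScalarTower Fq L (ULift.{u} E) := .of_algebraMap_eq fun _ => rfl
  let ε : ULift.{u} E ≃ₗ[L] E := ULift.moduleEquiv
  have hfin : FiniteDimensional L (ULift.{u} E) := Module.Finite.equiv ε.symm
  exact ⟨ULift.{u} E, inferInstance, iFq, inferInstance, hT, hfin, by
    rw [ε.finrank_eq, FiniteField.finrank_extension]⟩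

end SeparableFrobenius


/-! ### Lattices over the rings `O_v ⊗ L` -/

section LatSpan

variable {Fq Q L : Type u} [Field Fq] [Field Q] [Algebra Fq Q] [Field L] [Algebra Fq L]
  {V W : CoeffModule Fq Q L}

/-- The `O_v ⊗ L`-submodule spanned by a set. -/
def latSpan (v : Place Fq Q) (s : Set V) : Submodule L V :=
  Submodule.span L {x | ∃ a ∈ v.ring, ∃ y ∈ s, x = a • y}

theorem smul_mem_latSpan {v : Place Fq Q} {s : Set V} {a : Q} (ha : a ∈ v.ring) {x : V}
    (hx : x ∈ latSpan v s) : a • x ∈ latSpan v s := by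
  induction hx using Submodule.span_induction with
  | mem x hx =>
    obtain ⟨b, hb, y, hy, rfl⟩ := hx
    exact Submodule.subset_span ⟨a * b, v.ring.mul_mem _ _ ha hb, y, hy, smul_smul a b y⟩
  | zero => rw [smul_zero]; exact zero_mem _
  | add x y _ _ hx hy => rw [smul_add]; exact add_mem hx hy
  | smul c x _ hx => rw [smul_comm]; exact Submodule.smul_mem _ _ hx

theorem subset_latSpan {v : Place Fq Q} {s : Set V} {x : V} (hx : x ∈ s) : x ∈ latSpan v s :=
  Submodule.subset_span ⟨1, v.ring.one_mem, x, hx, (one_smul Q x).symm⟩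

theorem latSpan_le {v : Place Fq Q} {s : Set V} {N : Submodule L V}
    (hN : ∀ a ∈ v.ring, ∀ x ∈ N, a • x ∈ N) (hs : ∀ x ∈ s, x ∈ N) : latSpan v s ≤ N := by
  refine Submodule.span_le.2 ?_
  rintro _ ⟨a, ha, y, hy, rfl⟩
  exact hN a ha y (hs y hy)

theorem latSpan_le_latSpan {v : Place Fq Q} {s t : Set V} (hs : ∀ x ∈ s, x ∈ latSpan v t) :
    latSpan v s ≤ latSpan v t :=
  latSpan_le (fun _ ha _ hx => smul_mem_latSpan ha hx) hs

theorem latSpan_mono {v : Place Fq Q} {s t : Set V} (h : s ⊆ t) : latSpan v s ≤ latSpan v t :=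
  latSpan_le_latSpan fun _ hx => subset_latSpan (h hx)

/-- Expressing `x` through `s` involves finitely many functions on the curve, each with finitely
many poles. -/
theorem finite_notMem_latSpan [Finite Fq] (hQ : IsCurveFunctionField Fq Q) {s : Set V}
    (hs : Submodule.span (Q ⊗[Fq] L) s = ⊤) (x : V) :
    {v : Place Fq Q | x ∉ latSpan v s}.Finite := by
  have hx : x ∈ Submodule.span (Q ⊗[Fq] L) s := hs ▸ Submodule.mem_top
  induction hx using Submodule.span_induction with
  | mem x hx =>
    convert! Set.finite_empty
    exact Set.eq_empty_of_forall_notMem fun v hv => hv (subset_latSpan hx)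
  | zero =>
    convert! Set.finite_empty
    exact Set.eq_empty_of_forall_notMem fun v hv => hv (zero_mem _)
  | add x y _ _ hx hy =>
    refine (hx.union hy).subset fun v hv => ?_
    by_contra h
    simp only [Set.mem_union, Set.mem_setOf_eq, not_or, not_not] at h
    exact hv (add_mem h.1 h.2)
  | smul k x _ hx =>
    induction k using TensorProduct.induction_on with
    | zero =>
      convert! Set.finite_empty
      exact Set.eq_empty_of_forall_notMem fun v hv => hv (by rw [zero_smul]; exact zero_mem _)
    | add k l hk hl =>
      refine (hk.union hl).subset fun v hv => ?_
      by_contra h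
      simp only [Set.mem_union, Set.mem_setOf_eq, not_or, not_not] at h
      exact hv (by rw [add_smul]; exact add_mem h.1 h.2)
    | tmul b a =>
      refine ((finite_poles hQ b).union hx).subset fun v hv => ?_
      by_contra h
      simp only [Set.mem_union, Set.mem_setOf_eq, not_or, not_not] at h
      rw [CoeffModule.tmul_smul] at hv
      exact hv (smul_mem_latSpan h.1 (Submodule.smul_mem _ _ h.2))

theorem exists_pow_smul_mem_latSpan [Finite Fq] (hQ : IsCurveFunctionField Fq Q) {s : Set V}
    (hs : Submodule.span (Q ⊗[Fq] L) s = ⊤) {v : Place Fq Q} {t : Q} (ht : t ∈ v.ring.nonunits)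
    (ht0 : t ≠ 0) (x : V) : ∃ k₀ : ℕ, ∀ k ≥ k₀, t ^ k • x ∈ latSpan v s := by
  have htr := Place.mem_of_nonunits ht
  have hx : x ∈ Submodule.span (Q ⊗[Fq] L) s := hs ▸ Submodule.mem_top
  induction hx using Submodule.span_induction with
  | mem x hx =>
    exact ⟨0, fun k _ => smul_mem_latSpan (pow_mem htr k) (subset_latSpan hx)⟩
  | zero => exact ⟨0, fun k _ => by rw [smul_zero]; exact zero_mem _⟩
  | add x y _ _ hx hy =>
    obtain ⟨k, hk⟩ := hx
    obtain ⟨l, hl⟩ := hy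
    exact ⟨max k l, fun m hm => by
      rw [smul_add]
      exact add_mem (hk m (le_trans (le_max_left _ _) hm)) (hl m (le_trans (le_max_right _ _) hm))⟩
  | smul k x _ hx =>
    induction k using TensorProduct.induction_on with
    | zero => exact ⟨0, fun k _ => by rw [zero_smul, smul_zero]; exact zero_mem _⟩
    | add k l hk hl =>
      obtain ⟨k, hk⟩ := hk
      obtain ⟨l, hl⟩ := hl
      exact ⟨max k l, fun m hm => by
        rw [add_smul, smul_add]
        exact add_mem (hk m (le_trans (le_max_left _ _) hm)) (hl m (le_trans (le_max_right _ _) hm))⟩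
    | tmul b a =>
      obtain ⟨k, hk⟩ := hx
      obtain ⟨l, hl⟩ := Place.exists_pow_mul_mem hQ v ht ht0 b
      refine ⟨l + k, fun m hm => ?_⟩
      obtain ⟨n, rfl⟩ := Nat.exists_eq_add_of_le hm
      have : t ^ (l + k + n) • (b ⊗ₜ[Fq] a : Q ⊗[Fq] L) • x = (t ^ (l + n) * b) • a • t ^ k • x := by
        rw [CoeffModule.tmul_smul, ← smul_comm (t ^ k) a, smul_smul, smul_smul]
        congr 1
        ring
      rw [this]
      exact smul_mem_latSpan (hl _ (by omega)) (Submodule.smul_mem _ _ (hk k le_rfl))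

theorem finite_latSpan_ne [Finite Fq] (hQ : IsCurveFunctionField Fq Q) {s t : Set V}
    (hsf : s.Finite) (htf : t.Finite)
    (hs : Submodule.span (Q ⊗[Fq] L) s = ⊤) (ht : Submodule.span (Q ⊗[Fq] L) t = ⊤) :
    {v : Place Fq Q | latSpan v s ≠ latSpan v t}.Finite := by
  refine ((hsf.biUnion fun x _ => finite_notMem_latSpan hQ ht x).union
    (htf.biUnion fun x _ => finite_notMem_latSpan hQ hs x)).subset fun v hv => ?_
  by_contra h
  simp only [Set.mem_union, Set.mem_iUnion, Set.mem_setOf_eq, not_or, not_exists, not_not] at h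
  exact hv (le_antisymm (latSpan_le_latSpan h.1) (latSpan_le_latSpan h.2))

/-- A basis of a `Q_L`-module and a basis of `L` yield a `Q`-basis in which the lattices spanned by
the given basis are described coordinatewise. -/
theorem exists_basis_mem_latSpan [FiniteDimensional Fq L] {r : ℕ}
    (b : Module.Basis (Fin r) (Q ⊗[Fq] L) V) :
    ∃ β : Module.Basis (Fin (Module.finrank Fq L) × Fin r) Q V, ∀ v x,
      x ∈ latSpan v (Set.range b) ↔ ∀ t, β.repr x t ∈ v.ring := by
  let e := Module.finBasis Fq L
  let β := (e.baseChange Q).smulTower b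
  have hβ : ∀ t j, β (t, j) = e t • b j := fun t j => by
    rw [Module.Basis.smulTower_apply, Module.Basis.baseChange_apply, CoeffModule.right_smul_def]
  refine ⟨β, fun v x => ⟨fun hx => ?_, fun hx => ?_⟩⟩
  -- The coordinate condition is stable under `L`: products in `L` expand in the chosen basis with
  -- coefficients in `Fq`, which lies in every local ring.
  · let N : Submodule L V :=
      { carrier := {x | ∀ t, β.repr x t ∈ v.ring}
        add_mem' := fun {x y} hx hy t => by
          rw [map_add, Finsupp.add_apply]; exact v.ring.add_mem _ _ (hx t) (hy t)
        zero_mem' := fun t => by rw [map_zero]; exact v.ring.zero_mem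
        smul_mem' := fun a x hx t => by
          rw [← β.sum_repr x, Finset.smul_sum, map_sum, Finsupp.finsetSum_apply]
          refine sum_mem fun p _ => ?_
          rw [← smul_comm, map_smul, Finsupp.smul_apply, smul_eq_mul]
          refine mul_mem (hx p) ?_
          obtain ⟨p, j⟩ := p
          rw [hβ, smul_smul, ← e.sum_repr (a * e p), Finset.sum_smul, map_sum,
            Finsupp.finsetSum_apply]
          refine sum_mem fun p' _ => ?_
          have : (e.repr (a * e p) p' • e p') • b j =
              algebraMap Fq Q (e.repr (a * e p) p') • β (p', j) := by
            rw [hβ, CoeffModule.right_smul_def, CoeffModule.right_smul_def,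
              CoeffModule.left_smul_def, ← mul_smul, Algebra.TensorProduct.tmul_mul_tmul,
              mul_one, one_mul, Algebra.algebraMap_eq_smul_one, TensorProduct.smul_tmul]
          rw [this, map_smul, Module.Basis.repr_self, Finsupp.smul_apply, smul_eq_mul,
            Finsupp.single_apply]
          refine mul_mem (v.const_mem _) ?_
          split_ifs
          · exact v.ring.one_mem
          · exact v.ring.zero_mem }
    refine (latSpan_le (N := N) (fun a ha x hx t => ?_) ?_) hx
    · rw [map_smul, Finsupp.smul_apply, smul_eq_mul]; exact mul_mem ha (hx t)
    · rintro _ ⟨j, rfl⟩ t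
      have : b j = ∑ p, algebraMap Fq Q (e.repr 1 p) • β (p, j) := by
        conv_lhs => rw [← one_smul L (b j), ← e.sum_repr 1, Finset.sum_smul]
        refine Finset.sum_congr rfl fun p' _ => ?_
        rw [hβ, CoeffModule.right_smul_def, CoeffModule.right_smul_def,
              CoeffModule.left_smul_def, ← mul_smul, Algebra.TensorProduct.tmul_mul_tmul,
              mul_one, one_mul, Algebra.algebraMap_eq_smul_one, TensorProduct.smul_tmul]
      rw [this, map_sum, Finsupp.finsetSum_apply]
      refine sum_mem fun p' _ => ?_
      rw [map_smul, Module.Basis.repr_self, Finsupp.smul_apply, smul_eq_mul,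
            Finsupp.single_apply]
      refine mul_mem (v.const_mem _) ?_
      split_ifs
      · exact v.ring.one_mem
      · exact v.ring.zero_mem
  · rw [← β.sum_repr x]
    refine sum_mem fun p _ => smul_mem_latSpan (hx p) ?_
    obtain ⟨p, j⟩ := p
    rw [hβ]
    exact Submodule.smul_mem _ _ (subset_latSpan ⟨j, rfl⟩)

theorem CoeffModule.exists_basis (hK : IsField (Q ⊗[Fq] L)) [Module.Finite (Q ⊗[Fq] L) V] :
    Nonempty (Module.Basis (Fin (Module.finrank (Q ⊗[Fq] L) V)) (Q ⊗[Fq] L) V) := by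
  let _ := hK.toField
  exact ⟨Module.finBasis (Q ⊗[Fq] L) V⟩

theorem exists_basis_span_eq_of_isPrincipalIdealRing {R K V : Type*} [CommRing R] [IsDomain R]
    [IsPrincipalIdealRing R] [CommRing K] (hK : IsField K) [Algebra R K] [IsFractionRing R K]
    [AddCommGroup V] [Module K V] [Module R V] [IsScalarTower R K V] {s : Set V} (hsf : s.Finite)
    (hs : Submodule.span K s = ⊤) :
    ∃ b : Module.Basis (Fin (Module.finrank K V)) K V,
      Submodule.span R s = Submodule.span R (Set.range b) := by
  let _ := hK.toField
  let N := Submodule.span R s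
  have hfin : Module.Finite R N := Module.Finite.span_of_finite _ hsf
  have htf : Module.IsTorsionFree R V := .trans_faithfulSMul R K V
  obtain ⟨n, b⟩ := Module.basisOfFiniteTypeTorsionFree' (R := R) (M := N)
  have hli : LinearIndependent R fun i => (b i : V) :=
    b.linearIndependent.map' N.subtype (Submodule.ker_subtype N)
  have hli' : LinearIndependent K fun i => (b i : V) :=
    (LinearIndependent.iff_fractionRing R K).1 hli
  have hspanN : Submodule.span R (Set.range fun i => (b i : V)) = N := by
    have := congrArg (Submodule.map N.subtype) b.span_eq
    rw [Submodule.map_span, Submodule.map_top, Submodule.range_subtype, ← Set.range_comp] at this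
    exact this
  have hspan : ⊤ ≤ Submodule.span K (Set.range fun i => (b i : V)) := by
    rw [← hs]
    refine Submodule.span_le.2 fun x hx => ?_
    have h1 : x ∈ N := Submodule.subset_span hx
    rw [← hspanN] at h1
    exact Submodule.span_le_restrictScalars R K _ h1
  let B := Module.Basis.mk hli' hspan
  have hn : Module.finrank K V = n := by
    rw [Module.finrank_eq_card_basis B, Fintype.card_fin]
  refine ⟨B.reindex (finCongr hn.symm), ?_⟩
  rw [Module.Basis.range_reindex, Module.Basis.coe_mk, hspanN]

/-- As `O_v ⊗ L` is a principal ideal domain, a finitely generated torsion-free module over it is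
free. This turns a description by generators into local freeness. -/
theorem exists_basis_latSpan [Finite Fq] (hQ : IsCurveFunctionField Fq Q)
    [FiniteDimensional Fq L] {s : Set V} (hsf : s.Finite)
    (hs : Submodule.span (Q ⊗[Fq] L) s = ⊤) (v : Place Fq Q) :
    ∃ b : Module.Basis (Fin (Module.finrank (Q ⊗[Fq] L) V)) (Q ⊗[Fq] L) V,
      latSpan v s = latSpan v (Set.range b) := by
  have h1 : IsDiscreteValuationRing v.alg := v.isDVR hQ
  have : IsFractionRing v.alg Q := (inferInstance : IsFractionRing v.ring Q)
  let _ : Algebra (v.alg ⊗[Fq] L) (Q ⊗[Fq] L) := (subHom v.alg L).toRingHom.toAlgebra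
  have hfrac : IsFractionRing (v.alg ⊗[Fq] L) (Q ⊗[Fq] L) := (coeffRing_facts hQ v.alg L).2
  obtain ⟨hdom, hpid⟩ := v.isPrincipalIdealRing_tensor hQ L
  let _ : Module (v.alg ⊗[Fq] L) V := Module.compHom V (subHom v.alg L).toRingHom
  have : IsScalarTower (v.alg ⊗[Fq] L) (Q ⊗[Fq] L) V := ⟨fun x y z => by
    rw [Algebra.smul_def, mul_smul]; rfl⟩
  have hN : ∀ (s : Set V) x, x ∈ Submodule.span (v.alg ⊗[Fq] L) s ↔ x ∈ latSpan v s := by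
    intro s x
    have hsm : ∀ (a : v.alg) (c : L) (x : V),
        (a ⊗ₜ[Fq] c : v.alg ⊗[Fq] L) • x = (a : Q) • c • x := fun a c x =>
      CoeffModule.tmul_smul (a : Q) c x
    constructor
    · intro hx
      induction hx using Submodule.span_induction with
      | mem x hx => exact subset_latSpan hx
      | zero => exact zero_mem _
      | add x y _ _ hx hy => exact add_mem hx hy
      | smul k x _ hx =>
        induction k using TensorProduct.induction_on with
        | zero =>
          have h0 : (0 : v.alg ⊗[Fq] L) • x = 0 := zero_smul _ x
          exact Set.mem_of_eq_of_mem h0 (zero_mem (latSpan v s))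
        | add k l hk hl => rw [add_smul]; exact add_mem hk hl
        | tmul a c => rw [hsm]; exact smul_mem_latSpan a.2 (Submodule.smul_mem _ _ hx)
    · intro hx
      induction hx using Submodule.span_induction with
      | mem x hx =>
        obtain ⟨a, ha, y, hy, rfl⟩ := hx
        have := hsm ⟨a, ha⟩ 1 y
        rw [one_smul] at this
        rw [← this]
        exact Submodule.smul_mem _ _ (Submodule.subset_span hy)
      | zero => exact zero_mem _
      | add x y _ _ hx hy => exact add_mem hx hy
      | smul c x _ hx =>
        have := hsm 1 c x
        rw [OneMemClass.coe_one, one_smul] at this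
        rw [← this]
        exact Submodule.smul_mem _ _ hx
  obtain ⟨b, hb⟩ := exists_basis_span_eq_of_isPrincipalIdealRing (R := v.alg ⊗[Fq] L)
    (isField_tensor hQ L) hsf hs
  exact ⟨b, Submodule.ext fun x => by rw [← hN, hb, hN]⟩

/-- A family of lattices in a `Q_L`-module, one for each closed point of the curve, almost all of
which are spanned by the same elements. -/
structure IsLattice (X : Place Fq Q → Submodule L V) : Prop where
  local_span : ∀ v, ∃ s : Set V, s.Finite ∧ Submodule.span (Q ⊗[Fq] L) s = ⊤ ∧ X v = latSpan v s
  generic_span : ∃ s : Set V, s.Finite ∧ Submodule.span (Q ⊗[Fq] L) s = ⊤ ∧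
    {v | X v ≠ latSpan v s}.Finite

namespace IsLattice

variable {X Y : Place Fq Q → Submodule L V}

theorem smul_mem (hX : IsLattice X) {v : Place Fq Q} {a : Q} (ha : a ∈ v.ring) {x : V}
    (hx : x ∈ X v) : a • x ∈ X v := by
  obtain ⟨s, -, -, hs⟩ := hX.local_span v
  rw [hs] at hx ⊢
  exact smul_mem_latSpan ha hx

theorem finite (hX : IsLattice X) : Module.Finite (Q ⊗[Fq] L) V := by
  obtain ⟨s, hs, h, -⟩ := hX.generic_span
  exact ⟨⟨hs.toFinset, by rw [Set.Finite.coe_toFinset, h]⟩⟩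

variable [Finite Fq] (hQ : IsCurveFunctionField Fq Q)

include hQ

theorem finite_ne_latSpan (hX : IsLattice X) {s : Set V} (hsf : s.Finite)
    (hs : Submodule.span (Q ⊗[Fq] L) s = ⊤) : {v | X v ≠ latSpan v s}.Finite := by
  obtain ⟨t, htf, ht, h⟩ := hX.generic_span
  refine (h.union (finite_latSpan_ne hQ htf hsf ht hs)).subset fun v hv => ?_
  by_contra h
  simp only [Set.mem_union, Set.mem_setOf_eq, not_or, not_not] at h
  exact hv (h.1.trans h.2)

theorem finite_ne (hX : IsLattice X) (hY : IsLattice Y) : {v | X v ≠ Y v}.Finite := by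
  obtain ⟨t, htf, ht, h⟩ := hY.generic_span
  refine (h.union (hX.finite_ne_latSpan hQ htf ht)).subset fun v hv => ?_
  by_contra h
  simp only [Set.mem_union, Set.mem_setOf_eq, not_or, not_not] at h
  exact hv (h.2.trans h.1.symm)

theorem finite_notMem (hX : IsLattice X) (x : V) : {v | x ∉ X v}.Finite := by
  obtain ⟨t, htf, ht, h⟩ := hX.generic_span
  refine (h.union (finite_notMem_latSpan hQ ht x)).subset fun v hv => ?_
  by_contra h
  simp only [Set.mem_union, Set.mem_setOf_eq, not_or, not_not] at h
  exact hv (h.1 ▸ h.2)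

theorem exists_pow_smul_mem (hX : IsLattice X) {v : Place Fq Q} {t : Q}
    (ht : t ∈ v.ring.nonunits) (ht0 : t ≠ 0) (x : V) : ∃ k₀ : ℕ, ∀ k ≥ k₀, t ^ k • x ∈ X v := by
  obtain ⟨s, -, hs, h⟩ := hX.local_span v
  rw [h]
  exact exists_pow_smul_mem_latSpan hQ hs ht ht0 x

variable [FiniteDimensional Fq L]

theorem exists_basis (hX : IsLattice X) (v : Place Fq Q) :
    ∃ b : Module.Basis (Fin (Module.finrank (Q ⊗[Fq] L) V)) (Q ⊗[Fq] L) V,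
      X v = latSpan v (Set.range b) := by
  obtain ⟨s, hsf, hs, h⟩ := hX.local_span v
  rw [h]
  exact exists_basis_latSpan hQ hsf hs v

omit hQ [Finite Fq] [FiniteDimensional Fq L] in
theorem latSpan_range_eq {r : ℕ} (v : Place Fq Q) (b : Fin r → V) :
    Submodule.span L {x | ∃ a ∈ v.ring, ∃ j, x = a • b j} = latSpan v (Set.range b) := by
  simp [latSpan]

theorem isLocallyFree (hX : IsLattice X) :
    (LatticeSheaf.mk V X).IsLocallyFree (Module.finrank (Q ⊗[Fq] L) V) := by
  intro v
  obtain ⟨b, hb⟩ := hX.exists_basis hQ v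
  refine ⟨b, {w | X w ≠ latSpan w (Set.range b)},
    hX.finite_ne_latSpan hQ (Set.finite_range b) b.span_eq, fun h => h hb, fun w hw => ?_⟩
  rw [latSpan_range_eq]
  exact not_not.1 hw

omit hQ [Finite Fq] [FiniteDimensional Fq L] in
theorem of_isLocallyFree {r : ℕ} (inf : Place Fq Q) (h : (LatticeSheaf.mk V X).IsLocallyFree r) :
    IsLattice X := by
  refine ⟨fun v => ?_, ?_⟩
  · obtain ⟨b, S, hS, hv, hb⟩ := h v
    exact ⟨Set.range b, Set.finite_range b, b.span_eq, (hb v hv).trans (latSpan_range_eq v b)⟩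
  · obtain ⟨b, S, hS, hv, hb⟩ := h inf
    refine ⟨Set.range b, Set.finite_range b, b.span_eq, hS.subset fun v hv => ?_⟩
    by_contra hvS
    exact hv ((hb v hvS).trans (latSpan_range_eq v b))

omit hQ in
theorem finrank_of_isLocallyFree (hQ : IsCurveFunctionField Fq Q) {r : ℕ} (inf : Place Fq Q)
    (h : (LatticeSheaf.mk V X).IsLocallyFree r) : Module.finrank (Q ⊗[Fq] L) V = r := by
  let _ := (isField_tensor hQ L).toField
  obtain ⟨b, -⟩ := h inf
  rw [Module.finrank_eq_card_basis b, Fintype.card_fin]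

end IsLattice

end LatSpan


/-! ### Images, sums, base changes and global sections of lattices -/

section LatticeOperations

variable {Fq Q L : Type u} [Field Fq] [Field Q] [Algebra Fq Q] [Field L] [Algebra Fq L]
  {V W : CoeffModule Fq Q L}

/-- The underlying `L`-linear map. -/
def CoeffModule.linL (f : V →ₗ[Q ⊗[Fq] L] W) : V →ₗ[L] W where
  toFun := f
  map_add' := map_add f
  map_smul' := CoeffModule.map_right_smul f

@[simp] theorem CoeffModule.linL_apply (f : V →ₗ[Q ⊗[Fq] L] W) (x : V) :
    CoeffModule.linL f x = f x := rfl

theorem map_latSpan (f : V →ₗ[Q ⊗[Fq] L] W) (v : Place Fq Q) (s : Set V) :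
    (latSpan v s).map (CoeffModule.linL f) = latSpan v (f '' s) := by
  rw [latSpan, latSpan, Submodule.map_span]
  congr 1
  ext x
  constructor
  · rintro ⟨_, ⟨a, ha, y, hy, rfl⟩, rfl⟩
    exact ⟨a, ha, f y, ⟨y, hy, rfl⟩, CoeffModule.map_left_smul f a y⟩
  · rintro ⟨a, ha, _, ⟨y, hy, rfl⟩, rfl⟩
    exact ⟨a • y, ⟨a, ha, y, hy, rfl⟩, CoeffModule.map_left_smul f a y⟩

theorem IsLattice.map {X : Place Fq Q → Submodule L V} (hX : IsLattice X)
    {f : V →ₗ[Q ⊗[Fq] L] W} (hf : Function.Surjective f) :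
    IsLattice fun v => (X v).map (CoeffModule.linL f) := by
  have hsp : ∀ s : Set V, Submodule.span (Q ⊗[Fq] L) s = ⊤ →
      Submodule.span (Q ⊗[Fq] L) (f '' s) = ⊤ := fun s hs => by
    rw [← Submodule.map_span, hs, Submodule.map_top, LinearMap.range_eq_top.2 hf]
  refine ⟨fun v => ?_, ?_⟩
  · obtain ⟨s, hsf, hs, h⟩ := hX.local_span v
    exact ⟨f '' s, hsf.image f, hsp s hs, by rw [h, map_latSpan]⟩
  · obtain ⟨s, hsf, hs, h⟩ := hX.generic_span
    refine ⟨f '' s, hsf.image f, hsp s hs, h.subset fun v hv hvs => hv ?_⟩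
    simp only [hvs, map_latSpan]

section Pi

variable {n : ℕ} {U : Fin n → CoeffModule Fq Q L}

/-- The direct sum of subspaces. -/
def piSub (N : ∀ j, Submodule L (U j)) : Submodule L (CoeffModule.pi U) where
  carrier := {x | ∀ j, x j ∈ N j}
  add_mem' := fun hx hy j => (N j).add_mem (hx j) (hy j)
  zero_mem' := fun j => (N j).zero_mem
  smul_mem' := fun a _ hx j => (N j).smul_mem a (hx j)

theorem mem_piSub {N : ∀ j, Submodule L (U j)} {x : CoeffModule.pi U} :
    x ∈ piSub N ↔ ∀ j, x j ∈ N j := Iff.rfl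

/-- The inclusion of a direct summand. -/
def piSingle (j : Fin n) : U j →ₗ[Q ⊗[Fq] L] CoeffModule.pi U :=
  LinearMap.single (Q ⊗[Fq] L) (fun j => U j) j

theorem piSingle_self (j : Fin n) (x : U j) : piSingle j x j = x := Pi.single_eq_same (M := fun j => U j) j x

theorem piSingle_ne {j i : Fin n} (h : i ≠ j) (x : U j) : piSingle j x i = 0 :=
  Pi.single_eq_of_ne (M := fun j => U j) h x

theorem sum_piSingle (x : CoeffModule.pi U) : ∑ j, piSingle j (x j) = x :=
  Finset.univ_sum_single (M := fun j => U j) x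

theorem latSpan_pi (v : Place Fq Q) (s : ∀ j, Set (U j)) :
    latSpan v (⋃ j, piSingle j '' s j) = piSub fun j => latSpan v (s j) := by
  refine le_antisymm (latSpan_le (fun a ha x hx j => ?_) fun x hx => ?_) fun x hx => ?_
  · exact smul_mem_latSpan ha (hx j)
  · obtain ⟨j, y, hy, rfl⟩ := Set.mem_iUnion.1 hx
    intro i
    by_cases h : i = j
    · subst h
      rw [piSingle_self]
      exact subset_latSpan hy
    · rw [piSingle_ne h]
      exact zero_mem _
  · rw [← sum_piSingle x]
    refine sum_mem fun j _ => ?_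
    have : piSingle j (x j) ∈ latSpan v (piSingle j '' s j) := by
      rw [← map_latSpan]
      exact ⟨x j, hx j, rfl⟩
    exact latSpan_mono (Set.subset_iUnion (fun j => piSingle j '' s j) j) this

theorem IsLattice.pi {X : ∀ j, Place Fq Q → Submodule L (U j)} (hX : ∀ j, IsLattice (X j)) :
    IsLattice fun v => piSub fun j => X j v := by
  have hsp : ∀ s : ∀ j, Set (U j), (∀ j, Submodule.span (Q ⊗[Fq] L) (s j) = ⊤) →
      Submodule.span (Q ⊗[Fq] L) (⋃ j, piSingle j '' s j) = ⊤ := fun s hs => by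
    rw [eq_top_iff]
    intro x _
    rw [← sum_piSingle x]
    refine sum_mem fun j _ => ?_
    refine Submodule.span_mono (Set.subset_iUnion (fun j => piSingle j '' s j) j) ?_
    rw [← Submodule.map_span, hs]
    exact ⟨x j, trivial, rfl⟩
  refine ⟨fun v => ?_, ?_⟩
  · choose s hsf hs h using fun j => (hX j).local_span v
    refine ⟨⋃ j, piSingle j '' s j, Set.finite_iUnion fun j => (hsf j).image _, hsp s hs, ?_⟩
    rw [latSpan_pi]
    simp only [h]
  · choose s hsf hs h using fun j => (hX j).generic_span
    refine ⟨⋃ j, piSingle j '' s j, Set.finite_iUnion fun j => (hsf j).image _, hsp s hs,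
      (Set.finite_iUnion h).subset fun v hv => ?_⟩
    by_contra hv'
    simp only [Set.mem_iUnion, Set.mem_setOf_eq, not_exists, not_not] at hv'
    apply hv
    rw [latSpan_pi]
    simp only [hv']

end Pi

section BaseChange

variable {L' : Type u} [Field L'] [Algebra Fq L'] [Algebra L L'] [IsScalarTower Fq L L']

variable (L') in
/-- The base change of a subspace. -/
def extSub (N : Submodule L V) : Submodule L' (V.baseChange L') :=
  Submodule.span L' (ofExt L' '' (N : Set V))

theorem ofExt_mem_extSub {N : Submodule L V} {x : V} (hx : x ∈ N) : ofExt L' x ∈ extSub L' N :=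
  Submodule.subset_span ⟨x, hx, rfl⟩

theorem extSub_le {N : Submodule L V} {M : Submodule L' (V.baseChange L')}
    (h : ∀ x ∈ N, ofExt L' x ∈ M) : extSub L' N ≤ M := by
  refine Submodule.span_le.2 ?_
  rintro _ ⟨x, hx, rfl⟩
  exact h x hx

theorem extSub_latSpan (v : Place Fq Q) (s : Set V) :
    extSub L' (latSpan v s) = latSpan v (ofExt L' '' s) := by
  refine le_antisymm (extSub_le fun x hx => ?_) (latSpan_le (fun a ha x hx => ?_) ?_)
  · induction hx using Submodule.span_induction with
    | mem x hx =>
      obtain ⟨a, ha, y, hy, rfl⟩ := hx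
      rw [ofExt_left_smul]
      exact smul_mem_latSpan ha (subset_latSpan ⟨y, hy, rfl⟩)
    | zero => rw [ofExt_zero]; exact zero_mem _
    | add x y _ _ hx hy => rw [ofExt_add]; exact add_mem hx hy
    | smul a x _ hx => rw [ofExt_right_smul]; exact Submodule.smul_mem _ _ hx
  · induction hx using Submodule.span_induction with
    | mem x hx =>
      obtain ⟨y, hy, rfl⟩ := hx
      rw [← ofExt_left_smul]
      exact ofExt_mem_extSub (smul_mem_latSpan ha hy)
    | zero => rw [smul_zero]; exact zero_mem _
    | add x y _ _ hx hy => rw [smul_add]; exact add_mem hx hy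
    | smul c x _ hx => rw [smul_comm]; exact Submodule.smul_mem _ _ hx
  · rintro _ ⟨x, hx, rfl⟩
    exact ofExt_mem_extSub (subset_latSpan hx)

theorem IsLattice.extSub {X : Place Fq Q → Submodule L V} (hX : IsLattice X) :
    IsLattice fun v => extSub L' (X v) := by
  have hsp : ∀ s : Set V, Submodule.span (Q ⊗[Fq] L) s = ⊤ →
      Submodule.span (Q ⊗[Fq] L') (ofExt L' '' s) = ⊤ := fun s hs => by
    have key : ∀ x : V, ofExt L' x ∈ Submodule.span (Q ⊗[Fq] L') (ofExt L' '' s) := fun x => by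
      have hx : x ∈ Submodule.span (Q ⊗[Fq] L) s := hs ▸ Submodule.mem_top
      induction hx using Submodule.span_induction with
      | mem x hx => exact Submodule.subset_span ⟨x, hx, rfl⟩
      | zero => rw [ofExt_zero]; exact zero_mem _
      | add x y _ _ hx hy => rw [ofExt_add]; exact add_mem hx hy
      | smul c x _ hx => rw [ofExt_smul]; exact Submodule.smul_mem _ _ hx
    rw [eq_top_iff]
    intro y _
    induction y using baseChange_induction with
    | h0 => exact zero_mem _
    | hadd x y hx hy => exact add_mem (hx trivial) (hy trivial)
    | h a x => exact CoeffModule.right_smul_mem _ a (key x)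
  refine ⟨fun v => ?_, ?_⟩
  · obtain ⟨s, hsf, hs, h⟩ := hX.local_span v
    exact ⟨ofExt L' '' s, hsf.image _, hsp s hs, by rw [h, extSub_latSpan]⟩
  · obtain ⟨s, hsf, hs, h⟩ := hX.generic_span
    refine ⟨ofExt L' '' s, hsf.image _, hsp s hs, h.subset fun v hv hvs => hv ?_⟩
    simp only [hvs, extSub_latSpan]

/-- The base change of a subspace, in coordinates. -/
theorem exists_addEquiv_extSub [FiniteDimensional L L'] (V : CoeffModule Fq Q L) :
    ∃ E : V.baseChange L' ≃+ (Fin (Module.finrank L L') → V), ∀ (N : Submodule L V) y,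
      y ∈ extSub L' N ↔ ∀ i, E y i ∈ N := by
  classical
  let e := Module.finBasis L L'
  obtain ⟨c, h1, h2, h3⟩ := exists_coord V e
  have h4 : ∀ i (a : L') x, c i (a • ofExt L' x) = e.repr a i • x := fun i a x => by
    conv_lhs => rw [← e.sum_repr a, Finset.sum_smul, map_sum]
    have : ∀ j, (e.repr a j • e j) • ofExt L' x = e j • ofExt L' (e.repr a j • x) := fun j => by
      rw [ofExt_right_smul, smul_smul, Algebra.smul_def, mul_comm]
    simp only [this, h3, Finset.sum_ite_eq, Finset.mem_univ, if_true]
  let E : V.baseChange L' ≃+ (Fin (Module.finrank L L') → V) :=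
    { toFun := fun y i => c i y
      invFun := fun f => ∑ i, e i • ofExt L' (f i)
      left_inv := fun y => (h2 y).symm
      right_inv := fun f => funext fun i => by
        simp only [map_sum, h3, Finset.sum_ite_eq, Finset.mem_univ, if_true]
      map_add' := fun x y => funext fun i => map_add (c i) x y }
  have hE : ∀ y i, E y i = c i y := fun _ _ => rfl
  refine ⟨E, fun N y => ⟨fun hy => ?_, fun hy => ?_⟩⟩
  · let M : Submodule L' (V.baseChange L') :=
      { carrier := {y | ∀ i, c i y ∈ N}
        add_mem' := fun {x y} hx hy i => by rw [map_add]; exact N.add_mem (hx i) (hy i)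
        zero_mem' := fun i => by rw [map_zero]; exact N.zero_mem
        smul_mem' := fun a y hy i => by
          rw [h2 y, Finset.smul_sum, map_sum]
          refine sum_mem fun j _ => ?_
          rw [smul_smul, h4]
          exact N.smul_mem _ (hy j) }
    refine extSub_le (M := M) (fun x hx i => ?_) hy
    have := h4 i 1 x
    rw [one_smul] at this
    rw [this]
    exact N.smul_mem _ hx
  · rw [h2 y]
    exact sum_mem fun i _ => Submodule.smul_mem _ _ (ofExt_mem_extSub (hy i))

end BaseChange

/-- The global sections form a finite set. -/
theorem IsLattice.finite_global [Finite Fq] [FiniteDimensional Fq L]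
    (hQ : IsCurveFunctionField Fq Q) {inf : Place Fq Q} (hinf : inf.IsRational)
    {X : Place Fq Q → Submodule L V} (hX : IsLattice X) : {x | ∀ v, x ∈ X v}.Finite := by
  classical
  obtain ⟨z, hz⟩ := Place.exists_uniformizer hQ inf
  obtain ⟨b, hb⟩ := hX.exists_basis hQ inf
  obtain ⟨β, hβ⟩ := exists_basis_mem_latSpan b
  have hbad := hX.finite_ne_latSpan hQ (Set.finite_range b) b.span_eq
  set T := hbad.toFinset.erase inf with hT
  obtain ⟨g, hgA, hg0, hgT⟩ := exists_affine_nonunits hQ hinf T (by simp [hT])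
  -- a power of `g` maps the lattices at the places in `T` into the free ones
  have hN : ∀ v ∈ T, ∃ N : ℕ, ∀ n ≥ N, ∀ x ∈ X v, g ^ n • x ∈ latSpan v (Set.range b) := by
    intro v hv
    obtain ⟨s, hsf, hs, h⟩ := hX.local_span v
    choose N hN using fun x : V => exists_pow_smul_mem_latSpan hQ b.span_eq (hgT v hv) hg0 x
    refine ⟨hsf.toFinset.sup N, fun n hn x hx => ?_⟩
    rw [h] at hx
    induction hx using Submodule.span_induction with
    | mem x hx =>
      obtain ⟨a, ha, y, hy, rfl⟩ := hx
      rw [smul_comm]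
      exact smul_mem_latSpan ha (hN y n (le_trans
        (Finset.le_sup (f := N) ((Set.Finite.mem_toFinset hsf).2 hy)) hn))
    | zero => rw [smul_zero]; exact zero_mem _
    | add x y _ _ hx hy => rw [smul_add]; exact add_mem hx hy
    | smul c x _ hx => rw [smul_comm]; exact Submodule.smul_mem _ _ hx
  choose! N hN using hN
  set n := T.sup N
  have hgA' : ∀ m : ℕ, g ^ m ∈ affineRing inf := fun m => pow_mem hgA m
  -- The factor `g ^ n` costs at most a bounded pole at `inf`. The coordinates of `g ^ n • x` thus
  -- lie in a finite-dimensional space of functions over the finite field `Fq`, that is, in a finite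
  -- set.
  obtain ⟨k, hk⟩ := Place.exists_pow_mul_mem hQ inf hz.2.1 hz.1 (g ^ n)
  obtain ⟨H, hHfin, hH⟩ := finite_bounded_poles hQ hinf hz k
  have : Finite H := Module.finite_of_finite Fq
  have key : ∀ x, (∀ v, x ∈ X v) → ∀ t, g ^ n * β.repr x t ∈ H := by
    intro x hx t
    rw [hH]
    have hrepr : ∀ y : Q, β.repr (y • x) t = y * β.repr x t := fun y => by
      rw [map_smul, Finsupp.smul_apply, smul_eq_mul]
    refine ⟨fun v hv => ?_, ?_⟩
    · rw [← hrepr]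
      refine (hβ v _).1 ?_ t
      by_cases hvT : v ∈ T
      · exact hN v hvT n (Finset.le_sup hvT) x (hx v)
      · have : X v = latSpan v (Set.range b) := by
          by_contra hne
          exact hvT (Finset.mem_erase.2 ⟨hv, (Set.Finite.mem_toFinset hbad).2 hne⟩)
        exact smul_mem_latSpan (hgA' n v hv) (this ▸ hx v)
    · rw [← mul_assoc]
      exact mul_mem (hk k le_rfl) ((hβ inf x).1 (hb ▸ hx inf) t)
  let F : {x | ∀ v, x ∈ X v} → (Fin (Module.finrank Fq L) ×
      Fin (Module.finrank (Q ⊗[Fq] L) V)) → H := fun x t => ⟨_, key x x.2 t⟩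
  have hF : Function.Injective F := fun x y hxy => by
    refine Subtype.ext (β.repr.injective (Finsupp.ext fun t => ?_))
    have := congrArg Subtype.val (congrFun hxy t)
    exact mul_left_cancel₀ (pow_ne_zero n hg0) this
  exact Finite.of_injective F hF

end LatticeOperations

/-! ### Indices of lattices at rational places -/

section Index

theorem relIndex_pi {ι : Type*} [Fintype ι] {G : ι → Type*} [∀ i, AddCommGroup (G i)]
    (X Y : ∀ i, AddSubgroup (G i)) :
    (AddSubgroup.pi Set.univ X).relIndex (AddSubgroup.pi Set.univ Y) =
      ∏ i, (X i).relIndex (Y i) := by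
  let f : (∀ i, Y i) →+ ∀ i, G i :=
    { toFun := fun y i => y i, map_zero' := rfl, map_add' := fun _ _ => rfl }
  have h1 : AddSubgroup.pi Set.univ Y = AddSubgroup.map f ⊤ := by
    ext y
    simp only [AddSubgroup.mem_pi, Set.mem_univ, true_imp_iff, AddSubgroup.mem_map,
      AddSubgroup.mem_top, true_and]
    exact ⟨fun h => ⟨fun i => ⟨y i, h i⟩, rfl⟩, by rintro ⟨x, rfl⟩ i; exact (x i).2⟩
  rw [h1, ← AddSubgroup.relIndex_comap, AddSubgroup.relIndex_top_right]
  let g : (∀ i, Y i) →+ ∀ i, Y i ⧸ (X i).addSubgroupOf (Y i) :=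
    { toFun := fun y i => QuotientAddGroup.mk' _ (y i)
      map_zero' := rfl
      map_add' := fun _ _ => rfl }
  have h2 : AddSubgroup.comap f (AddSubgroup.pi Set.univ X) = g.ker := by
    ext y
    simp only [AddSubgroup.mem_comap, AddSubgroup.mem_pi, Set.mem_univ, true_imp_iff,
      AddMonoidHom.mem_ker]
    rw [funext_iff]
    refine forall_congr' fun i => ?_
    exact (QuotientAddGroup.eq_zero_iff (N := (X i).addSubgroupOf (Y i)) (y i)).symm
  have hg : Function.Surjective g := fun q => by
    choose y hy using fun i => QuotientAddGroup.mk'_surjective _ (q i)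
    exact ⟨y, funext hy⟩
  rw [h2, AddSubgroup.index_ker, AddMonoidHom.range_eq_top.2 hg, ← AddSubgroup.relIndex_bot_left,
    AddSubgroup.relIndex_top_right, AddSubgroup.index_bot, Nat.card_pi]
  rfl

variable {Fq Q L : Type u} [Field Fq] [Field Q] [Algebra Fq Q] [Field L] [Algebra Fq L]

/-- The functions which vanish to order `n` at a place with uniformizer `z`. -/
def Place.vanishing (v : Place Fq Q) (z : Q) (n : ℕ) : AddSubgroup Q where
  carrier := {y | (z ^ n)⁻¹ * y ∈ v.ring}
  add_mem' := fun {x y} hx hy => by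
    rw [Set.mem_setOf_eq, mul_add]; exact v.ring.add_mem _ _ hx hy
  zero_mem' := by rw [Set.mem_setOf_eq, mul_zero]; exact v.ring.zero_mem
  neg_mem' := fun {x} hx => by
    rw [Set.mem_setOf_eq, mul_neg]; exact v.ring.neg_mem _ hx

theorem Place.mem_vanishing {v : Place Fq Q} {z : Q} {n : ℕ} {y : Q} :
    y ∈ v.vanishing z n ↔ (z ^ n)⁻¹ * y ∈ v.ring := Iff.rfl

theorem Place.vanishing_succ_le {v : Place Fq Q} {z : Q} (hz : v.IsUniformizer z) (n : ℕ) :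
    v.vanishing z (n + 1) ≤ v.vanishing z n := fun y hy => by
  rw [mem_vanishing] at hy ⊢
  have : (z ^ n)⁻¹ * y = z * ((z ^ (n + 1))⁻¹ * y) := by
    have := hz.1
    field_simp
    ring
  rw [this]
  exact mul_mem (Place.mem_of_nonunits hz.2.1) hy

/-- The residue field at a rational place is `Fq`, so the multiples of `z ^ n` by constants are a
complement of the next step of the filtration. -/
theorem Place.relIndex_vanishing_succ [Finite Fq] {v : Place Fq Q} (hv : v.IsRational) {z : Q}
    (hz : v.IsUniformizer z) (n : ℕ) :
    (v.vanishing z (n + 1)).relIndex (v.vanishing z n) = Nat.card Fq := by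
  have hz0 := hz.1
  let f : Fq →+ Q := (AddMonoidHom.mulLeft (z ^ n)).comp (algebraMap Fq Q).toAddMonoidHom
  have hf : ∀ b, f b = z ^ n * algebraMap Fq Q b := fun _ => rfl
  have hsup : v.vanishing z n = f.range ⊔ v.vanishing z (n + 1) := by
    refine le_antisymm (fun y hy => ?_) (sup_le ?_ (vanishing_succ_le hz n))
    · obtain ⟨b, hb⟩ := hv _ (mem_vanishing.1 hy)
      rw [← add_sub_cancel (f b) y]
      refine AddSubgroup.add_mem_sup ⟨b, rfl⟩ ?_
      rw [mem_vanishing, hf]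
      convert! hz.2.2 _ hb using 1
      field_simp
      ring
    · rintro _ ⟨b, rfl⟩
      rw [mem_vanishing, hf, inv_mul_cancel_left₀ (pow_ne_zero _ hz0)]
      exact v.const_mem b
  rw [hsup, AddSubgroup.relIndex_sup_right, ← AddSubgroup.inf_relIndex_right]
  have hbot : v.vanishing z (n + 1) ⊓ f.range = ⊥ := by
    rw [eq_bot_iff]
    rintro _ ⟨hy, b, rfl⟩
    rw [AddSubgroup.mem_bot]
    by_contra hb
    have hb0 : algebraMap Fq Q b ≠ 0 := fun h => hb (by rw [hf, h, mul_zero])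
    have h1 : algebraMap Fq Q b⁻¹ * ((z ^ (n + 1))⁻¹ * f b) ∈ v.ring :=
      mul_mem (v.const_mem _) hy
    have h2 : algebraMap Fq Q b⁻¹ * ((z ^ (n + 1))⁻¹ * f b) = z⁻¹ := by
      rw [hf, map_inv₀]
      field_simp
      ring
    rw [h2] at h1
    have h3 := Place.mul_mem_nonunits hz.2.1 h1
    rw [mul_inv_cancel₀ hz0] at h3
    exact Place.one_notMem_nonunits h3
  have hinj : Function.Injective f := fun a b hab =>
    (algebraMap Fq Q).injective (mul_left_cancel₀ (pow_ne_zero n hz0) hab)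
  rw [hbot, AddSubgroup.relIndex_bot_left]
  exact Nat.card_congr (AddMonoidHom.ofInjective hinj).symm.toEquiv

theorem Place.relIndex_vanishing [Finite Fq] {v : Place Fq Q} (hv : v.IsRational) {z : Q}
    (hz : v.IsUniformizer z) (n : ℕ) :
    (v.vanishing z n).relIndex (v.vanishing z 0) = Nat.card Fq ^ n := by
  have hle : ∀ n, v.vanishing z n ≤ v.vanishing z 0 := fun n => by
    induction n with
    | zero => exact le_rfl
    | succ n ih => exact (vanishing_succ_le hz n).trans ih
  induction n with
  | zero => rw [AddSubgroup.relIndex_self, pow_zero]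
  | succ n ih =>
    rw [← AddSubgroup.relIndex_mul_relIndex _ _ _ (vanishing_succ_le hz n) (hle n), ih,
      relIndex_vanishing_succ hv hz, pow_succ']

/-- The index of `z ^ k Y` in a lattice `Y` at a rational place with uniformizer `z`. -/
theorem IsLattice.relIndex_pow_smul [Finite Fq] [FiniteDimensional Fq L]
    (hQ : IsCurveFunctionField Fq Q) {V : CoeffModule Fq Q L}
    {X : Place Fq Q → Submodule L V} (hX : IsLattice X) {v : Place Fq Q} (hv : v.IsRational) {z : Q}
    (hz : v.IsUniformizer z) (k : ℕ) {N : AddSubgroup V} (hN : ∀ x, x ∈ N ↔ (z ^ k)⁻¹ • x ∈ X v) :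
    N.relIndex (X v).toAddSubgroup = Nat.card L ^ (Module.finrank (Q ⊗[Fq] L) V * k) := by
  obtain ⟨b, hb⟩ := hX.exists_basis hQ v
  obtain ⟨β, hβ⟩ := exists_basis_mem_latSpan b
  let E : V →+ (Fin (Module.finrank Fq L) × Fin (Module.finrank (Q ⊗[Fq] L) V) → Q) :=
    β.equivFun.toLinearMap.toAddMonoidHom
  have hE : ∀ x t, E x t = β.repr x t := fun _ _ => rfl
  have hEs : Function.Surjective E := β.equivFun.surjective
  have h1 : ∀ n (M : AddSubgroup V), (∀ x, x ∈ M ↔ (z ^ n)⁻¹ • x ∈ X v) →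
      M = AddSubgroup.comap E (AddSubgroup.pi Set.univ fun _ => v.vanishing z n) := by
    intro n M hM
    ext x
    rw [hM, hb, hβ]
    simp only [AddSubgroup.mem_comap, AddSubgroup.mem_pi, Set.mem_univ, true_imp_iff,
      Place.mem_vanishing, hE, map_smul, Finsupp.smul_apply, smul_eq_mul]
  rw [h1 k N hN, h1 0 (X v).toAddSubgroup (fun x => by simp), AddSubgroup.relIndex_comap,
    AddSubgroup.map_comap_eq_self_of_surjective hEs, relIndex_pi]
  simp only [Place.relIndex_vanishing hv hz, Finset.prod_const, Finset.card_univ,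
    Fintype.card_prod, Fintype.card_fin]
  rw [Module.natCard_eq_pow_finrank (K := Fq) (V := L), ← pow_mul, ← pow_mul]
  congr 1
  ring

end Index


/-! ### Index identities and the exhaustion estimate -/

section GroupIndex

variable {G H : Type*} [AddCommGroup G] [AddCommGroup H]

/-- The intermediate group `(Y ⊓ ker f) ⊔ X` splits the index into the part inside the kernel and
the part seen by the image. -/
theorem relIndex_eq_inf_ker_mul_map (f : G →+ H) {X Y : AddSubgroup G} (hXY : X ≤ Y) :
    X.relIndex Y = (X ⊓ f.ker).relIndex (Y ⊓ f.ker) * (X.map f).relIndex (Y.map f) := by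
  have h1 : X ≤ (Y ⊓ f.ker) ⊔ X := le_sup_right
  have h2 : (Y ⊓ f.ker) ⊔ X ≤ Y := sup_le inf_le_left hXY
  rw [← AddSubgroup.relIndex_mul_relIndex _ _ _ h1 h2, AddSubgroup.relIndex_sup_right,
    AddSubgroup.relIndex_map_map]
  congr 1
  · rw [← AddSubgroup.inf_relIndex_right, ← inf_assoc, inf_eq_left.2 hXY]
  · have h3 : Y ⊔ f.ker = Y ⊔ (X ⊔ f.ker) := by rw [← sup_assoc, sup_eq_left.2 hXY]
    rw [h3, AddSubgroup.relIndex_sup_right, ← AddSubgroup.inf_relIndex_right (X ⊔ f.ker) Y]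
    congr 1
    rw [sup_inf_assoc_of_le _ hXY, inf_comm, sup_comm]

theorem relIndex_eq_pow {Z : ℕ → AddSubgroup G} {ρ : ℕ} (hZ : ∀ n, Z n ≤ Z (n + 1))
    (hρ : ∀ n, (Z n).relIndex (Z (n + 1)) = ρ) (n : ℕ) : (Z 0).relIndex (Z n) = ρ ^ n := by
  have hle : ∀ n, Z 0 ≤ Z n := fun n => monotone_nat_of_le_succ hZ (Nat.zero_le n)
  induction n with
  | zero => rw [AddSubgroup.relIndex_self, pow_zero]
  | succ n ih => rw [← AddSubgroup.relIndex_mul_relIndex _ _ _ (hle n) (hZ n), ih, hρ, pow_succ]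

theorem relIndex_eq_of_map_eq {φ : G →+ G} (hφ : Function.Injective φ) {Z : ℤ → AddSubgroup G}
    (hZ : ∀ i, (Z i).map φ = Z (i + 1)) (i : ℤ) :
    (Z i).relIndex (Z (i + 1)) = (Z 0).relIndex (Z 1) := by
  have h : ∀ i, (Z (i + 1)).relIndex (Z (i + 1 + 1)) = (Z i).relIndex (Z (i + 1)) := fun i => by
    rw [← hZ (i + 1), ← hZ i, AddSubgroup.relIndex_map_map_of_injective _ _ hφ, hZ i]
  induction i using Int.induction_on with
  | zero => rfl
  | succ n ih => rw [h, ih]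
  | pred n ih =>
    rw [← ih, ← h]
    congr 2 <;> ring

/-- If `M ⊆ C` surjects onto `C / φ C` and is exhausted by finite subgroups `M ∩ X n`, then the
order of `C / φ C` is at most that of `X (n + 1) / X n`. -/
theorem relIndex_map_le_of_exhaustion {φ : G →+ G} (hφ : Function.Injective φ)
    {C M : AddSubgroup G} {X : ℕ → AddSubgroup G} (hMC : M ≤ C) (hφM : ∀ x ∈ M, φ x ∈ M)
    (hφC : ∀ x ∈ C, φ x ∈ C) (hφX : ∀ n, ∀ x ∈ X n, φ x ∈ X (n + 1)) (hX : ∀ n, X n ≤ X (n + 1))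
    (hfin : ∀ n, Finite ↥(M ⊓ X n)) (hex : ∀ x ∈ M, ∃ n, x ∈ X n)
    (hsurj : ∀ x ∈ C, ∃ m ∈ M, x - m ∈ C.map φ) (hne : (C.map φ).relIndex C ≠ 0) {ρ : ℕ}
    (hρ0 : ρ ≠ 0) (hρ : ∀ n, (X n).relIndex (X (n + 1)) = ρ) : (C.map φ).relIndex C ≤ ρ := by
  have hmono : Monotone X := monotone_nat_of_le_succ hX
  -- The quotient `C / φ C` is finite, so its finitely many representatives in `M` all lie in one `X
  -- n`.
  obtain ⟨n, hn⟩ : ∃ n, ∀ x ∈ C, ∃ m ∈ M ⊓ X n, x - m ∈ C.map φ := by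
    have : Finite (C ⧸ (C.map φ).addSubgroupOf C) :=
      (Nat.card_ne_zero.1 hne).2
    have := Fintype.ofFinite (C ⧸ (C.map φ).addSubgroupOf C)
    choose m hm1 hm2 using fun x : C => hsurj x x.2
    choose N hN using fun x : C => hex _ (hm1 x)
    refine ⟨Finset.univ.sup fun q : C ⧸ (C.map φ).addSubgroupOf C => N q.out, fun x hx => ?_⟩
    let q : C ⧸ (C.map φ).addSubgroupOf C := QuotientAddGroup.mk ⟨x, hx⟩
    refine ⟨m q.out, ⟨hm1 _, hmono (Finset.le_sup (f := fun q => N (Quotient.out q))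
      (Finset.mem_univ q)) (hN _)⟩, ?_⟩
    have h1 : -q.out + ⟨x, hx⟩ ∈ (C.map φ).addSubgroupOf C :=
      QuotientAddGroup.eq.1 (QuotientAddGroup.out_eq' q)
    have h2 : x - m q.out = (-(q.out : G) + x) + ((q.out : G) - m q.out) := by abel
    rw [h2]
    exact add_mem h1 (hm2 _)
  set H := M ⊓ X n with hH
  set H' := M ⊓ X (n + 1) with hH'
  have hHH' : H ≤ H' := inf_le_inf_left _ (hX n)
  have hφH : H.map φ ≤ H' := by
    rintro _ ⟨x, hx, rfl⟩
    exact ⟨hφM _ hx.1, hφX _ _ hx.2⟩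
  have hC : C = H' ⊔ C.map φ := by
    refine le_antisymm (fun x hx => ?_) (sup_le (inf_le_left.trans hMC) ?_)
    · obtain ⟨m, hm, hm'⟩ := hn x hx
      rw [← add_sub_cancel m x]
      exact AddSubgroup.add_mem_sup (hHH' hm) hm'
    · rintro _ ⟨x, hx, rfl⟩
      exact hφC x hx
  have hfinH : Finite H := hfin n
  have hfinH' : Finite H' := hfin (n + 1)
  have hcard : Nat.card (H.map φ) = Nat.card H :=
    Nat.card_congr (H.equivMapOfInjective φ hφ).symm.toEquiv
  -- `φ H` and `H` are subgroups of the same order in the finite group `H'`, so they have the same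
  -- index. This exchanges the cokernel of `φ` for a step of the chain.
  have h1 : (H.map φ).relIndex H' = H.relIndex H' := by
    have e1 := AddSubgroup.relIndex_mul_relIndex ⊥ (H.map φ) H' bot_le hφH
    have e2 := AddSubgroup.relIndex_mul_relIndex ⊥ H H' bot_le hHH'
    rw [AddSubgroup.relIndex_bot_left, AddSubgroup.relIndex_bot_left] at e1 e2
    rw [hcard, ← e2] at e1
    exact Nat.eq_of_mul_eq_mul_left Nat.card_pos e1
  have h0 : (H.map φ).relIndex H' ≠ 0 := by
    intro h
    have := AddSubgroup.relIndex_mul_relIndex ⊥ (H.map φ) H' bot_le hφH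
    rw [h, mul_zero, AddSubgroup.relIndex_bot_left] at this
    exact Nat.card_pos.ne this
  calc (C.map φ).relIndex C = (C.map φ).relIndex (H' ⊔ C.map φ) := by rw [← hC]
    _ = (C.map φ).relIndex H' := AddSubgroup.relIndex_sup_right _ _
    _ ≤ (H.map φ).relIndex H' :=
        AddSubgroup.relIndex_le_of_le_left (AddSubgroup.map_mono (inf_le_left.trans hMC)) h0
    _ = H.relIndex H' := h1
    _ = (X n ⊓ H').relIndex H' := by
        congr 1
        rw [hH, hH', inf_left_comm, inf_eq_left.2 (hX n)]
    _ = (X n).relIndex H' := AddSubgroup.inf_relIndex_right _ _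
    _ ≤ (X n).relIndex (X (n + 1)) :=
        AddSubgroup.relIndex_le_of_le_right inf_le_right (by rw [hρ]; exact hρ0)
    _ = ρ := hρ n

end GroupIndex

/-! ### Indices and dimensions over a finite field -/

section SubspaceIndex

variable {L : Type u} [Field L] [Finite L] {V : Type u} [AddCommGroup V] [Module L V]

/-- The index of a subspace in another one. -/
noncomputable abbrev relIdx (X Y : Submodule L V) : ℕ := X.toAddSubgroup.relIndex Y.toAddSubgroup

omit [Finite L] in
theorem relIdx_eq_card (X Y : Submodule L V) : relIdx X Y = Nat.card (Y ⧸ X.submoduleOf Y) := rfl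

theorem exists_relIdx_eq_pow {X Y : Submodule L V} (h : relIdx X Y ≠ 0) :
    ∃ d, relIdx X Y = Nat.card L ^ d := by
  rw [relIdx_eq_card] at h ⊢
  have := (Nat.card_ne_zero.1 h).2
  exact ⟨_, Module.natCard_eq_pow_finrank (K := L)⟩

theorem rank_eq_iff_relIdx_eq {X Y : Submodule L V} {d : ℕ} :
    Module.rank L (Y ⧸ X.submoduleOf Y) = d ↔ relIdx X Y = Nat.card L ^ d := by
  rw [relIdx_eq_card]
  have h2 : 1 < Nat.card L := Finite.one_lt_card
  constructor
  · intro h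
    have : Module.Finite L (Y ⧸ X.submoduleOf Y) := by
      rw [← Module.rank_lt_aleph0_iff, h]; exact Cardinal.natCast_lt_aleph0
    rw [Module.natCard_eq_pow_finrank (K := L), Module.finrank_eq_of_rank_eq h]
  · intro h
    have h0 : Nat.card (Y ⧸ X.submoduleOf Y) ≠ 0 := by
      rw [h]; exact pow_ne_zero _ (by omega)
    have := (Nat.card_ne_zero.1 h0).2
    rw [Module.natCard_eq_pow_finrank (K := L)] at h
    rw [← Module.finrank_eq_rank, Nat.pow_right_injective h2 h]

end SubspaceIndex


/-! ### τ-sheaves as chains of lattices in a single space -/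

section Good

variable {Fq Q L : Type u} [Field Fq] [Fintype Fq] [Field Q] [Algebra Fq Q] [Field L] [Algebra Fq L]
  [Finite L] {V U : CoeffModule Fq Q L}

/-- The image of an `L`-subspace under a semilinear map. -/
def semiImage (φ : V →ₛₗ[sigma Fq Q L] U) (N : Submodule L V) : Submodule L U where
  carrier := φ '' N
  add_mem' := by
    rintro _ _ ⟨x, hx, rfl⟩ ⟨y, hy, rfl⟩
    exact ⟨x + y, N.add_mem hx hy, map_add φ x y⟩
  zero_mem' := ⟨0, N.zero_mem, map_zero φ⟩
  smul_mem' := by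
    rintro a _ ⟨x, hx, rfl⟩
    obtain ⟨b, hb⟩ := frobenius_surjective (Fq := Fq) 1 a
    refine ⟨b • x, N.smul_mem b hx, ?_⟩
    rw [semi_right_smul, ← hb, pow_one]

theorem span_image_eq_semiImage (φ : V →ₛₗ[sigma Fq Q L] U) (N : Submodule L V) :
    Submodule.span L (φ '' (N : Set V)) = semiImage φ N :=
  (Submodule.span_eq (semiImage φ N))

/-- The generators of the ideal of the graph of a characteristic. -/
def graphElt (c : Characteristic Fq Q L) (a : c.place.ring) : Q ⊗[Fq] L :=
  (a : Q) ⊗ₜ[Fq] (1 : L) - (1 : Q) ⊗ₜ[Fq] c.hom a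

theorem graphElt_smul (c : Characteristic Fq Q L) (a : c.place.ring) (x : V) :
    graphElt c a • x = (a : Q) • x - c.hom a • x := by
  rw [graphElt, sub_smul]; rfl

/-- An abelian `τ`-sheaf all of whose sheaves have the same generic fibre `V` and for which the
maps `Π_i` are the inclusions. -/
structure Good (φ : V →ₛₗ[sigma Fq Q L] V) (X : ℤ → Place Fq Q → Submodule L V)
    (inf : Place Fq Q) (c : Characteristic Fq Q L) (k l d : ℕ) : Prop where
  lat : ∀ i, IsLattice (X i)
  phi_injective : Function.Injective φ
  mono : ∀ i v, X i v ≤ X (i + 1) v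
  phi_mem : ∀ i v, ∀ x ∈ X i v, φ x ∈ X (i + 1) v
  k_pos : 0 < k
  l_pos : 0 < l
  slope : l * d = k * Module.finrank (Q ⊗[Fq] L) V
  away : ∀ i v, v ≠ inf → X (i + l) v ≤ X i v
  periodic : ∀ i z, inf.IsUniformizer z → ∀ x, x ∈ X i inf ↔ (z ^ k)⁻¹ • x ∈ X (i + l) inf
  dim_pi : ∀ i, relIdx (X i inf) (X (i + 1) inf) = Nat.card L ^ d
  dim_tau : ∀ i, relIdx (semiImage φ (X i c.place)) (X (i + 1) c.place) = Nat.card L ^ d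
  tau_away : ∀ i v, v ≠ c.place → X (i + 1) v ≤ semiImage φ (X i v)
  -- The exponent is left open, because the dimension of a quotient is not known beforehand; the
  -- exponent `d` is recovered by `prod_smul_mem_of_nilpotent`.
  graph : ∃ m, ∀ n ≥ m, ∀ i, ∀ a : Fin n → c.place.ring, ∀ x ∈ X (i + 1) c.place,
    (∏ j, graphElt c (a j)) • x ∈ semiImage φ (X i c.place)

namespace Good

variable {φ : V →ₛₗ[sigma Fq Q L] V} {X : ℤ → Place Fq Q → Submodule L V}
    {inf : Place Fq Q} {c : Characteristic Fq Q L} {k l d : ℕ}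

theorem mono_add (h : Good φ X inf c k l d) (i : ℤ) (n : ℕ) (v : Place Fq Q) :
    X i v ≤ X (i + n) v := by
  induction n with
  | zero => simp
  | succ n ih =>
    refine ih.trans ((h.mono _ v).trans ?_)
    rw [Nat.cast_succ, add_assoc]

theorem away_succ (h : Good φ X inf c k l d) (i : ℤ) {v : Place Fq Q} (hv : v ≠ inf) :
    X (i + 1) v = X i v := by
  refine le_antisymm (le_trans ?_ (h.away i v hv)) (h.mono i v)
  have := h.mono_add (i + 1) (l - 1) v
  rwa [Nat.cast_sub h.l_pos, Nat.cast_one, add_assoc, add_sub_cancel] at this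

theorem away_eq (h : Good φ X inf c k l d) (i : ℤ) {v : Place Fq Q} (hv : v ≠ inf) :
    X i v = X 0 v := by
  induction i using Int.induction_on with
  | zero => rfl
  | succ n ih => rw [h.away_succ _ hv, ih]
  | pred n ih => rw [← ih, ← h.away_succ _ hv, sub_add_cancel]

theorem periodic_iterate (h : Good φ X inf c k l d) {z : Q} (hz : inf.IsUniformizer z) (n : ℕ)
    (i : ℤ) (x : V) : x ∈ X i inf ↔ (z ^ (k * n))⁻¹ • x ∈ X (i + l * n) inf := by
  induction n with
  | zero => simp
  | succ n ih =>
    rw [ih, h.periodic _ z hz, smul_smul, ← mul_inv, ← pow_add, Nat.cast_succ]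
    have e1 : k + k * n = k * (n + 1) := by ring
    have e2 : i + l * n + l = i + l * (n + 1 : ℤ) := by ring
    rw [e1, e2]

variable (hQ : IsCurveFunctionField Fq Q)

-- A high power of the uniformizer carries `x` into `X 0`, and periodicity trades that power for a
-- shift of the index.
include hQ in
theorem exists_mem_inf (h : Good φ X inf c k l d) (x : V) : ∃ n : ℕ, x ∈ X n inf := by
  obtain ⟨z, hz⟩ := Place.exists_uniformizer hQ inf
  obtain ⟨m, hm⟩ := (h.lat 0).exists_pow_smul_mem hQ hz.2.1 hz.1 x
  refine ⟨l * m, ?_⟩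
  have h1 := hm (k * m) (Nat.le_mul_of_pos_left m h.k_pos)
  rw [h.periodic_iterate hz m, smul_smul, inv_mul_cancel₀ (pow_ne_zero _ hz.1), one_smul,
    zero_add] at h1
  exact_mod_cast h1

theorem semiImage_le (h : Good φ X inf c k l d) (i : ℤ) (v : Place Fq Q) :
    semiImage φ (X i v) ≤ X (i + 1) v := by
  rintro _ ⟨x, hx, rfl⟩
  exact h.phi_mem i v x hx

theorem semiImage_eq (h : Good φ X inf c k l d) (i : ℤ) {v : Place Fq Q} (hv : v ≠ c.place) :
    semiImage φ (X i v) = X (i + 1) v :=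
  le_antisymm (h.semiImage_le i v) (h.tau_away i v hv)

include hQ in
/-- A multiple of a section near a point `v ≠ ∞` by a function which does not vanish at `v` extends
to the complement of `∞`. -/
theorem exists_smul_mem_of_mem (hinf : inf.IsRational) {Y : Place Fq Q → Submodule L V}
    (hY : IsLattice Y) {v : Place Fq Q} (hv : v ≠ inf) {x : V} (hx : x ∈ Y v) :
    ∃ s ∈ affineRing inf, s ∉ v.ring.nonunits ∧ ∀ w ≠ inf, s • x ∈ Y w := by
  classical
  have hbad := hY.finite_notMem hQ x
  obtain ⟨s, hs, hsv, hsT⟩ := exists_affine_separate hQ hinf hv (hbad.toFinset.erase inf)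
    (fun h => (Set.Finite.mem_toFinset hbad).1 (Finset.mem_of_mem_erase h) hx) (by simp)
  have hs0 : s ≠ 0 := (Place.notMem_nonunits hsv).1
  have hex : ∀ w ∈ hbad.toFinset.erase inf, ∃ N : ℕ, ∀ n ≥ N, s ^ n • x ∈ Y w := fun w hw =>
    hY.exists_pow_smul_mem hQ (hsT w hw) hs0 x
  choose! N hN using hex
  set n := (hbad.toFinset.erase inf).sup N
  refine ⟨s ^ n, pow_mem hs n, fun h => ?_, fun w hw => ?_⟩
  · clear_value n
    induction n with
    | zero => exact Place.one_notMem_nonunits (by simpa using h)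
    | succ n ih =>
      rw [pow_succ] at h
      rcases Place.mem_or_mem_nonunits (pow_mem (hs v hv) n) (hs v hv) h with h | h
      · exact ih h
      · exact hsv h
  · by_cases hwT : w ∈ hbad.toFinset.erase inf
    · exact hN w hwT n (Finset.le_sup hwT)
    · have : x ∈ Y w := by
        by_contra hne
        exact hwT (Finset.mem_erase.2 ⟨hw, (Set.Finite.mem_toFinset hbad).2 hne⟩)
      exact hY.smul_mem (pow_mem (hs w hw) n) this

include hQ in
/-- Sections over the complement of `∞` generate the cokernel of `τ`. -/
theorem exists_section (h : Good φ X inf c k l d) (hinf : inf.IsRational) (hc : c.place ≠ inf)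
    {x : V} (hx : x ∈ X 0 c.place) :
    ∃ t : Q, (∀ w ≠ inf, t • x ∈ X 0 w) ∧ ∃ y ∈ X 0 c.place, φ y = x - t • x := by
  obtain ⟨s, hsA, hsc, hs⟩ := exists_smul_mem_of_mem hQ hinf (h.lat 0) hc hx
  obtain ⟨m, hm⟩ := h.graph
  have hsr : s ∈ c.place.ring := hsA _ hc
  obtain ⟨hs0, hsi⟩ := Place.notMem_nonunits hsc
  have hhom : c.hom ⟨s, hsr⟩ ≠ 0 := fun h0 => by
    have h1 : (⟨s, hsr⟩ : c.place.ring) * ⟨s⁻¹, hsi⟩ = 1 := Subtype.ext (mul_inv_cancel₀ hs0)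
    have h2 := congrArg c.hom h1
    rw [map_mul, h0, zero_mul, map_one] at h2
    exact zero_ne_one h2
  have := Fintype.ofFinite L
  -- Since `c.hom s` is a non-zero element of the finite field `L`, its `N`-th power is one. Hence
  -- the generator of the graph ideal given by `s ^ N` is `(s ^ N - 1) ⊗ 1`, which comes from `Q`.
  set N := Fintype.card L - 1 with hNdef
  have hN1 : 0 < N := Nat.sub_pos_of_lt Fintype.one_lt_card
  have hpow : c.hom (⟨s, hsr⟩ ^ N) = 1 := by
    rw [map_pow]; exact FiniteField.pow_card_sub_one_eq_one _ hhom
  -- This `t` is divisible by `s` in `A`, so `t • x` is a section outside `inf`, while `x - t • x =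
  -- (1 - s ^ N) ^ m • x` is in the image of `φ` by the graph condition. That `t` is a scalar in `Q`
  -- matters: it preserves kernels of linear maps.
  refine ⟨1 - (1 - s ^ N) ^ m, fun w hw => ?_, ?_⟩
  · have hd : (⟨s, hsA⟩ : affineRing inf) ∣ 1 - (1 - ⟨s, hsA⟩ ^ N) ^ m := by
      refine (dvd_pow_self _ hN1.ne').trans ?_
      have := sub_dvd_pow_sub_pow (1 : affineRing inf) (1 - ⟨s, hsA⟩ ^ N) m
      rwa [sub_sub_cancel, one_pow] at this
    obtain ⟨p, hp⟩ := hd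
    have hp' : 1 - (1 - s ^ N) ^ m = p * s := by
      have := congrArg (Subtype.val) hp
      rw [mul_comm] at this
      simpa using this
    rw [hp', mul_smul]
    exact (h.lat 0).smul_mem (p.2 w hw) (hs w hw)
  · have h1 := hm m le_rfl 0 (fun _ => ⟨s, hsr⟩ ^ N) ((-1 : Q) ^ m • x) (by
      rw [h.away_succ 0 hc]
      exact (h.lat 0).smul_mem (pow_mem (neg_mem (one_mem _)) m) hx)
    obtain ⟨y, hy, hyx⟩ := h1
    refine ⟨y, hy, hyx.trans ?_⟩
    have h2 : graphElt c (⟨s, hsr⟩ ^ N) = (s ^ N - 1) ⊗ₜ[Fq] (1 : L) := by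
      rw [graphElt, hpow, TensorProduct.sub_tmul]; rfl
    rw [Finset.prod_const, Finset.card_univ, Fintype.card_fin, h2, Algebra.TensorProduct.tmul_pow,
      one_pow, ← CoeffModule.left_smul_def, smul_smul, ← mul_pow, sub_smul, one_smul,
      sub_sub_cancel]
    congr 2
    ring

end Good

end Good


/-! ### Quotients of abelian τ-sheaves -/

section Quotient

variable {Fq Q L : Type u} [Field Fq] [Fintype Fq] [Field Q] [Algebra Fq Q] [Field L] [Algebra Fq L]
  [Finite L] {V U : CoeffModule Fq Q L}

theorem AddSubgroup.map_inf_ker_of_semiconj {G H : Type*} [AddCommGroup G] [AddCommGroup H]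
    {φ : G →+ G} {f : G →+ H} (hker : ∀ x, f (φ x) = 0 ↔ f x = 0) (N : AddSubgroup G) :
    (N ⊓ f.ker).map φ = N.map φ ⊓ f.ker := by
  ext y
  constructor
  · rintro ⟨x, ⟨hx, hx'⟩, rfl⟩
    exact ⟨⟨x, hx, rfl⟩, (hker x).2 hx'⟩
  · rintro ⟨⟨x, hx, rfl⟩, hy⟩
    exact ⟨x, ⟨hx, (hker x).1 hy⟩, rfl⟩

/-- The sections over the complement of `∞`. -/
def sectionsAway (inf : Place Fq Q) (Y : Place Fq Q → Submodule L V) : Submodule L V :=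
  ⨅ w : {w : Place Fq Q // w ≠ inf}, Y w

theorem mem_sectionsAway {inf : Place Fq Q} {Y : Place Fq Q → Submodule L V} {x : V} :
    x ∈ sectionsAway inf Y ↔ ∀ w ≠ inf, x ∈ Y w := by
  simp [sectionsAway]

namespace Good

variable {φ : V →ₛₗ[sigma Fq Q L] V} {X : ℤ → Place Fq Q → Submodule L V}
    {inf : Place Fq Q} {c : Characteristic Fq Q L} {k l d : ℕ}
    (hQ : IsCurveFunctionField Fq Q)

include hQ in
/-- The dimension is determined by the rank. -/
theorem slope_of_periodic (hinf : inf.IsRational) (hlat : ∀ i, IsLattice (X i))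
    (hmono : ∀ i v, X i v ≤ X (i + 1) v)
    (hper : ∀ i z, inf.IsUniformizer z → ∀ x, x ∈ X i inf ↔ (z ^ k)⁻¹ • x ∈ X (i + l) inf)
    (hdim : ∀ i, relIdx (X i inf) (X (i + 1) inf) = Nat.card L ^ d) :
    l * d = k * Module.finrank (Q ⊗[Fq] L) V := by
  obtain ⟨z, hz⟩ := Place.exists_uniformizer hQ inf
  have hfd : FiniteDimensional Fq L := Module.Finite.of_finite
  -- The index of `X 0` in `X l` at `inf` is computed twice: as `l` steps of index `#L ^ d`, and as
  -- the index of `z ^ k • X l` in `X l`.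
  have h1 := relIndex_eq_pow (Z := fun n : ℕ => (X n inf).toAddSubgroup)
    (fun n x hx => by simpa using hmono n inf hx) (fun n => by simpa using hdim n) l
  have h2 := (hlat (0 + l)).relIndex_pow_smul hQ hinf hz k (N := (X 0 inf).toAddSubgroup)
    (hper 0 z hz)
  rw [zero_add] at h2
  rw [Nat.cast_zero, h2, ← pow_mul] at h1
  have := Nat.pow_right_injective Finite.one_lt_card h1
  rw [mul_comm k, this, mul_comm]

include hQ in
/-- The order of the cokernel of `τ` is at most that of the cokernel of `Π`. -/
theorem relIndex_map_le (hinf : inf.IsRational) {Y : ℤ → Place Fq Q → Submodule L U}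
    {ψ : U →ₛₗ[sigma Fq Q L] U} (hψ : Function.Injective ψ) (hlat : ∀ i, IsLattice (Y i))
    (hmono : ∀ i v, Y i v ≤ Y (i + 1) v) (hψY : ∀ i v, ∀ x ∈ Y i v, ψ x ∈ Y (i + 1) v)
    (haway : ∀ i v, v ≠ inf → Y i v = Y 0 v) (hex : ∀ x, ∃ n : ℕ, x ∈ Y n inf)
    (hc : c.place ≠ inf) {K : AddSubgroup U} (hK : ∀ x ∈ K, ψ x ∈ K)
    (hsurj : ∀ x ∈ Y 0 c.place, x ∈ K → ∃ m, m ∈ K ∧ (∀ w ≠ inf, m ∈ Y 0 w) ∧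
      ∃ y ∈ Y 0 c.place, y ∈ K ∧ ψ y = x - m)
    (hne : (((Y 0 c.place).toAddSubgroup ⊓ K).map ψ.toAddMonoidHom).relIndex
      ((Y 0 c.place).toAddSubgroup ⊓ K) ≠ 0)
    {ρ : ℕ} (hρ0 : ρ ≠ 0) (hρ : ∀ i, ((Y i inf).toAddSubgroup ⊓ K).relIndex
      ((Y (i + 1) inf).toAddSubgroup ⊓ K) = ρ) :
    (((Y 0 c.place).toAddSubgroup ⊓ K).map ψ.toAddMonoidHom).relIndex
      ((Y 0 c.place).toAddSubgroup ⊓ K) ≤ ρ := by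
  have hfd : FiniteDimensional Fq L := Module.Finite.of_finite
  have hA : ∀ w ≠ inf, ∀ x ∈ Y 0 w, ψ x ∈ Y 0 w := fun w hw x hx => by
    rw [← haway (0 + 1) w hw]
    exact hψY 0 w x hx
  have hcast : ∀ n : ℕ, Y ((n + 1 : ℕ) : ℤ) = Y ((n : ℤ) + 1) := fun n => by rw [Nat.cast_succ]
  -- Here `C` is the stalk at the characteristic point, `M` the sections outside `inf` and `X n` the
  -- stalks at `inf`, all cut down to `K`. The groups `M ⊓ X n` are finite because they consist of
  -- global sections.
  refine relIndex_map_le_of_exhaustion (φ := ψ.toAddMonoidHom) hψ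
    (C := (Y 0 c.place).toAddSubgroup ⊓ K)
    (M := (sectionsAway inf (Y 0)).toAddSubgroup ⊓ K)
    (X := fun n : ℕ => (Y n inf).toAddSubgroup ⊓ K) ?_ ?_ ?_ ?_ ?_ ?_ ?_ ?_ hne hρ0 ?_
  · exact fun x hx => ⟨mem_sectionsAway.1 hx.1 _ hc, hx.2⟩
  · exact fun x hx => ⟨mem_sectionsAway.2 fun w hw => hA w hw x (mem_sectionsAway.1 hx.1 w hw),
      hK x hx.2⟩
  · exact fun x hx => ⟨hA _ hc x hx.1, hK x hx.2⟩
  · intro n x hx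
    simp only [hcast]
    exact ⟨hψY n inf x hx.1, hK x hx.2⟩
  · intro n
    simp only [hcast]
    exact inf_le_inf_right _ (hmono n inf)
  · refine fun n => ((hlat n).finite_global hQ hinf).subset fun x hx v => ?_
    by_cases hv : v = inf
    · rw [hv]; exact hx.2.1
    · rw [haway n v hv]; exact mem_sectionsAway.1 hx.1.1 v hv
  · intro x hx
    obtain ⟨n, hn⟩ := hex x
    exact ⟨n, hn, hx.2⟩
  · intro x hx
    obtain ⟨m, hm, hm', y, hy, hyK, hyx⟩ := hsurj x hx.1 hx.2
    exact ⟨m, ⟨mem_sectionsAway.2 hm', hm⟩, y, ⟨hy, hyK⟩, hyx⟩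
  · intro n
    simp only [hcast]
    exact hρ n

include hQ in
/-- A quotient of an abelian `τ`-sheaf of characteristic different from `∞` by a stable subspace of
the generic fibre is an abelian `τ`-sheaf. -/
theorem map (hinf : inf.IsRational) (h : Good φ X inf c k l d) (hc : c.place ≠ inf)
    {ψ : U →ₛₗ[sigma Fq Q L] U} {f : V →ₗ[Q ⊗[Fq] L] U} (hf : Function.Surjective f)
    (hfφ : ∀ x, f (φ x) = ψ (f x)) :
    ∃ d', Good ψ (fun i v => (X i v).map (CoeffModule.linL f)) inf c k l d' := by
  have hfd : FiniteDimensional Fq L := Module.Finite.of_finite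
  have hfin := (h.lat 0).finite
  have hW : IsStable φ (LinearMap.ker f) := fun x hx => by
    rw [LinearMap.mem_ker] at hx ⊢
    rw [hfφ, hx, map_zero]
  have hker : ∀ x, f (φ x) = 0 ↔ f x = 0 := fun x =>
    ⟨fun hx => hW.exists_mem h.phi_injective hx, fun hx => hW x hx⟩
  have hψ : Function.Injective ψ := by
    refine (injective_iff_map_eq_zero _).2 fun y hy => ?_
    obtain ⟨x, rfl⟩ := hf y
    rw [← hfφ] at hy
    exact (hker x).1 hy
  let p : V →+ V := φ.toAddMonoidHom
  let p' : U →+ U := ψ.toAddMonoidHom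
  let g : V →+ U := f.toAddMonoidHom
  have hpk : ∀ x, g (p x) = 0 ↔ g x = 0 := hker
  have hpi : Function.Injective p := h.phi_injective
  have hpi' : Function.Injective p' := hψ
  have hgp : ∀ N : AddSubgroup V, (N.map g).map p' = (N.map p).map g := fun N => by
    rw [AddSubgroup.map_map, AddSubgroup.map_map]
    congr 1
    ext x
    exact (hfφ x).symm
  let Z : ℤ → AddSubgroup V := fun i => (X i inf).toAddSubgroup
  -- The characteristic differs from `inf`, so `φ` carries each stalk at `inf` onto the next. The
  -- indices on the kernel and on the image are therefore the same at every step of the chain.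
  have hZ : ∀ i, (Z i).map p = Z (i + 1) := fun i =>
    congrArg Submodule.toAddSubgroup (h.semiImage_eq i (Ne.symm hc))
  have hmonoZ : ∀ i, Z i ≤ Z (i + 1) := fun i => h.mono i inf
  have hZW := relIndex_eq_of_map_eq hpi (Z := fun i => Z i ⊓ g.ker) fun i => by
    rw [AddSubgroup.map_inf_ker_of_semiconj hpk, hZ]
  have hZU := relIndex_eq_of_map_eq hpi' (Z := fun i => (Z i).map g) fun i => by
    rw [hgp, hZ]
  set ρW := (Z 0 ⊓ g.ker).relIndex (Z 1 ⊓ g.ker)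
  set ρU := ((Z 0).map g).relIndex ((Z 1).map g)
  -- Both for the inclusions at `inf` and for `φ` at the characteristic point, the index `#L ^ d`
  -- factors into the contributions of kernel and image.
  have hρ : ρW * ρU = Nat.card L ^ d := by
    rw [← relIndex_eq_inf_ker_mul_map g (by simpa using hmonoZ 0)]
    simpa using h.dim_pi 0
  have hpos : Nat.card L ^ d ≠ 0 := pow_ne_zero _ Nat.card_pos.ne'
  have hρW : ρW ≠ 0 := fun h0 => hpos (by rw [← hρ, h0, zero_mul])
  have hρU : ρU ≠ 0 := fun h0 => hpos (by rw [← hρ, h0, mul_zero])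
  let C : AddSubgroup V := (X 0 c.place).toAddSubgroup
  have hpC : C.map p ≤ C := by
    have := h.semiImage_le 0 c.place
    rwa [h.away_succ 0 hc] at this
  have hα : (C.map p ⊓ g.ker).relIndex (C ⊓ g.ker) * ((C.map g).map p').relIndex (C.map g) =
      Nat.card L ^ d := by
    rw [hgp, ← relIndex_eq_inf_ker_mul_map g hpC]
    have := h.dim_tau 0
    rwa [h.away_succ 0 hc] at this
  rw [← AddSubgroup.map_inf_ker_of_semiconj hpk] at hα
  have hαW : ((C ⊓ g.ker).map p).relIndex (C ⊓ g.ker) ≠ 0 := fun h0 => hpos (by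
    rw [← hα, h0, zero_mul])
  have hαU : ((C.map g).map p').relIndex (C.map g) ≠ 0 := fun h0 => hpos (by
    rw [← hα, h0, mul_zero])
  have hW_le : ((C ⊓ g.ker).map p).relIndex (C ⊓ g.ker) ≤ ρW := by
    refine relIndex_map_le hQ hinf h.phi_injective h.lat h.mono h.phi_mem
      (fun i v hv => h.away_eq i hv) (h.exists_mem_inf hQ) hc (fun x hx => (hpk x).2 hx)
      (fun x hx hxK => ?_) hαW hρW hZW
    obtain ⟨t, ht, y, hy, hyx⟩ := h.exists_section hQ hinf hc hx
    have hfx : f x = 0 := hxK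
    have htx : f (t • x) = 0 := by rw [CoeffModule.map_left_smul, hfx, smul_zero]
    refine ⟨t • x, htx, ht, y, hy, (hker y).1 ?_, hyx⟩
    rw [hyx, map_sub, hfx, htx, sub_zero]
  have hU_le : ((C.map g).map p').relIndex (C.map g) ≤ ρU := by
    have := relIndex_map_le hQ hinf (Y := fun i v => (X i v).map (CoeffModule.linL f)) hψ
      (fun i => (h.lat i).map hf) (fun i v => Submodule.map_mono (h.mono i v)) ?_
      (fun i v hv => by rw [h.away_eq i hv]) (fun y => ?_) hc (K := ⊤) (fun _ _ => trivial) ?_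
      (by rw [inf_top_eq]; exact hαU) hρU (fun i => by rw [inf_top_eq, inf_top_eq]; exact hZU i)
    · rw [inf_top_eq] at this
      exact this
    · rintro i v _ ⟨x, hx, rfl⟩
      exact ⟨φ x, h.phi_mem i v x hx, hfφ x⟩
    · obtain ⟨x, rfl⟩ := hf y
      obtain ⟨n, hn⟩ := h.exists_mem_inf hQ x
      exact ⟨n, x, hn, rfl⟩
    · rintro _ ⟨x, hx, rfl⟩ -
      obtain ⟨t, ht, y, hy, hyx⟩ := h.exists_section hQ hinf hc hx
      refine ⟨f (t • x), trivial, fun w hw => ⟨t • x, ht w hw, rfl⟩, f y, ⟨y, hy, rfl⟩,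
        trivial, ?_⟩
      rw [← hfφ, hyx, map_sub]
      rfl
  -- Two factorizations of the same number in which each factor on one side is at most its
  -- counterpart: the factors agree.
  have hαρ : ((C.map g).map p').relIndex (C.map g) = ρU := by
    refine le_antisymm hU_le (Nat.le_of_mul_le_mul_left ?_ (Nat.pos_of_ne_zero hρW))
    rw [hρ, ← hα]
    exact Nat.mul_le_mul_right _ hW_le
  obtain ⟨d', hd'⟩ : ∃ d', ρU = Nat.card L ^ d' :=
    exists_relIdx_eq_pow (X := (X 0 inf).map (CoeffModule.linL f))
      (Y := (X 1 inf).map (CoeffModule.linL f)) hρU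
  have hlat : ∀ i, IsLattice fun v => (X i v).map (CoeffModule.linL f) := fun i => (h.lat i).map hf
  have hmono : ∀ i v, (X i v).map (CoeffModule.linL f) ≤ (X (i + 1) v).map (CoeffModule.linL f) :=
    fun i v => Submodule.map_mono (h.mono i v)
  have hper : ∀ i z, inf.IsUniformizer z → ∀ x, x ∈ (X i inf).map (CoeffModule.linL f) ↔
      (z ^ k)⁻¹ • x ∈ (X (i + l) inf).map (CoeffModule.linL f) := fun i z hz y => by
    constructor
    · rintro ⟨x, hx, rfl⟩
      exact ⟨(z ^ k)⁻¹ • x, (h.periodic i z hz x).1 hx, CoeffModule.map_left_smul f _ x⟩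
    · rintro ⟨x, hx, hxy⟩
      refine ⟨z ^ k • x, (h.periodic i z hz _).2 ?_, ?_⟩
      · rwa [smul_smul, inv_mul_cancel₀ (pow_ne_zero _ hz.1), one_smul]
      · rw [CoeffModule.linL_apply] at hxy ⊢
        rw [CoeffModule.map_left_smul, hxy, smul_smul, mul_inv_cancel₀ (pow_ne_zero _ hz.1),
          one_smul]
  have hdim : ∀ i, relIdx ((X i inf).map (CoeffModule.linL f))
      ((X (i + 1) inf).map (CoeffModule.linL f)) = Nat.card L ^ d' := fun i => (hZU i).trans hd'
  refine ⟨d', hlat, hψ, hmono, ?_, h.k_pos, h.l_pos,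
    slope_of_periodic hQ hinf hlat hmono hper hdim, fun i v hv => Submodule.map_mono (h.away i v hv),
    hper, hdim, fun i => ?_, ?_, ?_⟩
  · rintro i v _ ⟨x, hx, rfl⟩
    exact ⟨φ x, h.phi_mem i v x hx, hfφ x⟩
  · rw [h.away_eq i hc, h.away_eq (i + 1) hc]
    exact hαρ.trans hd'
  · rintro i v hv _ ⟨x, hx, rfl⟩
    obtain ⟨y, hy, rfl⟩ := h.tau_away i v hv hx
    exact ⟨f y, ⟨y, hy, rfl⟩, (hfφ y).symm⟩
  · obtain ⟨m, hm⟩ := h.graph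
    refine ⟨m, ?_⟩
    rintro n hn i a _ ⟨x, hx, rfl⟩
    obtain ⟨y, hy, hyx⟩ := hm n hn i a x hx
    refine ⟨f y, ⟨y, hy, rfl⟩, ?_⟩
    rw [← hfφ, hyx, map_smul]
    rfl

end Good

end Quotient


/-! ### Direct sums and base changes of chains -/

section Sums

variable {Fq Q L : Type u} [Field Fq] [Fintype Fq] [Field Q] [Algebra Fq Q] [Field L] [Algebra Fq L]
  [Finite L]

section Pi

variable {n : ℕ} {U : Fin n → CoeffModule Fq Q L}

omit [Fintype Fq] [Finite L] in
theorem relIdx_piSub (N N' : ∀ j, Submodule L (U j)) :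
    relIdx (piSub N) (piSub N') = ∏ j, relIdx (N j) (N' j) := by
  let E : CoeffModule.pi U →+ ∀ j, U j :=
    { toFun := fun x => x, map_zero' := rfl, map_add' := fun _ _ => rfl }
  have hE : Function.Surjective E := fun x => ⟨x, rfl⟩
  have h : ∀ N : ∀ j, Submodule L (U j), (piSub N).toAddSubgroup = AddSubgroup.comap E
      (AddSubgroup.pi Set.univ fun j => (N j).toAddSubgroup) := fun N => by
    ext x
    exact ⟨fun h j _ => h j, fun h j => h j trivial⟩
  rw [relIdx, h, h, AddSubgroup.relIndex_comap, AddSubgroup.map_comap_eq_self_of_surjective hE,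
    relIndex_pi]

theorem semiImage_piSub {φ : ∀ j, U j →ₛₗ[sigma Fq Q L] U j}
    {ψ : CoeffModule.pi U →ₛₗ[sigma Fq Q L] CoeffModule.pi U} (hψ : ∀ x j, ψ x j = φ j (x j))
    (N : ∀ j, Submodule L (U j)) :
    semiImage ψ (piSub N) = piSub fun j => semiImage (φ j) (N j) := by
  ext y
  constructor
  · rintro ⟨x, hx, rfl⟩ j
    exact ⟨x j, hx j, (hψ x j).symm⟩
  · intro hy
    choose x hx hxy using hy
    exact ⟨x, hx, funext fun j => (hψ x j).trans (hxy j)⟩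

/-- Direct sums of abelian `τ`-sheaves with the same period and slope. -/
theorem Good.pi (hQ : IsCurveFunctionField Fq Q) {φ : ∀ j, U j →ₛₗ[sigma Fq Q L] U j}
    {X : ∀ j, ℤ → Place Fq Q → Submodule L (U j)} {inf : Place Fq Q} {c : Characteristic Fq Q L}
    {k l : ℕ} {d : Fin n → ℕ} (hinf : inf.IsRational)
    (h : ∀ j, Good (φ j) (X j) inf c k l (d j)) (hk : 0 < k) (hl : 0 < l)
    {ψ : CoeffModule.pi U →ₛₗ[sigma Fq Q L] CoeffModule.pi U} (hψ : ∀ x j, ψ x j = φ j (x j)) :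
    Good ψ (fun i v => piSub fun j => X j i v) inf c k l (∑ j, d j) := by
  have hlat : ∀ i, IsLattice fun v => piSub fun j => X j i v := fun i =>
    IsLattice.pi fun j => (h j).lat i
  have hmono : ∀ i v, piSub (fun j => X j i v) ≤ piSub fun j => X j (i + 1) v :=
    fun i v x hx j => (h j).mono i v (hx j)
  have hper : ∀ i z, inf.IsUniformizer z → ∀ x, x ∈ piSub (fun j => X j i inf) ↔
      (z ^ k)⁻¹ • x ∈ piSub fun j => X j (i + l) inf := fun i z hz x =>
    forall_congr' fun j => (h j).periodic i z hz (x j)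
  have hdim : ∀ i, relIdx (piSub fun j => X j i inf) (piSub fun j => X j (i + 1) inf) =
      Nat.card L ^ ∑ j, d j := fun i => by
    rw [relIdx_piSub, ← Finset.prod_pow_eq_pow_sum]
    exact Finset.prod_congr rfl fun j _ => (h j).dim_pi i
  refine ⟨hlat, fun x y hxy => funext fun j => (h j).phi_injective ?_, hmono, fun i v x hx j => ?_,
    hk, hl, slope_of_periodic hQ hinf hlat hmono hper hdim, fun i v hv x hx j =>
    (h j).away i v hv (hx j), hper, hdim, fun i => ?_, fun i v hv x hx => ?_, ?_⟩
  · rw [← hψ, ← hψ, hxy]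
  · rw [hψ]
    exact (h j).phi_mem i v _ (hx j)
  · rw [semiImage_piSub hψ, relIdx_piSub, ← Finset.prod_pow_eq_pow_sum]
    exact Finset.prod_congr rfl fun j _ => (h j).dim_tau i
  · rw [semiImage_piSub hψ]
    exact fun j => (h j).tau_away i v hv (hx j)
  · choose m hm using fun j => (h j).graph
    refine ⟨Finset.univ.sup m, fun n hn i a x hx => ?_⟩
    rw [semiImage_piSub hψ]
    exact fun j => hm j n ((Finset.le_sup (Finset.mem_univ j)).trans hn) i a (x j) (hx j)

end Pi

section BaseChange

variable (L' : Type u) [Field L'] [Algebra Fq L'] [Algebra L L'] [IsScalarTower Fq L L']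
  [FiniteDimensional L L'] {V : CoeffModule Fq Q L}

-- In coordinates with respect to a basis of `L'` over `L`, a base-changed subspace is a `[L' :
-- L]`-fold power. As `#L'` is the same power of `#L`, dimensions are unchanged.
omit [Fintype Fq] [Finite L] in
theorem relIdx_extSub (N N' : Submodule L V) :
    relIdx (extSub L' N) (extSub L' N') = relIdx N N' ^ Module.finrank L L' := by
  obtain ⟨E, hE⟩ := exists_addEquiv_extSub (L' := L') V
  have h : ∀ N : Submodule L V, (extSub L' N).toAddSubgroup = AddSubgroup.comap E.toAddMonoidHom
      (AddSubgroup.pi Set.univ fun _ => N.toAddSubgroup) := fun N => by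
    ext x
    exact (hE N x).trans ⟨fun h j _ => h j, fun h j => h j trivial⟩
  rw [relIdx, h, h, AddSubgroup.relIndex_comap,
    AddSubgroup.map_comap_eq_self_of_surjective E.surjective, relIndex_pi]
  simp

omit [Fintype Fq] [Finite L] [FiniteDimensional L L'] in
theorem smul_mem_extSub {N N' : Submodule L V} {b : Q} (h : ∀ x ∈ N, b • x ∈ N')
    {x : V.baseChange L'} (hx : x ∈ extSub L' N) : b • x ∈ extSub L' N' := by
  induction hx using Submodule.span_induction with
  | mem x hx =>
    obtain ⟨y, hy, rfl⟩ := hx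
    rw [← ofExt_left_smul]
    exact ofExt_mem_extSub (h y hy)
  | zero => rw [smul_zero]; exact zero_mem _
  | add x y _ _ hx hy => rw [smul_add]; exact add_mem hx hy
  | smul a x _ hx => rw [smul_comm]; exact Submodule.smul_mem _ _ hx

omit [FiniteDimensional L L'] in
theorem semiImage_extSub [Finite L'] (φ : V →ₛₗ[sigma Fq Q L] V) (N : Submodule L V) :
    semiImage (extSemi L' φ) (extSub L' N) = extSub L' (semiImage φ N) := by
  refine le_antisymm ?_ (extSub_le ?_)
  · rintro _ ⟨x, hx, rfl⟩
    induction hx using Submodule.span_induction with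
    | mem x hx =>
      obtain ⟨y, hy, rfl⟩ := hx
      rw [extSemi_ofExt]
      exact ofExt_mem_extSub ⟨y, hy, rfl⟩
    | zero => rw [map_zero]; exact zero_mem _
    | add x y _ _ hx hy => rw [map_add]; exact add_mem hx hy
    | smul a x _ hx => rw [semi_right_smul]; exact Submodule.smul_mem _ _ hx
  · rintro _ ⟨y, hy, rfl⟩
    exact ⟨ofExt L' y, ofExt_mem_extSub hy, extSemi_ofExt φ y⟩

omit [Fintype Fq] [Finite L] [FiniteDimensional L L'] in
theorem extHom_graphElt (c : Characteristic Fq Q L) (a : c.place.ring) :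
    extHom Fq Q L L' (graphElt c a) = graphElt (c.baseChange L') a := by
  rw [graphElt, map_sub, extHom_tmul, extHom_tmul, map_one]
  rfl

/-- The base change of an abelian `τ`-sheaf. -/
theorem Good.baseChange [Finite L'] (hQ : IsCurveFunctionField Fq Q) {φ : V →ₛₗ[sigma Fq Q L] V}
    {X : ℤ → Place Fq Q → Submodule L V} {inf : Place Fq Q} {c : Characteristic Fq Q L}
    {k l d : ℕ} (hinf : inf.IsRational) (h : Good φ X inf c k l d) :
    Good (extSemi L' φ) (fun i v => extSub L' (X i v)) inf (c.baseChange L') k l d := by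
  have hcard : Nat.card L' = Nat.card L ^ Module.finrank L L' := Module.natCard_eq_pow_finrank
  have hext : ∀ {N N' : Submodule L V}, N ≤ N' → extSub L' N ≤ extSub L' N' := fun h =>
    extSub_le fun x hx => ofExt_mem_extSub (h hx)
  have hidx : ∀ {N N' : Submodule L V}, relIdx N N' = Nat.card L ^ d →
      relIdx (extSub L' N) (extSub L' N') = Nat.card L' ^ d := fun h => by
    rw [relIdx_extSub, h, hcard, ← pow_mul, ← pow_mul, mul_comm]
  have hlat : ∀ i, IsLattice fun v => extSub L' (X i v) := fun i => (h.lat i).extSub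
  have hmono : ∀ i v, extSub L' (X i v) ≤ extSub L' (X (i + 1) v) := fun i v => hext (h.mono i v)
  have hper : ∀ i z, inf.IsUniformizer z → ∀ x, x ∈ extSub L' (X i inf) ↔
      (z ^ k)⁻¹ • x ∈ extSub L' (X (i + l) inf) := fun i z hz x => by
    have hz0 := pow_ne_zero k hz.1
    refine ⟨smul_mem_extSub L' fun x hx => (h.periodic i z hz x).1 hx, fun hx => ?_⟩
    rw [← one_smul Q x, ← mul_inv_cancel₀ hz0, mul_smul]
    refine smul_mem_extSub L' (fun y hy => (h.periodic i z hz _).2 ?_) hx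
    rwa [smul_smul, inv_mul_cancel₀ hz0, one_smul]
  have hdim : ∀ i, relIdx (extSub L' (X i inf)) (extSub L' (X (i + 1) inf)) = Nat.card L' ^ d :=
    fun i => hidx (h.dim_pi i)
  refine ⟨hlat, extSemi_injective h.phi_injective, hmono, fun i v x hx => ?_, h.k_pos, h.l_pos,
    slope_of_periodic hQ hinf hlat hmono hper hdim, fun i v hv => hext (h.away i v hv), hper, hdim,
    fun i => ?_, fun i v hv => ?_, ?_⟩
  · have h1 : extSemi L' φ x ∈ semiImage (extSemi L' φ) (extSub L' (X i v)) := ⟨x, hx, rfl⟩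
    rw [semiImage_extSub] at h1
    exact hext (h.semiImage_le i v) h1
  · rw [semiImage_extSub]
    exact hidx (h.dim_tau i)
  · rw [semiImage_extSub]
    exact hext (h.tau_away i v hv)
  · obtain ⟨m, hm⟩ := h.graph
    refine ⟨m, fun n hn i a x hx => ?_⟩
    rw [semiImage_extSub]
    induction hx using Submodule.span_induction with
    | mem x hx =>
      obtain ⟨y, hy, rfl⟩ := hx
      have : ∏ j, graphElt (c.baseChange L') (a j) =
          extHom Fq Q L L' (∏ j, graphElt c (a j : c.place.ring)) := by
        rw [map_prod]
        exact Finset.prod_congr rfl fun j _ => (extHom_graphElt L' c (a j)).symm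
      rw [this, ← ofExt_smul]
      exact ofExt_mem_extSub (hm n hn i a y hy)
    | zero => rw [smul_zero]; exact zero_mem _
    | add x y _ _ hx hy => rw [smul_add]; exact add_mem hx hy
    | smul b x _ hx =>
      rw [CoeffModule.right_smul_def, smul_comm, ← CoeffModule.right_smul_def]
      exact Submodule.smul_mem _ _ hx

end BaseChange

end Sums


/-! ### Families indexed by ℤ, twists and commuting nilpotent operators -/

section Preliminaries

/-- Used to identify all generic fibres of a τ-sheaf along the maps `Π_i`. Below zero the recursion
passes through `k - 1 + 1`, whose equality with `k` is not definitional; hence the `cast`. -/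
theorem exists_int_family {R : Type*} [Semiring R] {G : ℤ → Type*} [∀ i, AddCommMonoid (G i)]
    [∀ i, Module R (G i)] (e : ∀ i, G i ≃ₗ[R] G (i + 1)) :
    ∃ θ : ∀ i, G i ≃ₗ[R] G 0, ∀ i x, θ (i + 1) (e i x) = θ i x := by
  let P : ∀ k, k ≤ 0 → (G k ≃ₗ[R] G 0) → (G (k - 1) ≃ₗ[R] G 0) := fun k _ t =>
    (e (k - 1)).trans (cast (by rw [sub_add_cancel]) t)
  let θ : ∀ i, G i ≃ₗ[R] G 0 := fun i => Int.inductionOn' (motive := fun i => G i ≃ₗ[R] G 0) i 0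
    (LinearEquiv.refl R (G 0)) (fun k _ t => (e k).symm.trans t) P
  refine ⟨θ, fun i x => ?_⟩
  rcases le_or_gt 0 i with hi | hi
  · have : θ (i + 1) = (e i).symm.trans (θ i) := Int.inductionOn'_add_one hi
    rw [this, LinearEquiv.trans_apply, LinearEquiv.symm_apply_apply]
  · have h1 : ∀ k (hk : k ≤ 0), θ (k - 1) = P k hk (θ k) := fun k hk => Int.inductionOn'_sub_one hk
    obtain ⟨k, rfl⟩ : ∃ k, i = k - 1 := ⟨i + 1, by ring⟩
    have h2 : ∀ j (h : k = j) (h' : (G k ≃ₗ[R] G 0) = (G j ≃ₗ[R] G 0)), cast h' (θ k) = θ j :=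
      fun j h h' => by subst h; rfl
    rw [h1 k (by omega), LinearEquiv.trans_apply, h2 (k - 1 + 1) (by ring)]

theorem rank_directSum_eq {R ι : Type u} [CommRing R] [DecidableEq ι] {M : ι → Type u}
    [∀ i, AddCommGroup (M i)] [∀ i, Module R (M i)] (i₀ : ι) (h : ∀ i ≠ i₀, Subsingleton (M i)) :
    Module.rank R (⨁ i, M i) = Module.rank R (M i₀) := by
  refine LinearEquiv.rank_eq (LinearEquiv.ofBijective (DirectSum.component R ι M i₀)
    ⟨fun x y hxy => ?_, fun y => ⟨DirectSum.lof R ι M i₀ y, DirectSum.component.lof_self R i₀ y⟩⟩)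
  refine DFinsupp.ext fun i => ?_
  by_cases hi : i = i₀
  · subst hi
    exact hxy
  · have := h i hi
    exact Subsingleton.elim _ _

variable {Fq Q L : Type u} [Field Fq] [Field Q] [Algebra Fq Q] [Field L] [Algebra Fq L]
  {V W : CoeffModule Fq Q L}

theorem Place.IsUniformizer.zpow_mul_inv_mem {v : Place Fq Q} {z z' : Q} (hz : v.IsUniformizer z)
    (hz' : v.IsUniformizer z') (n : ℤ) : z ^ n * (z' ^ n)⁻¹ ∈ v.ring := by
  rw [← inv_zpow, ← mul_zpow]
  have h1 : z * z'⁻¹ ∈ v.ring := hz'.2.2 z hz.2.1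
  have h2 : (z * z'⁻¹)⁻¹ ∈ v.ring := by
    rw [mul_inv, inv_inv, mul_comm]
    exact hz.2.2 z' hz'.2.1
  obtain ⟨m, rfl | rfl⟩ := n.eq_nat_or_neg
  · rw [zpow_natCast]; exact pow_mem h1 m
  · rw [zpow_neg, ← inv_zpow, zpow_natCast]; exact pow_mem h2 m

theorem IsLattice.mem_twist_iff {X : Place Fq Q → Submodule L V} (hX : IsLattice X)
    {D : Place Fq Q →₀ ℤ} {v : Place Fq Q} {z : Q} (hz : v.IsUniformizer z) {x : V} :
    x ∈ ((LatticeSheaf.mk V X).twist D).stalk v ↔ z ^ D v • x ∈ X v := by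
  refine ⟨fun h => h z hz, fun h z' hz' => ?_⟩
  have h1 := hX.smul_mem (hz'.zpow_mul_inv_mem hz (D v)) h
  rwa [smul_smul, inv_mul_cancel_right₀ (zpow_ne_zero _ hz.1)] at h1

theorem relIdx_map (e : V ≃ₗ[Q ⊗[Fq] L] W) (N N' : Submodule L V) :
    relIdx (N.map (CoeffModule.linL e.toLinearMap)) (N'.map (CoeffModule.linL e.toLinearMap)) =
      relIdx N N' := by
  let f : V →+ W := e.toLinearMap.toAddMonoidHom
  have hf : Function.Injective f := e.injective
  have h : ∀ N : Submodule L V, (N.map (CoeffModule.linL e.toLinearMap)).toAddSubgroup =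
      N.toAddSubgroup.map f := fun _ => rfl
  rw [relIdx, h, h, AddSubgroup.relIndex_map_map_of_injective _ _ hf]

variable [Finite L]

/-- If `n` commuting nilpotent operators act on a space of dimension `d`, the image of their product
has dimension at most `d - n`. -/
theorem exists_submodule_prod_smul_mem {C D : Submodule L V} (hDC : D ≤ C) {d : ℕ}
    (hd : relIdx D C = Nat.card L ^ d) {S : Set (Q ⊗[Fq] L)}
    (hC : ∀ g ∈ S, ∀ x ∈ C, g • x ∈ C) (hD : ∀ g ∈ S, ∀ x ∈ D, g • x ∈ D) {m : ℕ}
    (hm : ∀ g ∈ S, ∀ x ∈ C, g ^ m • x ∈ D) (n : ℕ) (g : Fin n → Q ⊗[Fq] L) (hg : ∀ j, g j ∈ S) :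
    ∃ R : Submodule L V, D ≤ R ∧ R ≤ C ∧ (∀ x ∈ C, (∏ j, g j) • x ∈ R) ∧
      (∀ a ∈ S, ∀ x ∈ R, a • x ∈ R) ∧ ∃ e, relIdx D R = Nat.card L ^ e ∧ e ≤ d - n := by
  induction n with
  | zero => exact ⟨C, hDC, le_rfl, fun x hx => by simpa, hC, d, hd, by simp⟩
  | succ n ih =>
    obtain ⟨R, hDR, hRC, hR, hRS, e, he, hed⟩ := ih (fun j => g j.castSucc) fun j => hg _
    let a := g (Fin.last n)
    have haS : a ∈ S := hg _
    let A : V →ₗ[L] V := CoeffModule.linL (LinearMap.lsmul (Q ⊗[Fq] L) V a)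
    have hA : ∀ x, A x = a • x := fun _ => rfl
    -- Either `R'` is strictly smaller than `R` and the dimension over `D` drops, or `R = D + a R`;
    -- iterating the latter and using that a power of `a` maps `C` into `D` gives `R = D`, of
    -- dimension zero.
    let R' := D ⊔ R.map A
    have hR'R : R' ≤ R := sup_le hDR (by rintro _ ⟨x, hx, rfl⟩; exact hRS a haS x hx)
    have hmul := AddSubgroup.relIndex_mul_relIndex D.toAddSubgroup R'.toAddSubgroup
      R.toAddSubgroup (le_sup_left : D ≤ R') hR'R
    have hpos : Nat.card L ^ e ≠ 0 := pow_ne_zero _ Nat.card_pos.ne'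
    have hne : relIdx D R' ≠ 0 := fun h0 => hpos (by
      rw [← he, relIdx, ← hmul, ← relIdx, h0, zero_mul])
    have hne' : relIdx R' R ≠ 0 := fun h0 => hpos (by
      rw [← he, relIdx, ← hmul, ← relIdx, ← relIdx, h0, mul_zero])
    obtain ⟨e', he'⟩ := exists_relIdx_eq_pow hne
    obtain ⟨e'', he''⟩ := exists_relIdx_eq_pow hne'
    have hee : e' + e'' = e := by
      refine Nat.pow_right_injective (Finite.one_lt_card : 1 < Nat.card L) ?_
      simp only [pow_add]
      rw [← he', ← he'', ← he]
      exact hmul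
    refine ⟨R', le_sup_left, hR'R.trans hRC, fun x hx => ?_, fun b hb x hx => ?_, e', he', ?_⟩
    · rw [Fin.prod_univ_castSucc, mul_comm, mul_smul]
      exact Submodule.mem_sup_right ⟨_, hR x hx, rfl⟩
    · obtain ⟨y, hy, _, ⟨w, hw, rfl⟩, rfl⟩ := Submodule.mem_sup.1 hx
      rw [smul_add, hA, smul_comm]
      exact Submodule.add_mem_sup (hD b hb y hy) ⟨_, hRS b hb w hw, rfl⟩
    · rcases Nat.eq_zero_or_pos e'' with h0 | h0
      · have h1 : R ≤ R' := AddSubgroup.relIndex_eq_one.1 (by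
          rw [h0, pow_zero] at he''
          exact he'')
        have h2 : ∀ (t : ℕ), ∀ x ∈ R, ∃ y ∈ R, x - a ^ t • y ∈ D := fun t => by
          induction t with
          | zero => exact fun x hx => ⟨x, hx, by simp⟩
          | succ t ih =>
            intro x hx
            obtain ⟨δ, hδ, _, ⟨w, hw, rfl⟩, rfl⟩ := Submodule.mem_sup.1 (h1 hx)
            obtain ⟨y, hy, hyw⟩ := ih w hw
            refine ⟨y, hy, ?_⟩
            have : δ + A w - a ^ (t + 1) • y = δ + a • (w - a ^ t • y) := by
              rw [hA, smul_sub, smul_smul, ← pow_succ', add_sub_assoc]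
            rw [this]
            exact D.add_mem hδ (hD a haS _ hyw)
        have h3 : R ≤ D := fun x hx => by
          obtain ⟨y, hy, hyx⟩ := h2 m x hx
          rw [← sub_add_cancel x (a ^ m • y)]
          exact D.add_mem hyx (hm a haS y (hRC hy))
        have h4 : relIdx D R = 1 := AddSubgroup.relIndex_eq_one.2 h3
        rw [h4] at he
        have : e = 0 := by
          by_contra hne
          exact absurd he.symm (Nat.one_lt_pow hne (Finite.one_lt_card : 1 < Nat.card L)).ne'
        omega
      · omega

/-- On a quotient of dimension `d` a product of any `d` commuting nilpotent operators vanishes. This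
recovers the precise exponent `d` from annihilation by some power. -/
theorem prod_smul_mem_of_nilpotent {C D : Submodule L V} (hDC : D ≤ C) {d : ℕ}
    (hd : relIdx D C = Nat.card L ^ d) {S : Set (Q ⊗[Fq] L)}
    (hC : ∀ g ∈ S, ∀ x ∈ C, g • x ∈ C) (hD : ∀ g ∈ S, ∀ x ∈ D, g • x ∈ D) {m : ℕ}
    (hm : ∀ g ∈ S, ∀ x ∈ C, g ^ m • x ∈ D) (g : Fin d → Q ⊗[Fq] L) (hg : ∀ j, g j ∈ S)
    {x : V} (hx : x ∈ C) : (∏ j, g j) • x ∈ D := by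
  obtain ⟨R, hDR, -, hR, -, e, he, hed⟩ :=
    exists_submodule_prod_smul_mem hDC hd hC hD hm d g hg
  rw [Nat.sub_self, Nat.le_zero] at hed
  rw [hed, pow_zero] at he
  exact AddSubgroup.relIndex_eq_one.1 he (hR x hx)

end Preliminaries


/-! ### Identifying the generic fibres of a τ-sheaf -/

section Trivialization

variable {Fq Q L : Type u} [Field Fq] [Fintype Fq] [Field Q] [Algebra Fq Q] [Field L] [Algebra Fq L]

/-- A trivialization of the generic fibres of a `τ`-sheaf, in which the maps `Π_i` become the
identity. -/
structure Triv (F : PreTauSheaf Fq Q L) {V : CoeffModule Fq Q L} (φ : V →ₛₗ[sigma Fq Q L] V)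
    (X : ℤ → Place Fq Q → Submodule L V) where
  /-- the identifications of the generic fibres with `V` -/
  equiv : ∀ i, (F.sheaf i).fibre ≃ₗ[Q ⊗[Fq] L] V
  equiv_pi : ∀ i x, equiv (i + 1) (F.Pi i x) = equiv i x
  equiv_tau : ∀ i x, equiv (i + 1) (F.tau i x) = φ (equiv i x)
  mem_stalk : ∀ i v x, x ∈ (F.sheaf i).stalk v ↔ equiv i x ∈ X i v

namespace Triv

variable {F : PreTauSheaf Fq Q L} {V : CoeffModule Fq Q L} {φ : V →ₛₗ[sigma Fq Q L] V}
    {X : ℤ → Place Fq Q → Submodule L V} {inf : Place Fq Q} {c : Characteristic Fq Q L}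

theorem map_stalk (T : Triv F φ X) (i : ℤ) (v : Place Fq Q) :
    ((F.sheaf i).stalk v).map (CoeffModule.linL (T.equiv i).toLinearMap) = X i v := by
  ext y
  constructor
  · rintro ⟨x, hx, rfl⟩
    exact (T.mem_stalk i v x).1 hx
  · intro hy
    refine ⟨(T.equiv i).symm y, (T.mem_stalk i v _).2 ?_, (T.equiv i).apply_symm_apply y⟩
    rwa [LinearEquiv.apply_symm_apply]

theorem map_symm (T : Triv F φ X) (i : ℤ) (v : Place Fq Q) :
    (X i v).map (CoeffModule.linL (T.equiv i).symm.toLinearMap) = (F.sheaf i).stalk v := by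
  ext y
  constructor
  · rintro ⟨x, hx, rfl⟩
    refine (T.mem_stalk i v _).2 ?_
    change T.equiv i ((T.equiv i).symm x) ∈ _
    rwa [LinearEquiv.apply_symm_apply]
  · intro hy
    exact ⟨T.equiv i y, (T.mem_stalk i v _).1 hy, (T.equiv i).symm_apply_apply y⟩

theorem map_piImage (T : Triv F φ X) (i : ℤ) (v : Place Fq Q) :
    (F.piImage i v).map (CoeffModule.linL (T.equiv (i + 1)).toLinearMap) = X i v := by
  rw [PreTauSheaf.piImage, Submodule.map_span, ← T.map_stalk i v, ← Set.image_comp]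
  have : (CoeffModule.linL (T.equiv (i + 1)).toLinearMap ∘ F.Pi i) =
      (CoeffModule.linL (T.equiv i).toLinearMap) := funext fun x => T.equiv_pi i x
  rw [this, ← Submodule.map_span, Submodule.span_eq]

theorem map_tauImage [Finite L] (T : Triv F φ X) (i : ℤ) (v : Place Fq Q) :
    (F.tauImage i v).map (CoeffModule.linL (T.equiv (i + 1)).toLinearMap) =
      semiImage φ (X i v) := by
  rw [PreTauSheaf.tauImage, Submodule.map_span, ← T.map_stalk i v, ← Set.image_comp,
    ← span_image_eq_semiImage, Submodule.map_coe, ← Set.image_comp]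
  congr 2
  exact funext fun x => T.equiv_tau i x

theorem mem_tauImage [Finite L] (T : Triv F φ X) (i : ℤ) (v : Place Fq Q)
    {x : (F.sheaf (i + 1)).fibre} :
    x ∈ F.tauImage i v ↔ T.equiv (i + 1) x ∈ semiImage φ (X i v) := by
  rw [← T.map_tauImage]
  refine ⟨fun h => ⟨x, h, rfl⟩, ?_⟩
  rintro ⟨y, hy, hyx⟩
  rwa [← (T.equiv (i + 1)).injective hyx]

theorem equiv_piIter (T : Triv F φ X) (n : ℕ) (i j : ℤ) (h : i + n = j) (x : (F.sheaf i).fibre) :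
    T.equiv j (F.piIter n i j h x) = T.equiv i x := by
  induction n generalizing i with
  | zero =>
    obtain rfl : i = j := by simpa using h
    rfl
  | succ n ih => exact (ih (i + 1) _ (F.Pi i x)).trans (T.equiv_pi i x)

theorem equiv_tauIter (T : Triv F φ X) (n : ℕ) (i j : ℤ) (h : i + n = j) (x : (F.sheaf i).fibre) :
    T.equiv j (F.tauIter n i j h x) = φ^[n] (T.equiv i x) := by
  induction n generalizing i with
  | zero =>
    obtain rfl : i = j := by simpa using h
    rfl
  | succ n ih =>
    refine (ih (i + 1) _ (F.tau i x)).trans ?_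
    rw [T.equiv_tau, Function.iterate_succ_apply]

theorem exists_equiv_eq (T : Triv F φ X) (i : ℤ) (y : V) : ∃ x, T.equiv i x = y :=
  (T.equiv i).surjective y

theorem equiv_left_smul (T : Triv F φ X) (i : ℤ) (b : Q) (x : (F.sheaf i).fibre) :
    T.equiv i (b • x) = b • T.equiv i x := (T.equiv i).map_smul _ _

theorem mem_twist_iff (T : Triv F φ X) {i : ℤ} (hlat : IsLattice (F.sheaf i).stalk)
    {D : Place Fq Q →₀ ℤ} {v : Place Fq Q} {z : Q} (hz : v.IsUniformizer z)
    {x : (F.sheaf i).fibre} :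
    x ∈ ((F.sheaf i).twist D).stalk v ↔ z ^ D v • T.equiv i x ∈ X i v :=
  (hlat.mem_twist_iff hz).trans (by rw [T.mem_stalk, T.equiv_left_smul])

variable [Finite L]

/-- The cokernel of a subsheaf which differs only at one place. -/
theorem rank_coker (T : Triv F φ X) (i : ℤ) {P : Place Fq Q → Submodule L (F.sheaf i).fibre}
    {N : Place Fq Q → Submodule L V}
    (hP : ∀ v, (P v).map (CoeffModule.linL (T.equiv i).toLinearMap) = N v) {v₀ : Place Fq Q}
    (h : ∀ v ≠ v₀, X i v ≤ N v) {d : ℕ} :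
    Module.rank L ((F.sheaf i).Coker P) = d ↔ relIdx (N v₀) (X i v₀) = Nat.card L ^ d := by
  classical
  have h1 : Module.rank L ((F.sheaf i).Coker P) =
      Module.rank L ((F.sheaf i).stalk v₀ ⧸ (P v₀).submoduleOf ((F.sheaf i).stalk v₀)) := by
    refine rank_directSum_eq (R := L) (ι := Place Fq Q)
      (M := fun v => (F.sheaf i).stalk v ⧸ (P v).submoduleOf ((F.sheaf i).stalk v)) v₀
      fun v hv => ?_
    rw [Submodule.Quotient.subsingleton_iff, Submodule.submoduleOf, Submodule.comap_subtype_eq_top]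
    intro x hx
    have := h v hv ((T.mem_stalk i v x).1 hx)
    rw [← hP] at this
    obtain ⟨y, hy, hyx⟩ := this
    rwa [← (T.equiv i).injective hyx]
  rw [h1, rank_eq_iff_relIdx_eq, ← relIdx_map (T.equiv i), hP, T.map_stalk]

variable (hQ : IsCurveFunctionField Fq Q)

include hQ in
theorem good (T : Triv F φ X) {r d : ℕ} (h : F.IsAbelianOf inf c r d) :
    ∃ k l, Good φ X inf c k l d := by
  obtain ⟨k, l, hk, hl, hkl, hper⟩ := h.periodic
  have hlat' : ∀ i, IsLattice (F.sheaf i).stalk := fun i =>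
    IsLattice.of_isLocallyFree inf (h.locallyFree i)
  have hlat : ∀ i, IsLattice (X i) := fun i => by
    have := (hlat' i).map (T.equiv i).surjective
    convert! this using 1
    exact funext fun v => (T.map_stalk i v).symm
  have hper' : ∀ i v z, v.IsUniformizer z → ∀ x, x ∈ X i v ↔
      z ^ (Finsupp.single inf (-(k : ℤ)) v) • x ∈ X (i + l) v := fun i v z hz y => by
    obtain ⟨x, rfl⟩ := T.exists_equiv_eq (i + l) y
    have h1 := (Set.ext_iff.1 (hper i v) x).trans (T.mem_twist_iff (hlat' (i + l)) hz)
    rw [← h1]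
    constructor
    · intro hx
      obtain ⟨w, hw⟩ := T.exists_equiv_eq i (T.equiv (i + l) x)
      refine ⟨w, (T.mem_stalk i v w).2 (hw ▸ hx), (T.equiv (i + l)).injective ?_⟩
      rw [T.equiv_piIter, hw]
    · rintro ⟨w, hw, rfl⟩
      rw [T.equiv_piIter]
      exact (T.mem_stalk i v w).1 hw
  have hmono : ∀ i v, X i v ≤ X (i + 1) v := fun i v y hy => by
    obtain ⟨x, rfl⟩ := T.exists_equiv_eq i y
    rw [← T.equiv_pi]
    exact (T.mem_stalk _ _ _).1 (h.pi_mem i v x ((T.mem_stalk _ _ _).2 hy))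
  have haway : ∀ i v, v ≠ inf → X (i + l) v = X i v := fun i v hv => by
    obtain ⟨z, hz⟩ := Place.exists_uniformizer hQ v
    ext x
    rw [hper' i v z hz, Finsupp.single_eq_of_ne hv, zpow_zero, one_smul]
  have hmono_add : ∀ (n : ℕ) i v, X i v ≤ X (i + n) v := fun n i v => by
    induction n with
    | zero => simp
    | succ n ih => exact ih.trans ((hmono _ v).trans (by rw [Nat.cast_succ, add_assoc]))
  -- Outside `inf` the composite of `l` inclusions is an equality, hence so is each of them.
  have haway1 : ∀ i v, v ≠ inf → X (i + 1) v ≤ X i v := fun i v hv => by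
    rw [← haway i v hv]
    have := hmono_add (l - 1) (i + 1) v
    rwa [Nat.cast_sub hl, Nat.cast_one, add_assoc, add_sub_cancel] at this
  have htau : ∀ i v, v ≠ c.place → X (i + 1) v ≤ semiImage φ (X i v) := fun i v hv y hy => by
    obtain ⟨x, rfl⟩ := T.exists_equiv_eq (i + 1) y
    exact (T.mem_tauImage i v).1 (h.coker_tau_away i v hv ((T.mem_stalk _ _ _).2 hy))
  refine ⟨k, l, hlat, ?_, hmono, ?_, hk, hl, ?_, fun i v hv => (haway i v hv).le, ?_, fun i => ?_,
    fun i => ?_, htau, d, fun n hn i a y hy => ?_⟩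
  · intro x y hxy
    obtain ⟨x, rfl⟩ := T.exists_equiv_eq 0 x
    obtain ⟨y, rfl⟩ := T.exists_equiv_eq 0 y
    rw [← T.equiv_tau, ← T.equiv_tau] at hxy
    rw [h.tau_injective 0 ((T.equiv (0 + 1)).injective hxy)]
  · intro i v y hy
    obtain ⟨x, rfl⟩ := T.exists_equiv_eq i y
    rw [← T.equiv_tau]
    exact (T.mem_stalk _ _ _).1 (h.tau_mem i v x ((T.mem_stalk _ _ _).2 hy))
  · rw [hkl, ← IsLattice.finrank_of_isLocallyFree hQ inf (h.locallyFree 0),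
      (T.equiv 0).finrank_eq]
  · intro i z hz x
    rw [hper' i inf z hz, Finsupp.single_eq_same, zpow_neg, zpow_natCast]
  · exact (T.rank_coker (i + 1) (T.map_piImage i) (fun v hv => haway1 i v hv)).1 (h.dim_coker_pi i)
  · exact (T.rank_coker (i + 1) (T.map_tauImage i) (htau i)).1 (h.dim_coker_tau i)
  · obtain ⟨e, rfl⟩ := Nat.exists_eq_add_of_le hn
    have hsm : ∀ (t : ℕ) (b : Fin t → c.place.ring), ∀ x ∈ X (i + 1) c.place,
        (∏ j, graphElt c (b j)) • x ∈ X (i + 1) c.place := fun t b => by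
      induction t with
      | zero => simp
      | succ t ih =>
        intro x hx
        rw [Fin.prod_univ_succ, mul_smul, graphElt_smul]
        have := ih (fun j => b j.succ) x hx
        exact sub_mem ((hlat (i + 1)).smul_mem (b 0).2 this) (Submodule.smul_mem _ _ this)
    rw [Fin.prod_univ_add, mul_smul]
    obtain ⟨x, hx⟩ := T.exists_equiv_eq (i + 1)
      ((∏ j, graphElt c (a (Fin.natAdd d j))) • y)
    have h1 := h.coker_tau_graph i (fun j => a (Fin.castAdd e j)) x
      ((T.mem_stalk _ _ _).2 (hx ▸ hsm e _ y hy))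
    rw [T.mem_tauImage, map_smul, hx] at h1
    exact h1

include hQ in
theorem isAbelianOf (T : Triv F φ X) {k l d : ℕ} (h : Good φ X inf c k l d) :
    F.IsAbelianOf inf c (Module.finrank (Q ⊗[Fq] L) V) d := by
  have hfd : FiniteDimensional Fq L := Module.Finite.of_finite
  have hlat : ∀ i, IsLattice (F.sheaf i).stalk := fun i => by
    have := (h.lat i).map (T.equiv i).symm.surjective
    convert! this using 1
    exact funext fun v => (T.map_symm i v).symm
  refine ⟨fun i => ?_, fun i v x hx => ?_, fun i v x hx => ?_, fun i x y hxy => ?_,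
    fun i x y hxy => ?_, fun i x => ?_, ⟨k, l, h.k_pos, h.l_pos, h.slope, fun i v => ?_⟩,
    fun i => ?_, fun i => ?_, fun i v hv x hx => ?_, fun i a x hx => ?_⟩
  · rw [← (T.equiv i).finrank_eq]
    exact (hlat i).isLocallyFree hQ
  · rw [T.mem_stalk, T.equiv_pi]
    exact h.mono i v ((T.mem_stalk _ _ _).1 hx)
  · rw [T.mem_stalk, T.equiv_tau]
    exact h.phi_mem i v _ ((T.mem_stalk _ _ _).1 hx)
  · apply (T.equiv i).injective
    rw [← T.equiv_pi i x, ← T.equiv_pi i y, hxy]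
  · apply (T.equiv i).injective
    apply h.phi_injective
    rw [← T.equiv_tau, ← T.equiv_tau, hxy]
  · apply (T.equiv (i + 1 + 1)).injective
    rw [T.equiv_pi, T.equiv_tau, T.equiv_tau, T.equiv_pi]
  · obtain ⟨z, hz⟩ := Place.exists_uniformizer hQ v
    have key : ∀ x, x ∈ X i v ↔ z ^ (Finsupp.single inf (-(k : ℤ)) v) • x ∈ X (i + l) v :=
        fun x => by
      by_cases hv : v = inf
      · subst hv
        rw [h.periodic i z hz, Finsupp.single_eq_same, zpow_neg, zpow_natCast]
      · rw [Finsupp.single_eq_of_ne hv, zpow_zero, one_smul, h.away_eq _ hv, h.away_eq (i + l) hv]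
    ext x
    refine Iff.trans ?_ (T.mem_twist_iff (hlat (i + l)) hz).symm
    rw [← key]
    constructor
    · rintro ⟨w, hw, rfl⟩
      rw [T.equiv_piIter]
      exact (T.mem_stalk i v w).1 hw
    · intro hx
      obtain ⟨w, hw⟩ := T.exists_equiv_eq i (T.equiv (i + l) x)
      refine ⟨w, (T.mem_stalk i v w).2 (hw ▸ hx), (T.equiv (i + l)).injective ?_⟩
      rw [T.equiv_piIter, hw]
  · exact (T.rank_coker (i + 1) (T.map_piImage i) (fun v hv => (h.away_succ i hv).le)).2
      (h.dim_pi i)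
  · exact (T.rank_coker (i + 1) (T.map_tauImage i) (h.tau_away i)).2 (h.dim_tau i)
  · rw [T.mem_tauImage]
    exact h.tau_away i v hv ((T.mem_stalk _ _ _).1 hx)
  · rw [T.mem_tauImage, map_smul]
    obtain ⟨m, hm⟩ := h.graph
    have hS : ∀ N : Submodule L V, (∀ b ∈ c.place.ring, ∀ x ∈ N, b • x ∈ N) →
        ∀ g ∈ Set.range (graphElt c), ∀ x ∈ N, g • x ∈ N := by
      rintro N hN _ ⟨b, rfl⟩ x hx
      rw [graphElt_smul]
      exact sub_mem (hN b b.2 x hx) (N.smul_mem _ hx)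
    refine prod_smul_mem_of_nilpotent (h.semiImage_le i c.place) (h.dim_tau i)
      (S := Set.range (graphElt c)) (hS _ fun b hb x hx => (h.lat _).smul_mem hb hx)
      (hS _ ?_) (m := m) ?_ (fun j => graphElt c (a j)) (fun j => ⟨a j, rfl⟩)
      ((T.mem_stalk _ _ _).1 hx)
    · rintro b hb _ ⟨x, hx, rfl⟩
      exact ⟨b • x, (h.lat i).smul_mem hb hx, semi_left_smul φ b x⟩
    · rintro _ ⟨b, rfl⟩ x hx
      have := hm m le_rfl i (fun _ => b) x hx
      rwa [Finset.prod_const, Finset.card_univ, Fintype.card_fin] at this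

include hQ in
theorem isAbelian_iff (T : Triv F φ X) :
    F.IsAbelian inf c ↔ ∃ k l d, Good φ X inf c k l d := by
  constructor
  · rintro ⟨r, d, h⟩
    obtain ⟨k, l, h⟩ := T.good hQ h
    exact ⟨k, l, d, h⟩
  · rintro ⟨k, l, d, h⟩
    exact ⟨_, _, T.isAbelianOf hQ h⟩

-- All fibres have the same rank, so the injective maps `Π_i` are isomorphisms of generic fibres.
-- Transport along them turns all `τ_i` into one map `φ`, because the `Π_i` commute with the `τ_i`.
include hQ in
theorem exists_of_isAbelian (h : F.IsAbelian inf c) : ∃ (V : CoeffModule Fq Q L)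
    (φ : V →ₛₗ[sigma Fq Q L] V) (X : ℤ → Place Fq Q → Submodule L V), Nonempty (Triv F φ X) := by
  obtain ⟨r, d, h⟩ := h
  let _ := (isField_tensor hQ L).toField
  have hfin : ∀ i, Module.Finite (Q ⊗[Fq] L) (F.sheaf i).fibre := fun i =>
    (IsLattice.of_isLocallyFree inf (h.locallyFree i)).finite
  have hr : ∀ i, Module.finrank (Q ⊗[Fq] L) (F.sheaf i).fibre = r := fun i =>
    IsLattice.finrank_of_isLocallyFree hQ inf (h.locallyFree i)
  let e : ∀ i, (F.sheaf i).fibre ≃ₗ[Q ⊗[Fq] L] (F.sheaf (i + 1)).fibre := fun i =>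
    LinearEquiv.ofBijective (F.Pi i) ⟨h.pi_injective i,
      (LinearMap.injective_iff_surjective_of_finrank_eq_finrank ((hr i).trans (hr _).symm)).1
        (h.pi_injective i)⟩
  have he : ∀ i x, e i x = F.Pi i x := fun _ _ => rfl
  obtain ⟨θ, hθ⟩ := exists_int_family e
  let φ : (F.sheaf 0).fibre →ₛₗ[sigma Fq Q L] (F.sheaf 0).fibre :=
    { toFun := fun x => θ (0 + 1) (F.tau 0 ((θ 0).symm x))
      map_add' := fun x y => by simp only [map_add]
      map_smul' := fun a x => by simp only [map_smul, map_smulₛₗ] }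
  have hφ : ∀ i x, θ (i + 1) (F.tau i x) = φ (θ i x) := fun i => by
    have key : ∀ i, (∀ x, θ (i + 1) (F.tau i x) = φ (θ i x)) ↔
        ∀ x, θ (i + 1 + 1) (F.tau (i + 1) x) = φ (θ (i + 1) x) := fun i => by
      refine Iff.trans ?_ (e i).surjective.forall.symm
      refine forall_congr' fun x => ?_
      rw [hθ, he, ← h.comm, ← he (i + 1), hθ]
    induction i using Int.induction_on with
    | zero =>
      intro x
      change _ = θ (0 + 1) (F.tau 0 ((θ 0).symm (θ 0 x)))
      rw [LinearEquiv.symm_apply_apply]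
    | succ n ih => exact (key n).1 ih
    | pred n ih =>
      refine (key _).2 ?_
      rwa [sub_add_cancel]
  refine ⟨_, φ, fun i v => ((F.sheaf i).stalk v).map (CoeffModule.linL (θ i).toLinearMap),
    ⟨θ, hθ, hφ, fun i v x => ⟨fun hx => ⟨x, hx, rfl⟩, ?_⟩⟩⟩
  rintro ⟨y, hy, hyx⟩
  rwa [← (θ i).injective hyx]

end Triv

end Trivialization


/-! ### Trivializations of sums, twists and base changes, and morphisms -/

section Constructions

variable {Fq Q L : Type u} [Field Fq] [Fintype Fq] [Field Q] [Algebra Fq Q] [Field L] [Algebra Fq L]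

/-- The `τ`-sheaf with constant generic fibre `V` for which the maps `Π_i` are the inclusions. -/
def chain {V : CoeffModule Fq Q L} (φ : V →ₛₗ[sigma Fq Q L] V)
    (X : ℤ → Place Fq Q → Submodule L V) : PreTauSheaf Fq Q L where
  sheaf i := ⟨V, X i⟩
  Pi _ := LinearMap.id
  tau _ := φ

/-- The trivialization of a chain. -/
def Triv.chain {V : CoeffModule Fq Q L} (φ : V →ₛₗ[sigma Fq Q L] V)
    (X : ℤ → Place Fq Q → Submodule L V) : Triv (chain φ X) φ X where
  equiv _ := LinearEquiv.refl (Q ⊗[Fq] L) V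
  equiv_pi _ _ := rfl
  equiv_tau _ _ := rfl
  mem_stalk _ _ _ := Iff.rfl

/-- The componentwise semilinear map on a direct sum. -/
def semiPi {n : ℕ} {V : Fin n → CoeffModule Fq Q L} (φ : ∀ j, V j →ₛₗ[sigma Fq Q L] V j) :
    CoeffModule.pi V →ₛₗ[sigma Fq Q L] CoeffModule.pi V where
  toFun x j := φ j (x j)
  map_add' x y := funext fun j => map_add (φ j) (x j) (y j)
  map_smul' a x := funext fun j => map_smulₛₗ (φ j) a (x j)

/-- The trivialization of a direct sum. -/
def Triv.directSum {n : ℕ} {F : Fin n → PreTauSheaf Fq Q L} {V : Fin n → CoeffModule Fq Q L}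
    {φ : ∀ j, V j →ₛₗ[sigma Fq Q L] V j} {X : ∀ j, ℤ → Place Fq Q → Submodule L (V j)}
    (T : ∀ j, Triv (F j) (φ j) (X j)) :
    Triv (PreTauSheaf.directSum F) (semiPi φ) fun i v => piSub fun j => X j i v where
  equiv i := LinearEquiv.piCongrRight (φ := fun j => ((F j).sheaf i).fibre) (ψ := fun j => V j)
    fun j => (T j).equiv i
  equiv_pi i x := funext fun j => (T j).equiv_pi i (x j)
  equiv_tau i x := funext fun j => (T j).equiv_tau i (x j)
  mem_stalk i v x := forall_congr' fun j => (T j).mem_stalk i v (x j)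

/-- The trivialization of a twist. -/
def Triv.twist {F : PreTauSheaf Fq Q L} {V : CoeffModule Fq Q L} {φ : V →ₛₗ[sigma Fq Q L] V}
    {X : ℤ → Place Fq Q → Submodule L V} (T : Triv F φ X) (D : Place Fq Q →₀ ℤ) :
    Triv (F.twist D) φ fun i v => ((LatticeSheaf.mk V (X i)).twist D).stalk v where
  equiv i := T.equiv i
  equiv_pi i x := T.equiv_pi i x
  equiv_tau i x := T.equiv_tau i x
  mem_stalk i v x := forall_congr' fun z => forall_congr' fun _ =>
    (T.mem_stalk i v _).trans (iff_of_eq (congrArg (· ∈ X i v) (T.equiv_left_smul i _ x)))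

section BaseChange

variable (L' : Type u) [Field L'] [Algebra Fq L'] [Algebra L L'] [IsScalarTower Fq L L']

/-- The base change of a linear map. -/
def extMap {V W : CoeffModule Fq Q L} (f : V →ₗ[Q ⊗[Fq] L] W) :
    V.baseChange L' →ₗ[Q ⊗[Fq] L'] W.baseChange L' := ScalarExt.map (extHom Fq Q L L') f

omit [Fintype Fq] in
theorem extMap_ofExt {V W : CoeffModule Fq Q L} (f : V →ₗ[Q ⊗[Fq] L] W) (x : V) :
    extMap L' f (ofExt L' x) = ofExt L' (f x) := ScalarExt.map_of _ _ _

/-- The base change of a linear equivalence. -/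
def extEquiv {V W : CoeffModule Fq Q L} (e : V ≃ₗ[Q ⊗[Fq] L] W) :
    V.baseChange L' ≃ₗ[Q ⊗[Fq] L'] W.baseChange L' :=
  LinearEquiv.ofLinear (extMap L' e.toLinearMap) (extMap L' e.symm.toLinearMap)
    (LinearMap.ext fun x => by
      induction x using baseChange_induction_tensor with
      | h0 => rw [map_zero, map_zero]
      | hadd x y hx hy => rw [map_add, map_add, hx, hy]
      | h a x =>
        rw [map_smul, map_smul, LinearMap.comp_apply, extMap_ofExt, extMap_ofExt]
        exact congrArg (a • ofExt L' ·) (e.apply_symm_apply x))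
    (LinearMap.ext fun x => by
      induction x using baseChange_induction_tensor with
      | h0 => rw [map_zero, map_zero]
      | hadd x y hx hy => rw [map_add, map_add, hx, hy]
      | h a x =>
        rw [map_smul, map_smul, LinearMap.comp_apply, extMap_ofExt, extMap_ofExt]
        exact congrArg (a • ofExt L' ·) (e.symm_apply_apply x))

omit [Fintype Fq] in
theorem extEquiv_ofExt {V W : CoeffModule Fq Q L} (e : V ≃ₗ[Q ⊗[Fq] L] W) (x : V) :
    extEquiv L' e (ofExt L' x) = ofExt L' (e x) := ScalarExt.map_of _ _ _

omit [Fintype Fq] in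
theorem extEquiv_map {V W U : CoeffModule Fq Q L} {f : V →ₗ[Q ⊗[Fq] L] W} {e : W ≃ₗ[Q ⊗[Fq] L] U}
    {e₀ : V ≃ₗ[Q ⊗[Fq] L] U} (h : ∀ x, e (f x) = e₀ x) (x : V.baseChange L') :
    extEquiv L' e (extMap L' f x) = extEquiv L' e₀ x := by
  induction x using baseChange_induction_tensor with
  | h0 => simp only [map_zero]
  | hadd x y hx hy => simp only [map_add, hx, hy]
  | h a x =>
    simp only [map_smul]
    rw [extEquiv_ofExt, ← h, extMap_ofExt, extEquiv_ofExt]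

theorem extEquiv_extSemi {V W U : CoeffModule Fq Q L} {f : V →ₛₗ[sigma Fq Q L] W}
    {e : W ≃ₗ[Q ⊗[Fq] L] U} {e₀ : V ≃ₗ[Q ⊗[Fq] L] U} {φ : U →ₛₗ[sigma Fq Q L] U}
    (h : ∀ x, e (f x) = φ (e₀ x)) (x : V.baseChange L') :
    extEquiv L' e (extSemi L' f x) = extSemi L' φ (extEquiv L' e₀ x) := by
  induction x using baseChange_induction_tensor with
  | h0 => simp only [map_zero]
  | hadd x y hx hy => simp only [map_add, hx, hy]
  | h a x =>
    rw [map_smulₛₗ, map_smul, map_smul, map_smulₛₗ, extEquiv_ofExt, extSemi_ofExt, extSemi_ofExt,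
      ← h, extEquiv_ofExt]

/-- The trivialization of a base change. -/
def Triv.baseChange {F : PreTauSheaf Fq Q L} {V : CoeffModule Fq Q L} {φ : V →ₛₗ[sigma Fq Q L] V}
    {X : ℤ → Place Fq Q → Submodule L V} (T : Triv F φ X) :
    Triv (F.baseChange L') (extSemi L' φ) fun i v => extSub L' (X i v) where
  equiv i := extEquiv L' (T.equiv i)
  equiv_pi i x := extEquiv_map L' (T.equiv_pi i) x
  equiv_tau i x := extEquiv_extSemi L' (T.equiv_tau i) x
  mem_stalk i v x := by
    have h : extSub L' (X i v) = (((F.baseChange L').sheaf i).stalk v).map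
        (CoeffModule.linL (extEquiv L' (T.equiv i)).toLinearMap) := by
      have h1 : ((F.baseChange L').sheaf i).stalk v =
        Submodule.span L' (ofExt L' '' ((F.sheaf i).stalk v : Set (F.sheaf i).fibre)) := rfl
      rw [h1, Submodule.map_span, ← Set.image_comp, extSub, ← T.map_stalk, Submodule.map_coe,
        ← Set.image_comp]
      congr 2
    rw [h]
    refine ⟨fun hx => ⟨x, hx, rfl⟩, ?_⟩
    rintro ⟨y, hy, hyx⟩
    rwa [← (extEquiv L' (T.equiv i)).injective hyx]

end BaseChange

namespace Triv

variable {F F' : PreTauSheaf Fq Q L} {V V' : CoeffModule Fq Q L} {φ : V →ₛₗ[sigma Fq Q L] V}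
  {φ' : V' →ₛₗ[sigma Fq Q L] V'} {X : ℤ → Place Fq Q → Submodule L V}
  {X' : ℤ → Place Fq Q → Submodule L V'}

/-- The morphism given by a linear map which is compatible with `φ`. -/
def hom (T : Triv F φ X) (T' : Triv F' φ' X') (g : V →ₗ[Q ⊗[Fq] L] V')
    (hg : ∀ x, g (φ x) = φ' (g x)) (hX : ∀ i v, ∀ x ∈ X i v, g x ∈ X' i v) :
    PreTauSheaf.Hom F F' where
  map i := (T'.equiv i).symm.toLinearMap ∘ₗ g ∘ₗ (T.equiv i).toLinearMap
  map_mem i v x hx := by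
    rw [T'.mem_stalk]
    change T'.equiv i ((T'.equiv i).symm (g (T.equiv i x))) ∈ _
    rw [LinearEquiv.apply_symm_apply]
    exact hX i v _ ((T.mem_stalk i v x).1 hx)
  map_pi i x := (T'.equiv (i + 1)).injective <| by
    change T'.equiv (i + 1) ((T'.equiv (i + 1)).symm (g (T.equiv (i + 1) (F.Pi i x)))) =
      T'.equiv (i + 1) (F'.Pi i ((T'.equiv i).symm (g (T.equiv i x))))
    rw [LinearEquiv.apply_symm_apply, T.equiv_pi, T'.equiv_pi, LinearEquiv.apply_symm_apply]
  map_tau i x := (T'.equiv (i + 1)).injective <| by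
    change T'.equiv (i + 1) ((T'.equiv (i + 1)).symm (g (T.equiv (i + 1) (F.tau i x)))) =
      T'.equiv (i + 1) (F'.tau i ((T'.equiv i).symm (g (T.equiv i x))))
    rw [LinearEquiv.apply_symm_apply, T.equiv_tau, T'.equiv_tau, LinearEquiv.apply_symm_apply, hg]

theorem equiv_hom (T : Triv F φ X) (T' : Triv F' φ' X') (g : V →ₗ[Q ⊗[Fq] L] V')
    (hg : ∀ x, g (φ x) = φ' (g x)) (hX : ∀ i v, ∀ x ∈ X i v, g x ∈ X' i v) (i : ℤ)
    (x : (F.sheaf i).fibre) : T'.equiv i ((T.hom T' g hg hX).map i x) = g (T.equiv i x) :=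
  (T'.equiv i).apply_symm_apply _

/-- Commutation with the bijective maps `Π_i` determines every component of `f` from the component
at index zero. -/
theorem exists_linearMap (T : Triv F φ X) (T' : Triv F' φ' X') (f : PreTauSheaf.Hom F F') :
    ∃ g : V →ₗ[Q ⊗[Fq] L] V', (∀ i x, T'.equiv i (f.map i x) = g (T.equiv i x)) ∧
      ∀ x, g (φ x) = φ' (g x) := by
  let g : V →ₗ[Q ⊗[Fq] L] V' :=
    (T'.equiv 0).toLinearMap ∘ₗ f.map 0 ∘ₗ (T.equiv 0).symm.toLinearMap
  have hg0 : ∀ y, g y = T'.equiv 0 (f.map 0 ((T.equiv 0).symm y)) := fun _ => rfl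
  have key : ∀ i, (∀ x, T'.equiv i (f.map i x) = g (T.equiv i x)) ↔
      ∀ x, T'.equiv (i + 1) (f.map (i + 1) x) = g (T.equiv (i + 1) x) := fun i => by
    have hsurj : Function.Surjective (F.Pi i) := fun x => by
      obtain ⟨y, hy⟩ := T.exists_equiv_eq i (T.equiv (i + 1) x)
      exact ⟨y, (T.equiv (i + 1)).injective ((T.equiv_pi i y).trans hy)⟩
    refine Iff.trans ?_ hsurj.forall.symm
    refine forall_congr' fun x => ?_
    rw [f.map_pi, T'.equiv_pi, T.equiv_pi]
  have hg : ∀ i x, T'.equiv i (f.map i x) = g (T.equiv i x) := fun i => by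
    induction i using Int.induction_on with
    | zero =>
      intro x
      rw [hg0, LinearEquiv.symm_apply_apply]
    | succ n ih => exact (key n).1 ih
    | pred n ih =>
      refine (key _).2 ?_
      rwa [sub_add_cancel]
  refine ⟨g, hg, fun y => ?_⟩
  obtain ⟨x, rfl⟩ := T.exists_equiv_eq 0 y
  rw [← T.equiv_tau, ← hg, f.map_tau, T'.equiv_tau, hg]

end Triv

end Constructions


/-! ### Quotients by stable submodules -/

section QuotientModule

variable {Fq B L : Type u} [Field Fq] [CommRing B] [Algebra Fq B] [Field L] [Algebra Fq L]
  {V : CoeffModule Fq B L}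

/-- A quotient module. -/
def CoeffModule.quot (W : Submodule (B ⊗[Fq] L) V) : CoeffModule Fq B L := ⟨V ⧸ W⟩

/-- The projection to a quotient module. -/
def quotMk (W : Submodule (B ⊗[Fq] L) V) : V →ₗ[B ⊗[Fq] L] CoeffModule.quot W := W.mkQ

theorem quotMk_surjective (W : Submodule (B ⊗[Fq] L) V) : Function.Surjective (quotMk W) :=
  W.mkQ_surjective

theorem quotMk_eq_zero {W : Submodule (B ⊗[Fq] L) V} {x : V} : quotMk W x = 0 ↔ x ∈ W :=
  Submodule.Quotient.mk_eq_zero W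

variable [Fintype Fq] {φ : V →ₛₗ[sigma Fq B L] V}

/-- The semilinear map induced on the quotient by a stable submodule. -/
def quotSemi {W : Submodule (B ⊗[Fq] L) V} (hW : IsStable φ W) :
    CoeffModule.quot W →ₛₗ[sigma Fq B L] CoeffModule.quot W := W.mapQ W φ hW

theorem quotMk_semi {W : Submodule (B ⊗[Fq] L) V} (hW : IsStable φ W) (x : V) :
    quotMk W (φ x) = quotSemi hW (quotMk W x) := rfl

end QuotientModule

/-! ### The semisimplicity criterion for τ-sheaves -/

section Semisimple

variable {Fq Q L : Type u} [Field Fq] [Fintype Fq] [Field Q] [Algebra Fq Q] [Field L] [Algebra Fq L]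
  [Finite L] {F : PreTauSheaf Fq Q L} {V : CoeffModule Fq Q L} {φ : V →ₛₗ[sigma Fq Q L] V}
  {X : ℤ → Place Fq Q → Submodule L V} {inf : Place Fq Q} {c : Characteristic Fq Q L}
  (hQ : IsCurveFunctionField Fq Q) (hinf : inf.IsRational)

include hQ hinf

/-- By `Good.map` the quotient of `V` by a stable subspace `W` is the generic fibre of an abelian
quotient τ-sheaf, so simplicity leaves only `W = ⊥` and `W = ⊤`. -/
theorem Triv.isStablySimple (hc : c.place ≠ inf) (T : Triv F φ X) (h : F.IsSimple inf c) :
    IsStablySimple φ := by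
  obtain ⟨hF, hne, hquot⟩ := h
  obtain ⟨k, l, d, hgood⟩ := (T.isAbelian_iff hQ).1 hF
  refine ⟨?_, fun W hW => ?_⟩
  · by_contra hV
    rw [not_nontrivial_iff_subsingleton] at hV
    exact hne fun i => (T.equiv i).toEquiv.subsingleton
  · obtain ⟨d', hgood'⟩ := hgood.map hQ hinf hc (quotMk_surjective W) (quotMk_semi hW)
    let T' := Triv.chain (quotSemi hW) fun i v => (X i v).map (CoeffModule.linL (quotMk W))
    have hX : ∀ i v, ∀ x ∈ X i v, quotMk W x ∈ (X i v).map (CoeffModule.linL (quotMk W)) :=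
      fun i v x hx => ⟨x, hx, rfl⟩
    let f := T.hom T' (quotMk W) (quotMk_semi hW) hX
    have hf : ∀ i x, f.map i x = quotMk W (T.equiv i x) := T.equiv_hom T' _ (quotMk_semi hW) hX
    have hsurj : f.IsSurjective := fun i => by
      refine ⟨fun y => ?_, ?_⟩
      · obtain ⟨y, rfl⟩ := quotMk_surjective W y
        obtain ⟨x, rfl⟩ := T.exists_equiv_eq i y
        exact ⟨x, hf i x⟩
      · rintro v _ ⟨y, hy, rfl⟩
        obtain ⟨x, rfl⟩ := T.exists_equiv_eq i y
        exact ⟨x, (T.mem_stalk i v x).2 hy, hf i x⟩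
    rcases hquot _ f ((T'.isAbelian_iff hQ).2 ⟨k, l, d', hgood'⟩) hsurj with h0 | h0
    · right
      have hs : Subsingleton (CoeffModule.quot W) := h0 0
      exact eq_top_iff.2 fun x _ => quotMk_eq_zero.1 (Subsingleton.elim _ _)
    · left
      rw [eq_bot_iff]
      intro y hy
      obtain ⟨x, rfl⟩ := T.exists_equiv_eq 0 y
      have h1 : f.map 0 x = f.map 0 0 := by
        rw [hf, hf, map_zero, map_zero]
        exact quotMk_eq_zero.2 hy
      rw [h0 0 h1, map_zero]
      exact zero_mem _

/-- The Frobenius of a semisimple abelian `τ`-sheaf generates a reduced algebra. -/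
theorem Triv.frobReduced (hc : c.place ≠ inf) (T : Triv F φ X) (h : F.IsSemisimple inf c) :
    FrobReduced φ := by
  obtain ⟨n, G, hG, -, -, D, -, f, hf⟩ := h
  choose U ψ Y TG using fun j => Triv.exists_of_isAbelian hQ (hG j).1
  have TG := fun j => (TG j).some
  have hred : FrobReduced (semiPi ψ) := FrobReduced.pi (fun j =>
    ((TG j).isStablySimple hQ hinf hc (hG j)).frobReduced) _ fun _ _ => rfl
  let T' := (Triv.directSum TG).twist D
  obtain ⟨g, hg, hgφ⟩ := T.exists_linearMap T' f
  obtain ⟨hinj, S, -, hsurj⟩ := hf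
  let g' : V →ₗ[Q] CoeffModule.pi U :=
    { toFun := g, map_add' := map_add g, map_smul' := CoeffModule.map_left_smul g }
  refine hred.of_injective g' hgφ (fun x y hxy => ?_) fun y => ?_
  · obtain ⟨x, rfl⟩ := T.exists_equiv_eq 0 x
    obtain ⟨y, rfl⟩ := T.exists_equiv_eq 0 y
    have h1 : g (T.equiv 0 x) = g (T.equiv 0 y) := hxy
    rw [← hg, ← hg] at h1
    rw [hinj 0 ((T'.equiv 0).injective h1)]
  · obtain ⟨y, rfl⟩ := T'.exists_equiv_eq 0 y
    obtain ⟨x, rfl⟩ := (hsurj 0).1 y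
    exact ⟨T.equiv 0 x, (hg 0 x).symm⟩

/-- An abelian quotient has as kernel in `V` a stable subspace containing `W`; maximality of `W`
leaves only the trivial ones. -/
theorem Triv.isSimple_chain_quot {k l d : ℕ} (h : Good φ X inf c k l d)
    (hc : c.place ≠ inf) {W : Submodule (Q ⊗[Fq] L) V} (hW : IsStable φ W) (hW' : W ≠ ⊤)
    (hmax : ∀ W', IsStable φ W' → W ≤ W' → W' = W ∨ W' = ⊤) :
    (TauSheaves.chain (quotSemi hW) fun i v =>
      (X i v).map (CoeffModule.linL (quotMk W))).IsSimple inf c := by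
  obtain ⟨d', hgood⟩ := h.map hQ hinf hc (quotMk_surjective W) (quotMk_semi hW)
  let T := Triv.chain (quotSemi hW) fun i v => (X i v).map (CoeffModule.linL (quotMk W))
  refine ⟨(T.isAbelian_iff hQ).2 ⟨k, l, d', hgood⟩, fun h0 => hW' ?_, fun G f hG hf => ?_⟩
  · have hs : Subsingleton (CoeffModule.quot W) := h0 0
    exact eq_top_iff.2 fun x _ => quotMk_eq_zero.1 (Subsingleton.elim _ _)
  · obtain ⟨U, ψ, Y, ⟨T'⟩⟩ := Triv.exists_of_isAbelian hQ hG
    obtain ⟨g, hg, hgφ⟩ := T.exists_linearMap T' f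
    have hstab : IsStable φ (LinearMap.ker (g ∘ₗ quotMk W)) := fun x hx => by
      rw [LinearMap.mem_ker, LinearMap.comp_apply] at hx ⊢
      rw [quotMk_semi hW, hgφ, hx, map_zero]
    rcases hmax _ hstab fun x hx => by
      rw [LinearMap.mem_ker, LinearMap.comp_apply, quotMk_eq_zero.2 hx, map_zero] with h0 | h0
    · right
      intro i
      have hgi : Function.Injective g := by
        refine (injective_iff_map_eq_zero g).2 fun y hy => ?_
        obtain ⟨x, rfl⟩ := quotMk_surjective W y
        have : x ∈ LinearMap.ker (g ∘ₗ quotMk W) := hy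
        rw [h0] at this
        exact quotMk_eq_zero.2 this
      intro x y hxy
      have := congrArg (T'.equiv i) hxy
      rw [hg, hg] at this
      exact (T.equiv i).injective (hgi this)
    · left
      intro i
      have h1 : ∀ y : CoeffModule.quot W, g y = 0 := fun y => by
        obtain ⟨x, rfl⟩ := quotMk_surjective W y
        have : x ∈ LinearMap.ker (g ∘ₗ quotMk W) := h0 ▸ Submodule.mem_top
        exact this
      have h2 : ∀ y : (G.sheaf i).fibre, y = 0 := fun y => by
        obtain ⟨x, rfl⟩ := (hf i).1 y
        apply (T'.equiv i).injective
        rw [hg, h1, map_zero]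
      exact ⟨fun a b => (h2 a).trans (h2 b).symm⟩

/-- An abelian `τ`-sheaf of characteristic different from `∞` is semisimple if its Frobenius
generates a reduced algebra. -/
theorem Triv.isSemisimple (hc : c.place ≠ inf) (T : Triv F φ X) {k l d : ℕ}
    (h : Good φ X inf c k l d) (hred : FrobReduced φ) : F.IsSemisimple inf c := by
  have hfin := (h.lat 0).finite
  obtain ⟨n, K, hK, hK', hmax, hker, hsurj⟩ := hred.exists_maximal_family h.phi_injective
  let U : Fin n → CoeffModule Fq Q L := fun j => CoeffModule.quot (K j)
  let ψ : ∀ j, U j →ₛₗ[sigma Fq Q L] U j := fun j => quotSemi (hK j)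
  let Y : ∀ j, ℤ → Place Fq Q → Submodule L (U j) := fun j i v =>
    (X i v).map (CoeffModule.linL (quotMk (K j)))
  choose d' hgood using fun j => h.map hQ hinf hc (quotMk_surjective (K j)) (quotMk_semi (hK j))
  have hY : ∀ j, Good (ψ j) (Y j) inf c k l (d' j) := hgood
  have hpi := Good.pi hQ hinf hY h.k_pos h.l_pos (ψ := semiPi ψ) fun _ _ => rfl
  let TG := Triv.directSum fun j => Triv.chain (ψ j) (Y j)
  let g : V →ₗ[Q ⊗[Fq] L] CoeffModule.pi U :=
    { toFun := fun x j => quotMk (K j) x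
      map_add' := fun x y => funext fun j => map_add (quotMk (K j)) x y
      map_smul' := fun a x => funext fun j => map_smul (quotMk (K j)) a x }
  have hgs : Function.Surjective g := fun y => by
    choose y' hy' using fun j => quotMk_surjective (K j) (y j)
    obtain ⟨x, hx⟩ := hsurj y'
    refine ⟨x, funext fun j => ?_⟩
    rw [← hy' j, ← sub_eq_zero]
    exact ((quotMk (K j)).map_sub _ _).symm.trans (quotMk_eq_zero.2 (hx j))
  have hgi : Function.Injective g := (injective_iff_map_eq_zero g).2 fun x hx =>
    hker x fun j => quotMk_eq_zero.1 (congrFun hx j)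
  have hgX : ∀ i v, ∀ x ∈ X i v, g x ∈ piSub fun j => Y j i v := fun i v x hx j => ⟨x, hx, rfl⟩
  -- Quasi-isogeny asks for a morphism into some twist; the zero divisor is enough because the
  -- lattices of the summands are images of those of `F`.
  let TG' := TG.twist 0
  have hmem : ∀ i v x, x ∈ piSub (fun j => Y j i v) ↔
      x ∈ ((LatticeSheaf.mk _ fun v => piSub fun j => Y j i v).twist 0).stalk v := fun i v x => by
    obtain ⟨z, hz⟩ := Place.exists_uniformizer hQ v
    rw [(hpi.lat i).mem_twist_iff hz, Finsupp.coe_zero, Pi.zero_apply, zpow_zero, one_smul]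
  let f := T.hom TG' g (fun _ => rfl) fun i v x hx => (hmem i v _).1 (hgX i v x hx)
  have hf : ∀ i x, TG'.equiv i (f.map i x) = g (T.equiv i x) := fun i x => T.equiv_hom TG' _ _ _ i x
  refine ⟨n, fun j => TauSheaves.chain (ψ j) (Y j), fun j => isSimple_chain_quot hQ hinf h hc (hK j)
    (hK' j) (hmax j), (T.isAbelian_iff hQ).2 ⟨k, l, d, h⟩, (TG.isAbelian_iff hQ).2 ⟨k, l, _, hpi⟩,
    0, le_rfl, f, fun i x y hxy => ?_,
    -- At index zero the cokernel is supported at the finitely many places where two lattices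
    -- differ. Outside `inf` the chains are constant, so adding `inf` gives a support valid for all
    -- indices.
    insert inf {v | (X 0 v).map (CoeffModule.linL g) ≠ piSub fun j => Y j 0 v},
    (((h.lat 0).map hgs).finite_ne hQ (hpi.lat 0)).insert _, fun i => ⟨fun y => ?_, ?_⟩⟩
  · have := congrArg (TG'.equiv i) hxy
    rw [hf, hf] at this
    exact (T.equiv i).injective (hgi this)
  · obtain ⟨w, hw⟩ := hgs (TG'.equiv i y)
    obtain ⟨x, rfl⟩ := T.exists_equiv_eq i w
    exact ⟨x, (TG'.equiv i).injective ((hf i x).trans hw)⟩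
  · intro v hv y hy
    simp only [Set.mem_insert_iff, Set.mem_setOf_eq, not_or, not_not] at hv
    have h1 := (hmem i v _).2 ((TG'.mem_stalk i v y).1 hy)
    have h2 := hpi.away_eq i hv.1
    rw [h2, ← hv.2] at h1
    obtain ⟨w, hw, hwy⟩ := h1
    obtain ⟨x, rfl⟩ := T.exists_equiv_eq i w
    refine ⟨x, (T.mem_stalk i v x).2 ?_, (TG'.equiv i).injective ((hf i x).trans hwy)⟩
    rw [h.away_eq i hv.1]
    exact hw

end Semisimple


/-! ### Algebras generated by a root of a separable polynomial -/

section AbsolutelySemisimple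

open Polynomial

/-- An algebra generated by a root of a separable polynomial is absolutely semisimple. -/
theorem isSemisimpleRing_tensor_adjoin {Q E : Type u} [Field Q] [Ring E] [Algebra Q E] {x : E}
    {h : Q[X]} (hs : h.Separable) (h0 : aeval x h = 0) (K : Type u) [Field K] [Algebra Q K] :
    IsSemisimpleRing (K ⊗[Q] Algebra.adjoin Q {x}) := by
  let x' : Algebra.adjoin Q {x} := ⟨x, Algebra.subset_adjoin rfl⟩
  have hx' : aeval x' h = 0 := Subtype.ext (by
    rw [← Subalgebra.coe_val, ← aeval_algHom_apply]
    exact h0)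
  have hsurj : Function.Surjective (aeval (R := Q) x') := fun ⟨y, hy⟩ => by
    rw [Algebra.adjoin_singleton_eq_range_aeval] at hy
    obtain ⟨p, hp⟩ := hy
    refine ⟨p, Subtype.ext ?_⟩
    rw [← Subalgebra.coe_val, ← aeval_algHom_apply]
    exact hp
  let ξ : K ⊗[Q] Algebra.adjoin Q {x} := 1 ⊗ₜ x'
  let f : K[X] →ₐ[K] K ⊗[Q] Algebra.adjoin Q {x} := Polynomial.aeval ξ
  have hmap : ∀ p : Q[X], f (p.map (algebraMap Q K)) = 1 ⊗ₜ aeval x' p := fun p => by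
    change aeval ξ (p.map (algebraMap Q K)) = _
    rw [aeval_map_algebraMap]
    exact aeval_algHom_apply (Algebra.TensorProduct.includeRight :
      Algebra.adjoin Q {x} →ₐ[Q] K ⊗[Q] Algebra.adjoin Q {x}) x' p
  have hf : Function.Surjective f := fun y => by
    induction y using TensorProduct.induction_on with
    | zero => exact ⟨0, map_zero f⟩
    | add y z hy hz =>
      obtain ⟨p, rfl⟩ := hy
      obtain ⟨q, rfl⟩ := hz
      exact ⟨p + q, map_add f p q⟩
    | tmul a y =>
      obtain ⟨p, rfl⟩ := hsurj y
      refine ⟨a • p.map (algebraMap Q K), ?_⟩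
      rw [map_smul, hmap, TensorProduct.smul_tmul', smul_eq_mul, mul_one]
  -- The tensor product is a quotient of `K[X] / (h)`. As `h` stays separable over `K`, that ring is
  -- reduced and artinian, hence semisimple, and so are its quotients.
  set hK := h.map (algebraMap Q K)
  have hsK : hK.Separable := hs.map
  have hK0 : hK ≠ 0 := hsK.ne_zero
  let I : Ideal K[X] := Ideal.span {hK}
  have hI : I.IsRadical := by
    rw [← isRadical_iff_span_singleton]
    exact hsK.squarefree.isRadical
  have : IsReduced (K[X] ⧸ I) := (Ideal.isRadical_iff_quotient_reduced I).1 hI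
  have hfin : Module.Finite K (K[X] ⧸ I) := (AdjoinRoot.powerBasis hK0).finite
  have : IsArtinianRing (K[X] ⧸ I) := IsArtinianRing.of_finite K _
  have : IsSemisimpleRing (K[X] ⧸ I) := IsArtinianRing.isSemisimpleRing_of_isReduced _
  have hle : ∀ p ∈ I, f p = 0 := fun p hp => by
    obtain ⟨q, rfl⟩ := Ideal.mem_span_singleton.1 hp
    rw [map_mul, hmap, hx', TensorProduct.tmul_zero, zero_mul]
  exact RingHom.isSemisimpleRing_of_surjective (Ideal.Quotient.lift I f.toRingHom hle)
    (Ideal.Quotient.lift_surjective_of_surjective I hle hf)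

end AbsolutelySemisimple

/-! ### The Frobenius of a τ-sheaf and base change -/

section Frobenius

variable {Fq Q L : Type u} [Field Fq] [Fintype Fq] [Field Q] [Algebra Fq Q] [Field L] [Algebra Fq L]
  [Finite L] {F : PreTauSheaf Fq Q L} {V : CoeffModule Fq Q L} {φ : V →ₛₗ[sigma Fq Q L] V}
  {X : ℤ → Place Fq Q → Submodule L V} {inf : Place Fq Q} {c : Characteristic Fq Q L}

/-- The Frobenius of a trivialized `τ`-sheaf. -/
noncomputable def Triv.frob (T : Triv F φ X) (i : ℤ) : Module.End (Q ⊗[Fq] L) (F.sheaf i).fibre :=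
  (T.equiv i).symm.toLinearMap ∘ₗ frobLin φ ∘ₗ (T.equiv i).toLinearMap

theorem Triv.equiv_frob (T : Triv F φ X) (i : ℤ) (x : (F.sheaf i).fibre) :
    T.equiv i (T.frob i x) = φ^[Module.finrank Fq L] (T.equiv i x) := by
  rw [← frobLin_apply]
  exact (T.equiv i).apply_symm_apply _

theorem Good.iterate_mem {k l d : ℕ} (h : Good φ X inf c k l d) (n : ℕ) (i : ℤ) (v : Place Fq Q)
    {x : V} (hx : x ∈ X i v) : φ^[n] x ∈ X (i + n) v := by
  induction n with
  | zero => simpa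
  | succ n ih =>
    rw [Function.iterate_succ_apply', Nat.cast_succ, ← add_assoc]
    exact h.phi_mem _ v _ ih

/-- `φ ^ e` maps `X i` into `X (i + e)`, which lies in `X (i + l e)`; at `inf` the latter is `z ^
(-k e) • X i`. So `φ ^ e` is a morphism to the twist by `k e` times `inf`. -/
theorem Triv.isFrobenius (hQ : IsCurveFunctionField Fq Q) (T : Triv F φ X) {k l d : ℕ}
    (h : Good φ X inf c k l d) : F.IsFrobenius T.frob := by
  have hlat : ∀ i, IsLattice (F.sheaf i).stalk := fun i => by
    have := (h.lat i).map (T.equiv i).symm.surjective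
    convert! this using 1
    exact funext fun v => (T.map_symm i v).symm
  classical
  set e := Module.finrank Fq L
  refine ⟨⟨Finsupp.single inf ((k * e : ℕ) : ℤ), ?_, ⟨T.frob, fun i v x hx => ?_, fun i x => ?_,
    fun i x => ?_⟩, fun i => rfl⟩, fun i x => ?_⟩
  · intro v
    rw [Finsupp.coe_zero, Pi.zero_apply, Finsupp.single_apply]
    split_ifs
    · exact Int.natCast_nonneg _
    · exact le_rfl
  · obtain ⟨z, hz⟩ := Place.exists_uniformizer hQ v
    suffices key : z ^ (Finsupp.single inf ((k * e : ℕ) : ℤ)) v • T.equiv i (T.frob i x) ∈ X i v from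
      (T.mem_twist_iff (hlat i) hz).2 key
    rw [T.equiv_frob]
    have h1 := h.iterate_mem e i v ((T.mem_stalk i v x).1 hx)
    by_cases hv : v = inf
    · subst hv
      rw [Finsupp.single_eq_same, zpow_natCast, h.periodic_iterate hz e, smul_smul,
        inv_mul_cancel₀ (pow_ne_zero _ hz.1), one_smul]
      obtain ⟨t, ht⟩ : ∃ t : ℕ, l * e = e + t := Nat.exists_eq_add_of_le
        (Nat.le_mul_of_pos_left e h.l_pos)
      have h2 := h.mono_add (i + e) t v h1
      rw [add_assoc] at h2
      have h3 : (l : ℤ) * e = e + t := by exact_mod_cast ht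
      rwa [h3]
    · rw [Finsupp.single_eq_of_ne hv, zpow_zero, one_smul, h.away_eq i hv]
      rwa [h.away_eq _ hv] at h1
  · apply (T.equiv (i + 1)).injective
    refine (T.equiv_frob (i + 1) _).trans ?_
    rw [T.equiv_pi, ← T.equiv_frob]
    exact (T.equiv_pi i _).symm
  · apply (T.equiv (i + 1)).injective
    refine (T.equiv_frob (i + 1) _).trans ?_
    rw [T.equiv_tau, ← Function.iterate_succ_apply, Function.iterate_succ_apply', ← T.equiv_frob]
    exact (T.equiv_tau i _).symm
  · apply (T.equiv (i + e)).injective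
    rw [T.equiv_piIter, T.equiv_tauIter, T.equiv_frob]

theorem Triv.isAbsolutelySemisimple (T : Triv F φ X) {h : Polynomial Q} (hs : h.Separable)
    (h0 : frobEval φ h = 0) : F.IsAbsolutelySemisimple T.frob := by
  intro K _ _
  refine isSemisimpleRing_tensor_adjoin hs ?_ K
  funext i
  have key : ∀ (p : Polynomial Q) x, T.equiv i (Polynomial.aeval T.frob p i x) =
      frobEval φ p (T.equiv i x) := fun p x => by
    have h1 : Polynomial.aeval T.frob p i = Polynomial.aeval (T.frob i) p :=
      (Polynomial.aeval_algHom_apply (Pi.evalAlgHom Q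
        (fun i => Module.End (Q ⊗[Fq] L) (F.sheaf i).fibre) i) T.frob p).symm
    have h2 : ∀ (n : ℕ) x, T.equiv i ((T.frob i ^ n) x) =
        ((semiLin φ ^ Module.finrank Fq L : Module.End Q V) ^ n) (T.equiv i x) := fun n => by
      induction n with
      | zero => simp
      | succ n ih =>
        intro x
        rw [pow_succ, Module.End.mul_apply, ih, T.equiv_frob, pow_succ, Module.End.mul_apply,
          semiLin_pow_apply φ (Module.finrank Fq L)]
    rw [h1]
    clear h1
    unfold frobEval
    induction p using Polynomial.induction_on' with
    | add p q hp hq =>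
      rw [map_add, LinearMap.add_apply, map_add, map_add, LinearMap.add_apply, hp, hq]
    | monomial n b =>
      rw [Polynomial.aeval_monomial, Polynomial.aeval_monomial, Module.End.mul_apply,
        Module.End.mul_apply, Module.algebraMap_end_apply, Module.algebraMap_end_apply,
        T.equiv_left_smul, h2]
  ext x
  apply (T.equiv i).injective
  rw [key, h0, LinearMap.zero_apply]
  exact (map_zero _).symm

/-- After an extension of degree a power of the characteristic, the Frobenius of an abelian
`τ`-sheaf is absolutely semisimple, and the sheaf is semisimple. -/
theorem PreTauSheaf.IsAbelian.exists_baseChange_isSemisimple (hQ : IsCurveFunctionField Fq Q)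
    (hinf : inf.IsRational) (hF : F.IsAbelian inf c) :
    ∃ (n : ℕ) (L' : Type u) (_ : Field L') (_ : Algebra Fq L') (_ : Algebra L L')
        (_ : IsScalarTower Fq L L') (_ : FiniteDimensional L L'),
        Module.finrank L L' = ringChar L ^ n ∧
        (F.baseChange L').IsAbelian inf (c.baseChange L') ∧
        (∃ π, (F.baseChange L').IsFrobenius π ∧ (F.baseChange L').IsAbsolutelySemisimple π) ∧
        (c.place ≠ inf → (F.baseChange L').IsSemisimple inf (c.baseChange L')) := by
  obtain ⟨V, φ, X, ⟨T⟩⟩ := Triv.exists_of_isAbelian hQ hF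
  obtain ⟨k, l, d, h⟩ := (T.isAbelian_iff hQ).1 hF
  have hfin := (h.lat 0).finite
  have hp : Fact (ringChar L).Prime := ⟨CharP.char_is_prime L _⟩
  -- The exponent `n` obtained here is the one used for the degree: over an extension of degree
  -- `ringChar L ^ n` the Frobenius becomes a root of the separable polynomial `p`.
  obtain ⟨n, p, hs, h0⟩ := exists_separable_frobEval φ (ringChar L)
  obtain ⟨L', _, _, _, _, _, hn⟩ := exists_extension (Fq := Fq) (L := L) (ringChar L) n
  have hL' : Finite L' := Module.finite_of_finite L
  rw [← hn] at h0
  have h0' := frobEval_extSemi_eq_zero (L' := L') h0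
  have h' := h.baseChange L' hQ hinf
  have hfin' := (h'.lat 0).finite
  let T' := T.baseChange L'
  exact ⟨n, L', _, _, _, _, inferInstance, hn, (T'.isAbelian_iff hQ).2 ⟨k, l, d, h'⟩,
    ⟨T'.frob, T'.isFrobenius hQ h', T'.isAbsolutelySemisimple hs h0'⟩,
    fun hc => T'.isSemisimple hQ hinf hc h' (FrobReduced.of_separable hs h0')⟩

/-- Base changes of semisimple abelian `τ`-sheaves of characteristic different from `∞` are
semisimple. -/
theorem PreTauSheaf.IsSemisimple.baseChange (hQ : IsCurveFunctionField Fq Q)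
    (hinf : inf.IsRational) (hc : c.place ≠ inf) (hF : F.IsSemisimple inf c) (L' : Type u)
    [Field L'] [Algebra Fq L'] [Algebra L L'] [IsScalarTower Fq L L'] [FiniteDimensional L L'] :
    (F.baseChange L').IsSemisimple inf (c.baseChange L') := by
  have hab : F.IsAbelian inf c := by
    obtain ⟨n, G, -, h, -⟩ := hF
    exact h
  obtain ⟨V, φ, X, ⟨T⟩⟩ := Triv.exists_of_isAbelian hQ hab
  obtain ⟨k, l, d, h⟩ := (T.isAbelian_iff hQ).1 hab
  have hL' : Finite L' := Module.finite_of_finite L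
  have hred := (T.frobReduced hQ hinf hc hF).extSemi (L' := L')
  exact (T.baseChange L').isSemisimple hQ hinf hc (h.baseChange L' hQ hinf) hred

end Frobenius


/-! ### Sections over the complement of ∞ -/

section SectionsAway

variable {Fq Q L : Type u} [Field Fq] [Fintype Fq] [Field Q] [Algebra Fq Q] [Field L] [Finite L]
  [Algebra Fq L] {V W : CoeffModule Fq Q L} {inf : Place Fq Q}

theorem smul_mem_sectionsAway {X : Place Fq Q → Submodule L V} (hX : IsLattice X) {a : Q}
    (ha : a ∈ affineRing inf) {x : V} (hx : x ∈ sectionsAway inf X) : a • x ∈ sectionsAway inf X :=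
  mem_sectionsAway.2 fun w hw => hX.smul_mem (ha w hw) (mem_sectionsAway.1 hx w hw)

theorem sectionsAway_piSub {n : ℕ} {U : Fin n → CoeffModule Fq Q L}
    (X : ∀ j, Place Fq Q → Submodule L (U j)) :
    sectionsAway inf (fun v => piSub fun j => X j v) = piSub fun j => sectionsAway inf (X j) := by
  ext x
  simp only [mem_piSub, mem_sectionsAway]
  exact ⟨fun h j w hw => h w hw j, fun h w hw j => h j w hw⟩

theorem sectionsAway_extSub (L' : Type u) [Field L'] [Algebra Fq L'] [Algebra L L']
    [IsScalarTower Fq L L'] [FiniteDimensional L L'] [Finite L'] (X : Place Fq Q → Submodule L V) :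
    sectionsAway inf (fun v => extSub L' (X v)) = extSub L' (sectionsAway inf X) := by
  obtain ⟨E, hE⟩ := exists_addEquiv_extSub (L' := L') V
  ext x
  simp only [hE, mem_sectionsAway]
  exact ⟨fun h j w hw => h w hw j, fun h w hw j => h j w hw⟩

variable (hQ : IsCurveFunctionField Fq Q) (hinf : inf.IsRational)

include hQ hinf

/-- Membership in a module of sections can be checked locally on the complement of `∞`. -/
theorem mem_of_forall_exists_smul_mem {P : AddSubgroup V}
    (hP : ∀ a ∈ affineRing inf, ∀ x ∈ P, a • x ∈ P) {y : V}
    (h0 : ∃ a ∈ affineRing inf, a ≠ 0 ∧ a • y ∈ P)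
    (h : ∀ v ≠ inf, ∃ s ∈ affineRing inf, s ∉ v.ring.nonunits ∧ s • y ∈ P) : y ∈ P := by
  -- The ideal of denominators of `y`. If it were proper, it would lie in the maximal ideal of a
  -- valuation ring above `A`. That ring is a place other than `inf`, since a non-zero element of
  -- `A` cannot vanish at `inf`; but at such a place some denominator is a unit.
  let I : Ideal (affineRing inf).toSubring :=
    { carrier := {a | (a : Q) • y ∈ P}
      add_mem' := fun {a b} ha hb => by
        rw [Set.mem_setOf_eq, Subring.coe_add, add_smul]; exact P.add_mem ha hb
      zero_mem' := by rw [Set.mem_setOf_eq, Subring.coe_zero, zero_smul]; exact P.zero_mem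
      smul_mem' := fun a b hb => by
        rw [Set.mem_setOf_eq, smul_eq_mul, Subring.coe_mul, mul_smul]
        exact hP a a.2 _ hb }
  by_contra hy
  have hI : I ≠ ⊤ := fun hI => hy (by
    have : (1 : (affineRing inf).toSubring) ∈ I := hI ▸ Submodule.mem_top
    rw [← one_smul Q y]
    exact this)
  obtain ⟨B, hAB, hIB⟩ := Ideal.image_subset_nonunits_valuationSubring I hI
  have hB : ∀ a ∈ affineRing inf, a • y ∈ P → a ∈ B.nonunits := fun a ha hay =>
    hIB ⟨⟨a, ha⟩, hay, rfl⟩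
  obtain ⟨a, ha, ha0, hay⟩ := h0
  let v : Place Fq Q :=
    { ring := B
      const_mem := fun b => hAB (Subalgebra.algebraMap_mem (affineRing inf) b)
      ne_top := fun htop => by
        have h1 : a⁻¹ ∈ B := htop ▸ ValuationSubring.mem_top _
        have := ((ValuationSubring.mem_nonunits_iff_or B).1 (hB a ha hay)).resolve_left ha0
        exact this h1 }
  have hv : v ≠ inf := fun hv => ha0
    (eq_zero_of_mem_affineRing_of_nonunits hQ ha (hv ▸ hB a ha hay))
  obtain ⟨s, hs, hsv, hsy⟩ := h v hv
  exact hsv (hB s hs hsy)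

/-- Two families of lattices are commensurable. -/
theorem IsLattice.exists_smul_mem {X Y : Place Fq Q → Submodule L V} (hX : IsLattice X)
    (hY : IsLattice Y) : ∃ a ∈ affineRing inf, a ≠ 0 ∧ ∀ v ≠ inf, ∀ x ∈ Y v, a • x ∈ X v := by
  classical
  have hbad := hX.finite_ne hQ hY
  set T := hbad.toFinset.erase inf with hT
  obtain ⟨g, hgA, hg0, hgT⟩ := exists_affine_nonunits hQ hinf T (by simp [hT])
  have hN : ∀ v ∈ T, ∃ N : ℕ, ∀ n ≥ N, ∀ x ∈ Y v, g ^ n • x ∈ X v := by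
    intro v hv
    obtain ⟨s, hsf, -, h⟩ := hY.local_span v
    choose N hN using fun x : V => hX.exists_pow_smul_mem hQ (hgT v hv) hg0 x
    refine ⟨hsf.toFinset.sup N, fun n hn x hx => ?_⟩
    rw [h] at hx
    induction hx using Submodule.span_induction with
    | mem x hx =>
      obtain ⟨a, ha, y, hy, rfl⟩ := hx
      rw [smul_comm]
      exact hX.smul_mem ha (hN y n (le_trans
        (Finset.le_sup (f := N) ((Set.Finite.mem_toFinset hsf).2 hy)) hn))
    | zero => rw [smul_zero]; exact zero_mem _
    | add x y _ _ hx hy => rw [smul_add]; exact add_mem hx hy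
    | smul c x _ hx => rw [smul_comm]; exact Submodule.smul_mem _ _ hx
  choose! N hN using hN
  refine ⟨g ^ T.sup N, pow_mem hgA _, pow_ne_zero _ hg0, fun v hv x hx => ?_⟩
  by_cases hvT : v ∈ T
  · exact hN v hvT _ (Finset.le_sup hvT) x hx
  · have : X v = Y v := by
      by_contra hne
      exact hvT (Finset.mem_erase.2 ⟨hv, (Set.Finite.mem_toFinset hbad).2 hne⟩)
    exact hX.smul_mem (pow_mem (hgA v hv) _) (this ▸ hx)

theorem IsLattice.exists_smul_mem_sectionsAway {X : Place Fq Q → Submodule L V} (hX : IsLattice X)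
    (x : V) : ∃ a ∈ affineRing inf, a ≠ 0 ∧ a • x ∈ sectionsAway inf X := by
  classical
  have hbad := hX.finite_notMem hQ x
  set T := hbad.toFinset.erase inf with hT
  obtain ⟨g, hgA, hg0, hgT⟩ := exists_affine_nonunits hQ hinf T (by simp [hT])
  have hN : ∀ v ∈ T, ∃ N : ℕ, ∀ n ≥ N, g ^ n • x ∈ X v := fun v hv =>
    hX.exists_pow_smul_mem hQ (hgT v hv) hg0 x
  choose! N hN using hN
  refine ⟨g ^ T.sup N, pow_mem hgA _, pow_ne_zero _ hg0, mem_sectionsAway.2 fun v hv => ?_⟩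
  by_cases hvT : v ∈ T
  · exact hN v hvT _ (Finset.le_sup hvT)
  · have : x ∈ X v := by
      by_contra hne
      exact hvT (Finset.mem_erase.2 ⟨hv, (Set.Finite.mem_toFinset hbad).2 hne⟩)
    exact hX.smul_mem (pow_mem (hgA v hv) _) this

/-- The complement of `inf` is affine, so sections over it lift along surjections: a local lift
extends after multiplication by a function not vanishing at the given point, and membership is
local. -/
theorem IsLattice.sectionsAway_map {X : Place Fq Q → Submodule L V} (hX : IsLattice X)
    {f : V →ₗ[Q ⊗[Fq] L] W} (hf : Function.Surjective f) :
    sectionsAway inf (fun v => (X v).map (CoeffModule.linL f)) =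
      (sectionsAway inf X).map (CoeffModule.linL f) := by
  refine le_antisymm (fun y hy => ?_) ?_
  · refine mem_of_forall_exists_smul_mem hQ hinf (y := y)
      (P := ((sectionsAway inf X).map (CoeffModule.linL f)).toAddSubgroup) ?_ ?_ ?_
    · rintro a ha _ ⟨x, hx, rfl⟩
      exact ⟨a • x, smul_mem_sectionsAway hX ha hx, CoeffModule.map_left_smul f a x⟩
    · obtain ⟨x, rfl⟩ := hf y
      obtain ⟨a, ha, ha0, hax⟩ := hX.exists_smul_mem_sectionsAway hQ hinf x
      exact ⟨a, ha, ha0, a • x, hax, CoeffModule.map_left_smul f a x⟩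
    · intro v hv
      obtain ⟨x, hx, rfl⟩ := mem_sectionsAway.1 hy v hv
      obtain ⟨s, hs, hsv, hsx⟩ := Good.exists_smul_mem_of_mem hQ hinf hX hv hx
      exact ⟨s, hs, hsv, s • x, mem_sectionsAway.2 hsx, CoeffModule.map_left_smul f s x⟩
  · rintro _ ⟨x, hx, rfl⟩
    exact mem_sectionsAway.2 fun w hw => ⟨x, mem_sectionsAway.1 hx w hw, rfl⟩

end SectionsAway


/-! ### Ranks and cardinalities at the generic point -/

section GenericRank

/-- Over a domain the rank of a finite flat module at `p` equals the rank at the generic point,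
where the localization of `M` is `V`. -/
theorem rankAtStalk_eq_finrank_of_injective {R K M V : Type*} [CommRing R] [IsDomain R] [Field K]
    [Algebra R K] [IsFractionRing R K] [AddCommGroup M] [Module R M] [AddCommGroup V] [Module K V]
    [Module R V] [IsScalarTower R K V] [Module.Finite R M] [Module.Flat R M] {ι : M →ₗ[R] V}
    (hι : Function.Injective ι) (hsurj : ∀ y, ∃ a : R, a ≠ 0 ∧ ∃ x, ι x = a • y)
    (p : PrimeSpectrum R) : Module.rankAtStalk M p = Module.finrank K V := by
  have : IsLocalizedModule (nonZeroDivisors R) ι :=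
    { map_units := fun x => by
        rw [Module.End.isUnit_iff]
        have h0 : algebraMap R K x ≠ 0 :=
          IsFractionRing.to_map_ne_zero_of_mem_nonZeroDivisors x.2
        have h : ∀ y : V, algebraMap R (Module.End R V) x y = algebraMap R K x • y := fun y => by
          rw [Module.algebraMap_end_apply, algebraMap_smul]
        refine ⟨fun y z hyz => ?_, fun y => ⟨(algebraMap R K x)⁻¹ • y, ?_⟩⟩
        · rw [h, h] at hyz
          exact smul_right_injective V h0 hyz
        · rw [h, smul_inv_smul₀ h0]
      surj := fun y => by
        obtain ⟨a, ha, x, hx⟩ := hsurj y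
        exact ⟨(x, ⟨a, mem_nonZeroDivisors_of_ne_zero ha⟩), hx.symm⟩
      exists_of_eq := fun h => ⟨1, by rw [hι h]⟩ }
  have hb := IsLocalizedModule.isBaseChange (nonZeroDivisors R) K ι
  have hq : (PrimeSpectrum.comap (algebraMap R K) ⊥) ≤ p := by
    have : PrimeSpectrum.comap (algebraMap R K) ⊥ = ⊥ := by
      ext1
      exact (RingHom.ker_eq_bot_iff_eq_zero _).2 fun x hx => by
        simpa using (IsFractionRing.injective R K) (hx.trans (map_zero _).symm)
    rw [this]
    exact bot_le
  rw [← Module.rankAtStalk_eq_of_le_of_finite_of_flat M hq, ← Module.rankAtStalk_isBaseChange hb,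
    Module.rankAtStalk_eq_finrank_of_free, Pi.natCast_apply, Nat.cast_id]

theorem rank_eq_iff_natCard_eq {L U : Type u} [Field L] [Finite L] [AddCommGroup U] [Module L U]
    {d : ℕ} : Module.rank L U = d ↔ Nat.card U = Nat.card L ^ d := by
  have h2 : 1 < Nat.card L := Finite.one_lt_card
  constructor
  · intro h
    have : Module.Finite L U := by
      rw [← Module.rank_lt_aleph0_iff, h]; exact Cardinal.natCast_lt_aleph0
    rw [Module.natCard_eq_pow_finrank (K := L), Module.finrank_eq_of_rank_eq h]
  · intro h
    have h0 : Nat.card U ≠ 0 := by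
      rw [h]; exact pow_ne_zero _ (by omega)
    have := (Nat.card_ne_zero.1 h0).2
    rw [Module.natCard_eq_pow_finrank (K := L)] at h
    rw [← Module.finrank_eq_rank, Nat.pow_right_injective h2 h]

end GenericRank

/-! ### Pure Anderson motives as sections of lattices -/

section Models

variable {Fq Q L : Type u} [Field Fq] [Fintype Fq] [Field Q] [Algebra Fq Q] [Field L]
  [Algebra Fq L] {inf : Place Fq Q}

theorem affineHom_tmul (a : affineRing inf) (x : L) :
    affineHom inf L (a ⊗ₜ x) = (a : Q) ⊗ₜ x := rfl

theorem affineHom_injective : Function.Injective (affineHom inf L) :=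
  Module.Flat.rTensor_preserves_injective_linearMap (affineRing inf).val.toLinearMap
    Subtype.val_injective

theorem affineHom_sigma (x : affineRing inf ⊗[Fq] L) :
    affineHom inf L (sigma Fq (affineRing inf) L x) = sigma Fq Q L (affineHom inf L x) := by
  induction x using TensorProduct.induction_on with
  | zero => simp
  | add x y hx hy => simp only [map_add, hx, hy]
  | tmul a x => rfl

theorem mem_span_iterate_image_iff [Finite L] {V : CoeffModule Fq Q L} (T : V →ₛₗ[sigma Fq Q L] V)
    (n : ℕ) (N : Submodule L V) (x : V) :
    x ∈ Submodule.span L (T^[n] '' (N : Set V)) ↔ ∃ y ∈ N, T^[n] y = x := by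
  let N' : Submodule L V :=
    { carrier := T^[n] '' (N : Set V)
      add_mem' := by
        rintro _ _ ⟨x, hx, rfl⟩ ⟨y, hy, rfl⟩
        exact ⟨x + y, N.add_mem hx hy, iterate_map_add T n x y⟩
      zero_mem' := ⟨0, N.zero_mem, iterate_map_zero T n⟩
      smul_mem' := by
        rintro a _ ⟨x, hx, rfl⟩
        obtain ⟨b, rfl⟩ := frobenius_surjective (Fq := Fq) n a
        exact ⟨b • x, N.smul_mem b hx, iterate_right_smul T n b x⟩ }
  have : Submodule.span L (T^[n] '' (N : Set V)) = N' := Submodule.span_eq N'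
  rw [this]
  rfl

/-- The element `a ⊗ 1 - 1 ⊗ c(a)` of `Q ⊗ L`. -/
def motiveElt (c : affineRing inf →ₐ[Fq] L) (a : affineRing inf) : Q ⊗[Fq] L :=
  affineHom inf L (a ⊗ₜ 1 - 1 ⊗ₜ c a)

theorem motiveElt_smul {V : CoeffModule Fq Q L} (c : affineRing inf →ₐ[Fq] L) (a : affineRing inf)
    (x : V) : motiveElt c a • x = (a : Q) • x - c a • x := by
  rw [motiveElt, map_sub, sub_smul]
  rfl

/-- An `A_L`-module with semilinear map is the module of sections outside `inf` of the lattice `X`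
in a `Q_L`-module with a semilinear map `T`. -/
structure MotiveModel (M : PreMotive inf L) {V : CoeffModule Fq Q L} (T : V →ₛₗ[sigma Fq Q L] V)
    (X : Place Fq Q → Submodule L V) where
  /-- the embedding in the generic fibre -/
  toFun : M.mod →ₛₗ[affineHom inf L] V
  injective : Function.Injective toFun
  mem_iff : ∀ y, (∃ x, toFun x = y) ↔ ∀ w ≠ inf, y ∈ X w
  map_tau : ∀ x, T (toFun x) = toFun (M.tau x)

variable [Finite L] {V : CoeffModule Fq Q L} {T : V →ₛₗ[sigma Fq Q L] V}
  {X : Place Fq Q → Submodule L V} {c : affineRing inf →ₐ[Fq] L} {M : PreMotive inf L}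

/-- The data `(V, T, X)` define a pure Anderson motive. -/
structure GoodMotive (T : V →ₛₗ[sigma Fq Q L] V) (X : Place Fq Q → Submodule L V)
    (c : affineRing inf →ₐ[Fq] L) (k l d : ℕ) : Prop where
  lat : IsLattice X
  injective : Function.Injective T
  map_mem : ∀ x ∈ sectionsAway inf X, T x ∈ sectionsAway inf X
  dim : relIdx (semiImage T (sectionsAway inf X)) (sectionsAway inf X) = Nat.card L ^ d
  -- As in `Good` the exponent is left open, so that the condition passes to quotients.
  nilpotent : ∃ m, ∀ n ≥ m, ∀ a, ∀ x ∈ sectionsAway inf X,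
    motiveElt c a ^ n • x ∈ semiImage T (sectionsAway inf X)
  k_pos : 0 < k
  l_pos : 0 < l
  pure : ∀ z, inf.IsUniformizer z → ∀ x, (∃ y ∈ X inf, T^[l] y = x) ↔ z ^ k • x ∈ X inf

namespace MotiveModel

omit [Fintype Fq] [Finite L] in
theorem map_left_smul' {M : CoeffModule Fq (affineRing inf) L} (ι : M →ₛₗ[affineHom inf L] V)
    (a : affineRing inf) (x : M) : ι (a • x) = (a : Q) • ι x := map_smulₛₗ ι _ _

omit [Fintype Fq] [Finite L] in
theorem map_right_smul' {M : CoeffModule Fq (affineRing inf) L} (ι : M →ₛₗ[affineHom inf L] V)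
    (a : L) (x : M) : ι (a • x) = a • ι x := map_smulₛₗ ι _ _

theorem mem_sectionsAway (μ : MotiveModel M T X) (x : M.mod) : μ.toFun x ∈ sectionsAway inf X :=
  TauSheaves.mem_sectionsAway.2 ((μ.mem_iff _).1 ⟨x, rfl⟩)

theorem exists_eq (μ : MotiveModel M T X) {y : V} (hy : y ∈ sectionsAway inf X) :
    ∃ x, μ.toFun x = y :=
  (μ.mem_iff y).2 (TauSheaves.mem_sectionsAway.1 hy)

theorem mem_tauImage {x : M.mod} : x ∈ M.tauImage ↔ ∃ y, M.tau y = x := by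
  let R : Submodule (affineRing inf ⊗[Fq] L) M.mod :=
    CoeffModule.mkSubmodule (M.tau.toAddMonoidHom.range)
      (by
        rintro b _ ⟨y, rfl⟩
        exact ⟨b • y, semi_left_smul M.tau b y⟩)
      (by
        rintro a _ ⟨y, rfl⟩
        obtain ⟨b, hb⟩ := frobenius_surjective (Fq := Fq) 1 a
        refine ⟨b • y, (semi_right_smul M.tau b y).trans ?_⟩
        rw [← hb, pow_one]
        rfl)
  have : M.tauImage = R := Submodule.span_eq R
  rw [this]
  rfl

theorem mem_tauImage_iff (μ : MotiveModel M T X) (x : M.mod) :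
    x ∈ M.tauImage ↔ μ.toFun x ∈ semiImage T (sectionsAway inf X) := by
  rw [mem_tauImage]
  constructor
  · rintro ⟨y, rfl⟩
    exact ⟨_, μ.mem_sectionsAway y, μ.map_tau y⟩
  · rintro ⟨y, hy, hyx⟩
    obtain ⟨y, rfl⟩ := μ.exists_eq hy
    rw [μ.map_tau] at hyx
    exact ⟨y, μ.injective hyx⟩

theorem rank_coker_iff (μ : MotiveModel M T X) (d : ℕ) :
    Module.rank L M.coker = d ↔
      relIdx (semiImage T (sectionsAway inf X)) (sectionsAway inf X) = Nat.card L ^ d := by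
  let p : M.mod →+ V := μ.toFun.toAddMonoidHom
  have hp : Function.Injective p := μ.injective
  have h1 : M.tauImage.toAddSubgroup.map p =
      (semiImage T (sectionsAway inf X)).toAddSubgroup := by
    ext y
    constructor
    · rintro ⟨x, hx, rfl⟩
      exact (μ.mem_tauImage_iff x).1 hx
    · rintro ⟨x, hx, rfl⟩
      obtain ⟨x, rfl⟩ := μ.exists_eq hx
      exact ⟨M.tau x, Submodule.subset_span ⟨x, rfl⟩, (μ.map_tau x).symm⟩
  have h2 : (⊤ : AddSubgroup M.mod).map p = (sectionsAway inf X).toAddSubgroup := by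
    ext y
    constructor
    · rintro ⟨x, -, rfl⟩
      exact μ.mem_sectionsAway x
    · intro hy
      obtain ⟨x, rfl⟩ := μ.exists_eq hy
      exact ⟨x, trivial, rfl⟩
  have h3 : Nat.card M.coker = M.tauImage.toAddSubgroup.relIndex ⊤ := by
    rw [AddSubgroup.relIndex_top_right]
    rfl
  rw [rank_eq_iff_natCard_eq, h3, ← AddSubgroup.relIndex_map_map_of_injective _ _ hp, h1, h2]

-- A power of an ideal is spanned by the products of its generators, so annihilation need only be
-- tested on these.
open scoped Pointwise in
theorem charIdeal_pow_smul_le_iff {d : ℕ} (N : Submodule (affineRing inf ⊗[Fq] L) M.mod) :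
    charIdeal c ^ d • (⊤ : Submodule (affineRing inf ⊗[Fq] L) M.mod) ≤ N ↔
      ∀ (a : Fin d → affineRing inf) (x : M.mod),
        (∏ j, (a j ⊗ₜ[Fq] (1 : L) - (1 : affineRing inf) ⊗ₜ[Fq] c (a j))) • x ∈ N := by
  have h : charIdeal c ^ d = Submodule.span (affineRing inf ⊗[Fq] L)
      (Set.range (fun a : affineRing inf => a ⊗ₜ[Fq] (1 : L) - (1 : affineRing inf) ⊗ₜ[Fq] c a) ^ d) :=
    Submodule.span_pow _ d
  rw [h, Submodule.smul_le]
  constructor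
  · intro H a x
    refine H _ (Submodule.subset_span (Set.mem_pow.2 ⟨fun j => ⟨_, a j, rfl⟩, ?_⟩)) x trivial
    rw [List.prod_ofFn]
  · intro H r hr x _
    refine Submodule.span_le (p := N.comap (LinearMap.toSpanSingleton _ _ x)) |>.2 (fun r hr => ?_) hr
    obtain ⟨f, rfl⟩ := Set.mem_pow.1 hr
    choose a ha using fun j => (f j).2
    rw [List.prod_ofFn]
    simp only [← ha]
    exact H a x

variable (hQ : IsCurveFunctionField Fq Q)

include hQ in
theorem exists_goodMotive (hinf : inf.IsRational) (h : M.IsPureAnderson c) :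
    ∃ (V : CoeffModule Fq Q L) (T : V →ₛₗ[sigma Fq Q L] V) (X : Place Fq Q → Submodule L V)
      (_ : MotiveModel M T X) (k l d : ℕ), GoodMotive T X c k l d := by
  obtain ⟨r, d, h⟩ := h
  obtain ⟨⟨V, X⟩, ι, T, k, l, hE, hι, hr, hT, hk, hl, hp⟩ := h.pure
  have hX : IsLattice X := .of_isLocallyFree inf hE
  let μ : MotiveModel M T X :=
    { toFun := ι
      injective := hι
      mem_iff := fun y => Set.ext_iff.1 hr y
      map_tau := hT }
  -- Every vector has a non-zero multiple in the image of `M`, where `T` is given by the injective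
  -- map `M.tau`.
  have hT0 : Function.Injective T := by
    refine (injective_iff_map_eq_zero _).2 fun y hy => ?_
    obtain ⟨a, ha, ha0, hay⟩ := hX.exists_smul_mem_sectionsAway hQ hinf y
    obtain ⟨x, hx⟩ := μ.exists_eq hay
    have h1 : μ.toFun (M.tau x) = 0 := by
      rw [← μ.map_tau, hx, semi_left_smul, hy, smul_zero]
    have h2 : x = 0 := by
      refine h.tau_injective (μ.injective ?_)
      rw [h1, map_zero, map_zero]
    rw [h2, map_zero] at hx
    rw [← inv_smul_smul₀ ha0 y, ← hx, smul_zero]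
  refine ⟨V, T, X, μ, k, l, d, hX, hT0, ?_, (μ.rank_coker_iff d).1 h.dim_coker, ⟨d, ?_⟩, hk, hl, ?_⟩
  · intro y hy
    obtain ⟨x, rfl⟩ := μ.exists_eq hy
    rw [μ.map_tau]
    exact μ.mem_sectionsAway _
  · intro n hn a y hy
    obtain ⟨x, rfl⟩ := μ.exists_eq hy
    have h1 := (charIdeal_pow_smul_le_iff _).1 h.coker_annihilated (fun _ => a)
      ((a ⊗ₜ[Fq] (1 : L) - (1 : affineRing inf) ⊗ₜ[Fq] c a) ^ (n - d) • x)
    rw [Finset.prod_const, Finset.card_univ, Fintype.card_fin, ← mul_smul, ← pow_add,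
      Nat.add_sub_cancel' hn, μ.mem_tauImage_iff, map_smulₛₗ, map_pow] at h1
    exact h1
  · intro z hz x
    have h1 := hX.mem_twist_iff (D := Finsupp.single inf (k : ℤ)) hz (x := x)
    rw [Finsupp.single_eq_same, zpow_natCast] at h1
    rw [← h1, ← mem_span_iterate_image_iff]
    exact (SetLike.ext_iff.1 hp x)

-- A non-zero `a ∈ A` carries the sections into a lattice with a global basis, whose coordinates
-- embed them into a free module of finite rank over the noetherian ring `A`.
include hQ in
theorem finite (hinf : inf.IsRational) (hX : IsLattice X) (μ : MotiveModel M T X) :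
    Module.Finite (affineRing inf ⊗[Fq] L) M.mod := by
  have := isDedekindDomain_affineRing hQ hinf
  have hfd : FiniteDimensional Fq L := Module.Finite.of_finite
  have := hX.finite
  obtain ⟨b⟩ := CoeffModule.exists_basis (V := V) (isField_tensor hQ L)
  obtain ⟨β, hβ⟩ := exists_basis_mem_latSpan b
  have hY : IsLattice fun v => latSpan v (Set.range b) :=
    ⟨fun v => ⟨_, Set.finite_range b, b.span_eq, rfl⟩,
      ⟨_, Set.finite_range b, b.span_eq, by simp⟩⟩
  obtain ⟨a, ha, ha0, haX⟩ := IsLattice.exists_smul_mem hQ hinf hY hX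
  let f : M.mod →ₗ[affineRing inf] (Fin (Module.finrank Fq L) ×
      Fin (Module.finrank (Q ⊗[Fq] L) V) → affineRing inf) :=
    { toFun := fun x t => ⟨β.repr (a • μ.toFun x) t, fun v hv =>
        (hβ v _).1 (haX v hv _ (TauSheaves.mem_sectionsAway.1 (μ.mem_sectionsAway x) v hv)) t⟩
      map_add' := fun x y => funext fun t => Subtype.ext <| by
        change β.repr (a • μ.toFun (x + y)) t = β.repr (a • μ.toFun x) t + β.repr (a • μ.toFun y) t
        rw [map_add, smul_add, map_add, Finsupp.add_apply]
      map_smul' := fun s x => funext fun t => Subtype.ext <| by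
        change β.repr (a • μ.toFun (s • x)) t = (s : Q) * β.repr (a • μ.toFun x) t
        rw [map_left_smul', smul_comm, map_smul, Finsupp.smul_apply, smul_eq_mul] }
  have hf : Function.Injective f := by
    intro x y hxy
    refine μ.injective ?_
    have h1 : a • μ.toFun x = a • μ.toFun y := β.repr.injective (Finsupp.ext fun t =>
      congrArg Subtype.val (congrFun hxy t))
    rw [← inv_smul_smul₀ ha0 (μ.toFun x), h1, inv_smul_smul₀ ha0]
  have : Module.Finite (affineRing inf) M.mod := Module.Finite.of_injective f hf
  exact Module.Finite.of_restrictScalars_finite (affineRing inf) _ _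

-- The module `M` is finitely generated and torsion-free over the Dedekind domain `A ⊗ L`, hence
-- projective; its rank is read off at the generic point. Annihilation by the `d`-th power of the
-- ideal comes from `prod_smul_mem_of_nilpotent`.
include hQ in
theorem isPureAnderson (hinf : inf.IsRational) (μ : MotiveModel M T X) {k l d : ℕ}
    (h : GoodMotive T X c k l d) : M.IsPureAnderson c := by
  have := isDedekindDomain_affineRing hQ hinf
  have := isFractionRing_affineRing hQ hinf
  have hfd : FiniteDimensional Fq L := Module.Finite.of_finite
  obtain ⟨hD, hfr⟩ := coeffRing_facts hQ (affineRing inf) L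
  letI := (isField_tensor hQ L).toField
  letI : Algebra (affineRing inf ⊗[Fq] L) (Q ⊗[Fq] L) := (affineHom inf L).toAlgebra
  have : IsFractionRing (affineRing inf ⊗[Fq] L) (Q ⊗[Fq] L) := hfr
  letI : Module (affineRing inf ⊗[Fq] L) V := Module.compHom V (affineHom inf L)
  have : IsScalarTower (affineRing inf ⊗[Fq] L) (Q ⊗[Fq] L) V := IsScalarTower.of_algebraMap_smul fun _ _ => rfl
  have hfin := μ.finite hQ hinf h.lat
  let ι : M.mod →ₗ[affineRing inf ⊗[Fq] L] V :=
    { toFun := μ.toFun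
      map_add' := map_add μ.toFun
      map_smul' := fun r x => map_smulₛₗ μ.toFun r x }
  have htf : Module.IsTorsionFree (affineRing inf ⊗[Fq] L) M.mod := by
    have : FaithfulSMul (affineRing inf ⊗[Fq] L) (Q ⊗[Fq] L) :=
      (faithfulSMul_iff_algebraMap_injective _ _).2 affineHom_injective
    have : Module.IsTorsionFree (affineRing inf ⊗[Fq] L) V := .trans_faithfulSMul _ (Q ⊗[Fq] L) V
    exact Function.Injective.moduleIsTorsionFree ι μ.injective (map_smul ι)
  have : Module.FinitePresentation (affineRing inf ⊗[Fq] L) M.mod :=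
    Module.finitePresentation_of_finite _ _
  refine ⟨Module.finrank (Q ⊗[Fq] L) V, d, hfin, Module.Flat.projective_of_finitePresentation,
    fun p => ?_, ?_, (μ.rank_coker_iff d).2 h.dim, ?_, ?_⟩
  · refine rankAtStalk_eq_finrank_of_injective (ι := ι) μ.injective (fun y => ?_) p
    obtain ⟨a, ha, ha0, hay⟩ := h.lat.exists_smul_mem_sectionsAway hQ hinf y
    obtain ⟨x, hx⟩ := μ.exists_eq hay
    refine ⟨(⟨a, ha⟩ : affineRing inf) ⊗ₜ 1, fun h0 => ha0 ?_, x, hx⟩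
    have h1 : (a : Q) ⊗ₜ[Fq] (1 : L) = 0 := (congrArg (affineHom inf L) h0).trans (map_zero _)
    exact (Algebra.TensorProduct.includeLeft_injective (S := Fq) (A := Q) (B := L)
      (algebraMap Fq L).injective) (h1.trans (map_zero _).symm)
  · intro x y hxy
    refine μ.injective (h.injective ?_)
    rw [μ.map_tau, μ.map_tau, hxy]
  · rw [charIdeal_pow_smul_le_iff]
    intro a x
    rw [μ.mem_tauImage_iff, map_smulₛₗ, map_prod]
    obtain ⟨m, hm⟩ := h.nilpotent
    refine prod_smul_mem_of_nilpotent (C := sectionsAway inf X) (S := Set.range (motiveElt c))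
      ?_ h.dim ?_ ?_ (m := m) ?_ (fun j => motiveElt c (a j)) (fun j => ⟨a j, rfl⟩)
      (μ.mem_sectionsAway x)
    · rintro _ ⟨y, hy, rfl⟩
      exact h.map_mem y hy
    · rintro _ ⟨b, rfl⟩ y hy
      rw [motiveElt_smul]
      exact sub_mem (smul_mem_sectionsAway h.lat b.2 hy) (Submodule.smul_mem _ _ hy)
    · rintro _ ⟨b, rfl⟩ _ ⟨y, hy, rfl⟩
      rw [motiveElt_smul]
      exact sub_mem ⟨_, smul_mem_sectionsAway h.lat b.2 hy, semi_left_smul T _ y⟩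
        (Submodule.smul_mem _ _ ⟨y, hy, rfl⟩)
    · rintro _ ⟨b, rfl⟩ y hy
      exact hm m le_rfl b y hy
  · refine ⟨⟨V, X⟩, μ.toFun, T, k, l, h.lat.isLocallyFree hQ, μ.injective, ?_, μ.map_tau,
      h.k_pos, h.l_pos, ?_⟩
    · ext y
      exact μ.mem_iff y
    · obtain ⟨z, hz⟩ := Place.exists_uniformizer hQ inf
      ext x
      rw [mem_span_iterate_image_iff]
      have h1 := h.lat.mem_twist_iff (D := Finsupp.single inf (k : ℤ)) hz (x := x)
      rw [Finsupp.single_eq_same, zpow_natCast] at h1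
      exact (h.pure z hz x).trans h1.symm

end MotiveModel

end Models


/-! ### Quotients, sums and base changes of motives -/

section GoodMotiveOperations

variable {Fq Q L : Type u} [Field Fq] [Fintype Fq] [Field Q] [Algebra Fq Q] [Field L]
  [Algebra Fq L] {inf : Place Fq Q} [Finite L] {V U : CoeffModule Fq Q L}
  {T : V →ₛₗ[sigma Fq Q L] V} {X : Place Fq Q → Submodule L V} {c : affineRing inf →ₐ[Fq] L}

namespace GoodMotive

/-- A quotient of a pure Anderson motive. -/
theorem map (hQ : IsCurveFunctionField Fq Q) (hinf : inf.IsRational) {k l d : ℕ}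
    (h : GoodMotive T X c k l d) {ψ : U →ₛₗ[sigma Fq Q L] U} {f : V →ₗ[Q ⊗[Fq] L] U}
    (hf : Function.Surjective f) (hfT : ∀ x, f (T x) = ψ (f x)) :
    ∃ d', GoodMotive ψ (fun v => (X v).map (CoeffModule.linL f)) c k l d' := by
  have hfd : FiniteDimensional Fq L := Module.Finite.of_finite
  have hfin := h.lat.finite
  have hW : IsStable T (LinearMap.ker f) := fun x hx => by
    rw [LinearMap.mem_ker] at hx ⊢
    rw [hfT, hx, map_zero]
  have hψ : Function.Injective ψ := by
    refine (injective_iff_map_eq_zero _).2 fun y hy => ?_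
    obtain ⟨x, rfl⟩ := hf y
    rw [← hfT] at hy
    exact hW.exists_mem h.injective hy
  have hsec := h.lat.sectionsAway_map hQ hinf hf
  have himg : semiImage ψ ((sectionsAway inf X).map (CoeffModule.linL f)) =
      (semiImage T (sectionsAway inf X)).map (CoeffModule.linL f) := by
    ext y
    constructor
    · rintro ⟨_, ⟨x, hx, rfl⟩, rfl⟩
      exact ⟨T x, ⟨x, hx, rfl⟩, hfT x⟩
    · rintro ⟨_, ⟨x, hx, rfl⟩, rfl⟩
      exact ⟨f x, ⟨x, hx, rfl⟩, (hfT x).symm⟩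
  have hiter : ∀ n x, f (T^[n] x) = ψ^[n] (f x) := fun n x =>
    (Function.Semiconj.iterate_right (f := f) hfT n) x
  have hle : semiImage T (sectionsAway inf X) ≤ sectionsAway inf X := by
    rintro _ ⟨x, hx, rfl⟩
    exact h.map_mem x hx
  -- The definition of a motive does not tie its dimension to `k` and `l`, so no equality of indices
  -- is needed here. The index on the image is a factor of the one on `V`, hence non-zero, that is,
  -- finite.
  have hne : relIdx ((semiImage T (sectionsAway inf X)).map (CoeffModule.linL f))
      ((sectionsAway inf X).map (CoeffModule.linL f)) ≠ 0 := fun h0 => by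
    have h1 := relIndex_eq_inf_ker_mul_map f.toAddMonoidHom
      (X := (semiImage T (sectionsAway inf X)).toAddSubgroup)
      (Y := (sectionsAway inf X).toAddSubgroup) hle
    have h2 : ((semiImage T (sectionsAway inf X)).toAddSubgroup.map f.toAddMonoidHom).relIndex
      ((sectionsAway inf X).toAddSubgroup.map f.toAddMonoidHom) = 0 := h0
    have h3 := h.dim
    rw [relIdx, h1, h2, mul_zero] at h3
    exact pow_ne_zero d Nat.card_pos.ne' h3.symm
  obtain ⟨d', hd'⟩ := exists_relIdx_eq_pow hne
  refine ⟨d', h.lat.map hf, hψ, ?_, ?_, ?_, h.k_pos, h.l_pos, fun z hz y => ?_⟩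
  · rw [hsec]
    rintro _ ⟨x, hx, rfl⟩
    exact ⟨T x, h.map_mem x hx, hfT x⟩
  · rw [hsec, himg, hd']
  · obtain ⟨m, hm⟩ := h.nilpotent
    rw [hsec, himg]
    refine ⟨m, fun n hn a => ?_⟩
    rintro _ ⟨x, hx, rfl⟩
    exact ⟨_, hm n hn a x hx, f.map_smul _ x⟩
  · constructor
    · rintro ⟨_, ⟨x, hx, rfl⟩, rfl⟩
      refine ⟨z ^ k • T^[l] x, (h.pure z hz _).1 ⟨x, hx, rfl⟩, ?_⟩
      exact (CoeffModule.map_left_smul f _ _).trans (congrArg _ (hiter l x))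
    · rintro ⟨x, hx, hxy⟩
      have hz0 := pow_ne_zero k hz.1
      have h1 : z ^ k • (z ^ k)⁻¹ • x ∈ X inf := by rwa [smul_inv_smul₀ hz0]
      obtain ⟨w, hw, hwx⟩ := (h.pure z hz _).2 h1
      refine ⟨f w, ⟨w, hw, rfl⟩, ?_⟩
      rw [← hiter, hwx, CoeffModule.map_left_smul]
      have hxy : f x = z ^ k • y := hxy
      rw [hxy, inv_smul_smul₀ hz0]

theorem pi {n : ℕ} {U : Fin n → CoeffModule Fq Q L} {φ : ∀ j, U j →ₛₗ[sigma Fq Q L] U j}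
    {X : ∀ j, Place Fq Q → Submodule L (U j)} {k l : ℕ} {d : Fin n → ℕ}
    (h : ∀ j, GoodMotive (φ j) (X j) c k l (d j)) (hk : 0 < k) (hl : 0 < l) :
    GoodMotive (semiPi φ) (fun v => piSub fun j => X j v) c k l (∑ j, d j) := by
  have himg := semiImage_piSub (φ := φ) (ψ := semiPi φ) (fun _ _ => rfl)
  have hiter : ∀ n x j, (semiPi φ)^[n] x j = (φ j)^[n] (x j) := fun n x j =>
    (Function.Semiconj.iterate_right (f := fun x : CoeffModule.pi U => x j) (fun _ => rfl) n) x
  refine ⟨IsLattice.pi fun j => (h j).lat, fun x y hxy => funext fun j =>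
    (h j).injective (congrFun hxy j), ?_, ?_, ?_, hk, hl, fun z hz x => ?_⟩
  · rw [sectionsAway_piSub]
    exact fun x hx j => (h j).map_mem _ (hx j)
  · rw [sectionsAway_piSub, himg, relIdx_piSub, ← Finset.prod_pow_eq_pow_sum]
    exact Finset.prod_congr rfl fun j _ => (h j).dim
  · choose m hm using fun j => (h j).nilpotent
    rw [sectionsAway_piSub, himg]
    exact ⟨Finset.univ.sup m, fun n hn a x hx j =>
      hm j n ((Finset.le_sup (Finset.mem_univ j)).trans hn) a (x j) (hx j)⟩
  · refine Iff.trans ?_ (forall_congr' fun j => (h j).pure z hz (x j))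
    constructor
    · rintro ⟨y, hy, rfl⟩ j
      exact ⟨y j, hy j, (hiter l y j).symm⟩
    · intro H
      choose y hy hyx using H
      exact ⟨y, hy, funext fun j => (hiter l y j).trans (hyx j)⟩

variable (L' : Type u) [Field L'] [Algebra Fq L'] [Algebra L L'] [IsScalarTower Fq L L']
  [FiniteDimensional L L'] [Finite L']

omit [Finite L] [FiniteDimensional L L'] [Finite L'] in
theorem extHom_motiveElt (c : affineRing inf →ₐ[Fq] L) (a : affineRing inf) :
    extHom Fq Q L L' (motiveElt c a) =
      motiveElt ((IsScalarTower.toAlgHom Fq L L').comp c) a := by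
  rw [motiveElt, motiveElt, map_sub, map_sub, map_sub, affineHom_tmul, affineHom_tmul,
    affineHom_tmul, affineHom_tmul, extHom_tmul, extHom_tmul, map_one]
  rfl

theorem baseChange {k l d : ℕ} (h : GoodMotive T X c k l d) :
    GoodMotive (extSemi L' T) (fun v => extSub L' (X v))
      ((IsScalarTower.toAlgHom Fq L L').comp c) k l d := by
  have hcard : Nat.card L' = Nat.card L ^ Module.finrank L L' := Module.natCard_eq_pow_finrank
  have hmap : ∀ x ∈ sectionsAway inf fun v => extSub L' (X v),
      extSemi L' T x ∈ sectionsAway inf fun v => extSub L' (X v) := by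
    rw [sectionsAway_extSub]
    intro x hx
    have h1 : extSemi L' T x ∈ semiImage (extSemi L' T) (extSub L' (sectionsAway inf X)) :=
      ⟨x, hx, rfl⟩
    rw [semiImage_extSub] at h1
    refine (extSub_le (L' := L') fun y hy => ?_ : _ ≤ extSub L' (sectionsAway inf X)) h1
    obtain ⟨y, hy, rfl⟩ := hy
    exact ofExt_mem_extSub (h.map_mem y hy)
  have hiter : ∀ n x, (extSemi L' T)^[n] (ofExt L' x) = ofExt L' (T^[n] x) := fun n x =>
    (Function.Semiconj.iterate_right (f := (ofExt L' : V → V.baseChange L'))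
      (fun x => (extSemi_ofExt T x).symm) n x).symm
  refine ⟨h.lat.extSub, extSemi_injective h.injective, hmap, ?_, ?_, h.k_pos, h.l_pos,
    fun z hz x => ?_⟩
  · rw [sectionsAway_extSub, semiImage_extSub, relIdx_extSub, h.dim, hcard, ← pow_mul, ← pow_mul,
      mul_comm]
  · obtain ⟨m, hm⟩ := h.nilpotent
    refine ⟨m, fun n hn a x hx => ?_⟩
    rw [sectionsAway_extSub] at hx ⊢
    rw [semiImage_extSub, ← extHom_motiveElt L', ← map_pow]
    induction hx using Submodule.span_induction with
    | mem x hx =>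
      obtain ⟨y, hy, rfl⟩ := hx
      rw [← ofExt_smul]
      exact ofExt_mem_extSub (hm n hn a y hy)
    | zero => rw [smul_zero]; exact zero_mem _
    | add x y _ _ hx hy => rw [smul_add]; exact add_mem hx hy
    | smul b x _ hx =>
      rw [CoeffModule.right_smul_def, smul_comm, ← CoeffModule.right_smul_def]
      exact Submodule.smul_mem _ _ hx
  · have hz0 := pow_ne_zero k hz.1
    constructor
    · rintro ⟨y, hy, rfl⟩
      induction hy using Submodule.span_induction with
      | mem y hy =>
        obtain ⟨w, hw, rfl⟩ := hy
        rw [hiter, ← ofExt_left_smul]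
        exact ofExt_mem_extSub ((h.pure z hz _).1 ⟨w, hw, rfl⟩)
      | zero => rw [iterate_map_zero, smul_zero]; exact zero_mem _
      | add x y _ _ hx hy => rw [iterate_map_add, smul_add]; exact add_mem hx hy
      | smul b x _ hx =>
        rw [iterate_right_smul, smul_comm]
        exact Submodule.smul_mem _ _ hx
    · intro hx
      rw [← mem_span_iterate_image_iff, ← inv_smul_smul₀ hz0 x]
      generalize z ^ k • x = y at hx
      induction hx using Submodule.span_induction with
      | mem y hy =>
        obtain ⟨w, hw, rfl⟩ := hy
        obtain ⟨u, hu, hu'⟩ := (h.pure z hz ((z ^ k)⁻¹ • w)).2 (by rwa [smul_inv_smul₀ hz0])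
        refine Submodule.subset_span ⟨ofExt L' u, ofExt_mem_extSub hu, ?_⟩
        rw [hiter, hu', ofExt_left_smul]
      | zero => rw [smul_zero]; exact zero_mem _
      | add x y _ _ hx hy => rw [smul_add]; exact add_mem hx hy
      | smul b x _ hx => rw [smul_comm]; exact Submodule.smul_mem _ _ hx

end GoodMotive

end GoodMotiveOperations


/-! ### Extending semilinear maps along ring homomorphisms -/

section ScalarExtension

variable {R R' S S' V W : Type u} [CommRing R] [CommRing R'] [CommRing S] [CommRing S']
  [AddCommGroup V] [Module R V] [AddCommGroup W] [Module S W] {φ : R →+* R'} {φ' : S →+* S'}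
  {σ : R →+* S} {σ' : R' →+* S'}

/-- A map semilinear with respect to `σ` extends to one semilinear with respect to `σ'`. -/
def ScalarExt.extAddHom (h : ∀ r, σ' (φ r) = φ' (σ r)) (ι : V →ₛₗ[σ] W) :
    ScalarExt φ V →+ ScalarExt φ' W :=
  letI := φ.toAlgebra
  TensorProduct.liftAddHom (R := R) (M := R') (N := V)
    { toFun := fun a =>
        { toFun := fun x => σ' a • ScalarExt.of φ' (ι x)
          map_zero' := by
            have h0 : ScalarExt.of φ' (0 : W) = 0 := by
              rw [← zero_smul S (0 : W), ScalarExt.of_smul, map_zero, zero_smul]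
            rw [map_zero, h0, smul_zero]
          map_add' := fun x y => by rw [map_add, ScalarExt.of_add, smul_add] }
      map_zero' := AddMonoidHom.ext fun x => by
        change σ' 0 • ScalarExt.of φ' (ι x) = 0
        rw [map_zero, zero_smul]
      map_add' := fun a b => AddMonoidHom.ext fun x => by
        change σ' (a + b) • ScalarExt.of φ' (ι x) = _
        rw [map_add, add_smul]
        rfl }
    fun r a x => by
      change σ' (φ r * a) • ScalarExt.of φ' (ι x) = σ' a • ScalarExt.of φ' (ι (r • x))
      rw [map_smulₛₗ, ScalarExt.of_smul, map_mul, h, mul_comm, mul_smul]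

theorem ScalarExt.extAddHom_smul_of (h : ∀ r, σ' (φ r) = φ' (σ r)) (ι : V →ₛₗ[σ] W) (a : R')
    (x : V) : ScalarExt.extAddHom h ι (a • ScalarExt.of φ x) = σ' a • ScalarExt.of φ' (ι x) := by
  letI := φ.toAlgebra
  have h : a • ScalarExt.of φ x = (a ⊗ₜ[R] x : R' ⊗[R] V) := by
    refine (TensorProduct.smul_tmul' a (1 : R') x).trans ?_
    rw [smul_eq_mul, mul_one]
  rw [h]
  rfl

/-- A map semilinear with respect to `σ` extends to one semilinear with respect to `σ'`. -/
def ScalarExt.extSemilinear (h : ∀ r, σ' (φ r) = φ' (σ r)) (ι : V →ₛₗ[σ] W) :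
    ScalarExt φ V →ₛₗ[σ'] ScalarExt φ' W where
  toFun := ScalarExt.extAddHom h ι
  map_add' := map_add _
  map_smul' a y := by
    induction y using ScalarExt.induction with
    | h0 => rw [smul_zero, map_zero, smul_zero]
    | hadd x y hx hy => rw [smul_add, map_add, map_add, smul_add, hx, hy]
    | h b x => rw [smul_smul, extAddHom_smul_of, extAddHom_smul_of, map_mul, mul_smul]

theorem ScalarExt.extSemilinear_of (h : ∀ r, σ' (φ r) = φ' (σ r)) (ι : V →ₛₗ[σ] W) (x : V) :
    ScalarExt.extSemilinear h ι (ScalarExt.of φ x) = ScalarExt.of φ' (ι x) := by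
  have := ScalarExt.extAddHom_smul_of h ι 1 x
  rwa [one_smul, map_one, one_smul] at this

end ScalarExtension

/-! ### Motives attached to lattices -/

section ModelConstructions

variable {Fq Q L : Type u} [Field Fq] [Fintype Fq] [Field Q] [Algebra Fq Q] [Field L]
  [Algebra Fq L] {inf : Place Fq Q} {V : CoeffModule Fq Q L}
  {T : V →ₛₗ[sigma Fq Q L] V} {X : Place Fq Q → Submodule L V} {c : affineRing inf →ₐ[Fq] L}

/-- The restriction of scalars from `Q_L` to `A_L`. -/
def CoeffModule.restrict (inf : Place Fq Q) (V : CoeffModule Fq Q L) :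
    CoeffModule Fq (affineRing inf) L :=
  letI := Module.compHom V (affineHom inf L)
  ⟨V⟩

/-- The identity, as a semilinear map. -/
def CoeffModule.ofRestrict (inf : Place Fq Q) (V : CoeffModule Fq Q L) :
    V.restrict inf →ₛₗ[affineHom inf L] V where
  toFun x := x
  map_add' _ _ := rfl
  map_smul' _ _ := rfl

/-- The sections outside `inf` as an `A_L`-module. -/
def sectionsModule [Finite L] (hX : IsLattice X) :
    Submodule (affineRing inf ⊗[Fq] L) (V.restrict inf) :=
  CoeffModule.mkSubmodule (V := V.restrict inf) (sectionsAway inf X).toAddSubgroup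
    (fun a _ hx => smul_mem_sectionsAway hX a.2 hx) fun a _ hx => (sectionsAway inf X).smul_mem a hx

/-- The motive of sections outside `inf`. -/
def sectionsMotive [Finite L] (hX : IsLattice X)
    (hT : ∀ x ∈ sectionsAway inf X, T x ∈ sectionsAway inf X) : PreMotive inf L where
  mod := ⟨sectionsModule hX⟩
  tau :=
    { toFun := fun x => ⟨T (V.ofRestrict inf x.1), hT x.1 x.2⟩
      map_add' := fun x y => Subtype.ext (map_add T (V.ofRestrict inf x.1) (V.ofRestrict inf y.1))
      map_smul' := fun a x => Subtype.ext <| by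
        change T (affineHom inf L a • V.ofRestrict inf x.1) =
          affineHom inf L (sigma Fq (affineRing inf) L a) • T (V.ofRestrict inf x.1)
        rw [map_smulₛₗ, affineHom_sigma] }

namespace MotiveModel

/-- The motive of sections outside `inf` is the one defined by the lattice. -/
def sections [Finite L] (hX : IsLattice X)
    (hT : ∀ x ∈ sectionsAway inf X, T x ∈ sectionsAway inf X) :
    MotiveModel (sectionsMotive hX hT) T X where
  toFun := (V.ofRestrict inf).comp (sectionsModule hX).subtype
  injective := Subtype.val_injective
  mem_iff y := ⟨fun ⟨x, hx⟩ => hx ▸ TauSheaves.mem_sectionsAway.1 x.2,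
    fun h => ⟨⟨y, TauSheaves.mem_sectionsAway.2 h⟩, rfl⟩⟩
  map_tau _ := rfl

/-- The direct sum of motives. -/
def directSum {n : ℕ} {N : Fin n → PreMotive inf L} {U : Fin n → CoeffModule Fq Q L}
    {φ : ∀ j, U j →ₛₗ[sigma Fq Q L] U j} {X : ∀ j, Place Fq Q → Submodule L (U j)}
    (μ : ∀ j, MotiveModel (N j) (φ j) (X j)) :
    MotiveModel (PreMotive.directSum N) (semiPi φ) fun v => piSub fun j => X j v where
  toFun :=
    { toFun := fun x j => (μ j).toFun (x j)
      map_add' := fun x y => funext fun j => map_add (μ j).toFun (x j) (y j)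
      map_smul' := fun a x => funext fun j => map_smulₛₗ (μ j).toFun a (x j) }
  injective x y hxy := funext fun j => (μ j).injective (congrFun hxy j)
  mem_iff y := by
    constructor
    · rintro ⟨x, rfl⟩ w hw j
      exact ((μ j).mem_iff _).1 ⟨x j, rfl⟩ w hw
    · intro h
      choose x hx using fun j => ((μ j).mem_iff (y j)).2 fun w hw => h w hw j
      exact ⟨x, funext hx⟩
  map_tau x := funext fun j => (μ j).map_tau (x j)

section BaseChange

variable (L' : Type u) [Field L'] [Algebra Fq L'] [Algebra L L'] [IsScalarTower Fq L L']

omit [Fintype Fq] in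
theorem affineHom_extHom (a : affineRing inf ⊗[Fq] L) :
    affineHom inf L' (extHom Fq (affineRing inf) L L' a) = extHom Fq Q L L' (affineHom inf L a) := by
  induction a using TensorProduct.induction_on with
  | zero => simp
  | add x y hx hy => simp only [map_add, hx, hy]
  | tmul a x => rfl

/-- The base change of the embedding in the generic fibre. -/
def extSemilinear {M : CoeffModule Fq (affineRing inf) L} (ι : M →ₛₗ[affineHom inf L] V) :
    M.baseChange L' →ₛₗ[affineHom inf L'] V.baseChange L' :=
  ScalarExt.extSemilinear (affineHom_extHom L') ι

theorem extSemilinear_ofExt {M : CoeffModule Fq (affineRing inf) L}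
    (ι : M →ₛₗ[affineHom inf L] V) (x : M) :
    extSemilinear L' ι (ofExt L' x) = ofExt L' (ι x) := ScalarExt.extSemilinear_of _ ι x

theorem extSemilinear_extSemi [Finite L] {M : CoeffModule Fq (affineRing inf) L}
    {ι : M →ₛₗ[affineHom inf L] V} {τ : M →ₛₗ[sigma Fq (affineRing inf) L] M}
    (h : ∀ x, T (ι x) = ι (τ x)) (x : M.baseChange L') :
    extSemi L' T (extSemilinear L' ι x) = extSemilinear L' ι (extSemi L' τ x) := by
  induction x using baseChange_induction with
  | h0 => simp only [map_zero]
  | hadd x y hx hy => simp only [map_add, hx, hy]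
  | h a x =>
    rw [map_right_smul', extSemilinear_ofExt, semi_right_smul, semi_right_smul, extSemi_ofExt,
      extSemi_ofExt, map_right_smul', extSemilinear_ofExt, h]

theorem exists_extSemilinear_eq_iff {M : CoeffModule Fq (affineRing inf) L}
    {ι : M →ₛₗ[affineHom inf L] V} {N : Submodule L V} (h : ∀ y, (∃ x, ι x = y) ↔ y ∈ N)
    (y : V.baseChange L') : (∃ x, extSemilinear L' ι x = y) ↔ y ∈ extSub L' N := by
  constructor
  · rintro ⟨x, rfl⟩
    induction x using baseChange_induction with
    | h0 => rw [map_zero]; exact zero_mem _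
    | hadd x y hx hy => rw [map_add]; exact add_mem hx hy
    | h a x =>
      rw [map_right_smul', extSemilinear_ofExt]
      exact Submodule.smul_mem _ _ (ofExt_mem_extSub ((h _).1 ⟨x, rfl⟩))
  · intro hy
    induction hy using Submodule.span_induction with
    | mem y hy =>
      obtain ⟨y, hy, rfl⟩ := hy
      obtain ⟨x, rfl⟩ := (h y).2 hy
      exact ⟨ofExt L' x, extSemilinear_ofExt L' _ x⟩
    | zero => exact ⟨0, map_zero _⟩
    | add x y _ _ hx hy =>
      obtain ⟨x, rfl⟩ := hx
      obtain ⟨y, rfl⟩ := hy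
      exact ⟨x + y, map_add _ _ _⟩
    | smul b x _ hx =>
      obtain ⟨x, rfl⟩ := hx
      exact ⟨b • x, map_right_smul' _ b x⟩

/-- With one basis of `L'` over `L` used on both sides, the extended map acts on each coordinate by
`ι`. -/
theorem extSemilinear_injective [FiniteDimensional L L'] {M : CoeffModule Fq (affineRing inf) L}
    {ι : M →ₛₗ[affineHom inf L] V} (hι : Function.Injective ι) :
    Function.Injective (extSemilinear L' ι) := by
  classical
  refine (injective_iff_map_eq_zero _).2 fun y hy => ?_
  obtain ⟨p, -, h2, -⟩ := exists_coord M (Module.finBasis L L')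
  obtain ⟨p', h1', -, h3'⟩ := exists_coord V (Module.finBasis L L')
  have h : ∀ i, p i y = 0 := fun i => by
    refine hι ?_
    rw [map_zero, ← map_zero (p' i)]
    rw [h2 y, map_sum] at hy
    rw [← hy, map_sum]
    simp only [map_right_smul', extSemilinear_ofExt, h3']
    simp
  rw [h2 y]
  exact Finset.sum_eq_zero fun i _ => by rw [h, ofExt_zero, smul_zero]

/-- The base change of a motive. -/
def baseChange [Finite L] [FiniteDimensional L L'] [Finite L'] {M : PreMotive inf L}
    (μ : MotiveModel M T X) :
    MotiveModel (M.baseChange L') (extSemi L' T) fun v => extSub L' (X v) where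
  toFun := extSemilinear L' μ.toFun
  injective := extSemilinear_injective L' μ.injective
  mem_iff y := by
    rw [← TauSheaves.mem_sectionsAway, sectionsAway_extSub]
    exact exists_extSemilinear_eq_iff L'
      (fun y => (μ.mem_iff y).trans TauSheaves.mem_sectionsAway.symm) y
  map_tau := extSemilinear_extSemi L' μ.map_tau

end BaseChange

/-- A linear map compatible with the semilinear maps and mapping sections to sections induces a
morphism of motives. -/
theorem exists_hom [Finite L] {M M' : PreMotive inf L} {V' : CoeffModule Fq Q L}
    {T' : V' →ₛₗ[sigma Fq Q L] V'} {X' : Place Fq Q → Submodule L V'} (μ : MotiveModel M T X)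
    (μ' : MotiveModel M' T' X') (f : V →ₗ[Q ⊗[Fq] L] V') (hf : ∀ x, f (T x) = T' (f x))
    (hX : ∀ x ∈ sectionsAway inf X, f x ∈ sectionsAway inf X') :
    ∃ g : PreMotive.Hom M M', ∀ x, μ'.toFun (g.map x) = f (μ.toFun x) := by
  choose g hg using fun x => μ'.exists_eq (hX _ (μ.mem_sectionsAway x))
  refine ⟨⟨⟨⟨g, fun x y => ?_⟩, fun a x => ?_⟩, fun x => ?_⟩, hg⟩
  · refine μ'.injective ?_
    rw [map_add, hg, hg, hg, map_add, map_add]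
  · refine μ'.injective ?_
    change μ'.toFun (g (a • x)) = μ'.toFun (a • g x)
    rw [map_smulₛₗ, hg, hg, map_smulₛₗ, map_smul]
  · refine μ'.injective ?_
    change μ'.toFun (g (M.tau x)) = μ'.toFun (M'.tau (g x))
    rw [hg, ← μ.map_tau, ← μ'.map_tau, hg, hf]

theorem eq_zero_of_smul {M : PreMotive inf L} (μ : MotiveModel M T X) {a : affineRing inf}
    (ha : a ≠ 0) {x : M.mod} (hx : a • x = 0) : x = 0 := by
  refine μ.injective ?_
  have h := map_left_smul' μ.toFun a x
  rw [hx, map_zero] at h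
  rw [map_zero]
  exact (smul_eq_zero.1 h.symm).resolve_left fun h0 => ha (Subtype.ext h0)

end MotiveModel

end ModelConstructions


/-! ### The semisimplicity criterion for motives -/

section SemisimpleMotives

variable {Fq Q L : Type u} [Field Fq] [Fintype Fq] [Field Q] [Algebra Fq Q] [Field L]
  [Algebra Fq L] {inf : Place Fq Q} [Finite L] {V : CoeffModule Fq Q L}
  {T : V →ₛₗ[sigma Fq Q L] V} {X : Place Fq Q → Submodule L V} {c : affineRing inf →ₐ[Fq] L}
  {M N : PreMotive inf L}

namespace MotiveModel

theorem map_frobEval (μ : MotiveModel M T X) (p : Polynomial (affineRing inf)) (x : M.mod) :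
    μ.toFun (frobEval M.tau p x) =
      frobEval T (p.map (affineRing inf).val.toRingHom) (μ.toFun x) := by
  have h1 : ∀ (n : ℕ) x, μ.toFun (M.tau^[n] x) = T^[n] (μ.toFun x) := fun n x =>
    Function.Semiconj.iterate_right (f := μ.toFun) (fun x => (μ.map_tau x).symm) n x
  unfold frobEval
  induction p using Polynomial.induction_on' with
  | add p q hp hq =>
    simp only [Polynomial.map_add, map_add, LinearMap.add_apply, hp, hq]
  | monomial n a =>
    simp only [Polynomial.map_monomial, Polynomial.aeval_monomial, ← pow_mul, Module.End.mul_apply,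
      semiLin_pow_apply, Module.algebraMap_end_apply]
    rw [map_left_smul', h1]
    rfl

variable (hQ : IsCurveFunctionField Fq Q) (hinf : inf.IsRational)

include hQ hinf

theorem frobEval_eq_zero_iff (hX : IsLattice X) (μ : MotiveModel M T X)
    (p : Polynomial (affineRing inf)) :
    frobEval M.tau p = 0 ↔ frobEval T (p.map (affineRing inf).val.toRingHom) = 0 := by
  constructor
  · intro h
    ext y
    obtain ⟨a, ha, ha0, hay⟩ := hX.exists_smul_mem_sectionsAway hQ hinf y
    obtain ⟨x, hx⟩ := μ.exists_eq hay
    have h1 := μ.map_frobEval p x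
    rw [h, LinearMap.zero_apply, map_zero, hx, map_smul] at h1
    exact (smul_eq_zero.1 h1.symm).resolve_left ha0
  · intro h
    ext x
    refine μ.injective ?_
    rw [μ.map_frobEval, h, LinearMap.zero_apply, LinearMap.zero_apply, map_zero]

/-- Non-zero elements of `A` act injectively and `M` spans `V` over `Q`, so polynomials over `Q` may
be replaced by polynomials over `A` after clearing denominators. -/
theorem frobReduced_iff (hX : IsLattice X) (μ : MotiveModel M T X) :
    FrobReduced M.tau ↔ FrobReduced T := by
  constructor
  · intro h p n hp
    have := isFractionRing_affineRing hQ hinf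
    obtain ⟨a, ha, hap⟩ :=
      IsLocalization.integerNormalization_spec (nonZeroDivisors (affineRing inf)) p
    set p' := IsLocalization.integerNormalization (nonZeroDivisors (affineRing inf)) p
    have ha0 : (a : Q) ≠ 0 := fun h0 => nonZeroDivisors.ne_zero ha (Subtype.ext h0)
    have h1 : frobEval T (p'.map (affineRing inf).val.toRingHom) = (a : Q) • frobEval T p :=
      (congrArg (frobEval T) hap).trans (map_smul (Polynomial.aeval (R := Q) _) (a : Q) p)
    have h2 : frobEval M.tau p' ^ n = 0 := by
      rw [← frobEval_pow, μ.frobEval_eq_zero_iff hQ hinf hX, Polynomial.map_pow, frobEval_pow, h1,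
        smul_pow, hp, smul_zero]
    have h3 := (μ.frobEval_eq_zero_iff hQ hinf hX p').1 (h p' n h2)
    rw [h1] at h3
    exact (smul_eq_zero.1 h3).resolve_left ha0
  · intro h p n hp
    rw [← frobEval_pow, μ.frobEval_eq_zero_iff hQ hinf hX, Polynomial.map_pow, frobEval_pow] at hp
    exact (μ.frobEval_eq_zero_iff hQ hinf hX p).2 (h _ n hp)

end MotiveModel

/-- The maps `f` and `g` intertwine the Frobenius algebras and are inverse to each other up to `a`,
which torsion-freeness allows to cancel. -/
theorem FrobReduced.of_quasiIsogeny
    (hM : ∀ a : affineRing inf, a ≠ 0 → ∀ x : M.mod, a • x = 0 → x = 0)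
    (hN : ∀ a : affineRing inf, a ≠ 0 → ∀ x : N.mod, a • x = 0 → x = 0) (f : PreMotive.Hom M N)
    (g : PreMotive.Hom N M) {a : affineRing inf} (ha : a ≠ 0) (hgf : ∀ x, g.map (f.map x) = a • x)
    (hfg : ∀ y, f.map (g.map y) = a • y) (h : FrobReduced N.tau) : FrobReduced M.tau := by
  have hf : ∀ p x, f.map (frobEval M.tau p x) = frobEval N.tau p (f.map x) := fun p x =>
    frobEval_map M.tau N.tau (f.map.restrictScalars (affineRing inf)) f.map_tau p x
  intro p n hp
  have h1 : frobEval N.tau p ^ n = 0 := by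
    ext y
    refine hN a ha _ ?_
    rw [← frobEval_pow, ← map_smul, ← hfg, ← hf, frobEval_pow, hp, LinearMap.zero_apply, map_zero]
  ext x
  refine hM a ha _ ?_
  rw [← hgf, hf, h p n h1, LinearMap.zero_apply, map_zero]

variable (hQ : IsCurveFunctionField Fq Q) (hinf : inf.IsRational)

include hQ hinf

/-- The generic fibre of a simple motive has no proper stable subspaces. -/
theorem MotiveModel.isStablySimple (μ : MotiveModel M T X) {k l d : ℕ}
    (hT : GoodMotive T X c k l d) (h : M.IsSimple c) : IsStablySimple T := by
  obtain ⟨-, hne, hs⟩ := h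
  refine ⟨μ.injective.nontrivial, fun W hW => ?_⟩
  obtain ⟨d', hgood⟩ := hT.map hQ hinf (quotMk_surjective W) (quotMk_semi hW)
  let μ' := MotiveModel.sections hgood.lat hgood.map_mem
  have hsec := hT.lat.sectionsAway_map hQ hinf (quotMk_surjective W)
  obtain ⟨f, hf⟩ := μ.exists_hom μ' (quotMk W) (quotMk_semi hW) fun x hx => by
    rw [hsec]
    exact ⟨x, hx, rfl⟩
  have hfs : Function.Surjective f.map := fun y => by
    have h1 := μ'.mem_sectionsAway y
    rw [hsec] at h1
    obtain ⟨x, hx, hxy⟩ := h1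
    obtain ⟨x, rfl⟩ := μ.exists_eq hx
    exact ⟨x, μ'.injective ((hf x).trans hxy)⟩
  rcases hs _ f (μ'.isPureAnderson hQ hinf hgood) hfs with h0 | hi
  · right
    refine eq_top_iff.2 fun x _ => ?_
    obtain ⟨a, ha, ha0, hax⟩ := hT.lat.exists_smul_mem_sectionsAway hQ hinf x
    obtain ⟨y, hy⟩ := μ.exists_eq hax
    have h1 := hf y
    rw [Subsingleton.elim (f.map y) 0, map_zero, hy] at h1
    have h2 : a • x ∈ W := quotMk_eq_zero.1 h1.symm
    rw [← inv_smul_smul₀ ha0 x]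
    exact CoeffModule.left_smul_mem W _ h2
  · left
    refine eq_bot_iff.2 fun x hx => ?_
    obtain ⟨a, ha, ha0, hax⟩ := hT.lat.exists_smul_mem_sectionsAway hQ hinf x
    obtain ⟨y, hy⟩ := μ.exists_eq hax
    have h1 : f.map y = 0 := μ'.injective (by
      rw [hf, hy, map_zero]
      exact quotMk_eq_zero.2 (CoeffModule.left_smul_mem W a hx))
    have h2 : y = 0 := hi (h1.trans (map_zero f.map).symm)
    rw [h2, map_zero] at hy
    exact (smul_eq_zero.1 hy.symm).resolve_left ha0

theorem PreMotive.IsSimple.frobReduced (h : N.IsSimple c) : FrobReduced N.tau := by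
  obtain ⟨V, T, X, μ, k, l, d, hT⟩ := MotiveModel.exists_goodMotive hQ hinf h.1
  exact (μ.frobReduced_iff hQ hinf hT.lat).2 (μ.isStablySimple hQ hinf hT h).frobReduced

theorem PreMotive.IsSemisimple.frobReduced (h : M.IsSemisimple c) : FrobReduced M.tau := by
  obtain ⟨n, N, hN, hM, -, f, g, a, ha, hgf, hfg⟩ := h
  obtain ⟨V, T, X, μ, -⟩ := MotiveModel.exists_goodMotive hQ hinf hM
  choose V' T' X' μ' _ using fun j => MotiveModel.exists_goodMotive hQ hinf (hN j).1
  exact FrobReduced.of_quasiIsogeny (fun a ha x => μ.eq_zero_of_smul ha)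
    (fun a ha x => (MotiveModel.directSum μ').eq_zero_of_smul ha) f g ha hgf hfg
    (FrobReduced.pi (fun j => (hN j).frobReduced hQ hinf) _ fun _ _ => rfl)

/-- A motive whose generic fibre has no proper stable subspaces is simple. -/
theorem MotiveModel.isSimple (μ : MotiveModel M T X) {k l d : ℕ}
    (hT : GoodMotive T X c k l d) (hs : IsStablySimple T) : M.IsSimple c := by
  obtain ⟨hne, hs⟩ := hs
  refine ⟨μ.isPureAnderson hQ hinf hT, ?_, fun G h hG hsurj => ?_⟩
  · obtain ⟨y, hy⟩ := exists_ne (0 : V)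
    obtain ⟨a, ha, ha0, hay⟩ := hT.lat.exists_smul_mem_sectionsAway hQ hinf y
    obtain ⟨x, hx⟩ := μ.exists_eq hay
    refine ⟨x, 0, fun h0 => ?_⟩
    rw [h0, map_zero] at hx
    exact hy ((smul_eq_zero.1 hx.symm).resolve_left ha0)
  obtain ⟨V', T', X', μ', -⟩ := MotiveModel.exists_goodMotive hQ hinf hG
  -- The generic fibre of the kernel of `h`: the vectors with a non-zero `A`-multiple in that
  -- kernel.
  let W₀ : AddSubgroup V :=
    { carrier := {y | ∃ a : affineRing inf, a ≠ 0 ∧ ∃ x, μ.toFun x = (a : Q) • y ∧ h.map x = 0}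
      zero_mem' := ⟨1, one_ne_zero, 0, by rw [map_zero, smul_zero], map_zero _⟩
      add_mem' := by
        rintro y y' ⟨a, ha, x, hx, hx0⟩ ⟨b, hb, x', hx', hx0'⟩
        refine ⟨a * b, mul_ne_zero ha hb, b • x + a • x', ?_, ?_⟩
        · rw [map_add, map_left_smul', map_left_smul', hx, hx', smul_smul, smul_smul, smul_add,
            Subalgebra.coe_mul, mul_comm (b : Q)]
        · rw [map_add, CoeffModule.map_left_smul, CoeffModule.map_left_smul, hx0, hx0', smul_zero,
            smul_zero, add_zero]
      neg_mem' := by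
        rintro y ⟨a, ha, x, hx, hx0⟩
        exact ⟨a, ha, -x, by rw [map_neg, hx, smul_neg], by rw [map_neg, hx0, neg_zero]⟩ }
  let W : Submodule (Q ⊗[Fq] L) V := CoeffModule.mkSubmodule W₀
    (by
      rintro b y ⟨a, ha, x, hx, hx0⟩
      obtain ⟨g, hg, hg0, hgb⟩ := exists_affine_denominator hQ hinf b
      refine ⟨a * ⟨g, hg⟩, mul_ne_zero ha fun h0 => hg0 (congrArg Subtype.val h0),
        (⟨g * b, hgb⟩ : affineRing inf) • x, ?_, ?_⟩
      · rw [map_left_smul', hx, smul_smul, smul_smul, Subalgebra.coe_mul]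
        congr 1
        change g * b * a = a * g * b
        ring
      · rw [CoeffModule.map_left_smul, hx0, smul_zero])
    (by
      rintro b y ⟨a, ha, x, hx, hx0⟩
      refine ⟨a, ha, b • x, ?_, ?_⟩
      · rw [map_right_smul', hx, ← smul_comm]
      · rw [CoeffModule.map_right_smul, hx0, smul_zero])
  have hW : IsStable T W := by
    rintro y ⟨a, ha, x, hx, hx0⟩
    refine ⟨a, ha, M.tau x, ?_, ?_⟩
    · rw [← μ.map_tau, hx, semi_left_smul]
    · rw [h.map_tau, hx0, map_zero]
  rcases hs W hW with h0 | h1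
  · right
    refine (injective_iff_map_eq_zero _).2 fun x hx => μ.injective ?_
    have h1 : μ.toFun x ∈ W := ⟨1, one_ne_zero, x, (one_smul _ _).symm, hx⟩
    rw [h0] at h1
    exact h1.trans (map_zero _).symm
  · left
    refine subsingleton_of_forall_eq 0 fun y => ?_
    obtain ⟨x, rfl⟩ := hsurj y
    obtain ⟨a, ha, x', hx', hx0⟩ : μ.toFun x ∈ W := h1 ▸ Submodule.mem_top
    rw [← map_left_smul'] at hx'
    rw [μ.injective hx', CoeffModule.map_left_smul] at hx0
    exact μ'.eq_zero_of_smul ha hx0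

omit hQ hinf [Finite L] in
theorem IsStablySimple.quot {W : Submodule (Q ⊗[Fq] L) V} (hW : IsStable T W) (hW' : W ≠ ⊤)
    (hmax : ∀ W', IsStable T W' → W ≤ W' → W' = W ∨ W' = ⊤) : IsStablySimple (quotSemi hW) := by
  refine ⟨Submodule.Quotient.nontrivial_iff.2 hW', fun U hU => ?_⟩
  have hle : W ≤ U.comap (quotMk W) := fun x hx => by
    rw [Submodule.mem_comap, quotMk_eq_zero.2 hx]
    exact U.zero_mem
  rcases hmax (U.comap (quotMk W)) (fun x hx => hU _ hx) hle with h | h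
  · left
    refine eq_bot_iff.2 fun y hy => ?_
    obtain ⟨x, rfl⟩ := quotMk_surjective W y
    have : x ∈ U.comap (quotMk W) := hy
    rw [h] at this
    exact quotMk_eq_zero.2 this
  · right
    refine eq_top_iff.2 fun y _ => ?_
    obtain ⟨x, rfl⟩ := quotMk_surjective W y
    have : x ∈ U.comap (quotMk W) := h ▸ Submodule.mem_top
    exact this

/-- The isomorphism from `V` to the product of its simple quotients maps `M` into the direct sum of
the quotient motives. Its inverse does so in the other direction after multiplication by a suitable
`a ∈ A`, since two lattices in one space are commensurable; the two maps form a quasi-isogeny. -/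
theorem MotiveModel.isSemisimple (μ : MotiveModel M T X) {k l d : ℕ} (h : GoodMotive T X c k l d)
    (hred : FrobReduced T) : M.IsSemisimple c := by
  have hfin := h.lat.finite
  obtain ⟨n, K, hK, hK', hmax, hker, hsurj⟩ := hred.exists_maximal_family h.injective
  let U : Fin n → CoeffModule Fq Q L := fun j => CoeffModule.quot (K j)
  let ψ : ∀ j, U j →ₛₗ[sigma Fq Q L] U j := fun j => quotSemi (hK j)
  let Y : ∀ j, Place Fq Q → Submodule L (U j) := fun j v =>
    (X v).map (CoeffModule.linL (quotMk (K j)))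
  choose d' hgood using fun j => h.map hQ hinf (quotMk_surjective (K j)) (quotMk_semi (hK j))
  have hY : ∀ j, GoodMotive (ψ j) (Y j) c k l (d' j) := hgood
  have hpi := GoodMotive.pi hY h.k_pos h.l_pos
  let μ' := MotiveModel.directSum fun j => MotiveModel.sections (hY j).lat (hY j).map_mem
  let f : V →ₗ[Q ⊗[Fq] L] CoeffModule.pi U :=
    { toFun := fun x j => quotMk (K j) x
      map_add' := fun x y => funext fun j => map_add (quotMk (K j)) x y
      map_smul' := fun a x => funext fun j => map_smul (quotMk (K j)) a x }
  have hfs : Function.Surjective f := fun y => by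
    choose y' hy' using fun j => quotMk_surjective (K j) (y j)
    obtain ⟨x, hx⟩ := hsurj y'
    refine ⟨x, funext fun j => ?_⟩
    rw [← hy' j, ← sub_eq_zero]
    exact ((quotMk (K j)).map_sub _ _).symm.trans (quotMk_eq_zero.2 (hx j))
  have hfi : Function.Injective f := (injective_iff_map_eq_zero f).2 fun x hx =>
    hker x fun j => quotMk_eq_zero.1 (congrFun hx j)
  let e : V ≃ₗ[Q ⊗[Fq] L] CoeffModule.pi U := LinearEquiv.ofBijective f ⟨hfi, hfs⟩
  have heT : ∀ x, e (T x) = semiPi ψ (e x) := fun x => rfl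
  obtain ⟨a, ha, ha0, haX⟩ := h.lat.exists_smul_mem hQ hinf
    (hpi.lat.map (f := e.symm.toLinearMap) e.symm.surjective)
  obtain ⟨F, hF⟩ := μ.exists_hom μ' f (fun _ => rfl) fun x hx =>
    TauSheaves.mem_sectionsAway.2 fun w hw j => ⟨x, TauSheaves.mem_sectionsAway.1 hx w hw, rfl⟩
  let g : CoeffModule.pi U →ₗ[Q ⊗[Fq] L] V := (a ⊗ₜ[Fq] (1 : L) : Q ⊗[Fq] L) • e.symm.toLinearMap
  have hg : ∀ y, g y = a • e.symm y := fun _ => rfl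
  obtain ⟨G, hG⟩ := μ'.exists_hom μ g (fun y => by
      obtain ⟨x, rfl⟩ := e.surjective y
      rw [hg, hg, ← heT, e.symm_apply_apply, e.symm_apply_apply, semi_left_smul]) fun y hy =>
    TauSheaves.mem_sectionsAway.2 fun w hw => haX w hw _ ⟨y, TauSheaves.mem_sectionsAway.1 hy w hw, rfl⟩
  refine ⟨n, fun j => sectionsMotive (hY j).lat (hY j).map_mem, fun j =>
    (MotiveModel.sections (hY j).lat (hY j).map_mem).isSimple hQ hinf (hY j)
      (IsStablySimple.quot (hK j) (hK' j) (hmax j)),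
    μ.isPureAnderson hQ hinf h, μ'.isPureAnderson hQ hinf hpi, F, G, ⟨a, ha⟩,
    fun h0 => ha0 (congrArg Subtype.val h0), fun x => μ.injective ?_, fun y => μ'.injective ?_⟩
  · rw [hG, hF, hg, map_left_smul']
    exact congrArg _ (e.symm_apply_apply _)
  · rw [hF, hG, hg, map_left_smul', CoeffModule.map_left_smul]
    exact congrArg _ (e.apply_symm_apply _)

/-- The criterion is used in both directions: semisimplicity over `L` makes the Frobenius algebra
reduced, this persists over `L'`, and there it gives back semisimplicity. -/
theorem PreMotive.IsSemisimple.baseChange (h : M.IsSemisimple c) (L' : Type u) [Field L']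
    [Algebra Fq L'] [Algebra L L'] [IsScalarTower Fq L L'] [FiniteDimensional L L'] :
    (M.baseChange L').IsSemisimple ((IsScalarTower.toAlgHom Fq L L').comp c) := by
  have : Finite L' := Module.finite_of_finite L
  have h0 := h.frobReduced hQ hinf
  obtain ⟨-, -, -, hM, -⟩ := h
  obtain ⟨V, T, X, μ, k, l, d, hT⟩ := MotiveModel.exists_goodMotive hQ hinf hM
  have hred := (μ.frobReduced_iff hQ hinf hT.lat).1 h0
  exact (μ.baseChange L').isSemisimple hQ hinf (hT.baseChange L') hred.extSemi

end SemisimpleMotives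

end TauSheaves

theorem mainTheorem8 {Fq Q L : Type u} [Field Fq] [Fintype Fq] [Field Q] [Algebra Fq Q]
    (hQ : TauSheaves.IsCurveFunctionField Fq Q)
    (inf : TauSheaves.Place Fq Q) (hinf : inf.IsRational)
    [Field L] [Finite L] [Algebra Fq L] :
    -- absolutely semisimple Frobenius after an extension of degree a power of the characteristic
    (∀ (c : TauSheaves.Characteristic Fq Q L) (F : TauSheaves.PreTauSheaf Fq Q L),
      F.IsAbelian inf c →
      ∃ (n : ℕ) (L' : Type u) (_ : Field L') (_ : Algebra Fq L') (_ : Algebra L L')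
        (_ : IsScalarTower Fq L L') (_ : FiniteDimensional L L'),
        Module.finrank L L' = ringChar L ^ n ∧
        (F.baseChange L').IsAbelian inf (c.baseChange L') ∧
        (∃ π, (F.baseChange L').IsFrobenius π ∧ (F.baseChange L').IsAbsolutelySemisimple π) ∧
        (c.place ≠ inf → (F.baseChange L').IsSemisimple inf (c.baseChange L'))) ∧
    -- semisimple abelian sheaves stay semisimple
    (∀ (c : TauSheaves.Characteristic Fq Q L) (F : TauSheaves.PreTauSheaf Fq Q L),
      c.place ≠ inf → F.IsSemisimple inf c →
      ∀ (L' : Type u) [Field L'] [Algebra Fq L'] [Algebra L L'] [IsScalarTower Fq L L']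
        [FiniteDimensional L L'],
        (F.baseChange L').IsSemisimple inf (c.baseChange L')) ∧
    -- semisimple pure Anderson motives stay semisimple
    (∀ (c : TauSheaves.affineRing inf →ₐ[Fq] L) (M : TauSheaves.PreMotive inf L),
      M.IsSemisimple c →
      ∀ (L' : Type u) [Field L'] [Algebra Fq L'] [Algebra L L'] [IsScalarTower Fq L L']
        [FiniteDimensional L L'],
        (M.baseChange L').IsSemisimple ((IsScalarTower.toAlgHom Fq L L').comp c)) :=
  ⟨fun _ _ hF => hF.exists_baseChange_isSemisimple hQ hinf,
    fun _ _ hc hF L' _ _ _ _ _ => hF.baseChange hQ hinf hc L',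
    fun _ _ hM L' _ _ _ _ _ => hM.baseChange hQ hinf L'⟩
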